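/- Let $(M,g)$ be an oriented closed Riemannian surface with a fixed spin structure, and let $S\to M$ be the associated spinor bundle of real rank four, with its spin metric, its spin connection $\nabla^s$ and Clifford multiplication satisfying $X\cdot Y\cdot s+Y\cdot X\cdot s=-2g(X,Y)s$. Let $(N,h)$ be a compact Riemannian manifold with curvature $\mathrm{Rm}(X,Y)=\nabla_X\nabla_Y-\nabla_Y\nabla_X-\nabla_{[X,Y]}$, $\mathrm{Rm}(\partial_k,\partial_l)\partial_j=R^i{}_{jkl}\partial_i$, let $\phi\colon M\to N$ be a smooth map, $\psi=\psi^i\otimes\phi^*\partial_{y^i}$ a smooth section of $S\otimes\phi^*TN$ and $\chi=\chi^\alpha\otimes e_\alpha$ a smooth section of $S\otimes TM$ (a gravitino), where $(e_\alpha)$ is a local oriented orthonormal frame of $M$ and repeated indices are summed. Let $\widetilde\nabla$ be the connection of $S\otimes\phi^*TN$ and put $$Q\chi=-\tfrac12\, e_\beta\cdot e_\alpha\cdot\chi^\beta\otimes e_\alpha,\qquad D\psi=e_\alpha\cdot\widetilde\nabla_{e_\alpha}\psi,\qquad SR(\psi)=R^i{}_{jkl}\langle\psi^l,\psi^j\rangle\psi^k\otimes\phi^*\partial_{y^i},\qquad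 \mathrm{Rm}(\psi)=\langle SR(\psi),\psi\rangle .$$ Suppose that $(\phi,\psi)$ solves the Euler--Lagrange equations $$\tau(\phi)=\tfrac12 R^i{}_{jkl}\langle\psi^k,e_\alpha\cdot\psi^l\rangle\, e_\alpha(\phi^j)\,\partial_{y^i}-\tfrac1{12}S\nabla R(\psi)-\big(\langle\nabla^s_{e_\beta}(e_\alpha\cdot e_\beta\cdot\chi^\alpha),\psi\rangle+\langle e_\alpha\cdot e_\beta\cdot\chi^\alpha,\widetilde\nabla_{e_\beta}\psi\rangle\big),$$ $$D\psi=|Q\chi|^2\psi+\tfrac13 SR(\psi)+2(1\otimes\phi_*)Q\chi ,$$ where $\tau(\phi)$ is the tension field, $S\nabla R(\psi)=h^{im}\nabla_mR_{bcde}\langle\psi^b,\psi^d\rangle\langle\psi^c,\psi^e\rangle\,\partial_{y^i}$ and $\nabla^s_{e_\beta}(e_\alpha\cdot e_\beta\cdot\chi^\alpha)$ denotes the covariant divergence of the section $e_\alpha\cdot e_\beta\cdot\chi^\alpha\otimes e_\beta$ of $S\otimes TM$. Suppose also that $\chi$ is critical, i.e. $\frac{d}{dt}\big|_{t=0}A(\phi,\psi;g,\chi_t)=0$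 for every smooth family $(\chi_t)$ of gravitinos with $\chi_0=\chi$, where $$A(\phi,\psi;g,\chi)=\int_M |d\phi|^2+\langle\psi,D\psi\rangle-4\langle(1\otimes\phi_*)Q\chi,\psi\rangle-|Q\chi|^2|\psi|^2-\tfrac16\mathrm{Rm}(\psi)\; dvol_g .$$ Let $T=T_{\alpha\beta}\,e^\alpha\otimes e^\beta$ be the energy-momentum tensor, $$\begin{aligned}T_{\alpha\beta}=&\,2\langle\phi_*e_\alpha,\phi_*e_\beta\rangle-|d\phi|^2g_{\alpha\beta}+\tfrac12\langle\psi,e_\alpha\cdot\widetilde\nabla_{e_\beta}\psi+e_\beta\cdot\widetilde\nabla_{e_\alpha}\psi\rangle-\langle\psi,D\psi\rangle g_{\alpha\beta}\\&+\langle e_\eta\cdot e_\alpha\cdot\chi^\eta\otimes\phi_*e_\beta+e_\eta\cdot e_\beta\cdot\chi^\eta\otimes\phi_*e_\alpha,\psi\rangle+4\langle(1\otimes\phi_*)Q\chi,\psi\rangle g_{\alpha\beta}+|Q\chi|^2|\psi|^2g_{\alpha\beta}+\tfrac16\mathrm{Rm}(\psi)g_{\alpha\beta},\end{aligned}$$ and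 for oriented local isothermal coordinates $z=x+iy$ on $M$ put $T(z)\,dz^2=(T_{11}-iT_{12})(dx+i\,dy)^2$ with $T_{11}=T(\partial_x,\partial_x)$ and $T_{12}=T(\partial_x,\partial_y)$. Then the quadratic differential $T(z)\,dz^2$ is well defined and holomorphic: $T$ does not depend on the local frames and charts used to compute it; if $z$ and $w$ are two oriented isothermal coordinates, then $w$ is a holomorphic function of $z$ and $T(z)=T(w)\,(dw/dz)^2$ on the common domain; and $T(z)$ is a holomorphic function of $z$ in every oriented isothermal coordinate $z$. -/

import Mathlib

open MeasureTheory Bundle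
open scoped Manifold ContDiff TensorProduct

noncomputable section

namespace SigmaModel

/-! ### The Riemannian surface, its spin structure and its spinor bundle -/

/-- Smooth Riemannian metrics on a surface `M`; charts of a surface take values in `ℂ`, viewed as
the real plane with coordinate `z = x + i y`. -/
abbrev SurfaceMetric (M : Type*) [TopologicalSpace M] [ChartedSpace ℂ M]
    [IsManifold 𝓘(ℝ, ℂ) ∞ M] :=
  ContMDiffRiemannianMetric 𝓘(ℝ, ℂ) ∞ ℂ (fun x : M ↦ TangentSpace 𝓘(ℝ, ℂ) x)

/-- Smooth Riemannian metrics on an `n`-dimensional manifold `N`. -/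
abbrev TargetMetric (n : ℕ) (N : Type*) [TopologicalSpace N]
    [ChartedSpace (EuclideanSpace ℝ (Fin n)) N] [IsManifold (𝓡 n) ∞ N] :=
  ContMDiffRiemannianMetric (𝓡 n) ∞ (EuclideanSpace ℝ (Fin n))
    (fun p : N ↦ TangentSpace (𝓡 n) p)

/-- The Clifford algebra of the Euclidean plane with `v² = -|v|²` is the quaternion algebra; the
generators `ε₁ = i`, `ε₂ = j` act on the spinor module (the quaternions, a real vector space of
dimension four with its Euclidean inner product) by left multiplication, `ε₁ ε₂ = k`. -/
def cliff : Fin 2 → Quaternion ℝ := ![⟨0, 1, 0, 0⟩, ⟨0, 0, 1, 0⟩]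

/-- An oriented atlas of orthonormal frames of `(M, g)` together with a spin structure, given by its
cocycle: the transition functions of the frames, which lie in `SO(2)`, are lifted to
`Spin(2) = {cos t + sin t ε₁ε₂}`. The orientation of `M` is the one for which all frames are
positively oriented. -/
structure SpinStructure {M : Type*} [TopologicalSpace M] [ChartedSpace ℂ M]
    [IsManifold 𝓘(ℝ, ℂ) ∞ M] (g : SurfaceMetric M) (ι : Type*) where
  U : ι → Set M
  isOpen : ∀ a, IsOpen (U a)
  cover : ∀ x, ∃ a, x ∈ U a
  frame : ι → Fin 2 → (x : M) → TangentSpace 𝓘(ℝ, ℂ) x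
  frame_smooth : ∀ a α, ContMDiffOn 𝓘(ℝ, ℂ) (𝓘(ℝ, ℂ).tangent) ∞
    (fun x ↦ (⟨x, frame a α x⟩ : TangentBundle 𝓘(ℝ, ℂ) M)) (U a)
  orthonormal : ∀ a, ∀ x ∈ U a, ∀ α β,
    g.inner x (frame a α x) (frame a β x) = if α = β then 1 else 0
  /-- The lifted transition functions `q_ab`. -/
  lift : ι → ι → M → Quaternion ℝ
  lift_smooth : ∀ a b, ContMDiffOn 𝓘(ℝ, ℂ) 𝓘(ℝ, Quaternion ℝ) ∞ (lift a b) (U a ∩ U b)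
  lift_mem : ∀ a b, ∀ x ∈ U a ∩ U b, ∃ t : ℝ, lift a b x = ⟨Real.cos t, 0, 0, Real.sin t⟩
  /-- `q_ab` covers the change of frames: `q_ab v_b q_ab⁻¹ = v_a` for the coordinate
  vectors `v_a`, `v_b` of a tangent vector in the two frames. -/
  lift_covers : ∀ a b, ∀ x ∈ U a ∩ U b, ∀ v : TangentSpace 𝓘(ℝ, ℂ) x,
    (∑ α, g.inner x (frame a α x) v • cliff α) * lift a b x =
      lift a b x * ∑ α, g.inner x (frame b α x) v • cliff α
  cocycle : ∀ a b c, ∀ x ∈ U a ∩ U b ∩ U c, lift a b x * lift b c x = lift a c x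

/-- For a linear form `ℓ` on `V`, the map `s ⊗ v ↦ ℓ(v) s`. -/
def coeff {V : Type*} [AddCommGroup V] [Module ℝ V] (ℓ : V →ₗ[ℝ] ℝ) :
    Quaternion ℝ ⊗[ℝ] V →ₗ[ℝ] Quaternion ℝ :=
  (TensorProduct.rid ℝ (Quaternion ℝ)).toLinearMap ∘ₗ ℓ.lTensor (Quaternion ℝ)

/-- The map `s ⊗ v ↦ q s ⊗ v`. -/
def spinAct {V : Type*} [AddCommGroup V] [Module ℝ V] (q : Quaternion ℝ) :
    Quaternion ℝ ⊗[ℝ] V →ₗ[ℝ] Quaternion ℝ ⊗[ℝ] V :=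
  (LinearMap.mulLeft ℝ q).rTensor V

section Surface

variable {M : Type*} [TopologicalSpace M] [ChartedSpace ℂ M] [IsManifold 𝓘(ℝ, ℂ) ∞ M]
  {g : SurfaceMetric M} {ι : Type*}

/-- A gravitino: a smooth section of `S ⊗ TM`, where `S` is the spinor bundle associated with the
spin structure. Sections are given by their local representatives with respect to the lifted frames
(only the values of the `a`-th representative on `U a` matter). -/
structure Gravitino (σ : SpinStructure g ι) where
  val : ι → (x : M) → Quaternion ℝ ⊗[ℝ] TangentSpace 𝓘(ℝ, ℂ) x
  compat : ∀ a b, ∀ x ∈ σ.U a ∩ σ.U b, val a x = spinAct (σ.lift a b x) (val b x)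
  smooth : ∀ a α, ContMDiffOn 𝓘(ℝ, ℂ) 𝓘(ℝ, Quaternion ℝ) ∞
    (fun x ↦ coeff (g.inner x (σ.frame a α x) : TangentSpace 𝓘(ℝ, ℂ) x →ₗ[ℝ] ℝ) (val a x)) (σ.U a)

/-- The components `χ^α` in `χ = χ^α ⊗ e_α`. -/
def Gravitino.comp {σ : SpinStructure g ι} (χ : Gravitino σ) (a : ι) (α : Fin 2) (x : M) :
    Quaternion ℝ :=
  coeff (g.inner x (σ.frame a α x) : TangentSpace 𝓘(ℝ, ℂ) x →ₗ[ℝ] ℝ) (χ.val a x)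

/-- A smooth one-parameter family of gravitinos. -/
def SmoothFamily {σ : SpinStructure g ι} (X : ℝ → Gravitino σ) : Prop :=
  ∀ a α, ContMDiffOn (𝓘(ℝ, ℝ).prod 𝓘(ℝ, ℂ)) 𝓘(ℝ, Quaternion ℝ) ∞
    (fun p : ℝ × M ↦ (X p.1).comp a α p.2) (Set.univ ×ˢ σ.U a)

/-- The components of `Qχ = -1/2 e_β · e_α · χ^β ⊗ e_α`. -/
def Gravitino.proj {σ : SpinStructure g ι} (χ : Gravitino σ) (a : ι) (α : Fin 2) (x : M) :
    Quaternion ℝ :=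
  -(1 / 2 : ℝ) • ∑ β, cliff β * cliff α * χ.comp a β x

/-- `|Qχ|²`. -/
def Gravitino.projSq {σ : SpinStructure g ι} (χ : Gravitino σ) (a : ι) (x : M) : ℝ :=
  ∑ α, inner ℝ (χ.proj a α x) (χ.proj a α x)

namespace SpinStructure

variable (σ : SpinStructure g ι)

/-- The derivative `e_α f` of a function `f` in the direction of a frame vector. -/
def deriv {F : Type*} [NormedAddCommGroup F] [NormedSpace ℝ F] (a : ι) (α : Fin 2) (f : M → F)
    (x : M) : F :=
  mfderiv 𝓘(ℝ, ℂ) 𝓘(ℝ, F) f x (σ.frame a α x)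

/-- The Levi-Civita connection coefficients `g(∇_{e_α} e_β, e_γ)` of the orthonormal frame, by the
Koszul formula. -/
def conn (a : ι) (α β γ : Fin 2) (x : M) : ℝ :=
  1 / 2 * (g.inner x (VectorField.mlieBracket 𝓘(ℝ, ℂ) (σ.frame a α) (σ.frame a β) x)
        (σ.frame a γ x)
    - g.inner x (VectorField.mlieBracket 𝓘(ℝ, ℂ) (σ.frame a α) (σ.frame a γ) x) (σ.frame a β x)
    - g.inner x (VectorField.mlieBracket 𝓘(ℝ, ℂ) (σ.frame a β) (σ.frame a γ) x) (σ.frame a α x))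

/-- The spin connection `∇_{e_α} s = e_α s + 1/4 g(∇_{e_α} e_β, e_γ) e_β · e_γ · s`. -/
def spinDeriv (a : ι) (α : Fin 2) (s : M → Quaternion ℝ) (x : M) : Quaternion ℝ :=
  σ.deriv a α s x + (1 / 4 : ℝ) • ∑ β, ∑ γ, σ.conn a α β γ x • (cliff β * cliff γ * s x)

/-- An index of a frame that is defined at `x`. -/
def index (x : M) : ι := (σ.cover x).choose

end SpinStructure

/-- The coordinate vector field of `z` at the point with coordinate `p`, in the direction `v`: it is
`∂_x` for `v = 1` and `∂_y` for `v = i`. -/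
def coordVec (z : OpenPartialHomeomorph M ℂ) (v p : ℂ) : TangentSpace 𝓘(ℝ, ℂ) (z.symm p) :=
  mfderiv 𝓘(ℝ, ℂ) 𝓘(ℝ, ℂ) z.symm p v

/-- The coefficient `g(∂_v, ∂_w)` in the coordinate `z`. -/
def surfaceCoeff (g : SurfaceMetric M) (z : OpenPartialHomeomorph M ℂ) (v w p : ℂ) : ℝ :=
  g.inner (z.symm p) (coordVec z v p) (coordVec z w p)

/-- The Riemannian volume measure: the least measure that dominates `√(det g) dx dy` in every
coordinate chart (these local measures agree on overlaps). -/
def volumeMeasure (g : SurfaceMetric M) [MeasurableSpace M] : Measure M :=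
  ⨆ z ∈ IsManifold.maximalAtlas 𝓘(ℝ, ℂ) ∞ M,
    Measure.map z.symm (((volume : Measure ℂ).restrict z.target).withDensity fun p ↦
      ENNReal.ofReal √(surfaceCoeff g z 1 1 p * surfaceCoeff g z Complex.I Complex.I p
        - surfaceCoeff g z 1 Complex.I p ^ 2))

/-- Oriented isothermal coordinates: an oriented smooth chart in which `g = ρ (dx² + dy²)`. -/
structure IsIsothermal (σ : SpinStructure g ι) (z : OpenPartialHomeomorph M ℂ) : Prop where
  smooth : z ∈ IsManifold.maximalAtlas 𝓘(ℝ, ℂ) ∞ M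
  conformal : ∀ p ∈ z.target, surfaceCoeff g z 1 1 p = surfaceCoeff g z Complex.I Complex.I p ∧
    surfaceCoeff g z 1 Complex.I p = 0
  /-- The determinant of `dz(e₁), dz(e₂)` is positive. -/
  oriented : ∀ a, ∀ x ∈ σ.U a ∩ z.source,
    0 < (starRingEnd ℂ (σ.deriv a 0 z x) * σ.deriv a 1 z x).im

end Surface

/-! ### The target manifold in local coordinates -/

section Target

variable {n : ℕ} {N : Type*} [TopologicalSpace N] [ChartedSpace (EuclideanSpace ℝ (Fin n)) N]
  [IsManifold (𝓡 n) ∞ N]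

/-- The differential `dy^i` at a point `p` of the domain of the chart `y`. -/
def coordForm (y : OpenPartialHomeomorph N (EuclideanSpace ℝ (Fin n))) (i : Fin n) (p : N) :
    TangentSpace (𝓡 n) p →ₗ[ℝ] ℝ :=
  ((EuclideanSpace.proj i : EuclideanSpace ℝ (Fin n) →L[ℝ] ℝ).comp
    (mfderiv (𝓡 n) 𝓘(ℝ, EuclideanSpace ℝ (Fin n)) y p) : TangentSpace (𝓡 n) p →L[ℝ] ℝ)

/-- The coordinate vector `∂/∂y^i` at the point with coordinates `u`. -/
def targetVec (y : OpenPartialHomeomorph N (EuclideanSpace ℝ (Fin n))) (i : Fin n)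
    (u : EuclideanSpace ℝ (Fin n)) : TangentSpace (𝓡 n) (y.symm u) :=
  mfderiv 𝓘(ℝ, EuclideanSpace ℝ (Fin n)) (𝓡 n) y.symm u (EuclideanSpace.single i (1 : ℝ))

/-- The partial derivative `∂f/∂y^k`. -/
def partialD (k : Fin n) (f : EuclideanSpace ℝ (Fin n) → ℝ) (u : EuclideanSpace ℝ (Fin n)) : ℝ :=
  fderiv ℝ f u (EuclideanSpace.single k (1 : ℝ))

variable (h : TargetMetric n N) (y : OpenPartialHomeomorph N (EuclideanSpace ℝ (Fin n)))

/-- The matrix `h_ij`. -/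
def metricCoeff (u : EuclideanSpace ℝ (Fin n)) : Matrix (Fin n) (Fin n) ℝ :=
  Matrix.of fun i j ↦ h.inner (y.symm u) (targetVec y i u) (targetVec y j u)

/-- The Christoffel symbols `Γ^i_jk`. -/
def christoffel (i j k : Fin n) (u : EuclideanSpace ℝ (Fin n)) : ℝ :=
  1 / 2 * ∑ l, (metricCoeff h y u)⁻¹ i l *
    (partialD j (fun v ↦ metricCoeff h y v l k) u + partialD k (fun v ↦ metricCoeff h y v l j) u
      - partialD l (fun v ↦ metricCoeff h y v j k) u)

/-- The curvature coefficients `R^i_jkl`, where `Rm(∂_k, ∂_l) ∂_j = R^i_jkl ∂_i` and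
`Rm(X, Y) = ∇_X ∇_Y - ∇_Y ∇_X - ∇_[X,Y]`. -/
def riemann (i j k l : Fin n) (u : EuclideanSpace ℝ (Fin n)) : ℝ :=
  partialD k (christoffel h y i l j) u - partialD l (christoffel h y i k j) u
    + ∑ m, (christoffel h y i k m u * christoffel h y m l j u
      - christoffel h y i l m u * christoffel h y m k j u)

/-- `R_ijkl = h_im R^m_jkl`. -/
def riemannLow (i j k l : Fin n) (u : EuclideanSpace ℝ (Fin n)) : ℝ :=
  ∑ m, metricCoeff h y u i m * riemann h y m j k l u

/-- The covariant derivative `∇_m R_ijkl`. -/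
def nablaRiemann (m i j k l : Fin n) (u : EuclideanSpace ℝ (Fin n)) : ℝ :=
  partialD m (riemannLow h y i j k l) u
    - ∑ s, (christoffel h y s m i u * riemannLow h y s j k l u
      + christoffel h y s m j u * riemannLow h y i s k l u
      + christoffel h y s m k u * riemannLow h y i j s l u
      + christoffel h y s m l u * riemannLow h y i j k s u)

end Target

/-! ### The sigma model -/

section Model

variable {M : Type*} [TopologicalSpace M] [ChartedSpace ℂ M] [IsManifold 𝓘(ℝ, ℂ) ∞ M]
  {g : SurfaceMetric M} {ι : Type*}
  {n : ℕ} {N : Type*} [TopologicalSpace N] [ChartedSpace (EuclideanSpace ℝ (Fin n)) N]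
  [IsManifold (𝓡 n) ∞ N]

/-- A vector spinor along `φ`: a smooth section of `S ⊗ φ^*TN`, given by its local representatives
with respect to the lifted frames. -/
structure VectorSpinor (n : ℕ) {N : Type*} [TopologicalSpace N]
    [ChartedSpace (EuclideanSpace ℝ (Fin n)) N] [IsManifold (𝓡 n) ∞ N]
    (σ : SpinStructure g ι) (φ : M → N) where
  val : ι → (x : M) → Quaternion ℝ ⊗[ℝ] TangentSpace (𝓡 n) (φ x)
  compat : ∀ a b, ∀ x ∈ σ.U a ∩ σ.U b, val a x = spinAct (σ.lift a b x) (val b x)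
  smooth : ∀ a, ∀ y ∈ IsManifold.maximalAtlas (𝓡 n) ∞ N, ∀ i,
    ContMDiffOn 𝓘(ℝ, ℂ) 𝓘(ℝ, Quaternion ℝ) ∞
      (fun x ↦ coeff (coordForm y i (φ x)) (val a x)) (σ.U a ∩ φ ⁻¹' y.source)

/-- The components `ψ^i` in `ψ = ψ^i ⊗ ∂/∂y^i`. -/
def VectorSpinor.comp {σ : SpinStructure g ι} {φ : M → N} (ψ : VectorSpinor n σ φ) (a : ι)
    (y : OpenPartialHomeomorph N (EuclideanSpace ℝ (Fin n))) (i : Fin n) (x : M) : Quaternion ℝ :=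
  coeff (coordForm y i (φ x)) (ψ.val a x)

variable (σ : SpinStructure g ι) (h : TargetMetric n N) (φ : M → N) (ψ : VectorSpinor n σ φ)
  (χ : Gravitino σ) (a : ι) (y : OpenPartialHomeomorph N (EuclideanSpace ℝ (Fin n)))

/-- The inner product `⟨A, B⟩ = h_ij ⟨A^i, B^j⟩` on `S ⊗ φ^*TN`. -/
def pairing (x : M) (A B : Fin n → Quaternion ℝ) : ℝ :=
  ∑ i, ∑ j, metricCoeff h y (y (φ x)) i j * inner ℝ (A i) (B j)

/-- The components of `φ_* e_α`. -/
def push (α : Fin 2) (i : Fin n) (x : M) : ℝ :=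
  σ.deriv a α (fun x' ↦ y (φ x') i) x

/-- `⟨φ_* e_α, φ_* e_β⟩`. -/
def pushInner (α β : Fin 2) (x : M) : ℝ :=
  ∑ i, ∑ j, metricCoeff h y (y (φ x)) i j * push σ φ a y α i x * push σ φ a y β j x

/-- The components of the tension field `τ(φ)`. -/
def tension (i : Fin n) (x : M) : ℝ :=
  ∑ α, (σ.deriv a α (push σ φ a y α i) x - ∑ γ, σ.conn a α α γ x * push σ φ a y γ i x
    + ∑ j, ∑ k, christoffel h y i j k (y (φ x)) * push σ φ a y α j x * push σ φ a y α k x)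

/-- The components of `∇_{e_α} ψ` for the connection of `S ⊗ φ^*TN`. -/
def covDeriv (α : Fin 2) (i : Fin n) (x : M) : Quaternion ℝ :=
  σ.spinDeriv a α (ψ.comp a y i) x
    + ∑ j, ∑ k, (christoffel h y i j k (y (φ x)) * push σ φ a y α j x) • ψ.comp a y k x

/-- The components of the twisted Dirac operator `Dψ = e_α · ∇_{e_α} ψ`. -/
def dirac (i : Fin n) (x : M) : Quaternion ℝ :=
  ∑ α, cliff α * covDeriv σ h φ ψ a y α i x

/-- The components of `(1 ⊗ φ_*) Qχ`. -/
def pushProj (i : Fin n) (x : M) : Quaternion ℝ :=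
  ∑ α, push σ φ a y α i x • χ.proj a α x

/-- `⟨ψ^i, ψ^j⟩`. -/
def gram (i j : Fin n) (x : M) : ℝ :=
  inner ℝ (ψ.comp a y i x) (ψ.comp a y j x)

/-- The components of `SR(ψ)`. -/
def curvSR (i : Fin n) (x : M) : Quaternion ℝ :=
  ∑ j, ∑ k, ∑ l, (riemann h y i j k l (y (φ x)) * gram σ φ ψ a y l j x) • ψ.comp a y k x

/-- `Rm(ψ) = ⟨SR(ψ), ψ⟩`. -/
def curvRm (x : M) : ℝ :=
  pairing h φ y x (fun i ↦ curvSR σ h φ ψ a y i x) (fun i ↦ ψ.comp a y i x)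

/-- `|ψ|²`. -/
def normSqSpinor (x : M) : ℝ :=
  pairing h φ y x (fun i ↦ ψ.comp a y i x) (fun i ↦ ψ.comp a y i x)

/-- The components of `SnablaR(ψ)`, the gradient
`h^{im} ∇_m R_bcde ⟨ψ^b, ψ^d⟩ ⟨ψ^c, ψ^e⟩`. -/
def curvSNablaR (i : Fin n) (x : M) : ℝ :=
  ∑ m, (metricCoeff h y (y (φ x)))⁻¹ i m *
    ∑ b, ∑ c, ∑ d, ∑ e, nablaRiemann h y m b c d e (y (φ x)) *
      gram σ φ ψ a y b d x * gram σ φ ψ a y c e x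

/-- The components of `Rm(ψ, e_α · ψ) φ_* e_α`. -/
def curvMixed (i : Fin n) (x : M) : ℝ :=
  ∑ α, ∑ j, ∑ k, ∑ l, riemann h y i j k l (y (φ x)) *
    inner ℝ (ψ.comp a y k x) (cliff α * ψ.comp a y l x) * push σ φ a y α j x

/-- The components of the section `e_α · e_β · χ^α ⊗ e_β` of `S ⊗ TM`. -/
def twist (β : Fin 2) (x : M) : Quaternion ℝ :=
  ∑ α, cliff α * cliff β * χ.comp a α x

/-- `⟨∇_{e_β}(e_α · e_β · χ^α), ψ^i⟩ + ⟨e_α · e_β · χ^α, (∇_{e_β} ψ)^i⟩`, where the first covariant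
derivative is the divergence of the section `e_α · e_β · χ^α ⊗ e_β` of `S ⊗ TM` (the terms with
`g(∇_{e_β} e_γ, e_β)` vanish for a frame that is parallel at the point). -/
def gravitinoTerm (i : Fin n) (x : M) : ℝ :=
  ∑ β, (inner ℝ (σ.spinDeriv a β (twist σ χ a β) x
        + ∑ γ, σ.conn a β γ β x • twist σ χ a γ x) (ψ.comp a y i x)
    + inner ℝ (twist σ χ a β x) (covDeriv σ h φ ψ a y β i x))

/-- The Euler-Lagrange equations for `(φ, ψ)`, in all local frames of `M` and charts of `N`. -/
def EulerLagrange : Prop :=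
  ∀ a, ∀ y ∈ IsManifold.maximalAtlas (𝓡 n) ∞ N, ∀ x ∈ σ.U a, φ x ∈ y.source → ∀ i,
    tension σ h φ a y i x = 1 / 2 * curvMixed σ h φ ψ a y i x
        - 1 / 12 * curvSNablaR σ h φ ψ a y i x - gravitinoTerm σ h φ ψ χ a y i x ∧
    dirac σ h φ ψ a y i x = χ.projSq a x • ψ.comp a y i x
        + (1 / 3 : ℝ) • curvSR σ h φ ψ a y i x + (2 : ℝ) • pushProj σ φ χ a y i x

/-- The integrand of the action, computed in a local frame of `M` and a chart of `N`. -/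
def lagrangianLocal (x : M) : ℝ :=
  ∑ α, pushInner σ h φ a y α α x
    + pairing h φ y x (fun i ↦ ψ.comp a y i x) (fun i ↦ dirac σ h φ ψ a y i x)
    - 4 * pairing h φ y x (fun i ↦ pushProj σ φ χ a y i x) (fun i ↦ ψ.comp a y i x)
    - χ.projSq a x * normSqSpinor σ h φ ψ a y x
    - 1 / 6 * curvRm σ h φ ψ a y x

/-- The action `A(φ, ψ; g, χ)`. -/
def action [MeasurableSpace M] : ℝ :=
  ∫ x, lagrangianLocal σ h φ ψ χ (σ.index x) (chartAt (EuclideanSpace ℝ (Fin n)) (φ x)) x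
    ∂volumeMeasure g

/-- The gravitino `χ` is critical: the action is stationary under all smooth variations of `χ`. -/
def IsCriticalGravitino [MeasurableSpace M] : Prop :=
  ∀ X : ℝ → Gravitino σ, SmoothFamily X → X 0 = χ →
    HasDerivAt (fun t ↦ action σ h φ ψ (X t)) 0 0

/-- The coefficients `T_αβ` of the energy-momentum tensor, computed in a local orthonormal frame of
`M` and a chart of `N`. -/
def emCoeff (α β : Fin 2) (x : M) : ℝ :=
  2 * pushInner σ h φ a y α β x
    + 1 / 2 * pairing h φ y x (fun i ↦ ψ.comp a y i x)
      (fun i ↦ cliff α * covDeriv σ h φ ψ a y β i x + cliff β * covDeriv σ h φ ψ a y α i x)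
    + pairing h φ y x
      (fun i ↦ ∑ η, (push σ φ a y β i x • (cliff η * cliff α * χ.comp a η x)
        + push σ φ a y α i x • (cliff η * cliff β * χ.comp a η x)))
      (fun i ↦ ψ.comp a y i x)
    + (if α = β then 1 else 0) *
      (-(∑ η, pushInner σ h φ a y η η x)
        - pairing h φ y x (fun i ↦ ψ.comp a y i x) (fun i ↦ dirac σ h φ ψ a y i x)
        + 4 * pairing h φ y x (fun i ↦ pushProj σ φ χ a y i x) (fun i ↦ ψ.comp a y i x)
        + χ.projSq a x * normSqSpinor σ h φ ψ a y x
        + 1 / 6 * curvRm σ h φ ψ a y x)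

/-- The bilinear form `T_αβ e^α ⊗ e^β`, computed in a local frame of `M` and a chart of `N`. -/
def emTensorLocal (x : M) (v w : TangentSpace 𝓘(ℝ, ℂ) x) : ℝ :=
  ∑ α, ∑ β, emCoeff σ h φ ψ χ a y α β x *
    g.inner x (σ.frame a α x) v * g.inner x (σ.frame a β x) w

/-- The energy-momentum tensor `T`. -/
def emTensor (x : M) (v w : TangentSpace 𝓘(ℝ, ℂ) x) : ℝ :=
  emTensorLocal σ h φ ψ χ (σ.index x) (chartAt (EuclideanSpace ℝ (Fin n)) (φ x)) x v w

/-- The coefficient `T(z) = T₁₁ - i T₁₂` in the coordinate `z`, with `T₁₁ = T(∂_x, ∂_x)` and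
`T₁₂ = T(∂_x, ∂_y)`. -/
def quadCoeff (z : OpenPartialHomeomorph M ℂ) (p : ℂ) : ℂ :=
  (emTensor σ h φ ψ χ (z.symm p) (coordVec z 1 p) (coordVec z 1 p) : ℂ)
    - Complex.I * (emTensor σ h φ ψ χ (z.symm p) (coordVec z 1 p) (coordVec z Complex.I p) : ℂ)

end Model

end SigmaModel

end

noncomputable section

namespace SigmaModel

set_option linter.unusedSectionVars false

/-! ### Calculus on a manifold read in a chart -/

section Charts

variable {E : Type*} [NormedAddCommGroup E] [NormedSpace ℝ E]
  {M : Type*} [TopologicalSpace M] [ChartedSpace E M] [IsManifold 𝓘(ℝ, E) ∞ M]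
  {F : Type*} [NormedAddCommGroup F] [NormedSpace ℝ F]
  {z : OpenPartialHomeomorph M E}

/-! Write e₀, e₁ for the frame, ω = e₀·e₁, κ_α for the components of Qχ and w_α = g(∇_{e_α} e₀, e₁).
The differential is holomorphic because T is symmetric, trace free and divergence free on shell; in
dimension two this is the Cauchy-Riemann system for T₀₀ - iT₀₁. The work lies in extracting the
three properties from the field equations and in showing that the local expressions are intrinsic.

Pointwise algebra. The map Q projects onto the pairs with κ₁ = -ωκ₀ (`proj_one`), and the action
depends on χ only through Qχ, quadratically. Testing criticality with gravitinos f(v ⊗ e₀ - ωv ⊗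
e₁), f a bump function, turns it into a pointwise identity, linear in a spinor s
(`gravitinoEq_eq_zero`). Taking s = κ₀ and s = ωκ₀, and pairing the Dirac equation with ψ and with
ωψ, gives the vanishing of the trace (`emCoeff_trace`) and the symmetry of the kinetic and gravitino
couplings (`kinetic_comm`, `coupling_comm`). Hence T₀₀ and T₀₁ take the short, unsymmetrised forms
`emFst` and `emSnd`.

Divergence. `divergence_eq_zero` differentiates these forms. Commuting the covariant derivatives of
ψ produces the target curvature, which cancels the curvature force in the tension equation, and an
intrinsic spinor curvature, which multiplies ⟨ψ, e₀·ψ⟩ = 0. The derivative of Rm(ψ) cancels the ∇R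
term, and the derivatives of Qχ cancel by the gravitino equation tested with the derivative of κ₀.
The theorem treats one frame direction; applied to the rotated frame (e₁, -e₀), which has the same
ω, it gives the other (`div_emCoord`, `div_emCoord_rotate`).

Holomorphy. Let c = dz(e₀); isothermality and orientation give dz(e₁) = ic. With F = T₀₀ - iT₀₁ one
has T(z) = F/c² (`quadCoeff_eq`). For Ω = w₀ + iw₁ the two conservation laws say e₁F = i e₀F + 2ΩF,
and the formula for [e₀, e₁] says e₁c = i e₀c + Ωc. The Ω terms cancel in F/c²
(`differentiableAt_div_sq`). The transformation law under a change of z follows from the same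
formula, F being common to both coordinates.

Independence of choices. The delicate term is ⟨ψ, e_α·∇_{e_β}ψ⟩: since Clifford multiplication is
skew, it can be rewritten with first derivatives of h only, without any connection, and then
transforms by direct computation. No transformation law for the curvature is needed: Rm(ψ) is
eliminated from T by tracelessness and from the Lagrangian by the Dirac equation. The invariance of
the Lagrangian also makes it continuous on M, so that the action is an honest integral against a
finite measure. -/

lemma mdifferentiableAt_chart (hz : z ∈ IsManifold.maximalAtlas 𝓘(ℝ, E) ∞ M) {x : M}
    (hx : x ∈ z.source) : MDifferentiableAt 𝓘(ℝ, E) 𝓘(ℝ, E) z x :=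
  (contMDiffAt_of_mem_maximalAtlas hz hx).mdifferentiableAt (by simp)

lemma mdifferentiableAt_chart_symm (hz : z ∈ IsManifold.maximalAtlas 𝓘(ℝ, E) ∞ M) {p : E}
    (hp : p ∈ z.target) : MDifferentiableAt 𝓘(ℝ, E) 𝓘(ℝ, E) z.symm p :=
  (contMDiffAt_symm_of_mem_maximalAtlas hz hp).mdifferentiableAt (by simp)

/-- The differential of a chart, with values in the model space. -/
def dchart (z : OpenPartialHomeomorph M E) (x : M) : TangentSpace 𝓘(ℝ, E) x →L[ℝ] E :=
  mfderiv 𝓘(ℝ, E) 𝓘(ℝ, E) z x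

/-- The differential of the inverse of a chart, defined on the model space. -/
def dchartSymm (z : OpenPartialHomeomorph M E) (p : E) : E →L[ℝ] TangentSpace 𝓘(ℝ, E) (z.symm p) :=
  mfderiv 𝓘(ℝ, E) 𝓘(ℝ, E) z.symm p

lemma dchartSymm_dchart (hz : z ∈ IsManifold.maximalAtlas 𝓘(ℝ, E) ∞ M) {p : E}
    (hp : p ∈ z.target) (v : TangentSpace 𝓘(ℝ, E) (z.symm p)) :
    dchartSymm z p (dchart z (z.symm p) v) = v := by
  have h0 := mdifferentiableAt_chart_symm hz hp
  have h1 := mfderiv_comp (z.symm p) (by rw [z.right_inv hp]; exact h0)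
    (mdifferentiableAt_chart hz (z.map_target hp))
  have h2 : z.symm ∘ z =ᶠ[nhds (z.symm p)] id :=
    Filter.eventually_of_mem (z.open_source.mem_nhds (z.map_target hp)) fun x hx ↦ z.left_inv hx
  rw [h2.mfderiv_eq, mfderiv_id, z.right_inv hp] at h1
  exact (congrArg (fun L ↦ L v) h1).symm

lemma dchart_dchartSymm (hz : z ∈ IsManifold.maximalAtlas 𝓘(ℝ, E) ∞ M) {p : E}
    (hp : p ∈ z.target) (v : E) : dchart z (z.symm p) (dchartSymm z p v) = v := by
  have h1 := mfderiv_comp p (mdifferentiableAt_chart hz (z.map_target hp))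
    (mdifferentiableAt_chart_symm hz hp)
  have h2 : z ∘ z.symm =ᶠ[nhds p] id :=
    Filter.eventually_of_mem (z.open_target.mem_nhds hp) fun x hx ↦ z.right_inv hx
  rw [h2.mfderiv_eq, mfderiv_id] at h1
  exact (congrArg (fun L ↦ L v) h1).symm

/-- Derivatives of functions, computed in a chart. -/
lemma mfderiv_eq_fderiv_chart (hz : z ∈ IsManifold.maximalAtlas 𝓘(ℝ, E) ∞ M) {p : E}
    (hp : p ∈ z.target) {f : M → F} (hf : MDifferentiableAt 𝓘(ℝ, E) 𝓘(ℝ, F) f (z.symm p))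
    (v : TangentSpace 𝓘(ℝ, E) (z.symm p)) :
    mfderiv 𝓘(ℝ, E) 𝓘(ℝ, F) f (z.symm p) v
      = fderiv ℝ (f ∘ z.symm) p (dchart z (z.symm p) v) := by
  have h1 := mfderiv_comp p hf (mdifferentiableAt_chart_symm hz hp)
  rw [mfderiv_eq_fderiv] at h1
  rw [h1]
  exact (congrArg _ (dchartSymm_dchart hz hp v)).symm

lemma contDiffOn_comp_symm (hz : z ∈ IsManifold.maximalAtlas 𝓘(ℝ, E) ∞ M) {O : Set M}
    {f : M → F} (hf : ContMDiffOn 𝓘(ℝ, E) 𝓘(ℝ, F) ∞ f O) :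
    ContDiffOn ℝ ∞ (f ∘ z.symm) (z.target ∩ z.symm ⁻¹' O) := by
  rw [← contMDiffOn_iff_contDiffOn]
  exact hf.comp ((contMDiffOn_symm_of_mem_maximalAtlas hz).mono Set.inter_subset_left)
    fun p hp ↦ hp.2

/-- The components of a smooth vector field in a chart are smooth. -/
lemma contDiffOn_vectorField (hz : z ∈ IsManifold.maximalAtlas 𝓘(ℝ, E) ∞ M) {O : Set M}
    {V : (x : M) → TangentSpace 𝓘(ℝ, E) x}
    (hV : ContMDiffOn 𝓘(ℝ, E) (𝓘(ℝ, E).tangent) ∞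
      (fun x ↦ (⟨x, V x⟩ : TangentBundle 𝓘(ℝ, E) M)) O) :
    ContDiffOn ℝ ∞ (fun p ↦ dchart z (z.symm p) (V (z.symm p)))
      (z.target ∩ z.symm ⁻¹' O) := by
  refine contMDiffOn_iff_contDiffOn.mp ?_
  have h1 : ContMDiffOn 𝓘(ℝ, E) (𝓘(ℝ, E).tangent) ∞
      (fun p ↦ (⟨z.symm p, V (z.symm p)⟩ : TangentBundle 𝓘(ℝ, E) M))
      (z.target ∩ z.symm ⁻¹' O) :=
    hV.comp ((contMDiffOn_symm_of_mem_maximalAtlas hz).mono Set.inter_subset_left)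
      fun p hp ↦ hp.2
  have h2 : ContMDiffOn 𝓘(ℝ, E).tangent 𝓘(ℝ, E).tangent ∞
      (tangentMapWithin 𝓘(ℝ, E) 𝓘(ℝ, E) z z.source) (π E (TangentSpace 𝓘(ℝ, E)) ⁻¹' z.source) :=
    (contMDiffOn_of_mem_maximalAtlas hz).contMDiffOn_tangentMapWithin (by simp)
      z.open_source.uniqueMDiffOn
  have h3 := (contMDiff_snd_tangentBundle_modelSpace E 𝓘(ℝ, E) (n := ∞)).comp_contMDiffOn
    (h2.comp h1 fun p hp ↦ z.map_target hp.1)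
  refine h3.congr fun p hp ↦ ?_
  have : mfderivWithin 𝓘(ℝ, E) 𝓘(ℝ, E) z z.source (z.symm p) = mfderiv 𝓘(ℝ, E) 𝓘(ℝ, E) z (z.symm p) :=
    mfderivWithin_of_isOpen z.open_source (z.map_target hp.1)
  exact (congrArg (fun L ↦ L (V (z.symm p))) this).symm

/-- Coordinate vector fields are smooth. -/
lemma contMDiffOn_coordVector (hz : z ∈ IsManifold.maximalAtlas 𝓘(ℝ, E) ∞ M) (v : E) :
    ContMDiffOn 𝓘(ℝ, E) (𝓘(ℝ, E).tangent) ∞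
      (fun p ↦ (⟨z.symm p, dchartSymm z p v⟩ : TangentBundle 𝓘(ℝ, E) M))
      z.target := by
  have h2 : ContMDiffOn 𝓘(ℝ, E).tangent 𝓘(ℝ, E).tangent ∞
      (tangentMapWithin 𝓘(ℝ, E) 𝓘(ℝ, E) z.symm z.target)
      (π E (TangentSpace 𝓘(ℝ, E)) ⁻¹' z.target) :=
    (contMDiffOn_symm_of_mem_maximalAtlas hz).contMDiffOn_tangentMapWithin (by simp)
      z.open_target.uniqueMDiffOn
  have h1 : ContMDiff 𝓘(ℝ, E) 𝓘(ℝ, E).tangent ∞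
      (fun p : E ↦ (⟨p, v⟩ : TangentBundle 𝓘(ℝ, E) E)) :=
    (contMDiff_vectorSpace_iff_contDiff (V := fun _ ↦ v)).mpr contDiff_const
  have h3 := h2.comp h1.contMDiffOn (s := z.target) fun p hp ↦ hp
  refine h3.congr fun p hp ↦ ?_
  have : mfderivWithin 𝓘(ℝ, E) 𝓘(ℝ, E) z.symm z.target p = mfderiv 𝓘(ℝ, E) 𝓘(ℝ, E) z.symm p :=
    mfderivWithin_of_isOpen z.open_target hp
  simp only [Function.comp_apply, tangentMapWithin, this]
  rfl

/-- The coefficients of a smooth metric are smooth. -/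
lemma contDiffOn_metric
    (g : ContMDiffRiemannianMetric 𝓘(ℝ, E) ∞ E (fun x : M ↦ TangentSpace 𝓘(ℝ, E) x))
    (hz : z ∈ IsManifold.maximalAtlas 𝓘(ℝ, E) ∞ M) (v w : E) :
    ContDiffOn ℝ ∞ (fun p ↦ g.inner (z.symm p) (dchartSymm z p v)
      (dchartSymm z p w)) z.target := by
  refine contMDiffOn_iff_contDiffOn.mp ?_
  intro p hp
  have h1 := contMDiffOn_coordVector hz v p hp
  have h2 := contMDiffOn_coordVector hz w p hp
  have : ContMDiffWithinAt 𝓘(ℝ, E) (𝓘(ℝ, E).prod 𝓘(ℝ)) ∞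
      (fun m ↦ TotalSpace.mk' ℝ (E := Bundle.Trivial M ℝ) (z.symm m)
        (g.inner (z.symm m) (dchartSymm z m v)
          (dchartSymm z m w))) z.target p := by
    apply ContMDiffWithinAt.clm_bundle_apply₂ (F₁ := E) (F₂ := E)
    · exact ContMDiffAt.comp_contMDiffWithinAt p g.contMDiff.contMDiffAt
        (contMDiffOn_symm_of_mem_maximalAtlas hz p hp)
    · exact h1
    · exact h2
  simp only [contMDiffWithinAt_totalSpace] at this
  exact this.2

/-- The Lie bracket of vector fields, computed in a chart. -/
lemma dchart_mlieBracket [CompleteSpace E] (hz : z ∈ IsManifold.maximalAtlas 𝓘(ℝ, E) ∞ M)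
    {V W : (x : M) → TangentSpace 𝓘(ℝ, E) x} {p : E} (hp : p ∈ z.target)
    (hV : ContMDiffAt 𝓘(ℝ, E) (𝓘(ℝ, E).tangent) ∞
      (fun x ↦ (⟨x, V x⟩ : TangentBundle 𝓘(ℝ, E) M)) (z.symm p))
    (hW : ContMDiffAt 𝓘(ℝ, E) (𝓘(ℝ, E).tangent) ∞
      (fun x ↦ (⟨x, W x⟩ : TangentBundle 𝓘(ℝ, E) M)) (z.symm p)) :
    dchart z (z.symm p) (VectorField.mlieBracket 𝓘(ℝ, E) V W (z.symm p))
      = VectorField.lieBracket ℝ (fun p ↦ dchart z (z.symm p) (V (z.symm p)))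
        (fun p ↦ dchart z (z.symm p) (W (z.symm p))) p := by
  have : IsManifold 𝓘(ℝ, E) (minSmoothness ℝ 3) M :=
    IsManifold.of_le (n := ∞) (by simp only [minSmoothness_of_isRCLikeNormedField]; exact ENat.LEInfty.out)
  -- Pullback of vector fields is defined through the inverse of the differential of `z.symm`. Once
  -- that inverse is known to be the differential of `z`, naturality of the bracket under pullback
  -- by `z.symm` is the claim.
  have hinv : ∀ p ∈ z.target, (mfderiv 𝓘(ℝ, E) 𝓘(ℝ, E) z.symm p).inverse = dchart z (z.symm p) := by
    intro p hp
    apply ContinuousLinearMap.inverse_eq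
    · ext v
      exact dchartSymm_dchart hz hp v
    · ext v
      exact dchart_dchartSymm hz hp v
  have key := VectorField.mpullback_mlieBracket (𝕜 := ℝ) (I := 𝓘(ℝ, E)) (I' := 𝓘(ℝ, E))
    (f := z.symm) (V := V) (W := W) (x₀ := p) (n := ∞)
    (hV.mdifferentiableAt (by simp)) (hW.mdifferentiableAt (by simp))
    (contMDiffAt_symm_of_mem_maximalAtlas hz hp)
    (by simp only [minSmoothness_of_isRCLikeNormedField]; exact ENat.LEInfty.out)
  rw [VectorField.mpullback_apply, hinv _ hp] at key
  refine key.trans ?_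
  rw [← VectorField.mlieBracketWithin_univ, VectorField.mlieBracketWithin_eq_lieBracketWithin]
  refine (congrFun (VectorField.lieBracketWithin_univ (𝕜 := ℝ) (E := E)) p).trans ?_
  apply Filter.EventuallyEq.lieBracket_vectorField_eq
  · filter_upwards [z.open_target.mem_nhds hp] with p hp
    rw [VectorField.mpullback_apply, hinv _ hp]
    rfl
  · filter_upwards [z.open_target.mem_nhds hp] with p hp
    rw [VectorField.mpullback_apply, hinv _ hp]
    rfl

end Charts

/-! ### Partial derivatives on Euclidean space -/

section Partial

variable {n : ℕ} {O : Set (EuclideanSpace ℝ (Fin n))} {u : EuclideanSpace ℝ (Fin n)}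
  {f f' : EuclideanSpace ℝ (Fin n) → ℝ} {k l : Fin n}

lemma contDiffOn_partialD (hO : IsOpen O) (hf : ContDiffOn ℝ ∞ f O) (k : Fin n) :
    ContDiffOn ℝ ∞ (partialD k f) O :=
  (hf.fderiv_of_isOpen hO (by simp)).clm_apply contDiffOn_const

lemma partialD_congr (hff : f =ᶠ[nhds u] f') : partialD k f u = partialD k f' u := by
  rw [partialD, partialD, hff.fderiv_eq]

lemma partialD_sum {ι : Type*} {s : Finset ι} {F : ι → EuclideanSpace ℝ (Fin n) → ℝ}
    (hF : ∀ i ∈ s, DifferentiableAt ℝ (F i) u) :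
    partialD k (fun v ↦ ∑ i ∈ s, F i v) u = ∑ i ∈ s, partialD k (F i) u := by
  simp only [partialD]
  rw [fderiv_fun_sum hF, sum_apply]

lemma partialD_mul (hf : DifferentiableAt ℝ f u) (hf' : DifferentiableAt ℝ f' u) :
    partialD k (fun v ↦ f v * f' v) u = partialD k f u * f' u + f u * partialD k f' u := by
  simp only [partialD]
  rw [fderiv_fun_mul hf hf']
  simp only [add_apply, smul_apply, smul_eq_mul]
  ring

lemma partialD_add (hf : DifferentiableAt ℝ f u) (hf' : DifferentiableAt ℝ f' u) :
    partialD k (fun v ↦ f v + f' v) u = partialD k f u + partialD k f' u := by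
  simp only [partialD]
  rw [fderiv_fun_add hf hf', add_apply]

lemma partialD_sub (hf : DifferentiableAt ℝ f u) (hf' : DifferentiableAt ℝ f' u) :
    partialD k (fun v ↦ f v - f' v) u = partialD k f u - partialD k f' u := by
  simp only [partialD]
  rw [fderiv_fun_sub hf hf', sub_apply]

lemma partialD_const_mul (a : ℝ) (hf : DifferentiableAt ℝ f u) :
    partialD k (fun v ↦ a * f v) u = a * partialD k f u := by
  simp only [partialD]
  rw [fderiv_const_mul hf, smul_apply, smul_eq_mul]

lemma partialD_comm (hO : IsOpen O) (hf : ContDiffOn ℝ ∞ f O) (hu : u ∈ O) (k l : Fin n) :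
    partialD k (partialD l f) u = partialD l (partialD k f) u := by
  have hf2 : ContDiffAt ℝ ∞ f u := hf.contDiffAt (hO.mem_nhds hu)
  have h1 : DifferentiableAt ℝ (fderiv ℝ f) u :=
    (hf2.fderiv_right (m := 1) (by rw [one_add_one_eq_two]; exact ENat.LEInfty.out)).differentiableAt one_ne_zero
  have h2 : ∀ k l : Fin n, partialD k (partialD l f) u
      = fderiv ℝ (fderiv ℝ f) u (EuclideanSpace.single k 1) (EuclideanSpace.single l 1) := by
    intro k l
    rw [partialD]
    change fderiv ℝ (fun v ↦ fderiv ℝ f v (EuclideanSpace.single l 1)) u _ = _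
    rw [fderiv_clm_apply h1 (by fun_prop)]
    simp
  rw [h2, h2]
  exact (hf2.isSymmSndFDerivAt (by simp only [minSmoothness_of_isRCLikeNormedField]; exact ENat.LEInfty.out)).eq _ _

/-- The derivative along a curve or a map, in terms of partial derivatives. -/
lemma fderiv_apply_eq_sum_partialD (w : EuclideanSpace ℝ (Fin n)) :
    fderiv ℝ f u w = ∑ k, w k * partialD k f u := by
  have : w = ∑ k, w k • EuclideanSpace.single k (1 : ℝ) := by
    ext i
    simp [Finset.sum_apply, Pi.single_apply]
  conv_lhs => rw [this]
  simp [partialD]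

end Partial

/-! ### Levi-Civita connection and curvature symmetries of the target -/

section Geometry

variable {n : ℕ} {N : Type*} [TopologicalSpace N] [ChartedSpace (EuclideanSpace ℝ (Fin n)) N]
  [IsManifold (𝓡 n) ∞ N] (h : TargetMetric n N)
  {y : OpenPartialHomeomorph N (EuclideanSpace ℝ (Fin n))}

lemma metricCoeff_apply (u : EuclideanSpace ℝ (Fin n)) (i j : Fin n) :
    metricCoeff h y u i j = h.inner (y.symm u) (dchartSymm y u (EuclideanSpace.single i 1))
      (dchartSymm y u (EuclideanSpace.single j 1)) := rfl

/-- The function `h_ij`. -/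
def metricFn (y : OpenPartialHomeomorph N (EuclideanSpace ℝ (Fin n))) (i j : Fin n)
    (u : EuclideanSpace ℝ (Fin n)) : ℝ := metricCoeff h y u i j

lemma metricFn_symm (i j : Fin n) : metricFn h y i j = metricFn h y j i :=
  funext fun _ ↦ h.symm _ _ _

lemma christoffel_eq (i j k : Fin n) (u : EuclideanSpace ℝ (Fin n)) :
    christoffel h y i j k u = 1 / 2 * ∑ l, (metricCoeff h y u)⁻¹ i l *
      (partialD j (metricFn h y l k) u + partialD k (metricFn h y l j) u
        - partialD l (metricFn h y j k) u) := rfl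

lemma metricCoeff_symm (u : EuclideanSpace ℝ (Fin n)) (i j : Fin n) :
    metricCoeff h y u i j = metricCoeff h y u j i := h.symm _ _ _

lemma inner_dchartSymm (u v w : EuclideanSpace ℝ (Fin n)) :
    h.inner (y.symm u) (dchartSymm y u v) (dchartSymm y u w)
      = ∑ i, ∑ j, metricCoeff h y u i j * v i * w j := by
  have H : ∀ w : EuclideanSpace ℝ (Fin n), w = ∑ k, w k • EuclideanSpace.single k (1 : ℝ) := by
    intro w
    ext i
    simp [Finset.sum_apply, Pi.single_apply]
  conv_lhs => rw [H v, H w]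
  simp only [map_sum, map_smul, sum_apply, smul_apply,
    smul_eq_mul, metricCoeff_apply, Finset.mul_sum]
  rw [Finset.sum_comm]
  refine Finset.sum_congr rfl fun i _ ↦ Finset.sum_congr rfl fun j _ ↦ by ring

variable (hy : y ∈ IsManifold.maximalAtlas (𝓡 n) ∞ N)
include hy

lemma contDiffOn_metricCoeff (i j : Fin n) :
    ContDiffOn ℝ ∞ (metricFn h y i j) y.target :=
  contDiffOn_metric h hy _ _

variable {u : EuclideanSpace ℝ (Fin n)} (hu : u ∈ y.target)

include hu in
-- A kernel vector would be the coordinate vector of a tangent vector of length zero; positivity of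
-- the metric and injectivity of the differential of `y.symm` exclude it.
lemma isUnit_det_metricCoeff : IsUnit (metricCoeff h y u).det := by
  rw [isUnit_iff_ne_zero]
  intro h0
  obtain ⟨v, hv0, hv⟩ := Matrix.exists_mulVec_eq_zero_iff.mpr h0
  apply hv0
  have h1 := inner_dchartSymm h (y := y) u (WithLp.toLp 2 v) (WithLp.toLp 2 v)
  have h2 : ∑ i, ∑ j, metricCoeff h y u i j * v i * v j = 0 := by
    have : ∀ i, ∑ j, metricCoeff h y u i j * v i * v j = v i * (metricCoeff h y u).mulVec v i := by
      intro i
      simp only [Matrix.mulVec, dotProduct, Finset.mul_sum]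
      exact Finset.sum_congr rfl fun j _ ↦ by ring
    simp [this, hv]
  rw [h2] at h1
  by_contra hv1
  have h3 : dchartSymm y u (WithLp.toLp 2 v) ≠ 0 := by
    intro h4
    have h5 := dchart_dchartSymm hy hu (WithLp.toLp 2 v)
    rw [h4, map_zero] at h5
    apply hv0
    have := congrArg WithLp.ofLp h5
    exact this.symm
  exact (h.pos _ _ h3).ne' h1

omit hy in
lemma contDiffOn_det {E : Type*} [NormedAddCommGroup E] [NormedSpace ℝ E] {O : Set E}
    {A : E → Matrix (Fin n) (Fin n) ℝ} (hA : ∀ i j, ContDiffOn ℝ ∞ (fun u ↦ A u i j) O) :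
    ContDiffOn ℝ ∞ (fun u ↦ (A u).det) O := by
  simp only [Matrix.det_apply']
  exact ContDiffOn.sum fun s _ ↦ contDiffOn_const.mul (contDiffOn_prod fun i _ ↦ hA _ _)

/-- Cramer's rule: every entry is a quotient of determinants, namely of the matrix with one row
replaced by a constant one over the full matrix. -/
lemma contDiffOn_metricCoeff_inv (i j : Fin n) :
    ContDiffOn ℝ ∞ (fun u ↦ (metricCoeff h y u)⁻¹ i j) y.target := by
  simp only [Matrix.inv_def, Matrix.smul_apply, smul_eq_mul, Ring.inverse_eq_inv',
    Matrix.adjugate_apply]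
  refine ContDiffOn.mul (ContDiffOn.inv (contDiffOn_det fun i j ↦ contDiffOn_metricCoeff h hy i j)
    fun u hu ↦ (isUnit_det_metricCoeff h hy hu).ne_zero) (contDiffOn_det fun a b ↦ ?_)
  by_cases ha : a = j
  · subst ha
    simpa using contDiffOn_const
  · simp only [Matrix.updateRow_ne ha]
    exact contDiffOn_metricCoeff h hy a b

lemma contDiffOn_christoffel (i j k : Fin n) :
    ContDiffOn ℝ ∞ (christoffel h y i j k) y.target := by
  rw [show christoffel h y i j k = _ from funext (christoffel_eq h i j k)]
  refine contDiffOn_const.mul (ContDiffOn.sum fun l _ ↦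
    (contDiffOn_metricCoeff_inv h hy i l).mul ?_)
  have H := fun a b c ↦ contDiffOn_partialD y.open_target (contDiffOn_metricCoeff h hy a b) c
  exact ((H _ _ _).add (H _ _ _)).sub (H _ _ _)

lemma contDiffOn_riemann (i j k l : Fin n) :
    ContDiffOn ℝ ∞ (riemann h y i j k l) y.target := by
  unfold riemann
  have H := fun a b c ↦ contDiffOn_christoffel h hy a b c
  have H' := fun a b c d ↦ contDiffOn_partialD y.open_target (H a b c) d
  exact ((H' _ _ _ _).sub (H' _ _ _ _)).add
    (ContDiffOn.sum fun m _ ↦ ((H _ _ _).mul (H _ _ _)).sub ((H _ _ _).mul (H _ _ _)))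

lemma contDiffOn_riemannLow (i j k l : Fin n) :
    ContDiffOn ℝ ∞ (riemannLow h y i j k l) y.target :=
  ContDiffOn.sum fun m _ ↦ (contDiffOn_metricCoeff h hy i m).mul (contDiffOn_riemann h hy m j k l)

omit hy in
lemma christoffel_symm (i j k : Fin n) (u : EuclideanSpace ℝ (Fin n)) :
    christoffel h y i j k u = christoffel h y i k j u := by
  simp only [christoffel_eq]
  congr 1
  refine Finset.sum_congr rfl fun l _ ↦ ?_
  rw [metricFn_symm h j k]
  ring

/-- The Christoffel symbols of the first kind. -/
def christoffelLow (y : OpenPartialHomeomorph N (EuclideanSpace ℝ (Fin n))) (i j k : Fin n)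
    (u : EuclideanSpace ℝ (Fin n)) : ℝ :=
  1 / 2 * (partialD j (metricFn h y i k) u
    + partialD k (metricFn h y i j) u
    - partialD i (metricFn h y j k) u)

include hu

/-- Lowering the index cancels the inverse metric. From here on the inverse is never differentiated.
-/
lemma sum_metricCoeff_christoffel (i j k : Fin n) :
    ∑ m, metricCoeff h y u i m * christoffel h y m j k u = christoffelLow h y i j k u := by
  have h1 : metricCoeff h y u * (metricCoeff h y u)⁻¹ = 1 :=
    Matrix.mul_nonsing_inv _ (isUnit_det_metricCoeff h hy hu)
  have h2 : ∀ l, ∑ m, metricCoeff h y u i m * (metricCoeff h y u)⁻¹ m l = if i = l then 1 else 0 := by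
    intro l
    have := congrFun (congrFun h1 i) l
    rwa [Matrix.mul_apply, Matrix.one_apply] at this
  simp only [christoffel_eq]
  have h3 : ∀ f : Fin n → ℝ, ∑ m, metricCoeff h y u i m *
      (1 / 2 * ∑ l, (metricCoeff h y u)⁻¹ m l * f l) = 1 / 2 * f i := by
    intro f
    calc _ = 1 / 2 * ∑ l, (∑ m, metricCoeff h y u i m * (metricCoeff h y u)⁻¹ m l) * f l := by
          simp only [Finset.mul_sum, Finset.sum_mul]
          rw [Finset.sum_comm]
          refine Finset.sum_congr rfl fun _ _ ↦ Finset.sum_congr rfl fun _ _ ↦ by ring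
      _ = _ := by simp [h2]
  rw [h3]
  rfl

omit hy hu in
lemma partialD_metricCoeff_eq_low (i j k : Fin n) :
    partialD k (metricFn h y i j) u
      = christoffelLow h y i k j u + christoffelLow h y j k i u := by
  unfold christoffelLow
  rw [metricFn_symm h j i, metricFn_symm h k i, metricFn_symm h k j]
  ring

/-- The metric is parallel. -/
lemma partialD_metricCoeff (i j k : Fin n) :
    partialD k (metricFn h y i j) u
      = ∑ m, metricCoeff h y u i m * christoffel h y m k j u
        + ∑ m, metricCoeff h y u j m * christoffel h y m k i u := by
  rw [sum_metricCoeff_christoffel h hy hu, sum_metricCoeff_christoffel h hy hu,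
    partialD_metricCoeff_eq_low]

/-- Apply the product rule to Γ_{i,lj} = h_im Γ^m_lj. Since ∂_k h_im = Γ_{i,km} + Γ_{m,ki}, half of
the terms so produced cancel the ΓΓ terms of the curvature and the other half remain. -/
lemma riemannLow_eq (i j k l : Fin n) :
    riemannLow h y i j k l u
      = partialD k (christoffelLow h y i l j) u - partialD l (christoffelLow h y i k j) u
        - ∑ m, christoffelLow h y m k i u * christoffel h y m l j u
        + ∑ m, christoffelLow h y m l i u * christoffel h y m k j u := by
  have hd : ∀ {f : EuclideanSpace ℝ (Fin n) → ℝ}, ContDiffOn ℝ ∞ f y.target →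
      DifferentiableAt ℝ f u := fun hf ↦
    (hf.contDiffAt (y.open_target.mem_nhds hu)).differentiableAt (by simp)
  have h1 : ∀ k l, partialD k (christoffelLow h y i l j) u
      = ∑ m, (christoffelLow h y i k m u * christoffel h y m l j u
          + christoffelLow h y m k i u * christoffel h y m l j u
          + metricCoeff h y u i m * partialD k (christoffel h y m l j) u) := by
    intro k l
    have : christoffelLow h y i l j =ᶠ[nhds u]
        fun v ↦ ∑ m, metricFn h y i m v * christoffel h y m l j v := by
      filter_upwards [y.open_target.mem_nhds hu] with v hv
      exact (sum_metricCoeff_christoffel h hy hv i l j).symm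
    rw [partialD_congr this, partialD_sum (F := fun m v ↦ metricFn h y i m v * christoffel h y m l j v)
      fun m _ ↦ (hd (contDiffOn_metricCoeff h hy i m)).mul (hd (contDiffOn_christoffel h hy m l j))]
    refine Finset.sum_congr rfl fun m _ ↦ ?_
    rw [partialD_mul (hd (contDiffOn_metricCoeff h hy i m)) (hd (contDiffOn_christoffel h hy m l j)),
      partialD_metricCoeff_eq_low, add_mul]
    rfl
  have h2 : ∀ k l, ∑ m, metricCoeff h y u i m *
        ∑ s, christoffel h y m k s u * christoffel h y s l j u
      = ∑ s, christoffelLow h y i k s u * christoffel h y s l j u := by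
    intro k l
    simp only [Finset.mul_sum, ← sum_metricCoeff_christoffel h hy hu, Finset.sum_mul]
    rw [Finset.sum_comm]
    refine Finset.sum_congr rfl fun _ _ ↦ Finset.sum_congr rfl fun _ _ ↦ by ring
  unfold riemannLow riemann
  rw [h1, h1]
  have h3 : ∀ m, metricCoeff h y u i m * (partialD k (christoffel h y m l j) u
        - partialD l (christoffel h y m k j) u
        + ∑ s, (christoffel h y m k s u * christoffel h y s l j u
          - christoffel h y m l s u * christoffel h y s k j u))
      = metricCoeff h y u i m * partialD k (christoffel h y m l j) u
        - metricCoeff h y u i m * partialD l (christoffel h y m k j) u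
        + metricCoeff h y u i m * ∑ s, christoffel h y m k s u * christoffel h y s l j u
        - metricCoeff h y u i m * ∑ s, christoffel h y m l s u * christoffel h y s k j u := by
    intro m
    rw [Finset.sum_sub_distrib]
    ring
  rw [Finset.sum_congr rfl fun m _ ↦ h3 m]
  simp only [Finset.sum_sub_distrib, Finset.sum_add_distrib, h2]
  ring

lemma partialD_christoffelLow (i j k l : Fin n) :
    partialD l (christoffelLow h y i j k) u
      = 1 / 2 * (partialD l (partialD j (metricFn h y i k)) u
        + partialD l (partialD k (metricFn h y i j)) u
        - partialD l (partialD i (metricFn h y j k)) u) := by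
  have hd : ∀ a b c, DifferentiableAt ℝ (partialD c (metricFn h y a b)) u := fun a b c ↦
    ((contDiffOn_partialD y.open_target (contDiffOn_metricCoeff h hy a b) c).contDiffAt
      (y.open_target.mem_nhds hu)).differentiableAt (by simp)
  change partialD l (fun v ↦ 1 / 2 * (partialD j (metricFn h y i k) v
    + partialD k (metricFn h y i j) v
    - partialD i (metricFn h y j k) v)) u = _
  rw [partialD_const_mul (f := fun v ↦ partialD j (metricFn h y i k) v
      + partialD k (metricFn h y i j) v - partialD i (metricFn h y j k) v) _
      (((hd _ _ _).add (hd _ _ _)).sub (hd _ _ _)),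
    partialD_sub (f := fun v ↦ partialD j (metricFn h y i k) v + partialD k (metricFn h y i j) v)
      ((hd _ _ _).add (hd _ _ _)) (hd _ _ _), partialD_add (hd _ _ _) (hd _ _ _)]

/-- Both sides are h_ab Γ^a_ki Γ^b_lj. -/
lemma sum_christoffelLow_christoffel_symm (i j k l : Fin n) :
    ∑ m, christoffelLow h y m k i u * christoffel h y m l j u
      = ∑ m, christoffelLow h y m l j u * christoffel h y m k i u := by
  simp only [← sum_metricCoeff_christoffel h hy hu, Finset.sum_mul]
  rw [Finset.sum_comm]
  refine Finset.sum_congr rfl fun a _ ↦ Finset.sum_congr rfl fun b _ ↦ ?_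
  rw [metricCoeff_symm h u b a]
  ring

/-- By `riemannLow_eq` the curvature is a combination of second derivatives of h and of quadratic
terms symmetric in the sense of `sum_christoffelLow_christoffel_symm`. Its symmetries then follow
from the symmetry of h and the commutation of partial derivatives. -/
lemma riemannLow_swap_fst (i j k l : Fin n) :
    riemannLow h y j i k l u = -riemannLow h y i j k l u := by
  have hc := fun a b c d ↦ partialD_comm y.open_target (contDiffOn_metricCoeff h hy a b) hu c d
  simp only [riemannLow_eq h hy hu, partialD_christoffelLow h hy hu]
  rw [sum_christoffelLow_christoffel_symm h hy hu j i k l,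
    sum_christoffelLow_christoffel_symm h hy hu j i l k,
    metricFn_symm h j i, metricFn_symm h l i, metricFn_symm h k i, metricFn_symm h l j,
    metricFn_symm h k j, hc _ _ l k]
  ring

lemma riemannLow_pair_symm (i j k l : Fin n) :
    riemannLow h y k l i j u = riemannLow h y i j k l u := by
  have hc := fun a b c d ↦ partialD_comm y.open_target (contDiffOn_metricCoeff h hy a b) hu c d
  have hs : ∀ m a b, christoffelLow h y m a b u = christoffelLow h y m b a u := by
    intro m a b
    unfold christoffelLow
    rw [metricFn_symm h b a]
    ring
  have h1 := sum_christoffelLow_christoffel_symm h hy hu j i k l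
  simp only [riemannLow_eq h hy hu, partialD_christoffelLow h hy hu]
  simp only [hs _ i k, hs _ j k, christoffel_symm h _ j l, christoffel_symm h _ i l]
  rw [metricFn_symm h k i, metricFn_symm h l j, metricFn_symm h k j, hc _ _ j i, hc _ _ l k,
    hc _ _ k j, hc _ _ l j, hc _ _ k i, hc _ _ l i]
  linarith

lemma riemannLow_swap_snd (i j k l : Fin n) :
    riemannLow h y i j l k u = -riemannLow h y i j k l u := by
  rw [← riemannLow_pair_symm h hy hu, riemannLow_swap_fst h hy hu, riemannLow_pair_symm h hy hu]

end Geometry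

/-! ### The pairing on tuples induced by the target metric -/

section Hin

variable {n : ℕ} {F : Type*} [NormedAddCommGroup F] [InnerProductSpace ℝ F]

/-- The bilinear form `h_ij ⟨a^i, b^j⟩` on tuples of vectors. -/
def hin (H : Fin n → Fin n → ℝ) (a b : Fin n → F) : ℝ :=
  ∑ i, ∑ j, H i j * inner ℝ (a i) (b j)

variable (H : Fin n → Fin n → ℝ) (a a' b b' : Fin n → F) (c : ℝ)

lemma hin_add_left : hin H (a + a') b = hin H a b + hin H a' b := by
  simp [hin, inner_add_left, mul_add, Finset.sum_add_distrib]

lemma hin_add_right : hin H a (b + b') = hin H a b + hin H a b' := by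
  simp [hin, inner_add_right, mul_add, Finset.sum_add_distrib]

lemma hin_smul_left : hin H (c • a) b = c * hin H a b := by
  simp only [hin, Pi.smul_apply, inner_smul_left, Finset.mul_sum, RCLike.conj_to_real]
  exact Finset.sum_congr rfl fun _ _ ↦ Finset.sum_congr rfl fun _ _ ↦ by ring

lemma hin_smul_right : hin H a (c • b) = c * hin H a b := by
  simp only [hin, Pi.smul_apply, inner_smul_right, Finset.mul_sum]
  exact Finset.sum_congr rfl fun _ _ ↦ Finset.sum_congr rfl fun _ _ ↦ by ring

lemma hin_neg_left : hin H (-a) b = -hin H a b := by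
  simpa using hin_smul_left H a b (-1)

lemma hin_neg_right : hin H a (-b) = -hin H a b := by
  simpa using hin_smul_right H a b (-1)

lemma hin_sub_left : hin H (a - a') b = hin H a b - hin H a' b := by
  rw [sub_eq_add_neg, hin_add_left, hin_neg_left, sub_eq_add_neg]

lemma hin_sub_right : hin H a (b - b') = hin H a b - hin H a b' := by
  rw [sub_eq_add_neg, hin_add_right, hin_neg_right, sub_eq_add_neg]

variable {H} in
lemma hin_comm (hH : ∀ i j, H i j = H j i) : hin H a b = hin H b a := by
  unfold hin
  rw [Finset.sum_comm]
  exact Finset.sum_congr rfl fun i _ ↦ Finset.sum_congr rfl fun j _ ↦ by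
    rw [hH j i, real_inner_comm]

end Hin

/-! ### Quaternions as the Clifford module of the plane -/

section Quat

/-- The inner product of quaternions in coordinates. -/
lemma quat_inner (a b : Quaternion ℝ) :
    inner ℝ a b = a.re * b.re + a.imI * b.imI + a.imJ * b.imJ + a.imK * b.imK := by
  rw [Quaternion.inner_def]
  simp

/-- Left multiplication by an imaginary quaternion is skew. -/
lemma inner_mul_left_of_re_eq_zero {q : Quaternion ℝ} (hq : q.re = 0) (a b : Quaternion ℝ) :
    inner ℝ (q * a) b = -inner ℝ a (q * b) := by
  simp only [quat_inner, Quaternion.re_mul, Quaternion.imI_mul, Quaternion.imJ_mul,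
    Quaternion.imK_mul, hq]
  ring

variable {n : ℕ} {H : Fin n → Fin n → ℝ}

lemma hin_mul_left {q : Quaternion ℝ} (hq : q.re = 0) (a b : Fin n → Quaternion ℝ) :
    hin H (q • a) b = -hin H a (q • b) := by
  simp only [hin, Pi.smul_apply, smul_eq_mul, inner_mul_left_of_re_eq_zero hq, mul_neg,
    Finset.sum_neg_distrib]

/-- A skew operator has zero quadratic form. This is what removes the intrinsic spinor curvature and
the spin connection from the kinetic terms. -/
lemma hin_mul_self (hH : ∀ i j, H i j = H j i) {q : Quaternion ℝ} (hq : q.re = 0)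
    (a : Fin n → Quaternion ℝ) : hin H a (q • a) = 0 := by
  have h1 := hin_mul_left (H := H) hq a a
  rw [hin_comm _ _ hH] at h1
  linarith

/-- Two anticommuting imaginary units. -/
structure IsCliffordPair (e f : Quaternion ℝ) : Prop where
  re_fst : e.re = 0
  re_snd : f.re = 0
  sq_fst : e * e = -1
  sq_snd : f * f = -1
  anticomm : f * e = -(e * f)

namespace IsCliffordPair

variable {e f : Quaternion ℝ} (hef : IsCliffordPair e f)
include hef

/-- The quarter turn keeps the product: f(-e) = ef. A statement proved for the first direction of an
arbitrary pair thus also covers the second direction. -/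
lemma rotate : IsCliffordPair f (-e) where
  re_fst := hef.re_snd
  re_snd := by simp [hef.re_fst]
  sq_fst := hef.sq_snd
  sq_snd := by simp [hef.sq_fst]
  anticomm := by simp [hef.anticomm]

/-- The products ef and fe have equal real parts and are opposite. Hence multiplication by ω is skew
too. -/
lemma re_mul : (e * f).re = 0 := by
  have h1 := congrArg QuaternionAlgebra.re hef.anticomm
  have h2 : (f * e).re = (e * f).re := by
    simp only [Quaternion.re_mul]
    ring
  simp only [Quaternion.re_neg] at h1
  linarith

lemma mul_snd : (e * f) * f = -e := by rw [mul_assoc, hef.sq_snd, mul_neg_one]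

lemma snd_mul : f * (e * f) = e := by
  rw [← mul_assoc, hef.anticomm, neg_mul, hef.mul_snd, neg_neg]

end IsCliffordPair

@[simp] lemma cliff_zero_re : (cliff 0).re = 0 := rfl
@[simp] lemma cliff_zero_imI : (cliff 0).imI = 1 := rfl
@[simp] lemma cliff_zero_imJ : (cliff 0).imJ = 0 := rfl
@[simp] lemma cliff_zero_imK : (cliff 0).imK = 0 := rfl
@[simp] lemma cliff_one_re : (cliff 1).re = 0 := rfl
@[simp] lemma cliff_one_imI : (cliff 1).imI = 0 := rfl
@[simp] lemma cliff_one_imJ : (cliff 1).imJ = 1 := rfl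
@[simp] lemma cliff_one_imK : (cliff 1).imK = 0 := rfl

lemma isCliffordPair_cliff : IsCliffordPair (cliff 0) (cliff 1) where
  re_fst := rfl
  re_snd := rfl
  sq_fst := by ext <;> simp <;> rfl
  sq_snd := by ext <;> simp <;> rfl
  anticomm := by ext <;> simp

end Quat

/-! ### The connection pulled back along a map -/

section Cov

variable {n : ℕ} {N : Type*} [TopologicalSpace N] [ChartedSpace (EuclideanSpace ℝ (Fin n)) N]
  [IsManifold (𝓡 n) ∞ N] (h : TargetMetric n N)
  {y : OpenPartialHomeomorph N (EuclideanSpace ℝ (Fin n))}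
  {F : Type*} [NormedAddCommGroup F] [NormedSpace ℝ F]

/-- The components of `φ_* V`. -/
def dirD (Φ : ℂ → EuclideanSpace ℝ (Fin n)) (V : ℂ → ℂ) (j : Fin n) (q : ℂ) : ℝ :=
  fderiv ℝ (fun q ↦ Φ q j) q (V q)

/-- The covariant derivative along `V` of a section of `φ^*TN ⊗ F`, with `F` a vector space. -/
def cov (y : OpenPartialHomeomorph N (EuclideanSpace ℝ (Fin n)))
    (Φ : ℂ → EuclideanSpace ℝ (Fin n)) (V : ℂ → ℂ) (a : Fin n → ℂ → F) (i : Fin n) (q : ℂ) : F :=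
  fderiv ℝ (a i) q (V q)
    + ∑ j, ∑ k, (christoffel h y i j k (Φ q) * dirD Φ V j q) • a k q

variable {Φ : ℂ → EuclideanSpace ℝ (Fin n)} {V W : ℂ → ℂ} {p : ℂ}

lemma fderiv_comp_eq_sum {f : EuclideanSpace ℝ (Fin n) → ℝ} (hΦ : DifferentiableAt ℝ Φ p)
    (hf : DifferentiableAt ℝ f (Φ p)) (v : ℂ) :
    fderiv ℝ (fun q ↦ f (Φ q)) p v = ∑ k, partialD k f (Φ p) * fderiv ℝ (fun q ↦ Φ q k) p v := by
  have h1 := fderiv_comp p hf hΦ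
  have h2 : ∀ k, fderiv ℝ (fun q ↦ Φ q k) p v = fderiv ℝ Φ p v k := by
    intro k
    have := ((EuclideanSpace.proj k : EuclideanSpace ℝ (Fin n) →L[ℝ] ℝ).hasFDerivAt.comp p
      hΦ.hasFDerivAt).fderiv
    exact congrArg (fun L ↦ L v) this
  change fderiv ℝ (f ∘ Φ) p v = _
  rw [h1, ContinuousLinearMap.comp_apply, fderiv_apply_eq_sum_partialD]
  exact Finset.sum_congr rfl fun k _ ↦ by rw [h2, mul_comm]

lemma cov_add {a b : Fin n → ℂ → F} {i : Fin n} (ha : DifferentiableAt ℝ (a i) p)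
    (hb : DifferentiableAt ℝ (b i) p) :
    cov h y Φ V (fun i q ↦ a i q + b i q) i p = cov h y Φ V a i p + cov h y Φ V b i p := by
  unfold cov
  rw [fderiv_fun_add ha hb]
  simp only [add_apply, smul_add, Finset.sum_add_distrib]
  abel

lemma cov_smul {a : Fin n → ℂ → ℝ} {s : ℂ → F} {i : Fin n} (ha : DifferentiableAt ℝ (a i) p)
    (hs : DifferentiableAt ℝ s p) :
    cov h y Φ V (fun i q ↦ a i q • s q) i p
      = cov h y Φ V a i p • s p + a i p • fderiv ℝ s p (V p) := by
  unfold cov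
  rw [fderiv_fun_smul ha hs]
  simp only [add_apply, smul_apply, ContinuousLinearMap.smulRight_apply,
    add_smul, Finset.sum_smul, smul_smul, smul_eq_mul]
  abel

lemma cov_smul_clm {a : Fin n → ℂ → F} {f : ℂ → ℝ} {i : Fin n} (ha : DifferentiableAt ℝ (a i) p)
    (hf : DifferentiableAt ℝ f p) (T : F →L[ℝ] F) :
    cov h y Φ V (fun i q ↦ f q • T (a i q)) i p
      = fderiv ℝ f p (V p) • T (a i p) + f p • T (cov h y Φ V a i p) := by
  unfold cov
  have h2 : DifferentiableAt ℝ (fun q ↦ T (a i q)) p := T.differentiableAt.comp p ha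
  rw [fderiv_fun_smul hf h2]
  have h1 : fderiv ℝ (fun q ↦ T (a i q)) p = T.comp (fderiv ℝ (a i) p) :=
    (T.hasFDerivAt.comp p ha.hasFDerivAt).fderiv
  rw [h1]
  simp only [add_apply, smul_apply, ContinuousLinearMap.smulRight_apply, map_add, map_sum, map_smul,
    smul_add, Finset.smul_sum, ContinuousLinearMap.comp_apply]
  simp only [smul_comm (f p)]
  abel

lemma cov_clm {a : Fin n → ℂ → F} {i : Fin n} (ha : DifferentiableAt ℝ (a i) p)
    (T : F →L[ℝ] F) :
    cov h y Φ V (fun i q ↦ T (a i q)) i p = T (cov h y Φ V a i p) := by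
  simpa using cov_smul_clm h (y := y) (Φ := Φ) (V := V) ha (differentiableAt_const (1 : ℝ)) T

variable (hy : y ∈ IsManifold.maximalAtlas (𝓡 n) ∞ N)
include hy

lemma differentiableAt_metricFn {u : EuclideanSpace ℝ (Fin n)} (hu : u ∈ y.target) (i j : Fin n) :
    DifferentiableAt ℝ (metricFn h y i j) u :=
  ((contDiffOn_metricCoeff h hy i j).contDiffAt (y.open_target.mem_nhds hu)).differentiableAt
    (by simp)

lemma differentiableAt_christoffel {u : EuclideanSpace ℝ (Fin n)} (hu : u ∈ y.target)
    (i j k : Fin n) : DifferentiableAt ℝ (christoffel h y i j k) u :=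
  ((contDiffOn_christoffel h hy i j k).contDiffAt (y.open_target.mem_nhds hu)).differentiableAt
    (by simp)

lemma differentiableAt_riemannLow {u : EuclideanSpace ℝ (Fin n)} (hu : u ∈ y.target)
    (i j k l : Fin n) : DifferentiableAt ℝ (riemannLow h y i j k l) u :=
  ((contDiffOn_riemannLow h hy i j k l).contDiffAt (y.open_target.mem_nhds hu)).differentiableAt
    (by simp)

/-- The connection is compatible with the metric. -/
lemma fderiv_hin {F : Type*} [NormedAddCommGroup F] [InnerProductSpace ℝ F] {a b : Fin n → ℂ → F}
    (hΦ : DifferentiableAt ℝ Φ p) (hp : Φ p ∈ y.target) (ha : ∀ i, DifferentiableAt ℝ (a i) p)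
    (hb : ∀ i, DifferentiableAt ℝ (b i) p) :
    fderiv ℝ (fun q ↦ hin (metricCoeff h y (Φ q)) (fun i ↦ a i q) (fun i ↦ b i q)) p (V p)
      = hin (metricCoeff h y (Φ p)) (fun i ↦ cov h y Φ V a i p) (fun i ↦ b i p)
        + hin (metricCoeff h y (Φ p)) (fun i ↦ a i p) (fun i ↦ cov h y Φ V b i p) := by
  have hm : ∀ i j, DifferentiableAt ℝ (fun q ↦ metricFn h y i j (Φ q)) p :=
    fun i j ↦ (differentiableAt_metricFn h hy hp i j).comp p hΦ
  have hi := fun i j ↦ (ha i).inner ℝ (hb j)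
  have h1 : ∀ i j, fderiv ℝ (fun q ↦ metricFn h y i j (Φ q) * inner ℝ (a i q) (b j q)) p (V p)
      = (∑ k, partialD k (metricFn h y i j) (Φ p) * dirD Φ V k p) * inner ℝ (a i p) (b j p)
        + metricFn h y i j (Φ p) * (inner ℝ (fderiv ℝ (a i) p (V p)) (b j p)
          + inner ℝ (a i p) (fderiv ℝ (b j) p (V p))) := by
    intro i j
    rw [fderiv_fun_mul (hm i j) (hi i j)]
    simp only [add_apply, smul_apply, smul_eq_mul]
    rw [fderiv_comp_eq_sum hΦ (differentiableAt_metricFn h hy hp i j),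
      fderiv_inner_apply ℝ (ha i) (hb j)]
    simp only [dirD]
    ring
  have h0 : fderiv ℝ (fun q ↦ hin (metricCoeff h y (Φ q)) (fun i ↦ a i q) (fun i ↦ b i q)) p (V p)
      = ∑ i, ∑ j, ((∑ k, partialD k (metricFn h y i j) (Φ p) * dirD Φ V k p)
            * inner ℝ (a i p) (b j p)
        + metricFn h y i j (Φ p) * (inner ℝ (fderiv ℝ (a i) p (V p)) (b j p)
          + inner ℝ (a i p) (fderiv ℝ (b j) p (V p)))) := by
    have hd : ∀ i j, DifferentiableAt ℝ
        (fun q ↦ metricFn h y i j (Φ q) * inner ℝ (a i q) (b j q)) p :=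
      fun i j ↦ (hm i j).mul (hi i j)
    change fderiv ℝ (fun q ↦ ∑ i, ∑ j, metricFn h y i j (Φ q) * inner ℝ (a i q) (b j q)) p (V p) = _
    rw [fderiv_fun_sum fun i _ ↦ DifferentiableAt.fun_sum fun j _ ↦ hd i j]
    simp only [sum_apply]
    refine Finset.sum_congr rfl fun i _ ↦ ?_
    rw [fderiv_fun_sum fun j _ ↦ hd i j]
    simp only [sum_apply, h1]
  rw [h0]
  -- The metric is parallel, so its derivative splits into two Christoffel sums, one for each index.
  -- The two sums complete the derivatives of a and of b to covariant ones.
  have h3 : ∀ i j k, partialD k (metricFn h y i j) (Φ p)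
      = ∑ m, metricCoeff h y (Φ p) m j * christoffel h y m k i (Φ p)
        + ∑ m, metricCoeff h y (Φ p) i m * christoffel h y m k j (Φ p) := by
    intro i j k
    rw [partialD_metricCoeff h hy hp, add_comm]
    simp only [metricCoeff_symm h _ j]
  simp only [h3, hin, cov, inner_add_left, inner_add_right, sum_inner, inner_sum, inner_smul_left,
    inner_smul_right, mul_add, Finset.sum_add_distrib, add_mul, RCLike.conj_to_real]
  have h4 : ∑ i, ∑ j, (∑ k, (∑ m, metricCoeff h y (Φ p) m j * christoffel h y m k i (Φ p))
        * dirD Φ V k p) * inner ℝ (a i p) (b j p)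
      = ∑ i, ∑ j, metricCoeff h y (Φ p) i j * ∑ k, ∑ m,
        christoffel h y i k m (Φ p) * dirD Φ V k p * inner ℝ (a m p) (b j p) := by
    simp only [Finset.mul_sum, Finset.sum_mul]
    calc _ = ∑ j, ∑ i, ∑ k, ∑ m, metricCoeff h y (Φ p) m j * christoffel h y m k i (Φ p)
          * dirD Φ V k p * inner ℝ (a i p) (b j p) := Finset.sum_comm
      _ = ∑ j, ∑ k, ∑ m, ∑ i, metricCoeff h y (Φ p) m j * christoffel h y m k i (Φ p)
          * dirD Φ V k p * inner ℝ (a i p) (b j p) := by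
            refine Finset.sum_congr rfl fun j _ ↦ ?_
            rw [Finset.sum_comm]
            exact Finset.sum_congr rfl fun k _ ↦ Finset.sum_comm
      _ = ∑ j, ∑ m, ∑ k, ∑ i, metricCoeff h y (Φ p) m j * christoffel h y m k i (Φ p)
          * dirD Φ V k p * inner ℝ (a i p) (b j p) :=
            Finset.sum_congr rfl fun j _ ↦ Finset.sum_comm
      _ = _ := by
            rw [Finset.sum_comm]
            exact Finset.sum_congr rfl fun _ _ ↦ Finset.sum_congr rfl fun _ _ ↦
              Finset.sum_congr rfl fun _ _ ↦ Finset.sum_congr rfl fun _ _ ↦ by ring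
  have h5 : ∑ i, ∑ j, (∑ k, (∑ m, metricCoeff h y (Φ p) i m * christoffel h y m k j (Φ p))
        * dirD Φ V k p) * inner ℝ (a i p) (b j p)
      = ∑ i, ∑ j, metricCoeff h y (Φ p) i j * ∑ k, ∑ m,
        christoffel h y j k m (Φ p) * dirD Φ V k p * inner ℝ (a i p) (b m p) := by
    refine Finset.sum_congr rfl fun i _ ↦ ?_
    simp only [Finset.mul_sum, Finset.sum_mul]
    calc _ = ∑ k, ∑ m, ∑ j, metricCoeff h y (Φ p) i m * christoffel h y m k j (Φ p)
          * dirD Φ V k p * inner ℝ (a i p) (b j p) := by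
            rw [Finset.sum_comm]
            exact Finset.sum_congr rfl fun k _ ↦ Finset.sum_comm
      _ = _ := by
            rw [Finset.sum_comm]
            exact Finset.sum_congr rfl fun _ _ ↦ 
              Finset.sum_congr rfl fun _ _ ↦ Finset.sum_congr rfl fun _ _ ↦ by ring
  rw [h4, h5]
  simp only [metricFn]
  ring

end Cov

/-! ### Curvature and torsion of the pulled-back connection -/

section Commutators

variable {n : ℕ} {N : Type*} [TopologicalSpace N] [ChartedSpace (EuclideanSpace ℝ (Fin n)) N]
  [IsManifold (𝓡 n) ∞ N] (h : TargetMetric n N)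
  {y : OpenPartialHomeomorph N (EuclideanSpace ℝ (Fin n))}
  {F : Type*} [NormedAddCommGroup F] [NormedSpace ℝ F]
  {Φ : ℂ → EuclideanSpace ℝ (Fin n)} {V W : ℂ → ℂ} {p : ℂ}

lemma differentiableAt_fderiv_apply {f : ℂ → F} (hf : ContDiffAt ℝ ∞ f p)
    (hV : ContDiffAt ℝ ∞ V p) : ContDiffAt ℝ ∞ (fun q ↦ fderiv ℝ f q (V q)) p :=
  (hf.fderiv_right (by simp)).clm_apply hV

/-- The commutator of two directional derivatives is the derivative along the Lie bracket. -/
lemma fderiv_fderiv_sub_swap {f : ℂ → F} (hf : ContDiffAt ℝ ∞ f p) (hV : ContDiffAt ℝ ∞ V p)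
    (hW : ContDiffAt ℝ ∞ W p) :
    fderiv ℝ (fun q ↦ fderiv ℝ f q (W q)) p (V p) - fderiv ℝ (fun q ↦ fderiv ℝ f q (V q)) p (W p)
      = fderiv ℝ f p (VectorField.lieBracket ℝ V W p) := by
  have h1 : DifferentiableAt ℝ (fderiv ℝ f) p :=
    (hf.fderiv_right (m := ∞) (by simp)).differentiableAt (by simp)
  rw [fderiv_clm_apply h1 (hW.differentiableAt (by simp)),
    fderiv_clm_apply h1 (hV.differentiableAt (by simp))]
  have h2 : IsSymmSndFDerivAt ℝ f p := hf.isSymmSndFDerivAt (by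
    simp only [minSmoothness_of_isRCLikeNormedField]; exact ENat.LEInfty.out)
  simp only [VectorField.lieBracket_eq, add_apply, ContinuousLinearMap.comp_apply,
    ContinuousLinearMap.flip_apply, map_sub, h2.eq (V p) (W p)]
  abel

/-- The connection matrix `Γ^i_jk V(φ^j)`. -/
def connMat (y : OpenPartialHomeomorph N (EuclideanSpace ℝ (Fin n)))
    (Φ : ℂ → EuclideanSpace ℝ (Fin n)) (V : ℂ → ℂ) (i k : Fin n) (q : ℂ) : ℝ :=
  ∑ j, christoffel h y i j k (Φ q) * dirD Φ V j q

lemma cov_eq (a : Fin n → ℂ → F) (i : Fin n) (q : ℂ) :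
    cov h y Φ V a i q = fderiv ℝ (a i) q (V q) + ∑ k, connMat h y Φ V i k q • a k q := by
  simp only [cov, connMat, Finset.sum_smul]
  rw [Finset.sum_comm]

lemma contDiffAt_comp_apply (hΦ : ContDiffAt ℝ ∞ Φ p) (j : Fin n) :
    ContDiffAt ℝ ∞ (fun q ↦ Φ q j) p :=
  (EuclideanSpace.proj j : EuclideanSpace ℝ (Fin n) →L[ℝ] ℝ).contDiff.contDiffAt.comp p hΦ

lemma contDiffAt_dirD (hΦ : ContDiffAt ℝ ∞ Φ p) (hV : ContDiffAt ℝ ∞ V p) (j : Fin n) :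
    ContDiffAt ℝ ∞ (dirD Φ V j) p :=
  differentiableAt_fderiv_apply (contDiffAt_comp_apply hΦ j) hV

variable (hy : y ∈ IsManifold.maximalAtlas (𝓡 n) ∞ N)
include hy

lemma contDiffAt_christoffel_comp (hΦ : ContDiffAt ℝ ∞ Φ p) (hp : Φ p ∈ y.target)
    (i j k : Fin n) : ContDiffAt ℝ ∞ (fun q ↦ christoffel h y i j k (Φ q)) p :=
  ((contDiffOn_christoffel h hy i j k).contDiffAt (y.open_target.mem_nhds hp)).comp p hΦ

lemma contDiffAt_connMat (hΦ : ContDiffAt ℝ ∞ Φ p) (hp : Φ p ∈ y.target)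
    (hV : ContDiffAt ℝ ∞ V p) (i k : Fin n) : ContDiffAt ℝ ∞ (connMat h y Φ V i k) p :=
  ContDiffAt.sum fun j _ ↦ (contDiffAt_christoffel_comp h hy hΦ hp i j k).mul
    (contDiffAt_dirD hΦ hV j)

lemma contDiffAt_cov (hΦ : ContDiffAt ℝ ∞ Φ p) (hp : Φ p ∈ y.target)
    (hV : ContDiffAt ℝ ∞ V p) {a : Fin n → ℂ → F} (ha : ∀ i, ContDiffAt ℝ ∞ (a i) p) (i : Fin n) :
    ContDiffAt ℝ ∞ (cov h y Φ V a i) p := by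
  rw [show cov h y Φ V a i = _ from funext (cov_eq h a i)]
  exact (differentiableAt_fderiv_apply (ha i) hV).add
    (ContDiffAt.sum fun k _ ↦ (contDiffAt_connMat h hy hΦ hp hV i k).smul (ha k))

/-- The curvature of the connection matrices. -/
lemma connMat_curvature (hΦ : ContDiffAt ℝ ∞ Φ p) (hp : Φ p ∈ y.target)
    (hV : ContDiffAt ℝ ∞ V p) (hW : ContDiffAt ℝ ∞ W p) (i k : Fin n) :
    fderiv ℝ (connMat h y Φ W i k) p (V p) - fderiv ℝ (connMat h y Φ V i k) p (W p)
        + ∑ l, (connMat h y Φ V i l p * connMat h y Φ W l k p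
          - connMat h y Φ W i l p * connMat h y Φ V l k p)
      = connMat h y Φ (VectorField.lieBracket ℝ V W) i k p
        + ∑ j, ∑ l, riemann h y i k j l (Φ p) * dirD Φ V j p * dirD Φ W l p := by
  have hE : ∀ V W : ℂ → ℂ, ContDiffAt ℝ ∞ W p →
      fderiv ℝ (connMat h y Φ W i k) p (V p)
      = ∑ l, ∑ j, partialD j (christoffel h y i l k) (Φ p) * dirD Φ V j p * dirD Φ W l p
        + ∑ l, christoffel h y i l k (Φ p) * fderiv ℝ (dirD Φ W l) p (V p) := by
    intro V W hW
    have hc := fun l ↦ (contDiffAt_christoffel_comp h hy hΦ hp i l k).differentiableAt (by simp)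
    have hd := fun l ↦ (contDiffAt_dirD hΦ hW l).differentiableAt (by simp)
    have : connMat h y Φ W i k = fun q ↦ ∑ l, christoffel h y i l k (Φ q) * dirD Φ W l q := rfl
    have hm : ∀ l, DifferentiableAt ℝ (fun q ↦ christoffel h y i l k (Φ q) * dirD Φ W l q) p :=
      fun l ↦ (hc l).mul (hd l)
    rw [this, fderiv_fun_sum fun l _ ↦ hm l, sum_apply, ← Finset.sum_add_distrib]
    refine Finset.sum_congr rfl fun l _ ↦ ?_
    rw [fderiv_fun_mul (hc l) (hd l)]
    simp only [add_apply, smul_apply, smul_eq_mul]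
    rw [fderiv_comp_eq_sum (hΦ.differentiableAt (by simp)) (differentiableAt_christoffel h hy hp i l k),
      add_comm, Finset.mul_sum]
    congr 1
    exact Finset.sum_congr rfl fun j _ ↦ by simp only [dirD]; ring
  -- The second derivatives of Φ enter only through the commutator of V and W, and so form the
  -- connection matrix along the bracket.
  have hB : connMat h y Φ (VectorField.lieBracket ℝ V W) i k p
      = ∑ l, christoffel h y i l k (Φ p) * fderiv ℝ (dirD Φ W l) p (V p)
        - ∑ l, christoffel h y i l k (Φ p) * fderiv ℝ (dirD Φ V l) p (W p) := by
    rw [← Finset.sum_sub_distrib]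
    refine Finset.sum_congr rfl fun l _ ↦ ?_
    rw [← mul_sub]
    congr 1
    exact (fderiv_fderiv_sub_swap (contDiffAt_comp_apply hΦ l) hV hW).symm
  have hQ : ∀ V W : ℂ → ℂ, ∑ l, connMat h y Φ V i l p * connMat h y Φ W l k p
      = ∑ j, ∑ l, (∑ m, christoffel h y i j m (Φ p) * christoffel h y m l k (Φ p))
        * dirD Φ V j p * dirD Φ W l p := by
    intro V W
    simp only [connMat, Finset.sum_mul, Finset.mul_sum]
    rw [Finset.sum_comm_cycle]
    refine Finset.sum_congr rfl fun j _ ↦ ?_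
    rw [Finset.sum_comm]
    exact Finset.sum_congr rfl fun _ _ ↦ Finset.sum_congr rfl fun _ _ ↦ by ring
  have hR : ∑ j, ∑ l, riemann h y i k j l (Φ p) * dirD Φ V j p * dirD Φ W l p
      = ∑ j, ∑ l, partialD j (christoffel h y i l k) (Φ p) * dirD Φ V j p * dirD Φ W l p
        - ∑ j, ∑ l, partialD l (christoffel h y i j k) (Φ p) * dirD Φ V j p * dirD Φ W l p
        + ∑ j, ∑ l, (∑ m, christoffel h y i j m (Φ p) * christoffel h y m l k (Φ p))
          * dirD Φ V j p * dirD Φ W l p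
        - ∑ j, ∑ l, (∑ m, christoffel h y i l m (Φ p) * christoffel h y m j k (Φ p))
          * dirD Φ V j p * dirD Φ W l p := by
    simp only [← Finset.sum_add_distrib, ← Finset.sum_sub_distrib]
    refine Finset.sum_congr rfl fun j _ ↦ Finset.sum_congr rfl fun l _ ↦ ?_
    rw [riemann, Finset.sum_sub_distrib]
    ring
  rw [hE V W hW, hE W V hV, hB, hR, Finset.sum_sub_distrib, hQ V W, hQ W V]
  have e1 : ∑ l, ∑ j, partialD j (christoffel h y i l k) (Φ p) * dirD Φ V j p * dirD Φ W l p
      = ∑ j, ∑ l, partialD j (christoffel h y i l k) (Φ p) * dirD Φ V j p * dirD Φ W l p :=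
    Finset.sum_comm
  have e2 : ∑ l, ∑ j, partialD j (christoffel h y i l k) (Φ p) * dirD Φ W j p * dirD Φ V l p
      = ∑ j, ∑ l, partialD l (christoffel h y i j k) (Φ p) * dirD Φ V j p * dirD Φ W l p :=
    Finset.sum_congr rfl fun _ _ ↦ Finset.sum_congr rfl fun _ _ ↦ by ring
  have e3 : ∑ j, ∑ l, (∑ m, christoffel h y i j m (Φ p) * christoffel h y m l k (Φ p))
        * dirD Φ W j p * dirD Φ V l p
      = ∑ j, ∑ l, (∑ m, christoffel h y i l m (Φ p) * christoffel h y m j k (Φ p))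
          * dirD Φ V j p * dirD Φ W l p := by
    rw [Finset.sum_comm]
    exact Finset.sum_congr rfl fun _ _ ↦ Finset.sum_congr rfl fun _ _ ↦ by ring
  rw [e1, e2, e3]
  ring

/-- The commutator of covariant derivatives. -/
lemma cov_cov_sub_swap (hΦ : ContDiffAt ℝ ∞ Φ p) (hp : Φ p ∈ y.target)
    (hV : ContDiffAt ℝ ∞ V p) (hW : ContDiffAt ℝ ∞ W p) {a : Fin n → ℂ → F}
    (ha : ∀ i, ContDiffAt ℝ ∞ (a i) p) (i : Fin n) :
    cov h y Φ V (cov h y Φ W a) i p - cov h y Φ W (cov h y Φ V a) i p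
      = cov h y Φ (VectorField.lieBracket ℝ V W) a i p
        + ∑ k, (∑ j, ∑ l, riemann h y i k j l (Φ p) * dirD Φ V j p * dirD Φ W l p) • a k p := by
  -- The terms with one connection matrix and one derivative of a form a last bracket symmetric in V
  -- and W, which drops out of the commutator.
  have hX : ∀ V W : ℂ → ℂ, ContDiffAt ℝ ∞ W p → cov h y Φ V (cov h y Φ W a) i p
      = fderiv ℝ (fun q ↦ fderiv ℝ (a i) q (W q)) p (V p)
        + ∑ k, (fderiv ℝ (connMat h y Φ W i k) p (V p)
          + ∑ l, connMat h y Φ V i l p * connMat h y Φ W l k p) • a k p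
        + (∑ k, connMat h y Φ W i k p • fderiv ℝ (a k) p (V p)
          + ∑ k, connMat h y Φ V i k p • fderiv ℝ (a k) p (W p)) := by
    intro V W hW
    have h1 : cov h y Φ W a i
        = fun q ↦ fderiv ℝ (a i) q (W q) + ∑ k, connMat h y Φ W i k q • a k q :=
      funext (cov_eq h a i)
    have hc := fun k ↦ (contDiffAt_connMat h hy hΦ hp hW i k).differentiableAt (by simp)
    have hd := fun k ↦ (ha k).differentiableAt (by simp)
    have hf := (differentiableAt_fderiv_apply (ha i) hW).differentiableAt (by simp)
    have hm : ∀ k, DifferentiableAt ℝ (fun q ↦ connMat h y Φ W i k q • a k q) p :=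
      fun k ↦ (hc k).smul (hd k)
    rw [cov_eq, h1, fderiv_fun_add hf (DifferentiableAt.fun_sum fun k _ ↦ hm k),
      fderiv_fun_sum fun k _ ↦ hm k]
    simp only [cov_eq, add_apply, sum_apply, smul_add, Finset.sum_add_distrib, Finset.smul_sum,
      add_smul, Finset.sum_smul, smul_smul]
    have h2 : ∀ k, fderiv ℝ (fun q ↦ connMat h y Φ W i k q • a k q) p (V p)
        = connMat h y Φ W i k p • fderiv ℝ (a k) p (V p)
          + fderiv ℝ (connMat h y Φ W i k) p (V p) • a k p := by
      intro k
      rw [fderiv_fun_smul (hc k) (hd k)]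
      rfl
    have h3 : ∑ x, ∑ x_1, (connMat h y Φ V i x p * connMat h y Φ W x x_1 p) • a x_1 p
        = ∑ x_1, ∑ x, (connMat h y Φ V i x p * connMat h y Φ W x x_1 p) • a x_1 p :=
      Finset.sum_comm
    simp only [h2, h3, Finset.sum_add_distrib]
    abel
  rw [hX V W hW, hX W V hV, cov_eq, ← fderiv_fderiv_sub_swap (ha i) hV hW]
  have h4 : ∀ k, (fderiv ℝ (connMat h y Φ W i k) p (V p)
          + ∑ l, connMat h y Φ V i l p * connMat h y Φ W l k p) • a k p
        - (fderiv ℝ (connMat h y Φ V i k) p (W p)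
          + ∑ l, connMat h y Φ W i l p * connMat h y Φ V l k p) • a k p
      = connMat h y Φ (VectorField.lieBracket ℝ V W) i k p • a k p
        + (∑ j, ∑ l, riemann h y i k j l (Φ p) * dirD Φ V j p * dirD Φ W l p) • a k p := by
    intro k
    rw [← sub_smul, ← add_smul, ← connMat_curvature h hy hΦ hp hV hW i k, Finset.sum_sub_distrib]
    congr 1
    ring
  have h5 := Finset.sum_congr (s₁ := Finset.univ) rfl fun k _ ↦ h4 k
  rw [Finset.sum_sub_distrib, Finset.sum_add_distrib, sub_eq_iff_eq_add] at h5
  rw [h5]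
  abel

omit hy in
/-- The connection is torsion free. -/
lemma cov_dirD_sub_swap (hΦ : ContDiffAt ℝ ∞ Φ p) (hV : ContDiffAt ℝ ∞ V p)
    (hW : ContDiffAt ℝ ∞ W p) (i : Fin n) :
    cov h y Φ V (dirD Φ W) i p - cov h y Φ W (dirD Φ V) i p
      = dirD Φ (VectorField.lieBracket ℝ V W) i p := by
  have h1 : ∑ j, ∑ k, (christoffel h y i j k (Φ p) * dirD Φ W j p) • dirD Φ V k p
      = ∑ j, ∑ k, (christoffel h y i j k (Φ p) * dirD Φ V j p) • dirD Φ W k p := by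
    rw [Finset.sum_comm]
    refine Finset.sum_congr rfl fun j _ ↦ Finset.sum_congr rfl fun k _ ↦ ?_
    rw [christoffel_symm h i k j, smul_eq_mul, smul_eq_mul]
    ring
  rw [cov, cov, h1, add_sub_add_right_eq_sub]
  exact fderiv_fderiv_sub_swap (contDiffAt_comp_apply hΦ i) hV hW

end Commutators

/-! ### The quartic curvature form and its symmetries -/

section Quartic

variable {n : ℕ} {F : Type*} [NormedAddCommGroup F] [InnerProductSpace ℝ F]

lemma sum_comm_pairs {ι : Type*} [Fintype ι] (f : ι → ι → ι → ι → ℝ) :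
    ∑ i, ∑ j, ∑ k, ∑ l, f i j k l = ∑ k, ∑ l, ∑ i, ∑ j, f i j k l := by
  calc _ = ∑ i, ∑ k, ∑ l, ∑ j, f i j k l := by
        refine Finset.sum_congr rfl fun i _ ↦ ?_
        rw [Finset.sum_comm]
        exact Finset.sum_congr rfl fun k _ ↦ Finset.sum_comm
    _ = _ := by
        rw [Finset.sum_comm]
        exact Finset.sum_congr rfl fun k _ ↦ Finset.sum_comm

/-- The quartic form `R_ijkl ⟨a^l, b^j⟩ ⟨c^k, d^i⟩`. -/
def quart (R : Fin n → Fin n → Fin n → Fin n → ℝ) (a b c d : Fin n → F) : ℝ :=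
  ∑ i, ∑ j, ∑ k, ∑ l, R i j k l * (inner ℝ (a l) (b j) * inner ℝ (c k) (d i))

lemma quart_swap {R : Fin n → Fin n → Fin n → Fin n → ℝ} (hR : ∀ i j k l, R k l i j = R i j k l)
    (a b c d : Fin n → F) : quart R a b c d = quart R b a d c := by
  unfold quart
  rw [sum_comm_pairs]
  refine Finset.sum_congr rfl fun i _ ↦ Finset.sum_congr rfl fun j _ ↦
    Finset.sum_congr rfl fun k _ ↦ Finset.sum_congr rfl fun l _ ↦ ?_
  rw [hR i j k l, real_inner_comm (b l), real_inner_comm (d k)]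

lemma quart_swap_pairs {R : Fin n → Fin n → Fin n → Fin n → ℝ}
    (hR : ∀ i j k l, R j i l k = R i j k l)
    (a b c d : Fin n → F) : quart R a b c d = quart R c d a b := by
  unfold quart
  rw [Finset.sum_comm]
  refine Finset.sum_congr rfl fun j _ ↦ Finset.sum_congr rfl fun i _ ↦ ?_
  rw [Finset.sum_comm]
  refine Finset.sum_congr rfl fun l _ ↦ Finset.sum_congr rfl fun k _ ↦ ?_
  rw [hR j i l k]
  ring

end Quartic

/-! ### Relabelling, linearity and contractions of the quartic form -/

section Quartic

lemma sum_comm_three {ι κ : Type*} [Fintype ι] [Fintype κ] (f : ι → ι → ι → κ → ℝ) :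
    ∑ i, ∑ j, ∑ k, ∑ m, f i j k m = ∑ m, ∑ i, ∑ j, ∑ k, f i j k m := by
  simp only [Finset.sum_comm (s := Finset.univ (α := ι)) (t := Finset.univ (α := κ))]

lemma sum_comm_four {ι κ : Type*} [Fintype ι] [Fintype κ] (f : ι → ι → ι → ι → κ → ℝ) :
    ∑ i, ∑ j, ∑ k, ∑ l, ∑ m, f i j k l m = ∑ m, ∑ i, ∑ j, ∑ k, ∑ l, f i j k l m := by
  simp only [Finset.sum_comm (s := Finset.univ (α := ι)) (t := Finset.univ (α := κ))]

variable {n : ℕ} {F : Type*} [NormedAddCommGroup F] [InnerProductSpace ℝ F]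
  (R R' : Fin n → Fin n → Fin n → Fin n → ℝ) (a b c d d' : Fin n → F)

/-- Only indices are renamed and R needs no symmetry. This and `quart_relabel_pairs` carry
`quart_contract_fst` over to the other three slots. -/
lemma quart_relabel : quart R a b c d = quart (fun i j k l ↦ R k l i j) b a d c := by
  unfold quart
  rw [sum_comm_pairs]
  refine Finset.sum_congr rfl fun i _ ↦ Finset.sum_congr rfl fun j _ ↦
    Finset.sum_congr rfl fun k _ ↦ Finset.sum_congr rfl fun l _ ↦ ?_
  rw [real_inner_comm (b l), real_inner_comm (d k)]

lemma quart_relabel_pairs : quart R a b c d = quart (fun i j k l ↦ R j i l k) c d a b := by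
  unfold quart
  rw [Finset.sum_comm]
  refine Finset.sum_congr rfl fun j _ ↦ Finset.sum_congr rfl fun i _ ↦ ?_
  rw [Finset.sum_comm]
  refine Finset.sum_congr rfl fun l _ ↦ Finset.sum_congr rfl fun k _ ↦ ?_
  ring

lemma quart_add_coeff :
    quart (fun i j k l ↦ R i j k l + R' i j k l) a b c d = quart R a b c d + quart R' a b c d := by
  simp only [quart, add_mul, Finset.sum_add_distrib]

lemma quart_sum_coeff {ι : Type*} [Fintype ι] (v : ι → ℝ)
    (Q : ι → Fin n → Fin n → Fin n → Fin n → ℝ) :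
    quart (fun i j k l ↦ ∑ m, v m * Q m i j k l) a b c d = ∑ m, v m * quart (Q m) a b c d := by
  simp only [quart, Finset.mul_sum, Finset.sum_mul]
  rw [sum_comm_four]
  simp only [mul_assoc]

lemma quart_add_fourth : quart R a b c (d + d') = quart R a b c d + quart R a b c d' := by
  simp only [quart, Pi.add_apply, inner_add_right, mul_add, Finset.sum_add_distrib]

lemma quart_smul_fourth (t : ℝ) : quart R a b c (t • d) = t * quart R a b c d := by
  simp only [quart, Pi.smul_apply, inner_smul_right, Finset.mul_sum]
  refine Finset.sum_congr rfl fun i _ ↦ Finset.sum_congr rfl fun j _ ↦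
    Finset.sum_congr rfl fun k _ ↦ Finset.sum_congr rfl fun l _ ↦ ?_
  ring

/-- Contraction of the first index of the coefficients with a matrix. -/
lemma quart_contract_fst (B : Fin n → Fin n → ℝ) :
    quart (fun i j k l ↦ ∑ s, B s i * R s j k l) a b c d
      = quart R a b c (fun s ↦ ∑ i, B s i • d i) := by
  simp only [quart, inner_sum, inner_smul_right, Finset.mul_sum, Finset.sum_mul]
  refine (Finset.sum_congr rfl fun i _ ↦ sum_comm_three _).trans
    (Finset.sum_comm.trans (Finset.sum_congr rfl fun s _ ↦ (sum_comm_three _).symm.trans ?_))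
  refine Finset.sum_congr rfl fun j _ ↦ Finset.sum_congr rfl fun k _ ↦
      Finset.sum_congr rfl fun l _ ↦ Finset.sum_congr rfl fun i _ ↦ ?_
  ring

lemma quart_contract_snd (B : Fin n → Fin n → ℝ) :
    quart (fun i j k l ↦ ∑ s, B s j * R i s k l) a b c d
      = quart R a (fun s ↦ ∑ i, B s i • b i) c d := by
  rw [quart_relabel_pairs, quart_contract_fst (fun i j k l ↦ R j i l k), quart_relabel_pairs]

lemma quart_contract_third (B : Fin n → Fin n → ℝ) :
    quart (fun i j k l ↦ ∑ s, B s k * R i j s l) a b c d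
      = quart R a b (fun s ↦ ∑ i, B s i • c i) d := by
  rw [quart_relabel, quart_contract_fst (fun i j k l ↦ R k l i j), quart_relabel]

lemma quart_contract_fourth (B : Fin n → Fin n → ℝ) :
    quart (fun i j k l ↦ ∑ s, B s l * R i j k s) a b c d
      = quart R (fun s ↦ ∑ i, B s i • a i) b c d := by
  rw [quart_relabel, quart_contract_snd (fun i j k l ↦ R k l i j), quart_relabel]

end Quartic

/-! ### The derivative of Rm(ψ) along a map -/

section QuarticDeriv

variable {n : ℕ} {F : Type*} [NormedAddCommGroup F] [InnerProductSpace ℝ F]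

/-- The two symmetries of R act transitively on the four slots, so the place of the varied entry
does not matter. -/
lemma quart_symm_first {R : Fin n → Fin n → Fin n → Fin n → ℝ}
    (hR : ∀ i j k l, R k l i j = R i j k l) (hR' : ∀ i j k l, R j i l k = R i j k l)
    (a b : Fin n → F) :
    quart R b a a a = quart R a a a b ∧ quart R a b a a = quart R a a a b
      ∧ quart R a a b a = quart R a a a b := by
  have h1 := quart_swap hR a a b a
  have h2 := quart_swap_pairs hR' b a a a
  have h3 := quart_swap_pairs hR' a b a a
  refine ⟨h2.trans h1, h3, h1⟩

variable {N : Type*} [TopologicalSpace N] [ChartedSpace (EuclideanSpace ℝ (Fin n)) N]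
  [IsManifold (𝓡 n) ∞ N] (h : TargetMetric n N)
  {y : OpenPartialHomeomorph N (EuclideanSpace ℝ (Fin n))}
  {Φ : ℂ → EuclideanSpace ℝ (Fin n)} {V : ℂ → ℂ} {p : ℂ}
  (hy : y ∈ IsManifold.maximalAtlas (𝓡 n) ∞ N)

/-- The coefficients `R_ijkl` along a map. -/
def riemannFn (y : OpenPartialHomeomorph N (EuclideanSpace ℝ (Fin n)))
    (u : EuclideanSpace ℝ (Fin n)) (i j k l : Fin n) : ℝ := riemannLow h y i j k l u

include hy in
-- The partial derivatives of R_ijkl differ from ∇R by four Christoffel contractions, one per index.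
-- Each of them completes the derivative of the entry in its slot to a covariant derivative, and the
-- four slots contribute equally, whence the factor 4.
lemma fderiv_quart {a : Fin n → ℂ → F} (hΦ : DifferentiableAt ℝ Φ p) (hp : Φ p ∈ y.target)
    (ha : ∀ i, DifferentiableAt ℝ (a i) p) :
    fderiv ℝ (fun q ↦ quart (riemannFn h y (Φ q)) (fun i ↦ a i q) (fun i ↦ a i q)
        (fun i ↦ a i q) (fun i ↦ a i q)) p (V p)
      = ∑ m, dirD Φ V m p * quart (fun i j k l ↦ nablaRiemann h y m i j k l (Φ p))
          (fun i ↦ a i p) (fun i ↦ a i p) (fun i ↦ a i p) (fun i ↦ a i p)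
        + 4 * quart (riemannFn h y (Φ p)) (fun i ↦ a i p) (fun i ↦ a i p)
          (fun i ↦ a i p) (fun i ↦ cov h y Φ V a i p) := by
  set A : Fin n → F := fun i ↦ a i p with hA
  set dA : Fin n → F := fun i ↦ fderiv ℝ (a i) p (V p) with hdA
  set B := fun i k ↦ connMat h y Φ V i k p with hB
  set R := riemannFn h y (Φ p) with hR
  have hsw : ∀ i j k l, R k l i j = R i j k l := fun i j k l ↦ riemannLow_pair_symm h hy hp i j k l
  have hsw' : ∀ i j k l, R j i l k = R i j k l := fun i j k l ↦ by
    simp only [hR, riemannFn]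
    rw [riemannLow_swap_fst h hy hp, riemannLow_swap_snd h hy hp, neg_neg]
  have hr : ∀ i j k l, DifferentiableAt ℝ (fun q ↦ riemannLow h y i j k l (Φ q)) p :=
    fun i j k l ↦ (differentiableAt_riemannLow h hy hp i j k l).comp p hΦ
  have hi : ∀ i j, DifferentiableAt ℝ (fun q ↦ inner ℝ (a i q) (a j q)) p :=
    fun i j ↦ (ha i).inner ℝ (ha j)
  have hii : ∀ i j k l, DifferentiableAt ℝ
      (fun q ↦ inner ℝ (a l q) (a j q) * inner ℝ (a k q) (a i q)) p :=
    fun i j k l ↦ (hi l j).mul (hi k i)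
  have ht : ∀ i j k l, DifferentiableAt ℝ (fun q ↦ riemannLow h y i j k l (Φ q) *
      (inner ℝ (a l q) (a j q) * inner ℝ (a k q) (a i q))) p :=
    fun i j k l ↦ (hr i j k l).mul (hii i j k l)
  have h1 : ∀ i j k l, fderiv ℝ (fun q ↦ riemannLow h y i j k l (Φ q) *
      (inner ℝ (a l q) (a j q) * inner ℝ (a k q) (a i q))) p (V p)
      = (∑ m, dirD Φ V m p * partialD m (riemannLow h y i j k l) (Φ p))
          * (inner ℝ (A l) (A j) * inner ℝ (A k) (A i))
        + R i j k l * (inner ℝ (dA l) (A j) * inner ℝ (A k) (A i))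
        + R i j k l * (inner ℝ (A l) (dA j) * inner ℝ (A k) (A i))
        + R i j k l * (inner ℝ (A l) (A j) * inner ℝ (dA k) (A i))
        + R i j k l * (inner ℝ (A l) (A j) * inner ℝ (A k) (dA i)) := by
    intro i j k l
    rw [fderiv_fun_mul (hr i j k l) (hii i j k l), fderiv_fun_mul (hi l j) (hi k i)]
    simp only [add_apply, smul_apply, smul_eq_mul]
    rw [fderiv_inner_apply ℝ (ha l) (ha j), fderiv_inner_apply ℝ (ha k) (ha i),
      fderiv_comp_eq_sum hΦ (differentiableAt_riemannLow h hy hp i j k l)]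
    have : ∑ m, partialD m (riemannLow h y i j k l) (Φ p) * fderiv ℝ (fun q ↦ Φ q m) p (V p)
        = ∑ m, dirD Φ V m p * partialD m (riemannLow h y i j k l) (Φ p) :=
      Finset.sum_congr rfl fun m _ ↦ mul_comm _ _
    rw [this]
    simp only [hA, hdA, hR, riemannFn]
    ring
  have h2 : fderiv ℝ (fun q ↦ quart (riemannFn h y (Φ q)) (fun i ↦ a i q) (fun i ↦ a i q)
        (fun i ↦ a i q) (fun i ↦ a i q)) p (V p)
      = quart (fun i j k l ↦ ∑ m, dirD Φ V m p * partialD m (riemannLow h y i j k l) (Φ p)) A A A A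
        + quart R dA A A A + quart R A dA A A + quart R A A dA A + quart R A A A dA := by
    simp only [quart, riemannFn]
    rw [fderiv_fun_sum fun i _ ↦ DifferentiableAt.fun_sum fun j _ ↦
      DifferentiableAt.fun_sum fun k _ ↦ DifferentiableAt.fun_sum fun l _ ↦ ht i j k l]
    simp only [sum_apply, ← Finset.sum_add_distrib]
    refine Finset.sum_congr rfl fun i _ ↦ ?_
    rw [fderiv_fun_sum fun j _ ↦
      DifferentiableAt.fun_sum fun k _ ↦ DifferentiableAt.fun_sum fun l _ ↦ ht i j k l]
    simp only [sum_apply]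
    refine Finset.sum_congr rfl fun j _ ↦ ?_
    rw [fderiv_fun_sum fun k _ ↦ DifferentiableAt.fun_sum fun l _ ↦ ht i j k l]
    simp only [sum_apply]
    refine Finset.sum_congr rfl fun k _ ↦ ?_
    rw [fderiv_fun_sum fun l _ ↦ ht i j k l]
    simp only [sum_apply]
    exact Finset.sum_congr rfl fun l _ ↦ h1 i j k l
  have h3 : ∀ i j k l, ∑ m, dirD Φ V m p * partialD m (riemannLow h y i j k l) (Φ p)
      = ∑ m, dirD Φ V m p * nablaRiemann h y m i j k l (Φ p)
        + (∑ s, B s i * R s j k l + ∑ s, B s j * R i s k l + ∑ s, B s k * R i j s l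
          + ∑ s, B s l * R i j k s) := by
    intro i j k l
    have h4 : ∀ i (f : Fin n → ℝ), ∑ s, B s i * f s
        = ∑ m, dirD Φ V m p * ∑ s, christoffel h y s m i (Φ p) * f s := by
      intro i f
      simp only [hB, connMat, Finset.sum_mul, Finset.mul_sum]
      rw [Finset.sum_comm]
      exact Finset.sum_congr rfl fun _ _ ↦ Finset.sum_congr rfl fun _ _ ↦ by ring
    rw [h4 i fun s ↦ R s j k l, h4 j fun s ↦ R i s k l, h4 k fun s ↦ R i j s l,
      h4 l fun s ↦ R i j k s]
    simp only [← Finset.sum_add_distrib, ← mul_add, hR, riemannFn]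
    refine Finset.sum_congr rfl fun m _ ↦ ?_
    rw [nablaRiemann]
    ring
  have h5 : (fun i ↦ cov h y Φ V a i p) = dA + fun s ↦ ∑ i, B s i • A i :=
    funext fun i ↦ cov_eq h a i p
  obtain ⟨q1, q2, q3⟩ := quart_symm_first hsw hsw' A dA
  obtain ⟨r1, r2, r3⟩ := quart_symm_first hsw hsw' A (fun s ↦ ∑ i, B s i • A i)
  rw [h2, h5, quart_add_fourth]
  simp only [h3]
  rw [quart_add_coeff, quart_add_coeff, quart_add_coeff, quart_add_coeff, quart_contract_fst,
    quart_contract_snd, quart_contract_third, quart_contract_fourth, quart_sum_coeff, q1, q2, q3,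
    r1, r2, r3]
  ring

end QuarticDeriv

/-! ### Pointwise consequences of the field equations -/

section Algebra

variable {n : ℕ}

/-- The tuple `v^i s`. -/
def tens {F : Type*} [AddCommGroup F] [Module ℝ F] (v : Fin n → ℝ) (s : F) : Fin n → F :=
  fun i ↦ v i • s

lemma mul_tens (q : Quaternion ℝ) (v : Fin n → ℝ) (s : Quaternion ℝ) :
    q • tens v s = tens v (q * s) := by
  ext1 i
  simp [tens]

lemma tens_neg (v : Fin n → ℝ) (s : Quaternion ℝ) : tens v (-s) = -tens v s := by
  ext1 i
  simp [tens]

lemma tens_add (v : Fin n → ℝ) (s t : Quaternion ℝ) : tens v (s + t) = tens v s + tens v t := by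
  ext1 i
  simp [tens]

lemma tens_smul (v : Fin n → ℝ) (c : ℝ) (s : Quaternion ℝ) : tens v (c • s) = c • tens v s := by
  ext1 i
  simp only [tens, Pi.smul_apply]
  exact smul_comm _ _ _

lemma add_tens (v w : Fin n → ℝ) (s : Quaternion ℝ) : tens (v + w) s = tens v s + tens w s := by
  ext1 i
  simp [tens, add_smul]

lemma smul_tens (v : Fin n → ℝ) (c : ℝ) (s : Quaternion ℝ) : tens (c • v) s = c • tens v s := by
  ext1 i
  simp [tens, mul_smul]

lemma neg_tens (v : Fin n → ℝ) (s : Quaternion ℝ) : tens (-v) s = -tens v s := by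
  ext1 i
  simp [tens]

lemma inner_neg_mul {q : Quaternion ℝ} (hq : q.re = 0) (a : Quaternion ℝ) :
    inner ℝ a (q * a) = 0 := by
  have h1 := inner_mul_left_of_re_eq_zero hq a a
  rw [real_inner_comm] at h1
  linarith

variable {H : Fin n → Fin n → ℝ} (hH : ∀ i j, H i j = H j i)
  {R : Fin n → Fin n → Fin n → Fin n → ℝ} (hR : ∀ i j k l, R k l i j = R i j k l)
  {e f : Quaternion ℝ} (hef : IsCliffordPair e f)
  {φ₀ φ₁ : Fin n → ℝ} {κ₀ κ₁ : Quaternion ℝ} {ψ N₀ N₁ SR : Fin n → Quaternion ℝ}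
  (hSR : ∀ X, hin H SR X = quart R ψ ψ ψ X)
  (hκ : κ₁ = -(e * f * κ₀))
  (hcrit : ∀ s : Quaternion ℝ, hin H (tens φ₀ s) ψ + hin H (tens φ₁ (-(e * f * s))) ψ
    + inner ℝ κ₀ s * hin H ψ ψ = 0)
  (hD : e • N₀ + f • N₁ = (inner ℝ κ₀ κ₀ + inner ℝ κ₁ κ₁ : ℝ) • ψ + (1 / 3 : ℝ) • SR
    + (2 : ℝ) • (tens φ₀ κ₀ + tens φ₁ κ₁))

include hef in
lemma omega_sq : (e * f) * (e * f) = -1 := by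
  rw [mul_assoc, hef.snd_mul, hef.sq_fst]

include hef hκ in
-- Multiplication by ω is an isometry.
lemma inner_snd_eq : inner ℝ κ₁ κ₁ = inner ℝ κ₀ κ₀ := by
  rw [hκ, inner_neg_neg, inner_mul_left_of_re_eq_zero hef.re_mul, ← mul_assoc, omega_sq hef,
    neg_one_mul, inner_neg_right, neg_neg]

include hR in
-- Pair symmetry moves q from the fourth slot to the third, skewness moves it back with a sign.
lemma quart_omega {q : Quaternion ℝ} (hq : q.re = 0) : quart R ψ ψ ψ (q • ψ) = 0 := by
  have h1 := quart_swap hR ψ ψ ψ (q • ψ)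
  have h2 : quart R ψ ψ (q • ψ) ψ = -quart R ψ ψ ψ (q • ψ) := by
    simp only [quart, Pi.smul_apply, smul_eq_mul, inner_mul_left_of_re_eq_zero hq, mul_neg,
      Finset.sum_neg_distrib]
  linarith

include hκ hcrit in
-- The gravitino equation tested with s = κ₀.
lemma crit_trace : hin H (tens φ₀ κ₀) ψ + hin H (tens φ₁ κ₁) ψ
    + inner ℝ κ₀ κ₀ * hin H ψ ψ = 0 := by
  rw [hκ]
  exact hcrit κ₀

include hef hκ hcrit in
-- The gravitino equation tested with s = ωκ₀, for which the term with |ψ|² vanishes.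
lemma crit_skew : hin H (tens φ₁ κ₀) ψ = hin H (tens φ₀ κ₁) ψ := by
  have h1 := hcrit (e * f * κ₀)
  rw [inner_neg_mul hef.re_mul, ← mul_assoc, omega_sq hef, neg_one_mul, neg_neg] at h1
  have h2 : hin H (tens φ₀ κ₁) ψ = -hin H (tens φ₀ (e * f * κ₀)) ψ := by
    rw [hκ, tens_neg, hin_neg_left]
  linarith

include hH hSR hD in
-- The Dirac equation paired with ψ.
lemma dirac_trace : hin H ψ (e • N₀) + hin H ψ (f • N₁)
    = (inner ℝ κ₀ κ₀ + inner ℝ κ₁ κ₁) * hin H ψ ψ + 1 / 3 * quart R ψ ψ ψ ψ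
      + 2 * (hin H (tens φ₀ κ₀) ψ + hin H (tens φ₁ κ₁) ψ) := by
  rw [← hin_add_right, hD, hin_add_right, hin_add_right, hin_smul_right, hin_smul_right,
    hin_smul_right, hin_add_right, hin_comm ψ SR hH, hin_comm ψ (tens φ₀ κ₀) hH,
    hin_comm ψ (tens φ₁ κ₁) hH, hSR]

include hH hR hef hSR hκ hcrit hD in
-- Multiply the Dirac equation by ω and pair it with ψ. The mass term and the curvature term vanish
-- by skewness, and the two gravitino terms cancel by `crit_skew`.
lemma dirac_skew : hin H ψ (f • N₀) = hin H ψ (e • N₁) := by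
  have h1 : (e * f) • (e • N₀ + f • N₁) = f • N₀ - e • N₁ := by
    have h2 : e * f * e = f := by
      rw [mul_assoc, hef.anticomm, mul_neg, ← mul_assoc, hef.sq_fst, neg_one_mul, neg_neg]
    ext1 i
    simp only [Pi.smul_apply, Pi.add_apply, Pi.sub_apply, smul_eq_mul, mul_add, ← mul_assoc, h2,
      hef.mul_snd, neg_mul, sub_eq_add_neg]
  have h3 : hin H ψ ((e * f) • (e • N₀ + f • N₁)) = 0 := by
    have e1 : (e * f) • ((inner ℝ κ₀ κ₀ + inner ℝ κ₁ κ₁ : ℝ) • ψ + (1 / 3 : ℝ) • SR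
        + (2 : ℝ) • (tens φ₀ κ₀ + tens φ₁ κ₁))
        = (inner ℝ κ₀ κ₀ + inner ℝ κ₁ κ₁ : ℝ) • ((e * f) • ψ) + (1 / 3 : ℝ) • ((e * f) • SR)
        + (2 : ℝ) • ((e * f) • tens φ₀ κ₀ + (e * f) • tens φ₁ κ₁) := by
      simp only [smul_add, smul_comm (e * f)]
    have e2 : hin H ψ ((e * f) • SR) = 0 := by
      have := hin_mul_left (H := H) hef.re_mul SR ψ
      rw [hSR, quart_omega hR hef.re_mul, hin_comm _ _ hH] at this
      linarith
    have e3 : e * f * κ₁ = κ₀ := by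
      rw [hκ, mul_neg, ← mul_assoc, omega_sq hef, neg_one_mul, neg_neg]
    have e4 : e * f * κ₀ = -κ₁ := by rw [hκ, neg_neg]
    rw [hD, e1, hin_add_right, hin_add_right, hin_smul_right, hin_smul_right, hin_smul_right,
      hin_add_right, hin_mul_self hH hef.re_mul, e2, mul_tens, mul_tens, e3, e4, tens_neg,
      hin_neg_right, hin_comm ψ (tens φ₀ κ₁) hH, hin_comm ψ (tens φ₁ κ₀) hH,
      crit_skew hef hκ hcrit]
    ring
  rw [h1, hin_sub_right] at h3
  linarith

include hH hef in
/-- The divergence of `⟨ψ, f · N⟩`. -/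
lemma div_kinetic {c₀ψ c₁ψ c₀N₁ c₁N₀ Rψ : Fin n → Quaternion ℝ} {w₀ w₁ s : ℝ}
    (h₀ : N₀ = c₀ψ + (w₀ / 2) • ((e * f) • ψ)) (h₁ : N₁ = c₁ψ + (w₁ / 2) • ((e * f) • ψ))
    (hc : c₀N₁ - c₁N₀ = -(w₀ • c₀ψ) - w₁ • c₁ψ + Rψ + s • ((e * f) • ψ)
      + (w₁ / 2) • ((e * f) • c₀ψ) - (w₀ / 2) • ((e * f) • c₁ψ)) :
    -(hin H c₀ψ (f • N₁) + hin H ψ (f • c₀N₁)) + (hin H c₁ψ (f • N₀) + hin H ψ (f • c₁N₀))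
      = -2 * hin H N₀ (e • N₀ + f • N₁) - hin H ψ (f • Rψ)
        + w₀ * (hin H ψ (e • N₁) + hin H ψ (f • N₀))
        - w₁ * (hin H ψ (e • N₀) - hin H ψ (f • N₁)) := by
  -- The derivatives of ψ for the target connection alone are expressed by the full ones; in the end
  -- only N₀ and N₁ may occur.
  have g₀ : c₀ψ = N₀ - (w₀ / 2) • ((e * f) • ψ) := by rw [h₀]; abel
  have g₁ : c₁ψ = N₁ - (w₁ / 2) • ((e * f) • ψ) := by rw [h₁]; abel
  have e1 : ∀ X : Fin n → Quaternion ℝ, hin H ((e * f) • ψ) (f • X) = hin H ψ (e • X) := by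
    intro X
    have : (e * f) • f • X = -(e • X) := by
      ext1 i
      simp only [Pi.smul_apply, Pi.neg_apply, smul_eq_mul, ← mul_assoc]
      rw [hef.mul_snd, neg_mul]
    rw [hin_mul_left hef.re_mul, this, hin_neg_right, neg_neg]
  have e2 : ∀ X : Fin n → Quaternion ℝ, f • (e * f) • X = e • X := by
    intro X
    ext1 i
    simp only [Pi.smul_apply, smul_eq_mul]
    rw [← mul_assoc, hef.snd_mul]
  -- The coefficient s of the intrinsic spinor curvature disappears here: it multiplies ⟨ψ, f·e·f·ψ⟩
  -- = ⟨ψ, e·ψ⟩ = 0.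
  have e3 : hin H ψ (f • c₀N₁) - hin H ψ (f • c₁N₀)
      = -w₀ * hin H ψ (f • N₀) - w₁ * hin H ψ (f • N₁) + hin H ψ (f • Rψ)
        + w₁ / 2 * hin H ψ (e • N₀) - w₀ / 2 * hin H ψ (e • N₁) := by
    have e4 : ∀ c₀ c₁ : Fin n → Quaternion ℝ, f • (-(w₀ • c₀) - w₁ • c₁ + Rψ + s • ((e * f) • ψ)
        + (w₁ / 2) • ((e * f) • c₀) - (w₀ / 2) • ((e * f) • c₁))
        = -(w₀ • (f • c₀)) - w₁ • (f • c₁) + f • Rψ + s • (e • ψ)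
          + (w₁ / 2) • (e • c₀) - (w₀ / 2) • (e • c₁) := by
      intro c₀ c₁
      simp only [smul_add, smul_sub, smul_neg, smul_comm f, e2]
    have e5 : e • (e * f) • ψ = -(f • ψ) := by
      ext1 i
      simp only [Pi.smul_apply, Pi.neg_apply, smul_eq_mul, ← mul_assoc, hef.sq_fst, one_mul,
        neg_mul]
    rw [← hin_sub_right, ← smul_sub, hc, e4]
    simp only [hin_sub_right, hin_add_right, hin_neg_right, hin_smul_right, g₀, g₁, smul_sub,
      smul_comm f (w₀ / 2), smul_comm f (w₁ / 2), smul_comm e (w₀ / 2), smul_comm e (w₁ / 2), e2,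
      e5, hin_mul_self hH hef.re_fst, hin_mul_self hH hef.re_snd]
    ring
  have e6 : hin H N₀ (e • N₀) = 0 := hin_mul_self hH hef.re_fst N₀
  have e7 : hin H N₁ (f • N₀) = -hin H N₀ (f • N₁) := by
    rw [hin_comm _ _ hH, hin_mul_left hef.re_snd]
  have e8 : hin H c₀ψ (f • N₁) = hin H N₀ (f • N₁) - w₀ / 2 * hin H ψ (e • N₁) := by
    rw [g₀, hin_sub_left, hin_smul_left, e1]
  have e9 : hin H c₁ψ (f • N₀) = -hin H N₀ (f • N₁) - w₁ / 2 * hin H ψ (e • N₀) := by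
    rw [g₁, hin_sub_left, hin_smul_left, e1, e7]
  rw [hin_add_right, e6, e8, e9]
  linarith

end Algebra

/-! ### The conservation law in one frame direction -/

section Divergence

variable {n : ℕ} {N : Type*} [TopologicalSpace N] [ChartedSpace (EuclideanSpace ℝ (Fin n)) N]
  [IsManifold (𝓡 n) ∞ N] (h : TargetMetric n N)
  (y : OpenPartialHomeomorph N (EuclideanSpace ℝ (Fin n)))

/-- The components of the curvature operator `R(v, w) ψ`. -/
def curvOp (u : EuclideanSpace ℝ (Fin n)) (v w : Fin n → ℝ) (ψ : Fin n → Quaternion ℝ) (i : Fin n) :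
    Quaternion ℝ :=
  ∑ k, (∑ j, ∑ l, riemann h y i k j l u * v j * w l) • ψ k

/-- The form `R_ijkl v^i w^j ⟨a^k, b^l⟩`. -/
def mixedForm (u : EuclideanSpace ℝ (Fin n)) (v w : Fin n → ℝ) (a b : Fin n → Quaternion ℝ) : ℝ :=
  ∑ i, ∑ j, ∑ k, ∑ l, riemannLow h y i j k l u * (v i * w j) * inner ℝ (a k) (b l)

variable {h y} (hy : y ∈ IsManifold.maximalAtlas (𝓡 n) ∞ N) {u : EuclideanSpace ℝ (Fin n)}
  (hu : u ∈ y.target)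
include hy hu

/-- R is skew in its first pair. When the tension equation is paired with φ_*e₀, this removes the
part of the curvature force that comes from e₀. -/
lemma mixedForm_self (v : Fin n → ℝ) (a b : Fin n → Quaternion ℝ) :
    mixedForm h y u v v a b = 0 := by
  have : mixedForm h y u v v a b = -mixedForm h y u v v a b := by
    conv_lhs => rw [mixedForm, Finset.sum_comm]
    simp only [mixedForm, ← Finset.sum_neg_distrib]
    refine Finset.sum_congr rfl fun i _ ↦ Finset.sum_congr rfl fun j _ ↦
      Finset.sum_congr rfl fun k _ ↦ Finset.sum_congr rfl fun l _ ↦ ?_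
    rw [riemannLow_swap_fst h hy hu]
    ring
  linarith

/-- The pair symmetry of R identifies the curvature that arises from commuting derivatives of ψ with
the force in the tension equation. -/
lemma hin_mul_curvOp (v w : Fin n → ℝ) (ψ : Fin n → Quaternion ℝ) (q : Quaternion ℝ) :
    hin (metricCoeff h y u) ψ (q • curvOp h y u v w ψ) = mixedForm h y u v w ψ (q • ψ) := by
  have h1 : hin (metricCoeff h y u) ψ (q • curvOp h y u v w ψ)
      = ∑ i, ∑ k, ∑ j, ∑ l, riemannLow h y i k j l u * (v j * w l) * inner ℝ (ψ i) (q * ψ k) := by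
    simp only [hin, curvOp, Pi.smul_apply, smul_eq_mul, Finset.mul_sum, inner_sum, mul_smul_comm,
      inner_smul_right, riemannLow, Finset.sum_mul]
    refine Finset.sum_congr rfl fun i _ ↦ ?_
    rw [← sum_comm_three]
    refine Finset.sum_congr rfl fun k _ ↦ Finset.sum_congr rfl fun j _ ↦
      Finset.sum_congr rfl fun l _ ↦ Finset.sum_congr rfl fun m _ ↦ ?_
    ring
  rw [h1, sum_comm_pairs, mixedForm]
  refine Finset.sum_congr rfl fun i _ ↦ Finset.sum_congr rfl fun j _ ↦
    Finset.sum_congr rfl fun k _ ↦ Finset.sum_congr rfl fun l _ ↦ ?_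
  rw [riemannLow_pair_symm h hy hu i j k l]
  rfl

omit hy hu
variable {Φ : ℂ → EuclideanSpace ℝ (Fin n)} {p : ℂ}

lemma contDiffAt_hin {F : Type*} [NormedAddCommGroup F] [InnerProductSpace ℝ F]
    (hy : y ∈ IsManifold.maximalAtlas (𝓡 n) ∞ N) {a b : Fin n → ℂ → F}
    (hΦ : ContDiffAt ℝ ∞ Φ p) (hp : Φ p ∈ y.target) (ha : ∀ i, ContDiffAt ℝ ∞ (a i) p)
    (hb : ∀ i, ContDiffAt ℝ ∞ (b i) p) :
    ContDiffAt ℝ ∞ (fun q ↦ hin (metricCoeff h y (Φ q)) (fun i ↦ a i q) (fun i ↦ b i q)) p :=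
  ContDiffAt.sum fun i _ ↦ ContDiffAt.sum fun j _ ↦
    (((contDiffOn_metricCoeff h hy i j).contDiffAt (y.open_target.mem_nhds hp)).comp p hΦ).mul
      ((ha i).inner ℝ (hb j))

lemma contDiffAt_quart {F : Type*} [NormedAddCommGroup F] [InnerProductSpace ℝ F]
    (hy : y ∈ IsManifold.maximalAtlas (𝓡 n) ∞ N) {a : Fin n → ℂ → F}
    (hΦ : ContDiffAt ℝ ∞ Φ p) (hp : Φ p ∈ y.target) (ha : ∀ i, ContDiffAt ℝ ∞ (a i) p) :
    ContDiffAt ℝ ∞ (fun q ↦ quart (riemannFn h y (Φ q)) (fun i ↦ a i q) (fun i ↦ a i q)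
      (fun i ↦ a i q) (fun i ↦ a i q)) p :=
  ContDiffAt.sum fun i _ ↦ ContDiffAt.sum fun j _ ↦ ContDiffAt.sum fun k _ ↦
    ContDiffAt.sum fun l _ ↦
    (((contDiffOn_riemannLow h hy i j k l).contDiffAt (y.open_target.mem_nhds hp)).comp p hΦ).mul
      (((ha l).inner ℝ (ha j)).mul ((ha k).inner ℝ (ha i)))

/-- The covariant derivative of spinors along a map. -/
def spinCov (h : TargetMetric n N) (y : OpenPartialHomeomorph N (EuclideanSpace ℝ (Fin n)))
    (Φ : ℂ → EuclideanSpace ℝ (Fin n)) (om : Quaternion ℝ) (w : ℂ → ℝ) (V : ℂ → ℂ)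
    (Ψ : Fin n → ℂ → Quaternion ℝ) (i : Fin n) (q : ℂ) : Quaternion ℝ :=
  cov h y Φ V Ψ i q + (w q / 2) • (om * Ψ i q)

variable {e f : Quaternion ℝ} {V₀ V₁ : ℂ → ℂ} {w₀ w₁ : ℂ → ℝ} {κ₀ κ₁ : ℂ → Quaternion ℝ}
  {Ψ : Fin n → ℂ → Quaternion ℝ}

/-- The component of the energy-momentum tensor with both indices equal to the first frame
vector. -/
def emFst (h : TargetMetric n N) (y : OpenPartialHomeomorph N (EuclideanSpace ℝ (Fin n)))
    (Φ : ℂ → EuclideanSpace ℝ (Fin n)) (e f : Quaternion ℝ) (V₀ V₁ : ℂ → ℂ) (w₁ : ℂ → ℝ)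
    (κ₀ κ₁ : ℂ → Quaternion ℝ) (Ψ : Fin n → ℂ → Quaternion ℝ) (q : ℂ) : ℝ :=
  hin (metricCoeff h y (Φ q)) (fun i ↦ dirD Φ V₀ i q) (fun i ↦ dirD Φ V₀ i q)
    - hin (metricCoeff h y (Φ q)) (fun i ↦ dirD Φ V₁ i q) (fun i ↦ dirD Φ V₁ i q)
    - hin (metricCoeff h y (Φ q)) (fun i ↦ Ψ i q)
      (fun i ↦ f * spinCov h y Φ (e * f) w₁ V₁ Ψ i q)
    + 4 * hin (metricCoeff h y (Φ q)) (fun i ↦ dirD Φ V₁ i q • κ₁ q) (fun i ↦ Ψ i q)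
    + (inner ℝ (κ₀ q) (κ₀ q) + inner ℝ (κ₁ q) (κ₁ q))
      * hin (metricCoeff h y (Φ q)) (fun i ↦ Ψ i q) (fun i ↦ Ψ i q)
    + 1 / 6 * quart (riemannFn h y (Φ q)) (fun i ↦ Ψ i q) (fun i ↦ Ψ i q) (fun i ↦ Ψ i q)
      (fun i ↦ Ψ i q)

/-- The off-diagonal component of the energy-momentum tensor. -/
def emSnd (h : TargetMetric n N) (y : OpenPartialHomeomorph N (EuclideanSpace ℝ (Fin n)))
    (Φ : ℂ → EuclideanSpace ℝ (Fin n)) (e f : Quaternion ℝ) (V₀ V₁ : ℂ → ℂ) (w₀ : ℂ → ℝ)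
    (κ₁ : ℂ → Quaternion ℝ) (Ψ : Fin n → ℂ → Quaternion ℝ) (q : ℂ) : ℝ :=
  2 * hin (metricCoeff h y (Φ q)) (fun i ↦ dirD Φ V₀ i q) (fun i ↦ dirD Φ V₁ i q)
    + hin (metricCoeff h y (Φ q)) (fun i ↦ Ψ i q)
      (fun i ↦ f * spinCov h y Φ (e * f) w₀ V₀ Ψ i q)
    - 4 * hin (metricCoeff h y (Φ q)) (fun i ↦ dirD Φ V₀ i q • κ₁ q) (fun i ↦ Ψ i q)

/-- Noether's identity for translations along V₀. The zeroth-order terms come from ∇_{e_α}e₀ = w_α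
e₁ and ∇_{e_α}e₁ = -w_α e₀ in the divergence of a symmetric trace-free tensor, with T₁₁ replaced by
-T₀₀. The field equations are needed at p only; the constraint κ₁ = -ωκ₀ must hold near p because κ₁
gets differentiated. The pair (e, f) stays abstract so that the rotated frame is covered as well. -/
theorem divergence_eq_zero (hy : y ∈ IsManifold.maximalAtlas (𝓡 n) ∞ N)
    (hef : IsCliffordPair e f) (hp : Φ p ∈ y.target) (hΦ : ContDiffAt ℝ ∞ Φ p)
    (hV₀ : ContDiffAt ℝ ∞ V₀ p) (hV₁ : ContDiffAt ℝ ∞ V₁ p) (hw₀ : ContDiffAt ℝ ∞ w₀ p)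
    (hw₁ : ContDiffAt ℝ ∞ w₁ p) (hκ₀ : ContDiffAt ℝ ∞ κ₀ p) (hκ₁ : ContDiffAt ℝ ∞ κ₁ p)
    (hΨ : ∀ i, ContDiffAt ℝ ∞ (Ψ i) p)
    (hbr : VectorField.lieBracket ℝ V₀ V₁ p = -(w₀ p • V₀ p) - w₁ p • V₁ p)
    (hκ : ∀ᶠ q in nhds p, κ₁ q = -(e * f * κ₀ q))
    (hcrit : ∀ s : Quaternion ℝ,
      hin (metricCoeff h y (Φ p)) (tens (fun i ↦ dirD Φ V₀ i p) s) (fun i ↦ Ψ i p)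
      + hin (metricCoeff h y (Φ p)) (tens (fun i ↦ dirD Φ V₁ i p) (-(e * f * s))) (fun i ↦ Ψ i p)
      + inner ℝ (κ₀ p) s * hin (metricCoeff h y (Φ p)) (fun i ↦ Ψ i p) (fun i ↦ Ψ i p) = 0)
    {SR : Fin n → Quaternion ℝ}
    (hSR : ∀ X, hin (metricCoeff h y (Φ p)) SR X
      = quart (riemannFn h y (Φ p)) (fun i ↦ Ψ i p) (fun i ↦ Ψ i p) (fun i ↦ Ψ i p) X)
    (hD : e • (fun i ↦ spinCov h y Φ (e * f) w₀ V₀ Ψ i p)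
        + f • (fun i ↦ spinCov h y Φ (e * f) w₁ V₁ Ψ i p)
      = (inner ℝ (κ₀ p) (κ₀ p) + inner ℝ (κ₁ p) (κ₁ p) : ℝ) • (fun i ↦ Ψ i p) + (1 / 3 : ℝ) • SR
        + (2 : ℝ) • (tens (fun i ↦ dirD Φ V₀ i p) (κ₀ p) + tens (fun i ↦ dirD Φ V₁ i p) (κ₁ p)))
    (hτ : hin (metricCoeff h y (Φ p)) (fun i ↦ dirD Φ V₀ i p)
        (fun i ↦ cov h y Φ V₀ (dirD Φ V₀) i p + cov h y Φ V₁ (dirD Φ V₁) i p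
          - w₀ p * dirD Φ V₁ i p + w₁ p * dirD Φ V₀ i p)
      = 1 / 2 * (mixedForm h y (Φ p) (fun i ↦ dirD Φ V₀ i p) (fun i ↦ dirD Φ V₀ i p)
            (fun i ↦ Ψ i p) (e • fun i ↦ Ψ i p)
          + mixedForm h y (Φ p) (fun i ↦ dirD Φ V₀ i p) (fun i ↦ dirD Φ V₁ i p)
            (fun i ↦ Ψ i p) (f • fun i ↦ Ψ i p))
        - 1 / 12 * ∑ m, dirD Φ V₀ m p * quart (fun i j k l ↦ nablaRiemann h y m i j k l (Φ p))
          (fun i ↦ Ψ i p) (fun i ↦ Ψ i p) (fun i ↦ Ψ i p) (fun i ↦ Ψ i p)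
        + 2 * (hin (metricCoeff h y (Φ p)) (tens (fun i ↦ dirD Φ V₀ i p)
              ((fderiv ℝ κ₀ p (V₀ p) + (w₀ p / 2) • (e * f * κ₀ p))
                + (fderiv ℝ κ₁ p (V₁ p) + (w₁ p / 2) • (e * f * κ₁ p))
                + w₁ p • κ₀ p - w₀ p • κ₁ p)) (fun i ↦ Ψ i p)
          + hin (metricCoeff h y (Φ p)) (tens (fun i ↦ dirD Φ V₀ i p) (κ₀ p))
            (fun i ↦ spinCov h y Φ (e * f) w₀ V₀ Ψ i p)
          + hin (metricCoeff h y (Φ p)) (tens (fun i ↦ dirD Φ V₀ i p) (κ₁ p))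
            (fun i ↦ spinCov h y Φ (e * f) w₁ V₁ Ψ i p))) :
    fderiv ℝ (emFst h y Φ e f V₀ V₁ w₁ κ₀ κ₁ Ψ) p (V₀ p)
        + fderiv ℝ (emSnd h y Φ e f V₀ V₁ w₀ κ₁ Ψ) p (V₁ p)
        + 2 * w₁ p * emFst h y Φ e f V₀ V₁ w₁ κ₀ κ₁ Ψ p
        - 2 * w₀ p * emSnd h y Φ e f V₀ V₁ w₀ κ₁ Ψ p = 0 := by
  set H : Fin n → Fin n → ℝ := metricCoeff h y (Φ p) with hHdef
  have hH : ∀ i j, H i j = H j i := metricCoeff_symm h (Φ p)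
  set φ₀ : Fin n → ℝ := fun i ↦ dirD Φ V₀ i p with hφ₀
  set φ₁ : Fin n → ℝ := fun i ↦ dirD Φ V₁ i p with hφ₁
  set ψ : Fin n → Quaternion ℝ := fun i ↦ Ψ i p with hψ
  set N₀ : Fin n → Quaternion ℝ := fun i ↦ spinCov h y Φ (e * f) w₀ V₀ Ψ i p with hN₀
  set N₁ : Fin n → Quaternion ℝ := fun i ↦ spinCov h y Φ (e * f) w₁ V₁ Ψ i p with hN₁
  set c₀ψ : Fin n → Quaternion ℝ := fun i ↦ cov h y Φ V₀ Ψ i p with hc₀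
  set c₁ψ : Fin n → Quaternion ℝ := fun i ↦ cov h y Φ V₁ Ψ i p with hc₁
  set S₀₀ : Fin n → ℝ := fun i ↦ cov h y Φ V₀ (dirD Φ V₀) i p with hS₀₀
  set S₀₁ : Fin n → ℝ := fun i ↦ cov h y Φ V₀ (dirD Φ V₁) i p with hS₀₁
  set S₁₀ : Fin n → ℝ := fun i ↦ cov h y Φ V₁ (dirD Φ V₀) i p with hS₁₀
  set S₁₁ : Fin n → ℝ := fun i ↦ cov h y Φ V₁ (dirD Φ V₁) i p with hS₁₁
  set c₀N₁ : Fin n → Quaternion ℝ := fun i ↦ cov h y Φ V₀ (spinCov h y Φ (e * f) w₁ V₁ Ψ) i p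
    with hc₀N₁
  set c₁N₀ : Fin n → Quaternion ℝ := fun i ↦ cov h y Φ V₁ (spinCov h y Φ (e * f) w₀ V₀ Ψ) i p
    with hc₁N₀
  set K₀ := fderiv ℝ κ₀ p (V₀ p) with hK₀
  set K₁ := fderiv ℝ κ₁ p (V₁ p) with hK₁
  set L₀ := fderiv ℝ κ₁ p (V₀ p) with hL₀
  have hd : ∀ {f : ℂ → Quaternion ℝ}, ContDiffAt ℝ ∞ f p → DifferentiableAt ℝ f p :=
    fun hf ↦ hf.differentiableAt (by simp)
  have hdφ₀ := contDiffAt_dirD hΦ hV₀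
  have hdφ₁ := contDiffAt_dirD hΦ hV₁
  have hcΨ₀ := fun i ↦ contDiffAt_cov h hy hΦ hp hV₀ hΨ i
  have hcΨ₁ := fun i ↦ contDiffAt_cov h hy hΦ hp hV₁ hΨ i
  have hsc : ∀ {w : ℂ → ℝ} {V : ℂ → ℂ}, ContDiffAt ℝ ∞ w p → ContDiffAt ℝ ∞ V p → ∀ i,
      ContDiffAt ℝ ∞ (spinCov h y Φ (e * f) w V Ψ i) p := fun hw hV i ↦
    (contDiffAt_cov h hy hΦ hp hV hΨ i).add ((hw.div_const 2).smul (contDiffAt_const.mul (hΨ i)))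
  have hfsc : ∀ {w : ℂ → ℝ} {V : ℂ → ℂ}, ContDiffAt ℝ ∞ w p → ContDiffAt ℝ ∞ V p → ∀ i,
      ContDiffAt ℝ ∞ (fun q ↦ f * spinCov h y Φ (e * f) w V Ψ i q) p := fun hw hV i ↦
    contDiffAt_const.mul (hsc hw hV i)
  have hFd : ∀ {f : ℂ → ℝ}, ContDiffAt ℝ ∞ f p → HasFDerivAt f (fderiv ℝ f p) p :=
    fun hf ↦ (hf.differentiableAt (by simp)).hasFDerivAt
  have hdd : ∀ {f : ℂ → ℝ}, ContDiffAt ℝ ∞ f p → DifferentiableAt ℝ f p :=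
    fun hf ↦ hf.differentiableAt (by simp)
  have hΦd : DifferentiableAt ℝ Φ p := hΦ.differentiableAt (by simp)
  have hφκ₀ : ∀ i, ContDiffAt ℝ ∞ (fun q ↦ dirD Φ V₀ i q • κ₁ q) p :=
    fun i ↦ (hdφ₀ i).smul hκ₁
  have hφκ₁ : ∀ i, ContDiffAt ℝ ∞ (fun q ↦ dirD Φ V₁ i q • κ₁ q) p :=
    fun i ↦ (hdφ₁ i).smul hκ₁
  -- derivatives of the individual terms
  have eF : fderiv ℝ (emFst h y Φ e f V₀ V₁ w₁ κ₀ κ₁ Ψ) p (V₀ p)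
      = (hin H S₀₀ φ₀ + hin H φ₀ S₀₀) - (hin H S₀₁ φ₁ + hin H φ₁ S₀₁)
        - (hin H c₀ψ (f • N₁) + hin H ψ (f • c₀N₁))
        + 4 * (hin H (tens S₀₁ (κ₁ p) + tens φ₁ L₀) ψ + hin H (tens φ₁ (κ₁ p)) c₀ψ)
        + ((inner ℝ (κ₀ p) (κ₀ p) + inner ℝ (κ₁ p) (κ₁ p)) * (hin H c₀ψ ψ + hin H ψ c₀ψ)
          + hin H ψ ψ * (2 * inner ℝ (κ₀ p) K₀ + 2 * inner ℝ (κ₁ p) L₀))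
        + 1 / 6 * (∑ m, φ₀ m * quart (fun i j k l ↦ nablaRiemann h y m i j k l (Φ p)) ψ ψ ψ ψ
          + 4 * quart (riemannFn h y (Φ p)) ψ ψ ψ c₀ψ) := by
    have t1 := fderiv_hin (V := V₀) h hy hΦd hp (fun i ↦ hdd (hdφ₀ i)) (fun i ↦ hdd (hdφ₀ i))
    have t2 := fderiv_hin (V := V₀) h hy hΦd hp (fun i ↦ hdd (hdφ₁ i)) (fun i ↦ hdd (hdφ₁ i))
    have t3 := fderiv_hin (V := V₀) h hy hΦd hp (fun i ↦ hd (hΨ i))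
      (fun i ↦ hd (hfsc hw₁ hV₁ i))
    have t4 := fderiv_hin (V := V₀) h hy hΦd hp (fun i ↦ hd (hφκ₁ i)) (fun i ↦ hd (hΨ i))
    have t5 := fderiv_hin (V := V₀) h hy hΦd hp (fun i ↦ hd (hΨ i)) (fun i ↦ hd (hΨ i))
    have t6 := fderiv_quart (V := V₀) h hy hΦd hp (fun i ↦ hd (hΨ i))
    have t3' : (fun i ↦ cov h y Φ V₀ (fun i q ↦ f * spinCov h y Φ (e * f) w₁ V₁ Ψ i q) i p)
        = f • c₀N₁ := by
      ext1 i
      exact cov_clm h (hd (hsc hw₁ hV₁ i)) (ContinuousLinearMap.mul ℝ (Quaternion ℝ) f)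
    have t4' : (fun i ↦ cov h y Φ V₀ (fun i q ↦ dirD Φ V₁ i q • κ₁ q) i p)
        = tens S₀₁ (κ₁ p) + tens φ₁ L₀ := by
      ext1 i
      exact cov_smul h (hdd (hdφ₁ i)) (hd hκ₁)
    rw [t3'] at t3
    rw [t4'] at t4
    have k0 := (hFd (hκ₀.inner ℝ hκ₀)).add (hFd (hκ₁.inner ℝ hκ₁))
    have g := (((((hFd (contDiffAt_hin (h := h) hy hΦ hp hdφ₀ hdφ₀)).sub
      (hFd (contDiffAt_hin (h := h) hy hΦ hp hdφ₁ hdφ₁))).sub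
      (hFd (contDiffAt_hin (h := h) hy hΦ hp hΨ (hfsc hw₁ hV₁)))).add
      ((hFd (contDiffAt_hin (h := h) hy hΦ hp hφκ₁ hΨ)).const_mul 4)).add
      (k0.mul (hFd (contDiffAt_hin (h := h) hy hΦ hp hΨ hΨ)))).add
      ((hFd (contDiffAt_quart (h := h) hy hΦ hp hΨ)).const_mul (1 / 6))
    have g' := congrArg (fun L ↦ L (V₀ p)) (HasFDerivAt.fderiv (f := emFst h y Φ e f V₀ V₁ w₁ κ₀ κ₁ Ψ) g)
    refine g'.trans ?_
    simp only [add_apply, sub_apply, smul_apply, smul_eq_mul]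
    rw [t1, t2, t3, t4, t5, t6, fderiv_inner_apply ℝ (hd hκ₀) (hd hκ₀),
      fderiv_inner_apply ℝ (hd hκ₁) (hd hκ₁), real_inner_comm (κ₀ p), real_inner_comm (κ₁ p),
      ← two_mul, ← two_mul]
    rfl
  have eS : fderiv ℝ (emSnd h y Φ e f V₀ V₁ w₀ κ₁ Ψ) p (V₁ p)
      = 2 * (hin H S₁₀ φ₁ + hin H φ₀ S₁₁) + (hin H c₁ψ (f • N₀) + hin H ψ (f • c₁N₀))
        - 4 * (hin H (tens S₁₀ (κ₁ p) + tens φ₀ K₁) ψ + hin H (tens φ₀ (κ₁ p)) c₁ψ) := by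
    have t1 := fderiv_hin (V := V₁) h hy hΦd hp (fun i ↦ hdd (hdφ₀ i)) (fun i ↦ hdd (hdφ₁ i))
    have t3 := fderiv_hin (V := V₁) h hy hΦd hp (fun i ↦ hd (hΨ i))
      (fun i ↦ hd (hfsc hw₀ hV₀ i))
    have t4 := fderiv_hin (V := V₁) h hy hΦd hp (fun i ↦ hd (hφκ₀ i)) (fun i ↦ hd (hΨ i))
    have t3' : (fun i ↦ cov h y Φ V₁ (fun i q ↦ f * spinCov h y Φ (e * f) w₀ V₀ Ψ i q) i p)
        = f • c₁N₀ := by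
      ext1 i
      exact cov_clm h (hd (hsc hw₀ hV₀ i)) (ContinuousLinearMap.mul ℝ (Quaternion ℝ) f)
    have t4' : (fun i ↦ cov h y Φ V₁ (fun i q ↦ dirD Φ V₀ i q • κ₁ q) i p)
        = tens S₁₀ (κ₁ p) + tens φ₀ K₁ := by
      ext1 i
      exact cov_smul h (hdd (hdφ₀ i)) (hd hκ₁)
    rw [t3'] at t3
    rw [t4'] at t4
    have g := (((hFd (contDiffAt_hin (h := h) hy hΦ hp hdφ₀ hdφ₁)).const_mul 2).add
      (hFd (contDiffAt_hin (h := h) hy hΦ hp hΨ (hfsc hw₀ hV₀)))).sub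
      ((hFd (contDiffAt_hin (h := h) hy hΦ hp hφκ₀ hΨ)).const_mul 4)
    have g' := congrArg (fun L ↦ L (V₁ p)) (HasFDerivAt.fderiv (f := emSnd h y Φ e f V₀ V₁ w₀ κ₁ Ψ) g)
    refine g'.trans ?_
    simp only [add_apply, sub_apply, smul_apply, smul_eq_mul]
    rw [t1, t3, t4]
    rfl
  -- the relations between second derivatives
  have hS : S₀₁ = S₁₀ - w₀ p • φ₀ - w₁ p • φ₁ := by
    ext1 i
    have h1 := cov_dirD_sub_swap h (y := y) hΦ hV₀ hV₁ i
    have h2 : dirD Φ (VectorField.lieBracket ℝ V₀ V₁) i p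
        = -(w₀ p * dirD Φ V₀ i p) - w₁ p * dirD Φ V₁ i p := by
      simp only [dirD, hbr, map_sub, map_neg, map_smul, smul_eq_mul]
    simp only [S₀₁, S₁₀, φ₀, φ₁, Pi.sub_apply, Pi.smul_apply, smul_eq_mul]
    linarith
  have hN₀' : N₀ = c₀ψ + (w₀ p / 2) • ((e * f) • ψ) := rfl
  have hN₁' : N₁ = c₁ψ + (w₁ p / 2) • ((e * f) • ψ) := rfl
  -- The commutator consists of the bracket terms, the target curvature and the derivatives of w₀
  -- and w₁; the last are the intrinsic spinor curvature up to terms without derivatives and enter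
  -- as a multiple of ωψ.
  have hcN : c₀N₁ - c₁N₀ = -(w₀ p • c₀ψ) - w₁ p • c₁ψ + curvOp h y (Φ p) φ₀ φ₁ ψ
      + ((fderiv ℝ w₁ p (V₀ p) - fderiv ℝ w₀ p (V₁ p)) / 2) • ((e * f) • ψ)
      + (w₁ p / 2) • ((e * f) • c₀ψ) - (w₀ p / 2) • ((e * f) • c₁ψ) := by
    have h1 : ∀ {w : ℂ → ℝ} {V W : ℂ → ℂ}, ContDiffAt ℝ ∞ w p → ContDiffAt ℝ ∞ V p → ∀ i,
        cov h y Φ W (spinCov h y Φ (e * f) w V Ψ) i p = cov h y Φ W (cov h y Φ V Ψ) i p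
          + ((fderiv ℝ w p (W p) / 2) • (e * f * Ψ i p) + (w p / 2) • (e * f * cov h y Φ W Ψ i p)) := by
      intro w V W hw hV i
      have hwd : DifferentiableAt ℝ (fun q ↦ w q / 2) p := hdd (hw.div_const 2)
      have h2 := cov_smul_clm h (y := y) (Φ := Φ) (V := W) (hd (hΨ i)) hwd
        (ContinuousLinearMap.mul ℝ (Quaternion ℝ) (e * f))
      have h3 : fderiv ℝ (fun q ↦ w q / 2) p (W p) = fderiv ℝ w p (W p) / 2 := by
        have := congrArg (fun L ↦ L (W p)) ((hdd hw).hasFDerivAt.mul_const (2⁻¹ : ℝ)).fderiv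
        simp only [div_eq_mul_inv]
        refine this.trans ?_
        simp [mul_comm]
      rw [h3] at h2
      refine (cov_add h (hd (contDiffAt_cov h hy hΦ hp hV hΨ i))
        (hd ((hw.div_const 2).smul (contDiffAt_const.mul (hΨ i))))).trans ?_
      exact congrArg _ h2
    ext1 i
    have h2 := cov_cov_sub_swap h hy hΦ hp hV₀ hV₁ hΨ i
    have h3 : cov h y Φ (VectorField.lieBracket ℝ V₀ V₁) Ψ i p
        = -(w₀ p • cov h y Φ V₀ Ψ i p) - w₁ p • cov h y Φ V₁ Ψ i p := by
      simp only [cov, dirD, hbr, map_sub, map_neg, map_smul, smul_eq_mul, smul_add, Finset.smul_sum,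
        smul_smul, mul_sub, sub_smul, Finset.sum_sub_distrib, mul_neg, neg_smul,
        Finset.sum_neg_distrib, mul_left_comm]
      abel
    rw [h3, sub_eq_iff_eq_add] at h2
    simp only [c₀N₁, c₁N₀, Pi.sub_apply, Pi.add_apply, Pi.neg_apply, Pi.smul_apply, smul_eq_mul,
      h1 hw₁ hV₁, h1 hw₀ hV₀, h2, c₀ψ, c₁ψ, curvOp, ψ, φ₀, φ₁]
    module
  have hkin := div_kinetic hH hef hN₀' hN₁' hcN
  rw [hin_mul_curvOp hy hp] at hkin
  have hκp : κ₁ p = -(e * f * κ₀ p) := hκ.self_of_nhds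
  have hef₀ : e * f * κ₀ p = -κ₁ p := by rw [hκp, neg_neg]
  have hef₁ : e * f * κ₁ p = κ₀ p := by
    rw [hκp, mul_neg, ← mul_assoc, omega_sq hef, neg_one_mul, neg_neg]
  -- ω is constant, so the constraint on κ passes to its derivative along V₀.
  have hL : L₀ = -(e * f * K₀) := by
    have h1 : fderiv ℝ κ₁ p = fderiv ℝ (fun q ↦ (-ContinuousLinearMap.mul ℝ (Quaternion ℝ) (e * f))
        (κ₀ q)) p := Filter.EventuallyEq.fderiv_eq hκ
    have h2 := ((-ContinuousLinearMap.mul ℝ (Quaternion ℝ) (e * f)).hasFDerivAt.comp p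
      (hd hκ₀).hasFDerivAt).fderiv
    exact congrArg (fun L ↦ L (V₀ p)) (h1.trans h2)
  have hLκ : inner ℝ (κ₁ p) L₀ = inner ℝ (κ₀ p) K₀ := by
    rw [hL, hκp, inner_neg_neg, inner_mul_left_of_re_eq_zero hef.re_mul, ← mul_assoc, omega_sq hef,
      neg_one_mul, inner_neg_right, neg_neg]
  have hRs : ∀ i j k l, riemannFn h y (Φ p) k l i j = riemannFn h y (Φ p) i j k l :=
    riemannLow_pair_symm h hy hp
  have q₀ : quart (riemannFn h y (Φ p)) ψ ψ ψ c₀ψ = quart (riemannFn h y (Φ p)) ψ ψ ψ N₀ := by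
    rw [hN₀', quart_add_fourth, quart_smul_fourth, quart_omega hRs hef.re_mul, mul_zero, add_zero]
  have hg₀ : ∀ X, hin H X c₀ψ = hin H X N₀ - w₀ p / 2 * hin H X ((e * f) • ψ) := by
    intro X
    rw [hN₀', hin_add_right, hin_smul_right]
    ring
  have hg₁ : ∀ X, hin H X c₁ψ = hin H X N₁ - w₁ p / 2 * hin H X ((e * f) • ψ) := by
    intro X
    rw [hN₁', hin_add_right, hin_smul_right]
    ring
  have ho : ∀ v s, hin H (tens v s) ((e * f) • ψ) = -hin H (tens v (e * f * s)) ψ := by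
    intro v s
    have := hin_mul_left (H := H) hef.re_mul (tens v s) ψ
    rw [mul_tens] at this
    linarith
  have hDN : hin H N₀ (e • N₀ + f • N₁)
      = (inner ℝ (κ₀ p) (κ₀ p) + inner ℝ (κ₁ p) (κ₁ p)) * hin H ψ N₀
        + 1 / 3 * quart (riemannFn h y (Φ p)) ψ ψ ψ N₀
        + 2 * (hin H (tens φ₀ (κ₀ p)) N₀ + hin H (tens φ₁ (κ₁ p)) N₀) := by
    rw [hD, hin_add_right, hin_add_right, hin_smul_right, hin_smul_right, hin_smul_right,
      hin_add_right, hin_comm N₀ ψ hH, hin_comm N₀ SR hH, hSR, hin_comm N₀ (tens φ₀ _) hH,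
      hin_comm N₀ (tens φ₁ _) hH]
  -- The test spinor is the derivative of κ₀ along V₀. This accounts for the terms of the divergence
  -- in which Qχ is differentiated along V₀.
  have hc1 := hcrit K₀
  rw [← hL] at hc1
  have hc2 := crit_trace hκp hcrit
  have hc3 := crit_skew hef hκp hcrit
  have hd1 := dirac_trace hH hSR hD
  have hd2 := dirac_skew hH hRs hef hSR hκp hcrit hD
  have hi := inner_snd_eq hef hκp
  have hτ' := hτ
  rw [show (fun i ↦ cov h y Φ V₀ (dirD Φ V₀) i p + cov h y Φ V₁ (dirD Φ V₁) i p
          - w₀ p * dirD Φ V₁ i p + w₁ p * dirD Φ V₀ i p)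
        = S₀₀ + S₁₁ - w₀ p • φ₁ + w₁ p • φ₀ from rfl, hin_add_right, hin_sub_right, hin_add_right,
      hin_smul_right, hin_smul_right] at hτ'
  -- Of the curvature force only the part from e₁ is left; it meets the curvature term of `hkin`.
  rw [mixedForm_self hy hp] at hτ'
  have e1 : hin H (tens φ₀ (K₀ + (w₀ p / 2) • (e * f * κ₀ p) + (K₁ + (w₁ p / 2) • (e * f * κ₁ p))
      + w₁ p • κ₀ p - w₀ p • κ₁ p)) ψ
      = hin H (tens φ₀ K₀) ψ + hin H (tens φ₀ K₁) ψ + 3 / 2 * w₁ p * hin H (tens φ₀ (κ₀ p)) ψ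
        - 3 / 2 * w₀ p * hin H (tens φ₀ (κ₁ p)) ψ := by
    rw [hef₀, hef₁, sub_eq_add_neg, tens_add, tens_add, tens_add, tens_add, tens_add, tens_neg,
      tens_smul, tens_smul, tens_smul, tens_smul, tens_neg, hin_add_left, hin_add_left,
      hin_add_left, hin_add_left, hin_add_left]
    simp only [hin_smul_left, hin_neg_left]
    ring
  rw [e1] at hτ'
  have hSφ : hin H S₀₁ φ₁ = hin H S₁₀ φ₁ - w₀ p * hin H φ₀ φ₁ - w₁ p * hin H φ₁ φ₁ := by
    rw [hS, hin_sub_left, hin_sub_left, hin_smul_left, hin_smul_left]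
  have hSκ : hin H (tens S₀₁ (κ₁ p)) ψ = hin H (tens S₁₀ (κ₁ p)) ψ
      - w₀ p * hin H (tens φ₀ (κ₁ p)) ψ - w₁ p * hin H (tens φ₁ (κ₁ p)) ψ := by
    rw [hS, sub_eq_add_neg, sub_eq_add_neg, add_tens, add_tens, neg_tens, neg_tens, smul_tens,
      smul_tens, hin_add_left, hin_add_left, hin_neg_left, hin_neg_left, hin_smul_left,
      hin_smul_left]
    ring
  have hFp : emFst h y Φ e f V₀ V₁ w₁ κ₀ κ₁ Ψ p = hin H φ₀ φ₀ - hin H φ₁ φ₁ - hin H ψ (f • N₁)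
      + 4 * hin H (tens φ₁ (κ₁ p)) ψ
      + (inner ℝ (κ₀ p) (κ₀ p) + inner ℝ (κ₁ p) (κ₁ p)) * hin H ψ ψ
      + 1 / 6 * quart (riemannFn h y (Φ p)) ψ ψ ψ ψ := rfl
  have hSp : emSnd h y Φ e f V₀ V₁ w₀ κ₁ Ψ p = 2 * hin H φ₀ φ₁ + hin H ψ (f • N₀)
      - 4 * hin H (tens φ₀ (κ₁ p)) ψ := rfl
  rw [eF, eS, hFp, hSp, q₀, hin_comm S₀₀ φ₀ hH, hin_comm φ₁ S₀₁ hH, hSφ, hin_add_left, hin_add_left,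
    hSκ, hin_comm c₀ψ ψ hH, hg₀ ψ, hg₀ (tens φ₁ (κ₁ p)), hg₁ (tens φ₀ (κ₁ p)), ho, ho, hef₁,
    hin_mul_self hH hef.re_mul, hLκ]
  rw [hDN] at hkin
  rw [hi] at hkin hd1 ⊢
  -- The derivatives of the |dφ|² part add up to 2⟨φ_*e₀, τ⟩, hence twice the tension equation. The
  -- multiples of w₀ and w₁ use the trace and skew relations to remove the terms of order zero in
  -- the connection.
  linear_combination 2 * hτ' + hkin + 4 * hc1 - w₁ p * hd1 - w₀ p * hd2 + 2 * w₁ p * hc2 + 2 * w₀ p * hc3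

end Divergence

/-! ### Orthonormal frames and the spin connection in a chart -/

section Frame

variable {M : Type*} [TopologicalSpace M] [ChartedSpace ℂ M] [IsManifold 𝓘(ℝ, ℂ) ∞ M]
  {g : SurfaceMetric M} {ι : Type*} (σ : SpinStructure g ι) {a : ι} {x : M}

/-- Expansion of a tangent vector in an orthonormal frame. -/
lemma eq_sum_frame (hx : x ∈ σ.U a) (v : TangentSpace 𝓘(ℝ, ℂ) x) :
    v = g.inner x (σ.frame a 0 x) v • σ.frame a 0 x
      + g.inner x (σ.frame a 1 x) v • σ.frame a 1 x := by
  have ho := σ.orthonormal a x hx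
  have hli : LinearIndependent ℝ (fun α ↦ σ.frame a α x) := by
    rw [Fintype.linearIndependent_iff]
    intro c hc β
    have h1 := congrArg (g.inner x (σ.frame a β x)) hc
    fin_cases β <;> simpa [ho] using h1
  have hfin : Module.finrank ℝ (TangentSpace 𝓘(ℝ, ℂ) x) = 2 := Complex.finrank_real_complex
  have hmem : v ∈ Submodule.span ℝ (Set.range fun α ↦ σ.frame a α x) := by
    have : FiniteDimensional ℝ (TangentSpace 𝓘(ℝ, ℂ) x) :=
      inferInstanceAs (FiniteDimensional ℝ ℂ)
    rw [hli.span_eq_top_of_card_eq_finrank' (by simp [hfin])]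
    trivial
  obtain ⟨c, hc⟩ := (Submodule.mem_span_range_iff_exists_fun ℝ).mp hmem
  have h2 : ∀ β, g.inner x (σ.frame a β x) v = c β := by
    intro β
    rw [← hc]
    fin_cases β <;> simp [ho]
  rw [h2, h2, ← hc, Fin.sum_univ_two]

lemma conn_swap (α β γ : Fin 2) (x : M) : σ.conn a α γ β x = -σ.conn a α β γ x := by
  have h1 : VectorField.mlieBracket 𝓘(ℝ, ℂ) (σ.frame a γ) (σ.frame a β) x
      = -VectorField.mlieBracket 𝓘(ℝ, ℂ) (σ.frame a β) (σ.frame a γ) x :=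
    congrFun VectorField.mlieBracket_swap x
  simp only [SpinStructure.conn, h1, map_neg, neg_apply]
  ring

lemma conn_self (α β : Fin 2) (x : M) : σ.conn a α β β x = 0 := by
  have := conn_swap σ (a := a) α β β x
  linarith

lemma conn_zero_zero_one (x : M) : σ.conn a 0 0 1 x
    = -g.inner x (VectorField.mlieBracket 𝓘(ℝ, ℂ) (σ.frame a 0) (σ.frame a 1) x)
      (σ.frame a 0 x) := by
  have h1 : VectorField.mlieBracket 𝓘(ℝ, ℂ) (σ.frame a 0) (σ.frame a 0) x = 0 := by
    rw [VectorField.mlieBracket_self]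
    rfl
  simp only [SpinStructure.conn, h1, map_zero, zero_apply]
  ring

lemma conn_one_zero_one (x : M) : σ.conn a 1 0 1 x
    = -g.inner x (VectorField.mlieBracket 𝓘(ℝ, ℂ) (σ.frame a 0) (σ.frame a 1) x)
      (σ.frame a 1 x) := by
  have h1 : VectorField.mlieBracket 𝓘(ℝ, ℂ) (σ.frame a 1) (σ.frame a 1) x = 0 := by
    rw [VectorField.mlieBracket_self]
    rfl
  have h2 : VectorField.mlieBracket 𝓘(ℝ, ℂ) (σ.frame a 1) (σ.frame a 0) x
      = -VectorField.mlieBracket 𝓘(ℝ, ℂ) (σ.frame a 0) (σ.frame a 1) x :=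
    congrFun VectorField.mlieBracket_swap x
  simp only [SpinStructure.conn, h1, h2, map_zero, map_neg, zero_apply, neg_apply]
  ring

/-- Torsion-freeness: [e₀, e₁] = ∇_{e₀}e₁ - ∇_{e₁}e₀. In dimension two the Koszul formula makes both
connection coefficients components of this bracket. -/
lemma mlieBracket_frame (hx : x ∈ σ.U a) :
    VectorField.mlieBracket 𝓘(ℝ, ℂ) (σ.frame a 0) (σ.frame a 1) x
      = -(σ.conn a 0 0 1 x • σ.frame a 0 x) - σ.conn a 1 0 1 x • σ.frame a 1 x := by
  rw [conn_zero_zero_one, conn_one_zero_one, g.symm x _ (σ.frame a 0 x),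
    g.symm x _ (σ.frame a 1 x), neg_smul, neg_smul, neg_neg, sub_neg_eq_add]
  exact eq_sum_frame σ hx _

/-- The diagonal terms vanish and the two off-diagonal ones agree, as both factors change sign; so
1/4 becomes 1/2. -/
lemma spinDeriv_eq (α : Fin 2) (s : M → Quaternion ℝ) (x : M) :
    σ.spinDeriv a α s x
      = σ.deriv a α s x + (σ.conn a α 0 1 x / 2) • (cliff 0 * cliff 1 * s x) := by
  have h1 : cliff 1 * cliff 0 = -(cliff 0 * cliff 1) := by
    rw [isCliffordPair_cliff.anticomm]
  simp only [SpinStructure.spinDeriv, Fin.sum_univ_two, conn_self, conn_swap σ α 0 1, h1,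
    zero_smul, neg_mul]
  module

variable {z : OpenPartialHomeomorph M ℂ}

/-- The components of a frame vector field in the chart `z`. -/
def frameCoord (σ : SpinStructure g ι) (a : ι) (z : OpenPartialHomeomorph M ℂ) (α : Fin 2)
    (q : ℂ) : ℂ := dchart z (z.symm q) (σ.frame a α (z.symm q))

/-- The connection coefficients in the chart `z`. -/
def connCoord (σ : SpinStructure g ι) (a : ι) (z : OpenPartialHomeomorph M ℂ) (α : Fin 2)
    (q : ℂ) : ℝ := σ.conn a α 0 1 (z.symm q)

variable (hz : z ∈ IsManifold.maximalAtlas 𝓘(ℝ, ℂ) ∞ M) {q : ℂ}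
include hz

lemma contDiffAt_frameCoord (hq : q ∈ z.target) (hx : z.symm q ∈ σ.U a) (α : Fin 2) :
    ContDiffAt ℝ ∞ (frameCoord σ a z α) q :=
  (contDiffOn_vectorField hz (σ.frame_smooth a α)).contDiffAt
    ((z.isOpen_inter_preimage_symm (σ.isOpen a)).mem_nhds ⟨hq, hx⟩)

lemma deriv_eq_fderiv {F : Type*} [NormedAddCommGroup F] [NormedSpace ℝ F] (hq : q ∈ z.target)
    {f : M → F} (hf : MDifferentiableAt 𝓘(ℝ, ℂ) 𝓘(ℝ, F) f (z.symm q)) (α : Fin 2) :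
    σ.deriv a α f (z.symm q) = fderiv ℝ (f ∘ z.symm) q (frameCoord σ a z α q) :=
  mfderiv_eq_fderiv_chart hz hq hf _

lemma lieBracket_frameCoord (hq : q ∈ z.target) (hx : z.symm q ∈ σ.U a) :
    VectorField.lieBracket ℝ (frameCoord σ a z 0) (frameCoord σ a z 1) q
      = -(connCoord σ a z 0 q • frameCoord σ a z 0 q)
        - connCoord σ a z 1 q • frameCoord σ a z 1 q := by
  have hs : ∀ α, ContMDiffAt 𝓘(ℝ, ℂ) (𝓘(ℝ, ℂ).tangent) ∞
      (fun x ↦ (⟨x, σ.frame a α x⟩ : TangentBundle 𝓘(ℝ, ℂ) M)) (z.symm q) :=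
    fun α ↦ (σ.frame_smooth a α).contMDiffAt ((σ.isOpen a).mem_nhds hx)
  have h1 := dchart_mlieBracket hz hq (hs 0) (hs 1)
  rw [mlieBracket_frame σ hx, map_sub, map_neg, map_smul, map_smul] at h1
  exact h1.symm

/-- Smoothness of the metric is known on constant vectors; varying ones are expanded in the real
basis 1, i. -/
lemma contDiffAt_inner_dchartSymm (hq : q ∈ z.target) {u v : ℂ → ℂ} (hu : ContDiffAt ℝ ∞ u q)
    (hv : ContDiffAt ℝ ∞ v q) :
    ContDiffAt ℝ ∞ (fun q ↦ g.inner (z.symm q) (dchartSymm z q (u q)) (dchartSymm z q (v q))) q := by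
  have hc := fun v w : ℂ ↦ (contDiffOn_metric g hz v w).contDiffAt (z.open_target.mem_nhds hq)
  have he : ∀ w : ℂ, w = w.re • (1 : ℂ) + w.im • Complex.I := fun w ↦ by
    simp [Complex.re_add_im]
  have hre := fun {w : ℂ → ℂ} (hw : ContDiffAt ℝ ∞ w q) ↦
    Complex.reCLM.contDiff.contDiffAt.comp q hw
  have him := fun {w : ℂ → ℂ} (hw : ContDiffAt ℝ ∞ w q) ↦
    Complex.imCLM.contDiff.contDiffAt.comp q hw
  have h1 := ((((hre hu).mul (hre hv)).mul (hc 1 1)).add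
    (((hre hu).mul (him hv)).mul (hc 1 Complex.I))).add
    ((((him hu).mul (hre hv)).mul (hc Complex.I 1)).add
    (((him hu).mul (him hv)).mul (hc Complex.I Complex.I)))
  refine h1.congr_of_eventuallyEq (Filter.Eventually.of_forall fun q ↦ ?_)
  change g.inner (z.symm q) (dchartSymm z q (u q)) (dchartSymm z q (v q)) = _
  rw [he (u q), he (v q)]
  simp only [map_add, map_smul, add_apply, smul_apply, smul_eq_mul]
  simp
  ring

/-- Near q the coefficients are minus the inner products of the bracket with the frame vectors. -/
lemma contDiffAt_connCoord (hq : q ∈ z.target) (hx : z.symm q ∈ σ.U a) (α : Fin 2) :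
    ContDiffAt ℝ ∞ (connCoord σ a z α) q := by
  have h0 := contDiffAt_frameCoord σ hz hq hx
  have hb : ContDiffAt ℝ ∞ (VectorField.lieBracket ℝ (frameCoord σ a z 0) (frameCoord σ a z 1)) q :=
    (differentiableAt_fderiv_apply (h0 1) (h0 0)).sub (differentiableAt_fderiv_apply (h0 0) (h0 1))
  refine (contDiffAt_inner_dchartSymm (g := g) hz hq hb (h0 α)).neg.congr_of_eventuallyEq ?_
  filter_upwards [(z.isOpen_inter_preimage_symm (σ.isOpen a)).mem_nhds ⟨hq, hx⟩] with p hp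
  have ho := σ.orthonormal a _ hp.2
  have hd : ∀ β, dchartSymm z p (frameCoord σ a z β p) = σ.frame a β (z.symm p) :=
    fun β ↦ dchartSymm_dchart hz hp.1 _
  rw [lieBracket_frameCoord σ hz hp.1 hp.2, map_sub, map_neg, map_smul, map_smul, hd, hd, hd]
  simp only [map_sub, map_neg, map_smul, sub_apply, neg_apply, smul_apply, ho, smul_eq_mul]
  fin_cases α <;> simp [connCoord]

end Frame

/-! ### The projection Q -/

section Gravitino

variable {M : Type*} [TopologicalSpace M] [ChartedSpace ℂ M] [IsManifold 𝓘(ℝ, ℂ) ∞ M]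
  {g : SurfaceMetric M} {ι : Type*} {σ : SpinStructure g ι} (χ : Gravitino σ) {a : ι}

/-- The section whose divergence occurs in the tension equation is -2Qχ, so κ is the only gravitino
quantity in the computation. -/
lemma twist_eq (β : Fin 2) (x : M) : twist σ χ a β x = (-2 : ℝ) • χ.proj a β x := by
  rw [twist, Gravitino.proj, smul_smul]
  norm_num

/-- This expresses that the Clifford contraction e_α·κ_α vanishes: one spinor κ₀ determines Qχ. -/
lemma proj_one (x : M) : χ.proj a 1 x = -(cliff 0 * cliff 1 * χ.proj a 0 x) := by
  ext <;> simp [Gravitino.proj, Fin.sum_univ_two] <;> ring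

lemma contMDiffOn_proj (α : Fin 2) :
    ContMDiffOn 𝓘(ℝ, ℂ) 𝓘(ℝ, Quaternion ℝ) ∞ (χ.proj a α) (σ.U a) := by
  have h1 : ∀ β, ContMDiffOn 𝓘(ℝ, ℂ) 𝓘(ℝ, Quaternion ℝ) ∞
      (fun x ↦ cliff β * cliff α * χ.comp a β x) (σ.U a) := fun β ↦
    (ContinuousLinearMap.mul ℝ (Quaternion ℝ) (cliff β * cliff α)).contMDiff.comp_contMDiffOn
      (χ.smooth a β)
  have h2 := (h1 0).add (h1 1)
  have h3 := ((-(1 / 2 : ℝ)) • ContinuousLinearMap.id ℝ (Quaternion ℝ)).contMDiff.comp_contMDiffOn h2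
  refine h3.congr fun x _ ↦ ?_
  simp [Gravitino.proj, Fin.sum_univ_two, add_comm]

end Gravitino

/-! ### Translation of the fields and their derivatives into charts -/

section Target

variable {M : Type*} [TopologicalSpace M] [ChartedSpace ℂ M] [IsManifold 𝓘(ℝ, ℂ) ∞ M]
  {g : SurfaceMetric M} {ι : Type*}
  {n : ℕ} {N : Type*} [TopologicalSpace N] [ChartedSpace (EuclideanSpace ℝ (Fin n)) N]
  [IsManifold (𝓡 n) ∞ N]
  {σ : SpinStructure g ι} (h : TargetMetric n N) {φ : M → N} (ψ : VectorSpinor n σ φ)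
  (χ : Gravitino σ) {a : ι} {y : OpenPartialHomeomorph N (EuclideanSpace ℝ (Fin n))}
  {z : OpenPartialHomeomorph M ℂ}

/-- The map `φ` in charts. -/
def mapCoord (φ : M → N) (y : OpenPartialHomeomorph N (EuclideanSpace ℝ (Fin n)))
    (z : OpenPartialHomeomorph M ℂ) (q : ℂ) : EuclideanSpace ℝ (Fin n) := y (φ (z.symm q))

/-- The components of a vector spinor in charts. -/
def spinorCoord (ψ : VectorSpinor n σ φ) (a : ι)
    (y : OpenPartialHomeomorph N (EuclideanSpace ℝ (Fin n))) (z : OpenPartialHomeomorph M ℂ)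
    (i : Fin n) (q : ℂ) : Quaternion ℝ := ψ.comp a y i (z.symm q)

/-- The components of `Qχ` in a chart. -/
def projCoord (χ : Gravitino σ) (a : ι) (z : OpenPartialHomeomorph M ℂ) (α : Fin 2) (q : ℂ) :
    Quaternion ℝ := χ.proj a α (z.symm q)

variable (hφ : ContMDiff 𝓘(ℝ, ℂ) (𝓡 n) ∞ φ) (hy : y ∈ IsManifold.maximalAtlas (𝓡 n) ∞ N)
  (hz : z ∈ IsManifold.maximalAtlas 𝓘(ℝ, ℂ) ∞ M) {q : ℂ} {x : M}

section

include hφ hy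

lemma contMDiffAt_comp_chart (hxy : φ x ∈ y.source) (i : Fin n) :
    ContMDiffAt 𝓘(ℝ, ℂ) 𝓘(ℝ, ℝ) ∞ (fun x' ↦ y (φ x') i) x :=
  (EuclideanSpace.proj i : EuclideanSpace ℝ (Fin n) →L[ℝ] ℝ).contMDiff.contMDiffAt.comp x
    ((contMDiffAt_of_mem_maximalAtlas hy hxy).comp x hφ.contMDiffAt)

include hz

lemma contDiffAt_mapCoord (hq : q ∈ z.target) (hxy : φ (z.symm q) ∈ y.source) :
    ContDiffAt ℝ ∞ (mapCoord φ y z) q := by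
  refine contMDiffAt_iff_contDiffAt.mp ?_
  exact ((contMDiffAt_of_mem_maximalAtlas hy hxy).comp _ hφ.contMDiffAt).comp q
    (contMDiffAt_symm_of_mem_maximalAtlas hz hq)

lemma push_eq_dirD (hq : q ∈ z.target) (hxy : φ (z.symm q) ∈ y.source) (α : Fin 2) (i : Fin n) :
    push σ φ a y α i (z.symm q) = dirD (mapCoord φ y z) (frameCoord σ a z α) i q :=
  deriv_eq_fderiv σ hz hq ((contMDiffAt_comp_chart hφ hy hxy i).mdifferentiableAt (by simp)) α

lemma eventually_nhds_chart (hq : q ∈ z.target) (hx : z.symm q ∈ σ.U a)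
    (hxy : φ (z.symm q) ∈ y.source) :
    ∀ᶠ p in nhds q, p ∈ z.target ∧ z.symm p ∈ σ.U a ∧ φ (z.symm p) ∈ y.source :=
  (z.isOpen_inter_preimage_symm ((σ.isOpen a).inter
    (y.open_source.preimage hφ.continuous))).mem_nhds ⟨hq, hx, hxy⟩

lemma contMDiffAt_push (hx : x ∈ σ.U a) (hxz : x ∈ z.source) (hxy : φ x ∈ y.source) (α : Fin 2)
    (i : Fin n) : ContMDiffAt 𝓘(ℝ, ℂ) 𝓘(ℝ, ℝ) ∞ (push σ φ a y α i) x := by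
  have hq : z x ∈ z.target := z.map_source hxz
  have hs := z.left_inv hxz
  have h1 : ContDiffAt ℝ ∞ (dirD (mapCoord φ y z) (frameCoord σ a z α) i) (z x) :=
    contDiffAt_dirD (contDiffAt_mapCoord hφ hy hz hq (by rwa [hs]))
      (contDiffAt_frameCoord σ hz hq (by rwa [hs]) α) i
  refine (h1.contMDiffAt.comp x (contMDiffAt_of_mem_maximalAtlas hz hxz)).congr_of_eventuallyEq ?_
  have h2 := eventually_nhds_chart (σ := σ) (a := a) hφ hy hz hq (by rwa [hs]) (by rwa [hs])
  filter_upwards [(z.continuousAt hxz).eventually h2, z.open_source.mem_nhds hxz] with p hp hp2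
  have := push_eq_dirD (σ := σ) (a := a) hφ hy hz hp.1 hp.2.2 α i
  rwa [z.left_inv hp2] at this

lemma deriv_push (hq : q ∈ z.target) (hx : z.symm q ∈ σ.U a) (hxy : φ (z.symm q) ∈ y.source)
    (α β : Fin 2) (i : Fin n) :
    σ.deriv a α (push σ φ a y β i) (z.symm q)
      = fderiv ℝ (dirD (mapCoord φ y z) (frameCoord σ a z β) i) q (frameCoord σ a z α q) := by
  have hd : MDifferentiableAt 𝓘(ℝ, ℂ) 𝓘(ℝ, ℝ) (push σ φ a y β i) (z.symm q) :=
    (contMDiffAt_push (x := z.symm q) hφ hy hz hx (z.map_target hq) hxy β i).mdifferentiableAt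
      (by simp)
  rw [deriv_eq_fderiv σ hz hq hd]
  refine congrArg (fun L : ℂ →L[ℝ] ℝ ↦ L (frameCoord σ a z α q)) (Filter.EventuallyEq.fderiv_eq ?_)
  filter_upwards [eventually_nhds_chart (σ := σ) (a := a) hφ hy hz hq hx hxy] with p hp
  exact push_eq_dirD hφ hy hz hp.1 hp.2.2 β i

lemma tension_eq (hq : q ∈ z.target) (hx : z.symm q ∈ σ.U a) (hxy : φ (z.symm q) ∈ y.source)
    (i : Fin n) :
    tension σ h φ a y i (z.symm q)
      = cov h y (mapCoord φ y z) (frameCoord σ a z 0)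
          (dirD (mapCoord φ y z) (frameCoord σ a z 0)) i q
        + cov h y (mapCoord φ y z) (frameCoord σ a z 1) (dirD (mapCoord φ y z) (frameCoord σ a z 1)) i q
        - connCoord σ a z 0 q * dirD (mapCoord φ y z) (frameCoord σ a z 1) i q
        + connCoord σ a z 1 q * dirD (mapCoord φ y z) (frameCoord σ a z 0) i q := by
  simp only [tension, Fin.sum_univ_two, conn_self, conn_swap σ 1 0 1,
    deriv_push (σ := σ) (a := a) hφ hy hz hq hx hxy,
    push_eq_dirD (σ := σ) (a := a) hφ hy hz hq hxy, cov, connCoord, mapCoord, smul_eq_mul]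
  ring

lemma contDiffAt_spinorCoord (hq : q ∈ z.target) (hx : z.symm q ∈ σ.U a)
    (hxy : φ (z.symm q) ∈ y.source) (i : Fin n) : ContDiffAt ℝ ∞ (spinorCoord ψ a y z i) q :=
  (contDiffOn_comp_symm hz (ψ.smooth a y hy i)).contDiffAt
    ((z.isOpen_inter_preimage_symm ((σ.isOpen a).inter
    (y.open_source.preimage hφ.continuous))).mem_nhds ⟨hq, hx, hxy⟩)

lemma contMDiffAt_comp (hx : x ∈ σ.U a) (hxy : φ x ∈ y.source) (i : Fin n) :
    ContMDiffAt 𝓘(ℝ, ℂ) 𝓘(ℝ, Quaternion ℝ) ∞ (ψ.comp a y i) x :=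
  (ψ.smooth a y hy i).contMDiffAt (((σ.isOpen a).inter
    (y.open_source.preimage hφ.continuous)).mem_nhds ⟨hx, hxy⟩)

lemma covDeriv_eq (hq : q ∈ z.target) (hx : z.symm q ∈ σ.U a) (hxy : φ (z.symm q) ∈ y.source)
    (α : Fin 2) (i : Fin n) :
    covDeriv σ h φ ψ a y α i (z.symm q)
      = spinCov h y (mapCoord φ y z) (cliff 0 * cliff 1) (connCoord σ a z α) (frameCoord σ a z α)
        (spinorCoord ψ a y z) i q := by
  simp only [covDeriv, spinDeriv_eq, spinCov, cov]
  rw [deriv_eq_fderiv σ hz hq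
    ((contMDiffAt_comp ψ hφ hy hz hx hxy i).mdifferentiableAt (by simp))]
  simp only [push_eq_dirD hφ hy hz hq hxy]
  rw [add_right_comm]
  rfl

end

include hz in
lemma contDiffAt_projCoord (hq : q ∈ z.target) (hx : z.symm q ∈ σ.U a) (α : Fin 2) :
    ContDiffAt ℝ ∞ (projCoord χ a z α) q :=
  (contDiffOn_comp_symm hz (contMDiffOn_proj χ α)).contDiffAt
    ((z.isOpen_inter_preimage_symm (σ.isOpen a)).mem_nhds ⟨hq, hx⟩)

include hz in
lemma spinDeriv_twist (hq : q ∈ z.target) (hx : z.symm q ∈ σ.U a) (α β : Fin 2) :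
    σ.spinDeriv a α (twist σ χ a β) (z.symm q)
      = (-2 : ℝ) • (fderiv ℝ (projCoord χ a z β) q (frameCoord σ a z α q)
        + (connCoord σ a z α q / 2) • (cliff 0 * cliff 1 * projCoord χ a z β q)) := by
  have h1 : twist σ χ a β = fun x ↦ (-2 : ℝ) • χ.proj a β x := funext (twist_eq χ β)
  have h2 : MDifferentiableAt 𝓘(ℝ, ℂ) 𝓘(ℝ, Quaternion ℝ) (fun x ↦ (-2 : ℝ) • χ.proj a β x)
      (z.symm q) :=
    ((((-2 : ℝ)) • ContinuousLinearMap.id ℝ (Quaternion ℝ)).contMDiff.contMDiffAt.comp (z.symm q)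
      ((contMDiffOn_proj χ β).contMDiffAt ((σ.isOpen a).mem_nhds hx))).mdifferentiableAt (n := ∞) (by simp)
  have h3 : fderiv ℝ ((fun x ↦ (-2 : ℝ) • χ.proj a β x) ∘ z.symm) q
      = (-2 : ℝ) • fderiv ℝ (projCoord χ a z β) q :=
    fderiv_const_smul ((contDiffAt_projCoord χ hz hq hx β).differentiableAt (by simp)) (-2 : ℝ)
  rw [spinDeriv_eq, h1, deriv_eq_fderiv σ hz hq h2, h3]
  simp only [smul_apply, smul_add, mul_smul_comm, projCoord, connCoord]
  module

end Target

/-! ### Contraction of the curvature terms with the target metric -/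

section Contraction

variable {M : Type*} [TopologicalSpace M] [ChartedSpace ℂ M] [IsManifold 𝓘(ℝ, ℂ) ∞ M]
  {g : SurfaceMetric M} {ι : Type*}
  {n : ℕ} {N : Type*} [TopologicalSpace N] [ChartedSpace (EuclideanSpace ℝ (Fin n)) N]
  [IsManifold (𝓡 n) ∞ N]
  {σ : SpinStructure g ι} (h : TargetMetric n N) {φ : M → N} (ψ : VectorSpinor n σ φ)
  (χ : Gravitino σ) {a : ι} {y : OpenPartialHomeomorph N (EuclideanSpace ℝ (Fin n))}

lemma pairing_eq (x : M) (A B : Fin n → Quaternion ℝ) :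
    pairing h φ y x A B = hin (metricCoeff h y (y (φ x))) A B := rfl

lemma pushInner_eq (α β : Fin 2) (x : M) :
    pushInner σ h φ a y α β x = hin (metricCoeff h y (y (φ x))) (fun i ↦ push σ φ a y α i x)
      (fun i ↦ push σ φ a y β i x) := by
  simp only [pushInner, hin, RCLike.inner_apply, conj_trivial]
  exact Finset.sum_congr rfl fun _ _ ↦ Finset.sum_congr rfl fun _ _ ↦ by ring

/-- The metric lowers the free index of R. In the divergence computation SR(ψ) is used only through
this pairing. -/
lemma hin_curvSR (x : M) (X : Fin n → Quaternion ℝ) :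
    hin (metricCoeff h y (y (φ x))) (fun i ↦ curvSR σ h φ ψ a y i x) X
      = quart (riemannFn h y (y (φ x))) (fun i ↦ ψ.comp a y i x) (fun i ↦ ψ.comp a y i x)
        (fun i ↦ ψ.comp a y i x) X := by
  simp only [hin, quart, curvSR, gram, sum_inner, inner_smul_left, riemannFn, riemannLow,
    Finset.mul_sum, Finset.sum_mul, conj_trivial]
  rw [Finset.sum_comm]
  refine Finset.sum_congr rfl fun i _ ↦ ?_
  rw [← sum_comm_three]
  refine Finset.sum_congr rfl fun j _ ↦ Finset.sum_congr rfl fun k _ ↦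
    Finset.sum_congr rfl fun l _ ↦ Finset.sum_congr rfl fun m _ ↦ ?_
  rw [metricCoeff_symm h _ i m]
  ring

lemma curvRm_eq (x : M) : curvRm σ h φ ψ a y x
    = quart (riemannFn h y (y (φ x))) (fun i ↦ ψ.comp a y i x) (fun i ↦ ψ.comp a y i x)
        (fun i ↦ ψ.comp a y i x) (fun i ↦ ψ.comp a y i x) := hin_curvSR h ψ x _

lemma hin_real (H : Fin n → Fin n → ℝ) (v X : Fin n → ℝ) :
    hin H v X = ∑ i, v i * ∑ m, H i m * X m := by
  simp only [hin, RCLike.inner_apply, conj_trivial, Finset.mul_sum]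
  exact Finset.sum_congr rfl fun _ _ ↦ Finset.sum_congr rfl fun _ _ ↦ by ring

lemma hin_inner (H : Fin n → Fin n → ℝ) (v : Fin n → ℝ) (s : Quaternion ℝ)
    (A : Fin n → Quaternion ℝ) : hin H v (fun i ↦ inner ℝ s (A i)) = hin H (tens v s) A := by
  simp only [hin, tens, RCLike.inner_apply, conj_trivial, inner_smul_left]
  exact Finset.sum_congr rfl fun _ _ ↦ Finset.sum_congr rfl fun _ _ ↦ by ring

lemma hin_curvMixed (x : M) (v : Fin n → ℝ) :
    hin (metricCoeff h y (y (φ x))) v (fun i ↦ curvMixed σ h φ ψ a y i x)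
      = ∑ α, mixedForm h y (y (φ x)) v (fun i ↦ push σ φ a y α i x) (fun i ↦ ψ.comp a y i x)
        (cliff α • fun i ↦ ψ.comp a y i x) := by
  have e1 : ∀ i, ∑ m, metricCoeff h y (y (φ x)) i m * curvMixed σ h φ ψ a y m x
      = ∑ α, ∑ j, ∑ k, ∑ l, riemannLow h y i j k l (y (φ x)) *
        inner ℝ (ψ.comp a y k x) (cliff α * ψ.comp a y l x) * push σ φ a y α j x := by
    intro i
    simp only [curvMixed, Finset.mul_sum, riemannLow, Finset.sum_mul]
    rw [Finset.sum_comm]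
    refine Finset.sum_congr rfl fun α _ ↦ ?_
    rw [← sum_comm_three]
    simp only [mul_assoc]
  refine (hin_real _ _ _).trans ?_
  simp only [e1, mixedForm, Pi.smul_apply, smul_eq_mul, Finset.mul_sum]
  rw [Finset.sum_comm]
  refine Finset.sum_congr rfl fun α _ ↦ Finset.sum_congr rfl fun i _ ↦
    Finset.sum_congr rfl fun j _ ↦ Finset.sum_congr rfl fun k _ ↦
    Finset.sum_congr rfl fun l _ ↦ ?_
  ring

/-- The metric cancels the inverse metric in the gradient; what remains is ∇_v R, in the form
produced by `fderiv_quart`. -/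
lemma hin_curvSNablaR (hy : y ∈ IsManifold.maximalAtlas (𝓡 n) ∞ N) (x : M)
    (hxy : φ x ∈ y.source) (v : Fin n → ℝ) :
    hin (metricCoeff h y (y (φ x))) v (fun i ↦ curvSNablaR σ h φ ψ a y i x)
      = ∑ m, v m * quart (fun i j k l ↦ nablaRiemann h y m i j k l (y (φ x)))
          (fun i ↦ ψ.comp a y i x) (fun i ↦ ψ.comp a y i x) (fun i ↦ ψ.comp a y i x)
          (fun i ↦ ψ.comp a y i x) := by
  refine (hin_real _ _ _).trans (Finset.sum_congr rfl fun i _ ↦ congrArg _ ?_)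
  have h1 := Matrix.mul_nonsing_inv (metricCoeff h y (y (φ x)))
    (isUnit_det_metricCoeff h hy (y.map_source hxy))
  set X : Fin n → ℝ := fun m ↦ ∑ b, ∑ c, ∑ d, ∑ e, nablaRiemann h y m b c d e (y (φ x)) *
      gram σ φ ψ a y b d x * gram σ φ ψ a y c e x with hX
  have h2 : (metricCoeff h y (y (φ x))).mulVec ((metricCoeff h y (y (φ x)))⁻¹.mulVec X) = X := by
    rw [Matrix.mulVec_mulVec, h1, Matrix.one_mulVec]
  refine (congrFun h2 i).trans ?_
  simp only [hX, quart, gram]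
  refine Finset.sum_congr rfl fun b _ ↦ Finset.sum_congr rfl fun c _ ↦
    Finset.sum_congr rfl fun d _ ↦ Finset.sum_congr rfl fun e _ ↦ ?_
  rw [real_inner_comm (ψ.comp a y d x), real_inner_comm (ψ.comp a y c x)]
  ring

lemma hin_gravitinoTerm (H : Fin n → Fin n → ℝ) (v : Fin n → ℝ) (x : M) :
    hin H v (fun i ↦ gravitinoTerm σ h φ ψ χ a y i x)
      = hin H (tens v (σ.spinDeriv a 0 (twist σ χ a 0) x + σ.spinDeriv a 1 (twist σ χ a 1) x
          + σ.conn a 1 0 1 x • twist σ χ a 0 x - σ.conn a 0 0 1 x • twist σ χ a 1 x))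
          (fun i ↦ ψ.comp a y i x)
        + hin H (tens v (twist σ χ a 0 x)) (fun i ↦ covDeriv σ h φ ψ a y 0 i x)
        + hin H (tens v (twist σ χ a 1 x)) (fun i ↦ covDeriv σ h φ ψ a y 1 i x) := by
  have h1 : (fun i ↦ gravitinoTerm σ h φ ψ χ a y i x)
      = (fun i ↦ inner ℝ (σ.spinDeriv a 0 (twist σ χ a 0) x + σ.spinDeriv a 1 (twist σ χ a 1) x
          + σ.conn a 1 0 1 x • twist σ χ a 0 x - σ.conn a 0 0 1 x • twist σ χ a 1 x)
          (ψ.comp a y i x))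
        + (fun i ↦ inner ℝ (twist σ χ a 0 x) (covDeriv σ h φ ψ a y 0 i x))
        + (fun i ↦ inner ℝ (twist σ χ a 1 x) (covDeriv σ h φ ψ a y 1 i x)) := by
    ext1 i
    simp only [gravitinoTerm, Fin.sum_univ_two, conn_self, conn_swap σ 0 0 1, zero_smul,
      neg_smul, inner_add_left, inner_sub_left, inner_neg_left, inner_zero_left, Pi.add_apply]
    ring
  rw [h1, hin_add_right, hin_add_right, hin_inner, hin_inner, hin_inner]

end Contraction

/-! ### The components of T on shell -/

section CauchyRiemann

variable {M : Type*} [TopologicalSpace M] [ChartedSpace ℂ M] [IsManifold 𝓘(ℝ, ℂ) ∞ M]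
  {g : SurfaceMetric M} {ι : Type*}
  {n : ℕ} {N : Type*} [TopologicalSpace N] [ChartedSpace (EuclideanSpace ℝ (Fin n)) N]
  [IsManifold (𝓡 n) ∞ N]
  {σ : SpinStructure g ι} (h : TargetMetric n N) {φ : M → N} (ψ : VectorSpinor n σ φ)
  (χ : Gravitino σ) {a : ι} {y : OpenPartialHomeomorph N (EuclideanSpace ℝ (Fin n))}
  {z : OpenPartialHomeomorph M ℂ}

/-- The Euler-Lagrange equation of the gravitino at a point, paired with a spinor `s`. -/
def gravitinoEq (h : TargetMetric n N) (ψ : VectorSpinor n σ φ) (χ : Gravitino σ) (a : ι)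
    (y : OpenPartialHomeomorph N (EuclideanSpace ℝ (Fin n))) (x : M) (s : Quaternion ℝ) : ℝ :=
  hin (metricCoeff h y (y (φ x))) (tens (fun i ↦ push σ φ a y 0 i x) s) (fun i ↦ ψ.comp a y i x)
    + hin (metricCoeff h y (y (φ x))) (tens (fun i ↦ push σ φ a y 1 i x) (-(cliff 0 * cliff 1 * s)))
      (fun i ↦ ψ.comp a y i x)
    + inner ℝ (χ.proj a 0 x) s * hin (metricCoeff h y (y (φ x))) (fun i ↦ ψ.comp a y i x)
      (fun i ↦ ψ.comp a y i x)

section Pointwise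

variable {x : M}

/-- `⟨ψ, e_α · ∇_β ψ⟩`. -/
def kinetic (h : TargetMetric n N) (ψ : VectorSpinor n σ φ) (a : ι)
    (y : OpenPartialHomeomorph N (EuclideanSpace ℝ (Fin n))) (α β : Fin 2) (x : M) : ℝ :=
  hin (metricCoeff h y (y (φ x))) (fun i ↦ ψ.comp a y i x)
    (cliff α • fun i ↦ covDeriv σ h φ ψ a y β i x)

/-- `⟨κ_β ⊗ φ_* e_α, ψ⟩` for the components `κ` of `Qχ`. -/
def coupling (h : TargetMetric n N) (ψ : VectorSpinor n σ φ) (χ : Gravitino σ) (a : ι)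
    (y : OpenPartialHomeomorph N (EuclideanSpace ℝ (Fin n))) (α β : Fin 2) (x : M) : ℝ :=
  hin (metricCoeff h y (y (φ x))) (tens (fun i ↦ push σ φ a y α i x) (χ.proj a β x))
    (fun i ↦ ψ.comp a y i x)

lemma pairing_dirac : pairing h φ y x (fun i ↦ ψ.comp a y i x) (fun i ↦ dirac σ h φ ψ a y i x)
    = kinetic h ψ a y 0 0 x + kinetic h ψ a y 1 1 x := by
  have h1 : (fun i ↦ dirac σ h φ ψ a y i x) = (cliff 0 • fun i ↦ covDeriv σ h φ ψ a y 0 i x)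
      + cliff 1 • fun i ↦ covDeriv σ h φ ψ a y 1 i x := by
    ext1 i
    simp [dirac, Fin.sum_univ_two]
  rw [pairing_eq, h1]
  exact hin_add_right _ _ _ _

lemma pairing_pushProj :
    pairing h φ y x (fun i ↦ pushProj σ φ χ a y i x) (fun i ↦ ψ.comp a y i x)
      = coupling h ψ χ a y 0 0 x + coupling h ψ χ a y 1 1 x := by
  have h1 : (fun i ↦ pushProj σ φ χ a y i x)
      = tens (fun i ↦ push σ φ a y 0 i x) (χ.proj a 0 x)
        + tens (fun i ↦ push σ φ a y 1 i x) (χ.proj a 1 x) := by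
    ext1 i
    simp [pushProj, tens, Fin.sum_univ_two]
  rw [pairing_eq, h1]
  exact hin_add_left _ _ _ _

lemma emCoeff_eq (α β : Fin 2) :
    emCoeff σ h φ ψ χ a y α β x = 2 * pushInner σ h φ a y α β x
      + 1 / 2 * (kinetic h ψ a y α β x + kinetic h ψ a y β α x)
      - 2 * (coupling h ψ χ a y α β x + coupling h ψ χ a y β α x)
      + (if α = β then 1 else 0) *
        (-(pushInner σ h φ a y 0 0 x + pushInner σ h φ a y 1 1 x)
          - (kinetic h ψ a y 0 0 x + kinetic h ψ a y 1 1 x)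
          + 4 * (coupling h ψ χ a y 0 0 x + coupling h ψ χ a y 1 1 x)
          + χ.projSq a x * normSqSpinor σ h φ ψ a y x
          + 1 / 6 * curvRm σ h φ ψ a y x) := by
  have h1 : pairing h φ y x (fun i ↦ ψ.comp a y i x)
      (fun i ↦ cliff α * covDeriv σ h φ ψ a y β i x + cliff β * covDeriv σ h φ ψ a y α i x)
      = kinetic h ψ a y α β x + kinetic h ψ a y β α x := hin_add_right _ _ _ _
  have h2 : (fun i ↦ ∑ η, (push σ φ a y β i x • (cliff η * cliff α * χ.comp a η x)
        + push σ φ a y α i x • (cliff η * cliff β * χ.comp a η x)))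
      = (-2 : ℝ) • (tens (fun i ↦ push σ φ a y α i x) (χ.proj a β x)
        + tens (fun i ↦ push σ φ a y β i x) (χ.proj a α x)) := by
    ext1 i
    have h3 := twist_eq χ (a := a) α x
    have h4 := twist_eq χ (a := a) β x
    simp only [twist] at h3 h4
    rw [Finset.sum_add_distrib, ← Finset.smul_sum, ← Finset.smul_sum, h3, h4]
    simp only [tens, Pi.smul_apply, Pi.add_apply, smul_add, smul_comm (-2 : ℝ)]
    abel
  have h5 : pairing h φ y x (fun i ↦ ∑ η, (push σ φ a y β i x • (cliff η * cliff α * χ.comp a η x)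
        + push σ φ a y α i x • (cliff η * cliff β * χ.comp a η x))) (fun i ↦ ψ.comp a y i x)
      = -2 * (coupling h ψ χ a y α β x + coupling h ψ χ a y β α x) := by
    rw [pairing_eq, h2]
    refine (hin_smul_left _ _ _ _).trans (congrArg _ (hin_add_left _ _ _ _))
  rw [emCoeff, h1, h5, pairing_dirac, pairing_pushProj, Fin.sum_univ_two]
  ring

lemma emCoeff_comm (α β : Fin 2) :
    emCoeff σ h φ ψ χ a y α β x = emCoeff σ h φ ψ χ a y β α x := by
  have : pushInner σ h φ a y α β x = pushInner σ h φ a y β α x := by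
    rw [pushInner_eq, pushInner_eq]
    exact hin_comm _ _ (metricCoeff_symm h _)
  rw [emCoeff_eq, emCoeff_eq, this]
  simp only [eq_comm (a := α)]
  ring

variable (hy : y ∈ IsManifold.maximalAtlas (𝓡 n) ∞ N)
  (hEL : EulerLagrange σ h φ ψ χ) (hx : x ∈ σ.U a) (hxy : φ x ∈ y.source)
  (hcrit : ∀ s, gravitinoEq h ψ χ a y x s = 0)

include hy hEL hx hxy in
-- The Dirac equation for whole tuples, in the form expected by the algebraic lemmas.
lemma dirac_equation :
    (cliff 0 • fun i ↦ covDeriv σ h φ ψ a y 0 i x) + (cliff 1 • fun i ↦ covDeriv σ h φ ψ a y 1 i x)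
      = (inner ℝ (χ.proj a 0 x) (χ.proj a 0 x) + inner ℝ (χ.proj a 1 x) (χ.proj a 1 x) : ℝ) •
          (fun i ↦ ψ.comp a y i x) + (1 / 3 : ℝ) • (fun i ↦ curvSR σ h φ ψ a y i x)
        + (2 : ℝ) • (tens (fun i ↦ push σ φ a y 0 i x) (χ.proj a 0 x)
          + tens (fun i ↦ push σ φ a y 1 i x) (χ.proj a 1 x)) := by
  ext1 i
  have := (hEL a y hy x hx hxy i).2
  simp only [dirac, Gravitino.projSq, pushProj, Fin.sum_univ_two] at this
  exact this

include hcrit in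
lemma coupling_trace : coupling h ψ χ a y 0 0 x + coupling h ψ χ a y 1 1 x
    + inner ℝ (χ.proj a 0 x) (χ.proj a 0 x) * normSqSpinor σ h φ ψ a y x = 0 :=
  crit_trace (proj_one χ x) hcrit

include hcrit in
lemma coupling_comm : coupling h ψ χ a y 1 0 x = coupling h ψ χ a y 0 1 x :=
  crit_skew isCliffordPair_cliff (proj_one χ x) hcrit

lemma projSq_eq : χ.projSq a x = 2 * inner ℝ (χ.proj a 0 x) (χ.proj a 0 x) := by
  rw [Gravitino.projSq, Fin.sum_univ_two, inner_snd_eq isCliffordPair_cliff (proj_one χ x)]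
  ring

include hy hEL hx hxy in
lemma kinetic_trace : kinetic h ψ a y 0 0 x + kinetic h ψ a y 1 1 x
    = χ.projSq a x * normSqSpinor σ h φ ψ a y x + 1 / 3 * curvRm σ h φ ψ a y x
      + 2 * (coupling h ψ χ a y 0 0 x + coupling h ψ χ a y 1 1 x) := by
  rw [Gravitino.projSq, Fin.sum_univ_two, curvRm_eq]
  exact dirac_trace (metricCoeff_symm h _) (hin_curvSR h ψ x)
    (dirac_equation h ψ χ hy hEL hx hxy)

include hy hEL hx hxy hcrit in
lemma kinetic_comm : kinetic h ψ a y 1 0 x = kinetic h ψ a y 0 1 x :=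
  dirac_skew (metricCoeff_symm h _) (riemannLow_pair_symm h hy (y.map_source hxy))
    isCliffordPair_cliff (hin_curvSR h ψ x) (proj_one χ x) hcrit
    (dirac_equation h ψ χ hy hEL hx hxy)

include hy hEL hx hxy hcrit in
/-- The energy-momentum tensor is traceless. -/
lemma emCoeff_trace : emCoeff σ h φ ψ χ a y 1 1 x = -emCoeff σ h φ ψ χ a y 0 0 x := by
  have h1 := kinetic_trace h ψ χ hy hEL hx hxy
  have h2 := coupling_trace h ψ χ hcrit
  have h3 := projSq_eq χ (a := a) (x := x)
  rw [emCoeff_eq, emCoeff_eq]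
  simp only [if_true]
  rw [h3] at h1 ⊢
  -- The |dφ|² part is trace free by itself in dimension two. The Dirac equation removes Rm(ψ) from
  -- the trace, and the rest is twice the gravitino equation tested with κ₀.
  linear_combination -h1 + 2 * h2

end Pointwise

/-- The coefficient `T_αβ` in a chart. -/
def emCoord (h : TargetMetric n N) (ψ : VectorSpinor n σ φ) (χ : Gravitino σ) (a : ι)
    (y : OpenPartialHomeomorph N (EuclideanSpace ℝ (Fin n))) (z : OpenPartialHomeomorph M ℂ)
    (α β : Fin 2) (q : ℂ) : ℝ := emCoeff σ h φ ψ χ a y α β (z.symm q)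

lemma dirD_neg (Φ : ℂ → EuclideanSpace ℝ (Fin n)) (V : ℂ → ℂ) (j : Fin n) :
    dirD Φ (fun q ↦ -V q) j = fun q ↦ -dirD Φ V j q := by
  ext1 q
  simp [dirD]

lemma cov_neg {F : Type*} [NormedAddCommGroup F] [NormedSpace ℝ F]
    (Φ : ℂ → EuclideanSpace ℝ (Fin n)) (V : ℂ → ℂ)
    (b : Fin n → ℂ → F) (i : Fin n) (q : ℂ) :
    cov h y Φ (fun q ↦ -V q) b i q = -cov h y Φ V b i q := by
  simp only [cov, dirD_neg, map_neg, mul_neg, neg_smul, Finset.sum_neg_distrib, neg_add]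

lemma cov_neg_right {F : Type*} [NormedAddCommGroup F] [NormedSpace ℝ F]
    (Φ : ℂ → EuclideanSpace ℝ (Fin n)) (V : ℂ → ℂ)
    (b : Fin n → ℂ → F) (i : Fin n) (q : ℂ) :
    cov h y Φ V (fun i q ↦ -b i q) i q = -cov h y Φ V b i q := by
  simp only [cov, fderiv_fun_neg, neg_apply, smul_neg, Finset.sum_neg_distrib, neg_add]

lemma spinCov_neg (Φ : ℂ → EuclideanSpace ℝ (Fin n)) (om : Quaternion ℝ) (w : ℂ → ℝ) (V : ℂ → ℂ)
    (Ψ : Fin n → ℂ → Quaternion ℝ) (i : Fin n) (q : ℂ) :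
    spinCov h y Φ om (fun q ↦ -w q) (fun q ↦ -V q) Ψ i q = -spinCov h y Φ om w V Ψ i q := by
  simp only [spinCov, cov_neg, neg_div, neg_smul, neg_add]

lemma mixedForm_neg (u : EuclideanSpace ℝ (Fin n)) (v w : Fin n → ℝ) (b c : Fin n → Quaternion ℝ) :
    mixedForm h y u v (fun i ↦ -w i) b (-c) = mixedForm h y u v w b c := by
  simp [mixedForm]

variable (hφ : ContMDiff 𝓘(ℝ, ℂ) (𝓡 n) ∞ φ) (hy : y ∈ IsManifold.maximalAtlas (𝓡 n) ∞ N)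
  (hz : z ∈ IsManifold.maximalAtlas 𝓘(ℝ, ℂ) ∞ M) {q : ℂ}
  (hq : q ∈ z.target) (hx : z.symm q ∈ σ.U a) (hxy : φ (z.symm q) ∈ y.source)
include hφ hy hz hq hx hxy

/-- Valid off shell: the trace terms cancel the e₀ kinetic and coupling terms and leave those of e₁
with opposite sign. -/
lemma emFst_eq : emFst h y (mapCoord φ y z) (cliff 0) (cliff 1) (frameCoord σ a z 0)
      (frameCoord σ a z 1) (connCoord σ a z 1) (projCoord χ a z 0) (projCoord χ a z 1)
      (spinorCoord ψ a y z) q = emCoord h ψ χ a y z 0 0 q := by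
  rw [emCoord, emCoeff_eq]
  have e1 : emFst h y (mapCoord φ y z) (cliff 0) (cliff 1) (frameCoord σ a z 0)
      (frameCoord σ a z 1) (connCoord σ a z 1) (projCoord χ a z 0) (projCoord χ a z 1)
      (spinorCoord ψ a y z) q
      = pushInner σ h φ a y 0 0 (z.symm q) - pushInner σ h φ a y 1 1 (z.symm q)
        - kinetic h ψ a y 1 1 (z.symm q) + 4 * coupling h ψ χ a y 1 1 (z.symm q)
        + χ.projSq a (z.symm q) * normSqSpinor σ h φ ψ a y (z.symm q)
        + 1 / 6 * curvRm σ h φ ψ a y (z.symm q) := by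
    rw [pushInner_eq, pushInner_eq, curvRm_eq, Gravitino.projSq, Fin.sum_univ_two]
    simp only [kinetic, coupling, push_eq_dirD (σ := σ) (a := a) hφ hy hz hq hxy,
      covDeriv_eq h ψ hφ hy hz hq hx hxy]
    rfl
  rw [e1]
  simp only [if_true]
  ring

lemma emFst_rotate_eq : emFst h y (mapCoord φ y z) (cliff 1) (-cliff 0) (frameCoord σ a z 1)
      (fun q ↦ -frameCoord σ a z 0 q) (fun q ↦ -connCoord σ a z 0 q) (projCoord χ a z 1)
      (fun q ↦ -projCoord χ a z 0 q) (spinorCoord ψ a y z) q = emCoord h ψ χ a y z 1 1 q := by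
  rw [emCoord, emCoeff_eq]
  have hm : cliff 1 * -cliff 0 = cliff 0 * cliff 1 := by
    rw [mul_neg, isCliffordPair_cliff.anticomm, neg_neg]
  have e1 : emFst h y (mapCoord φ y z) (cliff 1) (-cliff 0) (frameCoord σ a z 1)
      (fun q ↦ -frameCoord σ a z 0 q) (fun q ↦ -connCoord σ a z 0 q) (projCoord χ a z 1)
      (fun q ↦ -projCoord χ a z 0 q) (spinorCoord ψ a y z) q
      = pushInner σ h φ a y 1 1 (z.symm q) - pushInner σ h φ a y 0 0 (z.symm q)
        - kinetic h ψ a y 0 0 (z.symm q) + 4 * coupling h ψ χ a y 0 0 (z.symm q)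
        + χ.projSq a (z.symm q) * normSqSpinor σ h φ ψ a y (z.symm q)
        + 1 / 6 * curvRm σ h φ ψ a y (z.symm q) := by
    rw [pushInner_eq, pushInner_eq, curvRm_eq, Gravitino.projSq, Fin.sum_univ_two,
      add_comm (inner ℝ (χ.proj a 0 (z.symm q)) (χ.proj a 0 (z.symm q)))]
    simp only [kinetic, coupling, push_eq_dirD (σ := σ) (a := a) hφ hy hz hq hxy,
      covDeriv_eq h ψ hφ hy hz hq hx hxy, emFst, dirD_neg, spinCov_neg, hm, neg_mul_neg,
      neg_smul_neg, inner_neg_neg, hin]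
    rfl
  rw [e1]
  simp only [if_true]
  ring

/-- By `kinetic_comm` and `coupling_comm` each symmetrised pair is twice one of its members. This
replacement requires the field equations. -/
lemma emSnd_eq (hcrit : ∀ s, gravitinoEq h ψ χ a y (z.symm q) s = 0)
    (hEL : EulerLagrange σ h φ ψ χ) :
    emSnd h y (mapCoord φ y z) (cliff 0) (cliff 1) (frameCoord σ a z 0)
      (frameCoord σ a z 1) (connCoord σ a z 0) (projCoord χ a z 1)
      (spinorCoord ψ a y z) q = emCoord h ψ χ a y z 0 1 q := by
  rw [emCoord, emCoeff_eq]
  have e1 : emSnd h y (mapCoord φ y z) (cliff 0) (cliff 1) (frameCoord σ a z 0)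
      (frameCoord σ a z 1) (connCoord σ a z 0) (projCoord χ a z 1) (spinorCoord ψ a y z) q
      = 2 * pushInner σ h φ a y 0 1 (z.symm q)
        + kinetic h ψ a y 1 0 (z.symm q) - 4 * coupling h ψ χ a y 0 1 (z.symm q) := by
    rw [pushInner_eq]
    simp only [kinetic, coupling, push_eq_dirD (σ := σ) (a := a) hφ hy hz hq hxy,
      covDeriv_eq h ψ hφ hy hz hq hx hxy]
    rfl
  rw [e1, kinetic_comm h ψ χ hy hEL hx hxy hcrit, coupling_comm h ψ χ hcrit]
  simp
  ring

lemma emSnd_rotate_eq (hcrit : ∀ s, gravitinoEq h ψ χ a y (z.symm q) s = 0)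
    (hEL : EulerLagrange σ h φ ψ χ) :
    emSnd h y (mapCoord φ y z) (cliff 1) (-cliff 0) (frameCoord σ a z 1)
      (fun q ↦ -frameCoord σ a z 0 q) (connCoord σ a z 1)
      (fun q ↦ -projCoord χ a z 0 q) (spinorCoord ψ a y z) q = -emCoord h ψ χ a y z 0 1 q := by
  rw [emCoord, emCoeff_eq]
  have hm : cliff 1 * -cliff 0 = cliff 0 * cliff 1 := by
    rw [mul_neg, isCliffordPair_cliff.anticomm, neg_neg]
  have e1 : emSnd h y (mapCoord φ y z) (cliff 1) (-cliff 0) (frameCoord σ a z 1)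
      (fun q ↦ -frameCoord σ a z 0 q) (connCoord σ a z 1)
      (fun q ↦ -projCoord χ a z 0 q) (spinorCoord ψ a y z) q
      = -(2 * pushInner σ h φ a y 1 0 (z.symm q)
        + kinetic h ψ a y 0 1 (z.symm q) - 4 * coupling h ψ χ a y 1 0 (z.symm q)) := by
    rw [pushInner_eq]
    simp only [kinetic, coupling, push_eq_dirD (σ := σ) (a := a) hφ hy hz hq hxy,
      covDeriv_eq h ψ hφ hy hz hq hx hxy, emSnd, dirD_neg, hm, neg_mul, smul_neg, inner_neg_left,
      inner_neg_right, mul_neg, hin, Finset.sum_neg_distrib]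
    simp only [tens, mapCoord, spinorCoord, projCoord, Pi.smul_apply, smul_eq_mul]
    ring
  have e2 : pushInner σ h φ a y 1 0 (z.symm q) = pushInner σ h φ a y 0 1 (z.symm q) := by
    rw [pushInner_eq, pushInner_eq]
    exact hin_comm _ _ (metricCoeff_symm h _)
  rw [e1, e2, kinetic_comm h ψ χ hy hEL hx hxy hcrit, coupling_comm h ψ χ hcrit]
  simp
  ring

/-- The vector v is left free, as the equation is needed along φ_*e₀ and, for the rotated frame,
along φ_*e₁. -/
lemma hin_tension (hEL : EulerLagrange σ h φ ψ χ) (v : Fin n → ℝ) :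
    hin (metricCoeff h y (mapCoord φ y z q)) v (fun i ↦ tension σ h φ a y i (z.symm q))
      = 1 / 2 * (mixedForm h y (mapCoord φ y z q) v (fun i ↦ dirD (mapCoord φ y z) (frameCoord σ a z 0) i q)
            (fun i ↦ spinorCoord ψ a y z i q) (cliff 0 • fun i ↦ spinorCoord ψ a y z i q)
          + mixedForm h y (mapCoord φ y z q) v (fun i ↦ dirD (mapCoord φ y z) (frameCoord σ a z 1) i q)
            (fun i ↦ spinorCoord ψ a y z i q) (cliff 1 • fun i ↦ spinorCoord ψ a y z i q))
        - 1 / 12 * ∑ m, v m * quart (fun i j k l ↦ nablaRiemann h y m i j k l (mapCoord φ y z q))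
          (fun i ↦ spinorCoord ψ a y z i q) (fun i ↦ spinorCoord ψ a y z i q)
          (fun i ↦ spinorCoord ψ a y z i q) (fun i ↦ spinorCoord ψ a y z i q)
        + 2 * (hin (metricCoeff h y (mapCoord φ y z q)) (tens v
              ((fderiv ℝ (projCoord χ a z 0) q (frameCoord σ a z 0 q)
                  + (connCoord σ a z 0 q / 2) • (cliff 0 * cliff 1 * projCoord χ a z 0 q))
                + (fderiv ℝ (projCoord χ a z 1) q (frameCoord σ a z 1 q)
                  + (connCoord σ a z 1 q / 2) • (cliff 0 * cliff 1 * projCoord χ a z 1 q))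
                + connCoord σ a z 1 q • projCoord χ a z 0 q
                - connCoord σ a z 0 q • projCoord χ a z 1 q)) (fun i ↦ spinorCoord ψ a y z i q)
          + hin (metricCoeff h y (mapCoord φ y z q)) (tens v (projCoord χ a z 0 q))
            (fun i ↦ spinCov h y (mapCoord φ y z) (cliff 0 * cliff 1) (connCoord σ a z 0)
              (frameCoord σ a z 0) (spinorCoord ψ a y z) i q)
          + hin (metricCoeff h y (mapCoord φ y z q)) (tens v (projCoord χ a z 1 q))
            (fun i ↦ spinCov h y (mapCoord φ y z) (cliff 0 * cliff 1) (connCoord σ a z 1)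
              (frameCoord σ a z 1) (spinorCoord ψ a y z) i q)) := by
  have h1 : (fun i ↦ tension σ h φ a y i (z.symm q))
      = (1 / 2 : ℝ) • (fun i ↦ curvMixed σ h φ ψ a y i (z.symm q))
        - (1 / 12 : ℝ) • (fun i ↦ curvSNablaR σ h φ ψ a y i (z.symm q))
        - fun i ↦ gravitinoTerm σ h φ ψ χ a y i (z.symm q) :=
    funext fun i ↦ (hEL a y hy _ hx hxy i).1
  have h2 := hin_curvMixed h ψ (a := a) (y := y) (z.symm q) v
  have h3 := hin_curvSNablaR h ψ (a := a) hy (z.symm q) hxy v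
  rw [Fin.sum_univ_two] at h2
  simp only [push_eq_dirD (σ := σ) (a := a) hφ hy hz hq hxy] at h2
  have h4 : ∀ H : Fin n → Fin n → ℝ, hin H v (fun i ↦ tension σ h φ a y i (z.symm q))
      = 1 / 2 * hin H v (fun i ↦ curvMixed σ h φ ψ a y i (z.symm q))
        - 1 / 12 * hin H v (fun i ↦ curvSNablaR σ h φ ψ a y i (z.symm q))
        + 2 * (hin H (tens v
              ((fderiv ℝ (projCoord χ a z 0) q (frameCoord σ a z 0 q)
                  + (connCoord σ a z 0 q / 2) • (cliff 0 * cliff 1 * projCoord χ a z 0 q))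
                + (fderiv ℝ (projCoord χ a z 1) q (frameCoord σ a z 1 q)
                  + (connCoord σ a z 1 q / 2) • (cliff 0 * cliff 1 * projCoord χ a z 1 q))
                + connCoord σ a z 1 q • projCoord χ a z 0 q
                - connCoord σ a z 0 q • projCoord χ a z 1 q)) (fun i ↦ spinorCoord ψ a y z i q)
          + hin H (tens v (projCoord χ a z 0 q))
            (fun i ↦ spinCov h y (mapCoord φ y z) (cliff 0 * cliff 1) (connCoord σ a z 0)
              (frameCoord σ a z 0) (spinorCoord ψ a y z) i q)
          + hin H (tens v (projCoord χ a z 1 q))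
            (fun i ↦ spinCov h y (mapCoord φ y z) (cliff 0 * cliff 1) (connCoord σ a z 1)
              (frameCoord σ a z 1) (spinorCoord ψ a y z) i q)) := by
    intro H
    have h5 : ∀ D₀ D₁ k₀ k₁ : Quaternion ℝ, ∀ w₀ w₁ : ℝ, (-2 : ℝ) • D₀ + (-2 : ℝ) • D₁
        + w₁ • (-2 : ℝ) • k₀ - w₀ • (-2 : ℝ) • k₁ = (-2 : ℝ) • (D₀ + D₁ + w₁ • k₀ - w₀ • k₁) := by
      intro D₀ D₁ k₀ k₁ w₀ w₁
      module
    rw [h1, hin_sub_right, hin_sub_right, hin_smul_right, hin_smul_right, hin_gravitinoTerm,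
      spinDeriv_twist χ hz hq hx, spinDeriv_twist χ hz hq hx, twist_eq, twist_eq, h5, tens_smul,
      tens_smul, tens_smul, hin_smul_left, hin_smul_left, hin_smul_left]
    simp only [covDeriv_eq h ψ hφ hy hz hq hx hxy, spinorCoord, connCoord, projCoord]
    ring
  refine (h4 _).trans (congrArg (· + _) ?_)
  exact congrArg₂ (fun s t : ℝ ↦ 1 / 2 * s - 1 / 12 * t) h2 h3

end CauchyRiemann

/-! ### Both components of the conservation law -/

section CauchyRiemann

variable {M : Type*} [TopologicalSpace M] [ChartedSpace ℂ M] [IsManifold 𝓘(ℝ, ℂ) ∞ M]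
  {g : SurfaceMetric M} {ι : Type*}
  {n : ℕ} {N : Type*} [TopologicalSpace N] [ChartedSpace (EuclideanSpace ℝ (Fin n)) N]
  [IsManifold (𝓡 n) ∞ N]
  {σ : SpinStructure g ι} (h : TargetMetric n N) {φ : M → N} (ψ : VectorSpinor n σ φ)
  (χ : Gravitino σ) {a : ι} {y : OpenPartialHomeomorph N (EuclideanSpace ℝ (Fin n))}
  {z : OpenPartialHomeomorph M ℂ}

lemma contDiffAt_emFst {Φ : ℂ → EuclideanSpace ℝ (Fin n)} {p : ℂ} {e f : Quaternion ℝ}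
    {V₀ V₁ : ℂ → ℂ} {w₁ : ℂ → ℝ} {κ₀ κ₁ : ℂ → Quaternion ℝ} {Ψ : Fin n → ℂ → Quaternion ℝ}
    (hy : y ∈ IsManifold.maximalAtlas (𝓡 n) ∞ N)
    (hp : Φ p ∈ y.target) (hΦ : ContDiffAt ℝ ∞ Φ p)
    (hV₀ : ContDiffAt ℝ ∞ V₀ p) (hV₁ : ContDiffAt ℝ ∞ V₁ p)
    (hw₁ : ContDiffAt ℝ ∞ w₁ p) (hκ₀ : ContDiffAt ℝ ∞ κ₀ p) (hκ₁ : ContDiffAt ℝ ∞ κ₁ p)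
    (hΨ : ∀ i, ContDiffAt ℝ ∞ (Ψ i) p) :
    ContDiffAt ℝ ∞ (emFst h y Φ e f V₀ V₁ w₁ κ₀ κ₁ Ψ) p := by
  have hdφ₀ := contDiffAt_dirD hΦ hV₀
  have hdφ₁ := contDiffAt_dirD hΦ hV₁
  have hsc : ∀ i, ContDiffAt ℝ ∞ (fun q ↦ f * spinCov h y Φ (e * f) w₁ V₁ Ψ i q) p := fun i ↦
    contDiffAt_const.mul ((contDiffAt_cov h hy hΦ hp hV₁ hΨ i).add
      ((hw₁.div_const 2).smul (contDiffAt_const.mul (hΨ i))))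
  exact (((((contDiffAt_hin (h := h) hy hΦ hp hdφ₀ hdφ₀).sub
    (contDiffAt_hin (h := h) hy hΦ hp hdφ₁ hdφ₁)).sub
    (contDiffAt_hin (h := h) hy hΦ hp hΨ hsc)).add
    (contDiffAt_const.mul (contDiffAt_hin (h := h) hy hΦ hp
      (fun i ↦ (hdφ₁ i).smul hκ₁) hΨ))).add
    (((hκ₀.inner ℝ hκ₀).add (hκ₁.inner ℝ hκ₁)).mul (contDiffAt_hin (h := h) hy hΦ hp hΨ hΨ))).add
    (contDiffAt_const.mul (contDiffAt_quart (h := h) hy hΦ hp hΨ))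

lemma contDiffAt_emSnd {Φ : ℂ → EuclideanSpace ℝ (Fin n)} {p : ℂ} {e f : Quaternion ℝ}
    {V₀ V₁ : ℂ → ℂ} {w₀ : ℂ → ℝ} {κ₁ : ℂ → Quaternion ℝ} {Ψ : Fin n → ℂ → Quaternion ℝ}
    (hy : y ∈ IsManifold.maximalAtlas (𝓡 n) ∞ N)
    (hp : Φ p ∈ y.target) (hΦ : ContDiffAt ℝ ∞ Φ p)
    (hV₀ : ContDiffAt ℝ ∞ V₀ p) (hV₁ : ContDiffAt ℝ ∞ V₁ p)
    (hw₀ : ContDiffAt ℝ ∞ w₀ p) (hκ₁ : ContDiffAt ℝ ∞ κ₁ p)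
    (hΨ : ∀ i, ContDiffAt ℝ ∞ (Ψ i) p) :
    ContDiffAt ℝ ∞ (emSnd h y Φ e f V₀ V₁ w₀ κ₁ Ψ) p := by
  have hdφ₀ := contDiffAt_dirD hΦ hV₀
  have hdφ₁ := contDiffAt_dirD hΦ hV₁
  have hsc : ∀ i, ContDiffAt ℝ ∞ (fun q ↦ f * spinCov h y Φ (e * f) w₀ V₀ Ψ i q) p := fun i ↦
    contDiffAt_const.mul ((contDiffAt_cov h hy hΦ hp hV₀ hΨ i).add
      ((hw₀.div_const 2).smul (contDiffAt_const.mul (hΨ i))))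
  exact ((contDiffAt_const.mul (contDiffAt_hin (h := h) hy hΦ hp hdφ₀ hdφ₁)).add
    (contDiffAt_hin (h := h) hy hΦ hp hΨ hsc)).sub
    (contDiffAt_const.mul (contDiffAt_hin (h := h) hy hΦ hp
      (fun i ↦ (hdφ₀ i).smul hκ₁) hΨ))

variable (hφ : ContMDiff 𝓘(ℝ, ℂ) (𝓡 n) ∞ φ) (hy : y ∈ IsManifold.maximalAtlas (𝓡 n) ∞ N)
  (hz : z ∈ IsManifold.maximalAtlas 𝓘(ℝ, ℂ) ∞ M) {q : ℂ}
  (hEL : EulerLagrange σ h φ ψ χ)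
  (hcrit : ∀ x ∈ σ.U a, φ x ∈ y.source → ∀ s, gravitinoEq h ψ χ a y x s = 0)
  (hq : q ∈ z.target) (hx : z.symm q ∈ σ.U a) (hxy : φ (z.symm q) ∈ y.source)
include hφ hy hz hEL hcrit hq hx hxy

/-- The energy-momentum tensor is divergence free. -/
theorem div_emCoord :
    fderiv ℝ (emCoord h ψ χ a y z 0 0) q (frameCoord σ a z 0 q)
      + fderiv ℝ (emCoord h ψ χ a y z 0 1) q (frameCoord σ a z 1 q)
      + 2 * connCoord σ a z 1 q * emCoord h ψ χ a y z 0 0 q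
      - 2 * connCoord σ a z 0 q * emCoord h ψ χ a y z 0 1 q = 0 := by
  have hev := eventually_nhds_chart (σ := σ) (a := a) hφ hy hz hq hx hxy
  -- The identifications are made on a neighbourhood of q, since both sides are differentiated.
  have hF : emFst h y (mapCoord φ y z) (cliff 0) (cliff 1) (frameCoord σ a z 0)
      (frameCoord σ a z 1) (connCoord σ a z 1) (projCoord χ a z 0) (projCoord χ a z 1)
      (spinorCoord ψ a y z) =ᶠ[nhds q] emCoord h ψ χ a y z 0 0 := by
    filter_upwards [hev] with p hp
    exact emFst_eq h ψ χ hφ hy hz hp.1 hp.2.1 hp.2.2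
  have hS : emSnd h y (mapCoord φ y z) (cliff 0) (cliff 1) (frameCoord σ a z 0)
      (frameCoord σ a z 1) (connCoord σ a z 0) (projCoord χ a z 1)
      (spinorCoord ψ a y z) =ᶠ[nhds q] emCoord h ψ χ a y z 0 1 := by
    filter_upwards [hev] with p hp
    exact emSnd_eq h ψ χ hφ hy hz hp.1 hp.2.1 hp.2.2 (hcrit _ hp.2.1 hp.2.2) hEL
  have key := divergence_eq_zero (h := h) (Φ := mapCoord φ y z) (e := cliff 0) (f := cliff 1)
    (V₀ := frameCoord σ a z 0) (V₁ := frameCoord σ a z 1) (w₀ := connCoord σ a z 0)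
    (w₁ := connCoord σ a z 1) (κ₀ := projCoord χ a z 0) (κ₁ := projCoord χ a z 1)
    (Ψ := spinorCoord ψ a y z) (SR := fun i ↦ curvSR σ h φ ψ a y i (z.symm q)) (p := q)
    hy isCliffordPair_cliff (y.map_source hxy) (contDiffAt_mapCoord hφ hy hz hq hxy)
    (contDiffAt_frameCoord σ hz hq hx 0) (contDiffAt_frameCoord σ hz hq hx 1)
    (contDiffAt_connCoord σ hz hq hx 0) (contDiffAt_connCoord σ hz hq hx 1)
    (contDiffAt_projCoord χ hz hq hx 0) (contDiffAt_projCoord χ hz hq hx 1)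
    (contDiffAt_spinorCoord ψ hφ hy hz hq hx hxy) (lieBracket_frameCoord σ hz hq hx)
    (Filter.Eventually.of_forall fun q ↦ proj_one χ _)
    (by
      intro s
      have := hcrit _ hx hxy s
      simp only [gravitinoEq, push_eq_dirD (σ := σ) (a := a) hφ hy hz hq hxy] at this
      exact this)
    (hin_curvSR h ψ _)
    (by
      have := dirac_equation h ψ χ hy hEL hx hxy
      simp only [covDeriv_eq h ψ hφ hy hz hq hx hxy,
        push_eq_dirD (σ := σ) (a := a) hφ hy hz hq hxy] at this
      exact this)
    (by
      have := hin_tension h ψ χ hφ hy hz hq hx hxy hEL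
        (fun i ↦ dirD (mapCoord φ y z) (frameCoord σ a z 0) i q)
      simp only [tension_eq h (σ := σ) (a := a) hφ hy hz hq hx hxy] at this
      exact this)
  rwa [hF.fderiv_eq, hS.fderiv_eq, hF.self_of_nhds, hS.self_of_nhds] at key

lemma contDiffAt_emCoord :
    ContDiffAt ℝ ∞ (emCoord h ψ χ a y z 0 0) q ∧ ContDiffAt ℝ ∞ (emCoord h ψ χ a y z 0 1) q := by
  have hev := eventually_nhds_chart (σ := σ) (a := a) hφ hy hz hq hx hxy
  constructor
  · refine (contDiffAt_emFst h (Φ := mapCoord φ y z) (e := cliff 0) (f := cliff 1)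
      hy (y.map_source hxy) (contDiffAt_mapCoord hφ hy hz hq hxy)
      (contDiffAt_frameCoord σ hz hq hx 0) (contDiffAt_frameCoord σ hz hq hx 1)
      (contDiffAt_connCoord σ hz hq hx 1)
      (contDiffAt_projCoord χ hz hq hx 0) (contDiffAt_projCoord χ hz hq hx 1)
      (contDiffAt_spinorCoord ψ hφ hy hz hq hx hxy)).congr_of_eventuallyEq ?_
    filter_upwards [hev] with p hp
    exact (emFst_eq h ψ χ hφ hy hz hp.1 hp.2.1 hp.2.2).symm
  · refine (contDiffAt_emSnd h (Φ := mapCoord φ y z) (e := cliff 0) (f := cliff 1)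
      hy (y.map_source hxy) (contDiffAt_mapCoord hφ hy hz hq hxy)
      (contDiffAt_frameCoord σ hz hq hx 0) (contDiffAt_frameCoord σ hz hq hx 1)
      (contDiffAt_connCoord σ hz hq hx 0) (contDiffAt_projCoord χ hz hq hx 1)
      (contDiffAt_spinorCoord ψ hφ hy hz hq hx hxy)).congr_of_eventuallyEq ?_
    filter_upwards [hev] with p hp
    exact (emSnd_eq h ψ χ hφ hy hz hp.1 hp.2.1 hp.2.2 (hcrit _ hp.2.1 hp.2.2) hEL).symm

/-- `divergence_eq_zero` for the frame (e₁, -e₀): the connection form does not change under a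
constant rotation, so its coefficients become (w₁, -w₀). The new first component T₁₁ is -T₀₀ by
tracelessness, the new off-diagonal one is -T₀₁. -/
theorem div_emCoord_rotate :
    fderiv ℝ (emCoord h ψ χ a y z 0 0) q (frameCoord σ a z 1 q)
      - fderiv ℝ (emCoord h ψ χ a y z 0 1) q (frameCoord σ a z 0 q)
      - 2 * connCoord σ a z 0 q * emCoord h ψ χ a y z 0 0 q
      - 2 * connCoord σ a z 1 q * emCoord h ψ χ a y z 0 1 q = 0 := by
  have hev := eventually_nhds_chart (σ := σ) (a := a) hφ hy hz hq hx hxy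
  have hm : cliff 1 * -cliff 0 = cliff 0 * cliff 1 := by
    rw [mul_neg, isCliffordPair_cliff.anticomm, neg_neg]
  have hF : emFst h y (mapCoord φ y z) (cliff 1) (-cliff 0) (frameCoord σ a z 1)
      (fun q ↦ -frameCoord σ a z 0 q) (fun q ↦ -connCoord σ a z 0 q) (projCoord χ a z 1)
      (fun q ↦ -projCoord χ a z 0 q) (spinorCoord ψ a y z)
      =ᶠ[nhds q] fun q ↦ -emCoord h ψ χ a y z 0 0 q := by
    filter_upwards [hev] with p hp
    rw [emFst_rotate_eq h ψ χ hφ hy hz hp.1 hp.2.1 hp.2.2]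
    exact emCoeff_trace h ψ χ hy hEL hp.2.1 hp.2.2 (hcrit _ hp.2.1 hp.2.2)
  have hS : emSnd h y (mapCoord φ y z) (cliff 1) (-cliff 0) (frameCoord σ a z 1)
      (fun q ↦ -frameCoord σ a z 0 q) (connCoord σ a z 1)
      (fun q ↦ -projCoord χ a z 0 q) (spinorCoord ψ a y z)
      =ᶠ[nhds q] fun q ↦ -emCoord h ψ χ a y z 0 1 q := by
    filter_upwards [hev] with p hp
    exact emSnd_rotate_eq h ψ χ hφ hy hz hp.1 hp.2.1 hp.2.2 (hcrit _ hp.2.1 hp.2.2) hEL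
  have key := divergence_eq_zero (h := h) (Φ := mapCoord φ y z) (e := cliff 1) (f := -cliff 0)
    (V₀ := frameCoord σ a z 1) (V₁ := fun q ↦ -frameCoord σ a z 0 q) (w₀ := connCoord σ a z 1)
    (w₁ := fun q ↦ -connCoord σ a z 0 q) (κ₀ := projCoord χ a z 1)
    (κ₁ := fun q ↦ -projCoord χ a z 0 q)
    (Ψ := spinorCoord ψ a y z) (SR := fun i ↦ curvSR σ h φ ψ a y i (z.symm q)) (p := q)
    hy isCliffordPair_cliff.rotate (y.map_source hxy) (contDiffAt_mapCoord hφ hy hz hq hxy)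
    (contDiffAt_frameCoord σ hz hq hx 1) (contDiffAt_frameCoord σ hz hq hx 0).neg
    (contDiffAt_connCoord σ hz hq hx 1) (contDiffAt_connCoord σ hz hq hx 0).neg
    (contDiffAt_projCoord χ hz hq hx 1) (contDiffAt_projCoord χ hz hq hx 0).neg
    (contDiffAt_spinorCoord ψ hφ hy hz hq hx hxy)
    (by
      have h1 := lieBracket_frameCoord σ hz hq hx
      have h2 : VectorField.lieBracket ℝ (frameCoord σ a z 1) (fun q ↦ -frameCoord σ a z 0 q) q
          = VectorField.lieBracket ℝ (frameCoord σ a z 0) (frameCoord σ a z 1) q := by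
        simp only [VectorField.lieBracket_eq, fderiv_fun_neg, neg_apply, map_neg]
        abel
      rw [h2, h1]
      module)
    (Filter.Eventually.of_forall fun q ↦ by
      rw [hm]
      have h1 := proj_one χ (a := a) (z.symm q)
      have h2 : cliff 0 * cliff 1 * projCoord χ a z 1 q = projCoord χ a z 0 q := by
        rw [projCoord, h1, mul_neg, ← mul_assoc, omega_sq isCliffordPair_cliff, neg_one_mul,
          neg_neg]
        rfl
      rw [h2])
    (by
      intro s
      -- The gravitino equation of the rotated frame at s is the original one at ωs.
      have h1 := hcrit _ hx hxy (cliff 0 * cliff 1 * s)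
      have h2 : inner ℝ (χ.proj a 0 (z.symm q)) (cliff 0 * cliff 1 * s)
          = inner ℝ (projCoord χ a z 1 q) s := by
        have := inner_mul_left_of_re_eq_zero isCliffordPair_cliff.re_mul (χ.proj a 0 (z.symm q)) s
        rw [projCoord, proj_one, inner_neg_left]
        linarith
      have h3 : cliff 0 * cliff 1 * (cliff 0 * cliff 1 * s) = -s := by
        rw [← mul_assoc, omega_sq isCliffordPair_cliff, neg_one_mul]
      have h4 : ∀ v : Fin n → ℝ, tens (fun i ↦ -v i) (-(cliff 0 * cliff 1 * s))
          = tens v (cliff 0 * cliff 1 * s) := fun v ↦ by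
        ext1 i
        simp [tens]
      simp only [gravitinoEq, push_eq_dirD (σ := σ) (a := a) hφ hy hz hq hxy, h2, h3,
        neg_neg] at h1
      rw [hm]
      simp only [dirD_neg, h4]
      rw [← h1]
      exact congrArg (· + _) (add_comm _ _))
    (hin_curvSR h ψ _)
    (by
      have h1 := dirac_equation h ψ χ hy hEL hx hxy
      simp only [covDeriv_eq h ψ hφ hy hz hq hx hxy,
        push_eq_dirD (σ := σ) (a := a) hφ hy hz hq hxy] at h1
      have h4 : ∀ (v : Fin n → ℝ) (s : Quaternion ℝ), tens (fun i ↦ -v i) (-s)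
          = tens v s := fun v s ↦ by
        ext1 i
        simp [tens]
      have h5 : ∀ X : Fin n → Quaternion ℝ, (-cliff 0) • (fun i ↦ -X i) = cliff 0 • X := fun X ↦ by
        ext1 i
        simp
      rw [hm]
      simp only [spinCov_neg, dirD_neg, h4, h5, inner_neg_neg]
      rw [add_comm, add_comm (inner ℝ (projCoord χ a z 1 q) _),
        add_comm (tens _ (projCoord χ a z 1 q))]
      exact h1)
    (by
      have h1 := hin_tension h ψ χ hφ hy hz hq hx hxy hEL
        (fun i ↦ dirD (mapCoord φ y z) (frameCoord σ a z 1) i q)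
      simp only [tension_eq h (σ := σ) (a := a) hφ hy hz hq hx hxy] at h1
      have h6 : fderiv ℝ (fun q ↦ -projCoord χ a z 0 q) q (-frameCoord σ a z 0 q)
          = fderiv ℝ (projCoord χ a z 0) q (frameCoord σ a z 0 q) := by
        rw [fderiv_fun_neg, neg_apply, map_neg, neg_neg]
      have e1 : (fun i ↦ cov h y (mapCoord φ y z) (frameCoord σ a z 1)
            (dirD (mapCoord φ y z) (frameCoord σ a z 1)) i q
          + cov h y (mapCoord φ y z) (fun q ↦ -frameCoord σ a z 0 q)
            (dirD (mapCoord φ y z) (fun q ↦ -frameCoord σ a z 0 q)) i q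
          - connCoord σ a z 1 q * dirD (mapCoord φ y z) (fun q ↦ -frameCoord σ a z 0 q) i q
          + -connCoord σ a z 0 q * dirD (mapCoord φ y z) (frameCoord σ a z 1) i q)
          = fun i ↦ cov h y (mapCoord φ y z) (frameCoord σ a z 0)
            (dirD (mapCoord φ y z) (frameCoord σ a z 0)) i q
          + cov h y (mapCoord φ y z) (frameCoord σ a z 1)
            (dirD (mapCoord φ y z) (frameCoord σ a z 1)) i q
          - connCoord σ a z 0 q * dirD (mapCoord φ y z) (frameCoord σ a z 1) i q
          + connCoord σ a z 1 q * dirD (mapCoord φ y z) (frameCoord σ a z 0) i q := by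
        ext1 i
        have h7 : dirD (mapCoord φ y z) (fun q ↦ -frameCoord σ a z 0 q)
            = fun i q ↦ -dirD (mapCoord φ y z) (frameCoord σ a z 0) i q :=
          funext fun i ↦ dirD_neg _ _ i
        rw [cov_neg, h7, cov_neg_right]
        ring
      have e3 : fderiv ℝ (projCoord χ a z 1) q (frameCoord σ a z 1 q)
          + (connCoord σ a z 1 q / 2) • (cliff 0 * cliff 1 * projCoord χ a z 1 q)
          + (fderiv ℝ (projCoord χ a z 0) q (frameCoord σ a z 0 q)
            + (-connCoord σ a z 0 q / 2) • (cliff 0 * cliff 1 * -projCoord χ a z 0 q))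
          + -connCoord σ a z 0 q • projCoord χ a z 1 q
          - connCoord σ a z 1 q • -projCoord χ a z 0 q
          = fderiv ℝ (projCoord χ a z 0) q (frameCoord σ a z 0 q)
            + (connCoord σ a z 0 q / 2) • (cliff 0 * cliff 1 * projCoord χ a z 0 q)
          + (fderiv ℝ (projCoord χ a z 1) q (frameCoord σ a z 1 q)
            + (connCoord σ a z 1 q / 2) • (cliff 0 * cliff 1 * projCoord χ a z 1 q))
          + connCoord σ a z 1 q • projCoord χ a z 0 q
          - connCoord σ a z 0 q • projCoord χ a z 1 q := by
        rw [mul_neg]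
        module
      have e4 : ∀ (H : Fin n → Fin n → ℝ) (v : Fin n → ℝ) (s : Quaternion ℝ)
          (X : Fin n → Quaternion ℝ), hin H (tens v (-s)) (fun i ↦ -X i) = hin H (tens v s) X := by
        intro H v s X
        rw [tens_neg, hin_neg_left, show (fun i ↦ -X i) = -X from rfl, hin_neg_right, neg_neg]
      have e5 : ∀ X : Fin n → Quaternion ℝ, (-cliff 0) • X = -(cliff 0 • X) := neg_smul _
      rw [hm, h6]
      simp only [e1, e3, spinCov_neg]
      rw [h1]
      simp only [dirD_neg, e5, mixedForm_neg]
      linear_combination -2 * e4 (metricCoeff h y (mapCoord φ y z q))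
        (fun i ↦ dirD (mapCoord φ y z) (frameCoord σ a z 1) i q) (projCoord χ a z 0 q)
        (fun i ↦ spinCov h y (mapCoord φ y z) (cliff 0 * cliff 1) (connCoord σ a z 0)
          (frameCoord σ a z 0) (spinorCoord ψ a y z) i q))
  rw [hF.fderiv_eq, hS.fderiv_eq, hF.self_of_nhds, hS.self_of_nhds, fderiv_fun_neg,
    fderiv_fun_neg] at key
  simp only [neg_apply, map_neg] at key
  linarith

end CauchyRiemann

/-! ### The kinetic term without connection coefficients -/

section KineticAlgebra

variable {n : ℕ}

lemma inner_mul_left_star (q a b : Quaternion ℝ) : inner ℝ (q * a) b = inner ℝ a (star q * b) := by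
  simp only [quat_inner, Quaternion.re_mul, Quaternion.imI_mul, Quaternion.imJ_mul,
    Quaternion.imK_mul, Quaternion.re_star, Quaternion.imI_star, Quaternion.imJ_star,
    Quaternion.imK_star]
  ring

/-- The form `⟨ψ, X ∇ψ⟩` for an imaginary `X`, written without Christoffel symbols. -/
def kinExpr (H : Fin n → Fin n → ℝ) (dH : Fin n → Fin n → Fin n → ℝ) (ψ dψ : Fin n → Quaternion ℝ)
    (p : Fin n → ℝ) (X : Quaternion ℝ) : ℝ :=
  hin H ψ (X • dψ) + ∑ i, ∑ k, ∑ l, p k * dH l i k * inner ℝ (ψ i) (X * ψ l)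

variable {H H' : Fin n → Fin n → ℝ} {dH dH' : Fin n → Fin n → Fin n → ℝ}
  {ψ dψ : Fin n → Quaternion ℝ} {p : Fin n → ℝ} {X : Quaternion ℝ}

lemma kinExpr_add_mul (s t : ℝ) (X Y : Quaternion ℝ) :
    kinExpr H dH ψ dψ p (s • X + t • Y)
      = s * kinExpr H dH ψ dψ p X + t * kinExpr H dH ψ dψ p Y := by
  have h1 : (s • X + t • Y) • dψ = s • (X • dψ) + t • (Y • dψ) := by
    ext1 i
    simp [add_mul]
  simp only [kinExpr, h1, hin_add_right, hin_smul_right, add_mul, smul_mul_assoc, inner_add_right,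
    inner_smul_right, mul_add, Finset.sum_add_distrib, Finset.mul_sum, mul_left_comm]
  ring

lemma kinExpr_add_deriv (s t : ℝ) (dψ dψ' : Fin n → Quaternion ℝ) (p p' : Fin n → ℝ) :
    kinExpr H dH ψ (s • dψ + t • dψ') (s • p + t • p') X
      = s * kinExpr H dH ψ dψ p X + t * kinExpr H dH ψ dψ' p' X := by
  have h1 : X • (s • dψ + t • dψ') = s • (X • dψ) + t • (X • dψ') := by
    ext1 i
    simp [mul_add]
  simp only [kinExpr, h1, hin_add_right, hin_smul_right, Pi.add_apply, Pi.smul_apply, smul_eq_mul,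
    mul_add, add_mul, Finset.sum_add_distrib, Finset.mul_sum, mul_assoc]
  ring

/-- Change of frame. -/
lemma kinExpr_frame (hH : ∀ i j, H i j = H j i) {q dq X' : Quaternion ℝ} (hq : star q * q = 1)
    (hX : X * q = q * X') (hd : (star q * (X * dq)).re = 0) :
    kinExpr H dH (q • ψ) (q • dψ + dq • ψ) p X = kinExpr H dH ψ dψ p X' := by
  have e1 : ∀ s t : Quaternion ℝ, inner ℝ (q * s) (X * (q * t)) = inner ℝ s (X' * t) := by
    intro s t
    rw [← mul_assoc X, hX, inner_mul_left_star, ← mul_assoc, ← mul_assoc, hq, one_mul]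
  have e2 : hin H (q • ψ) (X • q • dψ) = hin H ψ (X' • dψ) := by
    simp only [hin, Pi.smul_apply, smul_eq_mul, e1]
  -- The derivative of the frame change enters through the imaginary quaternion `star q * (X * dq)`,
  -- whose quadratic form vanishes.
  have e3 : hin H (q • ψ) (X • dq • ψ) = 0 := by
    rw [← hin_mul_self hH hd ψ]
    simp only [hin, Pi.smul_apply, smul_eq_mul, inner_mul_left_star, ← mul_assoc]
  simp only [kinExpr, smul_add, hin_add_right, e2, e3, Pi.smul_apply, smul_eq_mul, e1, add_zero]

lemma inner_sum_mul_sum (s t : Fin n → ℝ) (ψ χ : Fin n → Quaternion ℝ) (X : Quaternion ℝ) :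
    inner ℝ (∑ a, s a • ψ a) (X * ∑ c, t c • χ c)
      = ∑ a, ∑ c, s a * t c * inner ℝ (ψ a) (X * χ c) := by
  simp only [sum_inner, Finset.mul_sum, inner_sum, mul_smul_comm, inner_smul_left, inner_smul_right,
    conj_trivial]
  rw [Finset.sum_comm]
  exact Finset.sum_congr rfl fun _ _ ↦ Finset.sum_congr rfl fun _ _ ↦ by ring

/-- Change of chart. -/
lemma kinExpr_chart (hX : X.re = 0) {J : Fin n → Fin n → ℝ} {J2 : Fin n → Fin n → Fin n → ℝ}
    (hJ2 : ∀ i a b, J2 i a b = J2 i b a)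
    (hH : ∀ a b, H a b = ∑ i, ∑ j, H' i j * (J i a * J j b))
    (hdH : ∀ c a b, dH c a b = ∑ i, ∑ j, ((∑ l, dH' l i j * J l c) * (J i a * J j b)
      + H' i j * (J2 i a c * J j b + J i a * J2 j b c))) :
    kinExpr H' dH' (fun i ↦ ∑ a, J i a • ψ a)
        ((fun i ↦ ∑ a, J i a • dψ a) + fun i ↦ ∑ a, (∑ b, J2 i a b * p b) • ψ a)
        (fun i ↦ ∑ a, J i a * p a) X
      = kinExpr H dH ψ dψ p X := by
  set B : Fin n → Fin n → ℝ := fun a c ↦ inner ℝ (ψ a) (X * ψ c) with hB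
  -- B is skew, so that coefficients symmetric in a and c contribute nothing.
  have hBs : ∀ a c, B c a = -B a c := by
    intro a c
    simp only [hB]
    rw [← real_inner_comm, inner_mul_left_of_re_eq_zero hX]
  set p' : Fin n → ℝ := fun i ↦ ∑ a, J i a * p a with hp'
  set K : Fin n → Fin n → ℝ := fun j c ↦ ∑ b, J2 j c b * p b with hK
  have e1 : hin H' (fun i ↦ ∑ a, J i a • ψ a) (X • fun i ↦ ∑ a, J i a • dψ a)
      = hin H ψ (X • dψ) := by
    simp only [hin, hH, Pi.smul_apply, smul_eq_mul, inner_sum_mul_sum]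
    simp only [Finset.mul_sum, Finset.sum_mul]
    rw [sum_comm_pairs]
    refine Finset.sum_congr rfl fun a _ ↦ Finset.sum_congr rfl fun b _ ↦
      Finset.sum_congr rfl fun i _ ↦ Finset.sum_congr rfl fun j _ ↦ ?_
    ring
  have e2 : hin H' (fun i ↦ ∑ a, J i a • ψ a) (X • fun i ↦ ∑ a, K i a • ψ a)
      = ∑ a, ∑ c, (∑ i, ∑ j, H' i j * (J i a * K j c)) * B a c := by
    simp only [hin, Pi.smul_apply, smul_eq_mul, inner_sum_mul_sum]
    simp only [Finset.mul_sum, Finset.sum_mul]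
    rw [sum_comm_pairs]
    refine Finset.sum_congr rfl fun a _ ↦ Finset.sum_congr rfl fun b _ ↦
      Finset.sum_congr rfl fun i _ ↦ Finset.sum_congr rfl fun j _ ↦ ?_
    ring
  have e3 : ∑ i, ∑ k, ∑ l, p' k * dH' l i k * inner ℝ (∑ a, J i a • ψ a) (X * ∑ a, J l a • ψ a)
      = ∑ a, ∑ c, (∑ i, ∑ j, (∑ l, dH' l i j * J l c) * (J i a * p' j)) * B a c := by
    simp only [inner_sum_mul_sum]
    simp only [Finset.mul_sum, Finset.sum_mul]
    have : ∀ i k, ∑ l, ∑ a, ∑ c, p' k * dH' l i k * (J i a * J l c * inner ℝ (ψ a) (X * ψ c))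
        = ∑ a, ∑ c, ∑ l, dH' l i k * J l c * (J i a * p' k) * B a c := by
      intro i k
      rw [Finset.sum_comm]
      refine Finset.sum_congr rfl fun a _ ↦ ?_
      rw [Finset.sum_comm]
      refine Finset.sum_congr rfl fun c _ ↦ Finset.sum_congr rfl fun l _ ↦ ?_
      simp only [hB]
      ring
    simp only [this]
    rw [sum_comm_pairs]
  have e4 : ∀ a c, ∑ b, p b * dH c a b
      = (∑ i, ∑ j, (∑ l, dH' l i j * J l c) * (J i a * p' j))
        + (∑ i, ∑ j, H' i j * (J2 i a c * p' j)) + ∑ i, ∑ j, H' i j * (J i a * K j c) := by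
    intro a c
    simp only [hdH, hp', hK]
    have h0 : ∀ b, p b * ∑ i, ∑ j, ((∑ l, dH' l i j * J l c) * (J i a * J j b)
        + H' i j * (J2 i a c * J j b + J i a * J2 j b c))
        = ∑ i, ∑ j, p b * ((∑ l, dH' l i j * J l c) * (J i a * J j b)
        + H' i j * (J2 i a c * J j b + J i a * J2 j b c)) := fun b ↦ by
      rw [Finset.mul_sum]
      exact Finset.sum_congr rfl fun i _ ↦ Finset.mul_sum _ _ _
    simp only [h0]
    rw [Finset.sum_comm]
    simp only [← Finset.sum_add_distrib]
    refine Finset.sum_congr rfl fun i _ ↦ ?_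
    rw [Finset.sum_comm]
    refine Finset.sum_congr rfl fun j _ ↦ ?_
    generalize ∑ l, dH' l i j * J l c = D
    simp only [Finset.mul_sum, ← Finset.sum_add_distrib]
    refine Finset.sum_congr rfl fun b _ ↦ ?_
    rw [hJ2 j c b]
    ring
  have e5 : ∑ i, ∑ k, ∑ l, p k * dH l i k * inner ℝ (ψ i) (X * ψ l)
      = ∑ a, ∑ c, (∑ b, p b * dH c a b) * B a c := by
    refine Finset.sum_congr rfl fun a _ ↦ ?_
    rw [Finset.sum_comm]
    simp only [Finset.sum_mul, hB]
  -- The Hessian of the transition map is symmetric in a and c; this is why the inhomogeneous part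
  -- of the transformation law cancels.
  have e6 : ∑ a, ∑ c, (∑ i, ∑ j, H' i j * (J2 i a c * p' j)) * B a c = 0 := by
    have h1 : ∑ a, ∑ c, (∑ i, ∑ j, H' i j * (J2 i a c * p' j)) * B a c
        = -∑ a, ∑ c, (∑ i, ∑ j, H' i j * (J2 i a c * p' j)) * B a c := by
      conv_lhs => rw [Finset.sum_comm]
      simp only [← Finset.sum_neg_distrib]
      refine Finset.sum_congr rfl fun c _ ↦ Finset.sum_congr rfl fun a _ ↦ ?_
      simp only [hBs c a, hJ2 _ a c, mul_neg]
    linarith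
  have e7 : hin H' (fun i ↦ ∑ a, J i a • ψ a)
      (X • ((fun i ↦ ∑ a, J i a • dψ a) + fun i ↦ ∑ a, K i a • ψ a))
      = hin H ψ (X • dψ) + ∑ a, ∑ c, (∑ i, ∑ j, H' i j * (J i a * K j c)) * B a c := by
    rw [smul_add, hin_add_right, e1, e2]
  simp only [kinExpr]
  rw [e7, e3, e5]
  simp only [e4, add_mul, Finset.sum_add_distrib]
  rw [e6]
  ring

/-- The Christoffel symbols enter `⟨ψ, X ∇ψ⟩` only through first derivatives of the metric. -/
lemma kinExpr_christoffel (hX : X.re = 0) {G : Fin n → Fin n → Fin n → ℝ}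
    (hdH : ∀ l i j, dH l i j = dH l j i)
    (hG : ∀ i j k, ∑ m, H i m * G m j k = 1 / 2 * (dH j i k + dH k i j - dH i j k)) :
    hin H ψ (X • (dψ + fun i ↦ ∑ j, ∑ k, (G i j k * p j) • ψ k)) = kinExpr H dH ψ dψ p X := by
  set B : Fin n → Fin n → ℝ := fun a c ↦ inner ℝ (ψ a) (X * ψ c) with hB
  have hBs : ∀ a c, B c a = -B a c := by
    intro a c
    simp only [hB]
    rw [← real_inner_comm, inner_mul_left_of_re_eq_zero hX]
  have e1 : hin H ψ (X • fun i ↦ ∑ j, ∑ k, (G i j k * p j) • ψ k)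
      = ∑ i, ∑ j, ∑ k, (∑ m, H i m * G m j k) * (p j * B i k) := by
    simp only [hin, Pi.smul_apply, smul_eq_mul, Finset.mul_sum, Finset.sum_mul, inner_sum,
      mul_smul_comm, inner_smul_right, hB]
    refine Finset.sum_congr rfl fun i _ ↦ ?_
    rw [Finset.sum_comm]
    refine Finset.sum_congr rfl fun j _ ↦ ?_
    rw [Finset.sum_comm]
    refine Finset.sum_congr rfl fun k _ ↦ Finset.sum_congr rfl fun m _ ↦ ?_
    ring
  have e2 : ∀ j, ∑ i, ∑ k, dH i j k * (p j * B i k) = -∑ i, ∑ k, dH k i j * (p j * B i k) := by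
    intro j
    rw [Finset.sum_comm]
    simp only [← Finset.sum_neg_distrib]
    refine Finset.sum_congr rfl fun k _ ↦ Finset.sum_congr rfl fun i _ ↦ ?_
    rw [hBs k i, hdH i j k]
    ring
  -- Of the three metric derivatives in Γ_{i,jk}, one is symmetric in i and k and drops out against
  -- B; the other two contribute equally, which cancels the 1/2.
  have e3 : ∀ j, ∑ i, ∑ k, dH j i k * (p j * B i k) = 0 := by
    intro j
    have h1 : ∑ i, ∑ k, dH j i k * (p j * B i k) = -∑ i, ∑ k, dH j i k * (p j * B i k) := by
      conv_lhs => rw [Finset.sum_comm]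
      simp only [← Finset.sum_neg_distrib]
      refine Finset.sum_congr rfl fun k _ ↦ Finset.sum_congr rfl fun i _ ↦ ?_
      rw [hBs k i, hdH j k i]
      ring
    linarith
  rw [smul_add, hin_add_right, kinExpr, e1]
  congr 1
  rw [Finset.sum_comm]
  conv_rhs => rw [Finset.sum_comm]
  refine Finset.sum_congr rfl fun j _ ↦ ?_
  have e4 : ∑ i, ∑ k, (∑ m, H i m * G m j k) * (p j * B i k)
      = 1 / 2 * (∑ i, ∑ k, dH j i k * (p j * B i k)) + 1 / 2 * (∑ i, ∑ k, dH k i j * (p j * B i k))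
        - 1 / 2 * ∑ i, ∑ k, dH i j k * (p j * B i k) := by
    simp only [hG, Finset.mul_sum, ← Finset.sum_add_distrib, ← Finset.sum_sub_distrib]
    refine Finset.sum_congr rfl fun i _ ↦ Finset.sum_congr rfl fun k _ ↦ ?_
    ring
  rw [e4, e2, e3]
  have e5 : ∑ i, ∑ l, p j * dH l i j * inner ℝ (ψ i) (X * ψ l)
      = ∑ i, ∑ k, dH k i j * (p j * B i k) := by
    refine Finset.sum_congr rfl fun i _ ↦ Finset.sum_congr rfl fun k _ ↦ ?_
    simp only [hB]
    ring
  rw [e5]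
  ring

end KineticAlgebra

/-! ### Components of tensors in S ⊗ V -/

section Tensor

variable {V : Type*} [AddCommGroup V] [Module ℝ V]

lemma coeff_tmul (l : V →ₗ[ℝ] ℝ) (s : Quaternion ℝ) (v : V) : coeff l (s ⊗ₜ v) = l v • s := by
  simp [coeff]

lemma coeff_spinAct (l : V →ₗ[ℝ] ℝ) (q : Quaternion ℝ) (t : Quaternion ℝ ⊗[ℝ] V) :
    coeff l (spinAct q t) = q * coeff l t := by
  induction t with
  | zero => simp
  | tmul s v => simp [coeff_tmul, spinAct]
  | add s t hs ht => simp only [map_add, hs, ht, mul_add]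

lemma coeff_sum {ι : Type*} [Fintype ι] (c : ι → ℝ) (l : ι → V →ₗ[ℝ] ℝ) {l' : V →ₗ[ℝ] ℝ}
    (hl : ∀ v, l' v = ∑ j, c j * l j v) (t : Quaternion ℝ ⊗[ℝ] V) :
    coeff l' t = ∑ j, c j • coeff (l j) t := by
  induction t with
  | zero => simp
  | tmul s v => simp [coeff_tmul, hl, Finset.sum_smul, mul_smul]
  | add s t hs ht => simp only [map_add, hs, ht, smul_add, Finset.sum_add_distrib]

end Tensor

/-! ### Change of charts on the target -/

section ChartChange

variable {n : ℕ} {N : Type*} [TopologicalSpace N] [ChartedSpace (EuclideanSpace ℝ (Fin n)) N]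
  [IsManifold (𝓡 n) ∞ N] (h : TargetMetric n N)
  {y y' : OpenPartialHomeomorph N (EuclideanSpace ℝ (Fin n))}

/-- The Jacobian matrix of the change of charts from `y` to `y'`. -/
def jac (y y' : OpenPartialHomeomorph N (EuclideanSpace ℝ (Fin n))) (i a : Fin n)
    (u : EuclideanSpace ℝ (Fin n)) : ℝ := partialD a (fun v ↦ y' (y.symm v) i) u

lemma coordForm_apply (i : Fin n) (p : N) (w : TangentSpace (𝓡 n) p) :
    coordForm y i p w = dchart y p w i := rfl

variable (hy : y ∈ IsManifold.maximalAtlas (𝓡 n) ∞ N) (hy' : y' ∈ IsManifold.maximalAtlas (𝓡 n) ∞ N)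

include hy in
lemma inner_eq_sum_coordForm {p : N} (hp : p ∈ y.source) (v w : TangentSpace (𝓡 n) p) :
    h.inner p v w = ∑ i, ∑ j, metricCoeff h y (y p) i j * coordForm y i p v * coordForm y j p w := by
  obtain ⟨u, hu, rfl⟩ : ∃ u ∈ y.target, y.symm u = p := ⟨y p, y.map_source hp, y.left_inv hp⟩
  rw [y.right_inv hu]
  have h1 := inner_dchartSymm h (y := y) u (dchart y (y.symm u) v) (dchart y (y.symm u) w)
  rw [dchartSymm_dchart hy hu, dchartSymm_dchart hy hu] at h1
  exact h1

include hy hy'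

lemma contDiffOn_chartChange (i : Fin n) :
    ContDiffOn ℝ ∞ (fun v ↦ y' (y.symm v) i) (y.target ∩ y.symm ⁻¹' y'.source) :=
  contDiffOn_comp_symm hy (f := fun p ↦ y' p i)
    ((EuclideanSpace.proj i : EuclideanSpace ℝ (Fin n) →L[ℝ] ℝ).contMDiff.comp_contMDiffOn
      (contMDiffOn_of_mem_maximalAtlas hy'))

lemma contDiffOn_jac (i a : Fin n) :
    ContDiffOn ℝ ∞ (jac y y' i a) (y.target ∩ y.symm ⁻¹' y'.source) :=
  contDiffOn_partialD (y.isOpen_inter_preimage_symm y'.open_source)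
    (contDiffOn_chartChange hy hy' i) a

lemma coordForm_chart {p : N} (hp : p ∈ y.source) (hp' : p ∈ y'.source) (i : Fin n)
    (w : TangentSpace (𝓡 n) p) :
    coordForm y' i p w = ∑ a, jac y y' i a (y p) * coordForm y a p w := by
  obtain ⟨u, hu, rfl⟩ : ∃ u ∈ y.target, y.symm u = p := ⟨y p, y.map_source hp, y.left_inv hp⟩
  rw [y.right_inv hu]
  have hd : MDifferentiableAt (𝓡 n) 𝓘(ℝ, ℝ) (fun p ↦ y' p i) (y.symm u) :=
    (((EuclideanSpace.proj i : EuclideanSpace ℝ (Fin n) →L[ℝ] ℝ).contMDiff.contMDiffAt.comp _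
      (contMDiffAt_of_mem_maximalAtlas hy' hp'))).mdifferentiableAt (n := ∞) (by simp)
  have h1 := mfderiv_eq_fderiv_chart hy hu hd w
  have h2 : mfderiv (𝓡 n) 𝓘(ℝ, ℝ) (fun p ↦ y' p i) (y.symm u) w = coordForm y' i (y.symm u) w := by
    have := mfderiv_comp (y.symm u)
      (EuclideanSpace.proj i : EuclideanSpace ℝ (Fin n) →L[ℝ] ℝ).mdifferentiableAt
      (mdifferentiableAt_chart hy' hp')
    rw [ContinuousLinearMap.mfderiv_eq] at this
    exact congrArg (fun L : TangentSpace (𝓡 n) (y.symm u) →L[ℝ] ℝ ↦ L w) this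
  rw [← h2, h1, fderiv_apply_eq_sum_partialD]
  exact Finset.sum_congr rfl fun a _ ↦ mul_comm _ _

variable {u : EuclideanSpace ℝ (Fin n)} (hu : u ∈ y.target) (hu' : y.symm u ∈ y'.source)
include hu hu'

lemma metricFn_chart (a b : Fin n) : metricFn h y a b u
    = ∑ i, ∑ j, metricFn h y' i j (y' (y.symm u)) * (jac y y' i a u * jac y y' j b u) := by
  have hp := y.map_target hu
  have hJ : ∀ i a, coordForm y' i (y.symm u) (dchartSymm y u (EuclideanSpace.single a 1))
      = jac y y' i a u := by
    intro i a
    rw [coordForm_chart hy hy' hp hu', y.right_inv hu]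
    simp only [coordForm_apply, dchart_dchartSymm hy hu]
    simp
  have h1 := inner_eq_sum_coordForm h hy' hu' (dchartSymm y u (EuclideanSpace.single a 1))
    (dchartSymm y u (EuclideanSpace.single b 1))
  refine h1.trans (Finset.sum_congr rfl fun i _ ↦ Finset.sum_congr rfl fun j _ ↦ ?_)
  rw [hJ, hJ, mul_assoc]
  rfl

lemma partialD_metricFn_chart (c a b : Fin n) : partialD c (metricFn h y a b) u
    = ∑ i, ∑ j, ((∑ l, partialD l (metricFn h y' i j) (y' (y.symm u)) * jac y y' l c u)
        * (jac y y' i a u * jac y y' j b u)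
      + metricFn h y' i j (y' (y.symm u)) * (partialD c (jac y y' i a) u * jac y y' j b u
        + jac y y' i a u * partialD c (jac y y' j b) u)) := by
  have hO := (y.isOpen_inter_preimage_symm y'.open_source).mem_nhds ⟨hu, hu'⟩
  have h1 : metricFn h y a b =ᶠ[nhds u] fun v ↦ ∑ i, ∑ j, metricFn h y' i j (y' (y.symm v)) *
      (jac y y' i a v * jac y y' j b v) :=
    Filter.eventually_of_mem hO fun v hv ↦ metricFn_chart h hy hy' hv.1 hv.2 a b
  have hJ : ∀ i a, DifferentiableAt ℝ (jac y y' i a) u := fun i a ↦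
    ((contDiffOn_jac hy hy' i a).contDiffAt hO).differentiableAt (by simp)
  have hF : DifferentiableAt ℝ (fun v ↦ y' (y.symm v)) u := by
    rw [differentiableAt_euclidean]
    exact fun i ↦ ((contDiffOn_chartChange hy hy' i).contDiffAt hO).differentiableAt (by simp)
  have hm : ∀ i j, DifferentiableAt ℝ (metricFn h y' i j) (y' (y.symm u)) :=
    fun i j ↦ differentiableAt_metricFn h hy' (y'.map_source hu') i j
  have hc : ∀ i j, DifferentiableAt ℝ (fun v ↦ metricFn h y' i j (y' (y.symm v))) u :=
    fun i j ↦ (hm i j).comp u (f := fun v ↦ y' (y.symm v)) hF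
  have hchain : ∀ i j, partialD c (fun v ↦ metricFn h y' i j (y' (y.symm v))) u
      = ∑ l, partialD l (metricFn h y' i j) (y' (y.symm u)) * jac y y' l c u := by
    intro i j
    have h2 := fderiv_comp u (hm i j) hF
    have h3 : ∀ l, fderiv ℝ (fun v ↦ y' (y.symm v)) u (EuclideanSpace.single c 1) l
        = jac y y' l c u := by
      intro l
      have := fderiv_comp u (EuclideanSpace.proj l :
        EuclideanSpace ℝ (Fin n) →L[ℝ] ℝ).differentiableAt hF
      rw [ContinuousLinearMap.fderiv] at this
      exact (congrArg (fun L : EuclideanSpace ℝ (Fin n) →L[ℝ] ℝ ↦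
        L (EuclideanSpace.single c 1)) this).symm
    have h4 := congrArg (fun L : EuclideanSpace ℝ (Fin n) →L[ℝ] ℝ ↦
        L (EuclideanSpace.single c 1)) h2
    refine h4.trans ((fderiv_apply_eq_sum_partialD _).trans
      (Finset.sum_congr rfl fun l _ ↦ ?_))
    exact (mul_comm _ _).trans (congrArg _ (h3 l))
  have hp : ∀ i j, DifferentiableAt ℝ (fun v ↦ metricFn h y' i j (y' (y.symm v)) *
      (jac y y' i a v * jac y y' j b v)) u := fun i j ↦
    (hc i j).fun_mul ((hJ i a).fun_mul (hJ j b))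
  rw [partialD_congr h1, partialD_sum fun i _ ↦ DifferentiableAt.fun_sum fun j _ ↦ hp i j]
  refine Finset.sum_congr rfl fun i _ ↦ ?_
  rw [partialD_sum fun j _ ↦ hp i j]
  refine Finset.sum_congr rfl fun j _ ↦ ?_
  rw [partialD_mul (hc i j) ((hJ i a).fun_mul (hJ j b)), partialD_mul (hJ i a) (hJ j b), hchain]

end ChartChange

/-! ### Invariance of ⟨ψ, X ∇ψ⟩ under changes of chart and frame -/

section KineticForm

variable {M : Type*} [TopologicalSpace M] [ChartedSpace ℂ M] [IsManifold 𝓘(ℝ, ℂ) ∞ M]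
  {g : SurfaceMetric M} {ι : Type*}
  {n : ℕ} {N : Type*} [TopologicalSpace N] [ChartedSpace (EuclideanSpace ℝ (Fin n)) N]
  [IsManifold (𝓡 n) ∞ N]
  {σ : SpinStructure g ι} (h : TargetMetric n N) {φ : M → N} (ψ : VectorSpinor n σ φ)
  {a b : ι} {y y' : OpenPartialHomeomorph N (EuclideanSpace ℝ (Fin n))}
  {z : OpenPartialHomeomorph M ℂ}

/-- The form `⟨ψ, X ∇_V ψ⟩` in charts. -/
def kinForm (a : ι) (y : OpenPartialHomeomorph N (EuclideanSpace ℝ (Fin n)))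
    (z : OpenPartialHomeomorph M ℂ) (q V : ℂ) (X : Quaternion ℝ) : ℝ :=
  kinExpr (metricCoeff h y (mapCoord φ y z q))
    (fun l i k ↦ partialD l (metricFn h y i k) (mapCoord φ y z q))
    (fun i ↦ spinorCoord ψ a y z i q) (fun i ↦ fderiv ℝ (spinorCoord ψ a y z i) q V)
    (fun i ↦ fderiv ℝ (fun q ↦ mapCoord φ y z q i) q V) X

variable (hφ : ContMDiff 𝓘(ℝ, ℂ) (𝓡 n) ∞ φ) (hy : y ∈ IsManifold.maximalAtlas (𝓡 n) ∞ N)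
  (hy' : y' ∈ IsManifold.maximalAtlas (𝓡 n) ∞ N)
  (hz : z ∈ IsManifold.maximalAtlas 𝓘(ℝ, ℂ) ∞ M) {q : ℂ} (hq : q ∈ z.target)
  (hx : z.symm q ∈ σ.U a) (hx' : z.symm q ∈ σ.U b)
  (hxy : φ (z.symm q) ∈ y.source) (hxy' : φ (z.symm q) ∈ y'.source)

include hφ hy hz hq hx hxy in
-- The spin connection contributes a multiple of ⟨ψ, e_α·ω·ψ⟩, which is zero because e_α·ω is
-- imaginary; the Christoffel symbols go by `kinExpr_christoffel`. What is left contains no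
-- connection and is linear in the direction and in X.
lemma kinetic_eq_kinForm (α β : Fin 2) : kinetic h ψ a y α β (z.symm q)
    = kinForm h ψ a y z q (frameCoord σ a z β q) (cliff α) := by
  have hre : (cliff α).re = 0 := by fin_cases α <;> rfl
  have hre2 : (cliff α * (cliff 0 * cliff 1)).re = 0 := by fin_cases α <;> simp
  have hG := kinExpr_christoffel (H := metricCoeff h y (mapCoord φ y z q))
    (dH := fun l i k ↦ partialD l (metricFn h y i k) (mapCoord φ y z q))
    (ψ := fun i ↦ spinorCoord ψ a y z i q)
    (dψ := fun i ↦ fderiv ℝ (spinorCoord ψ a y z i) q (frameCoord σ a z β q))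
    (p := fun i ↦ fderiv ℝ (fun q ↦ mapCoord φ y z q i) q (frameCoord σ a z β q)) hre
    (G := fun i j k ↦ christoffel h y i j k (mapCoord φ y z q))
    (fun l i j ↦ by rw [metricFn_symm])
    (fun i j k ↦ sum_metricCoeff_christoffel h hy (y.map_source hxy) i j k)
  rw [kinForm, ← hG]
  have h1 : (cliff α • fun i ↦ covDeriv σ h φ ψ a y β i (z.symm q))
      = cliff α • ((fun i ↦ fderiv ℝ (spinorCoord ψ a y z i) q (frameCoord σ a z β q))
        + fun i ↦ ∑ j, ∑ k, (christoffel h y i j k (mapCoord φ y z q)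
          * fderiv ℝ (fun q ↦ mapCoord φ y z q j) q (frameCoord σ a z β q))
            • spinorCoord ψ a y z k q)
        + (connCoord σ a z β q / 2) • ((cliff α * (cliff 0 * cliff 1)) •
          fun i ↦ spinorCoord ψ a y z i q) := by
    ext1 i
    simp only [covDeriv_eq h ψ hφ hy hz hq hx hxy, spinCov, cov, dirD, Pi.add_apply,
      Pi.smul_apply, smul_eq_mul, mul_add, mul_smul_comm, mul_assoc]
  have h2 := hin_mul_self (metricCoeff_symm h (y := y) (mapCoord φ y z q)) hre2
    (fun i ↦ spinorCoord ψ a y z i q)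
  rw [kinetic, h1]
  refine (hin_add_right _ _ _ _).trans ?_
  refine (congrArg₂ (· + ·) rfl ((hin_smul_right _ _ _ _).trans (congrArg _ h2))).trans ?_
  rw [mul_zero, add_zero]
  rfl

include hφ hy hy' hz hq hx hxy hxy' in
lemma kinForm_chart {X : Quaternion ℝ} (hX : X.re = 0) (V : ℂ) :
    kinForm h ψ a y' z q V X = kinForm h ψ a y z q V X := by
  set u := mapCoord φ y z q with hu_def
  have hu : u ∈ y.target := y.map_source hxy
  have hus : y.symm u = φ (z.symm q) := y.left_inv hxy
  have hu' : y.symm u ∈ y'.source := by rw [hus]; exact hxy'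
  have hO := (y.isOpen_inter_preimage_symm y'.open_source)
  have hOn := hO.mem_nhds ⟨hu, hu'⟩
  have hm : mapCoord φ y' z q = y' (y.symm u) := by rw [hus]; rfl
  have hΦ : DifferentiableAt ℝ (mapCoord φ y z) q :=
    (contDiffAt_mapCoord hφ hy hz hq hxy).differentiableAt (by simp)
  have hev : ∀ᶠ p in nhds q, φ (z.symm p) ∈ y.source ∧ φ (z.symm p) ∈ y'.source := by
    filter_upwards [eventually_nhds_chart (σ := σ) (a := a) hφ hy hz hq hx hxy,
      eventually_nhds_chart (σ := σ) (a := a) hφ hy' hz hq hx hxy'] with p hp hp'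
    exact ⟨hp.2.2, hp'.2.2⟩
  have hs : ∀ i p, φ (z.symm p) ∈ y.source → φ (z.symm p) ∈ y'.source →
      spinorCoord ψ a y' z i p
        = ∑ j, jac y y' i j (mapCoord φ y z p) • spinorCoord ψ a y z j p :=
    fun i p hp hp' ↦ coeff_sum _ _ (fun w ↦ coordForm_chart hy hy' hp hp' i w) _
  have hJd : ∀ i j, DifferentiableAt ℝ (jac y y' i j) u := fun i j ↦
    ((contDiffOn_jac hy hy' i j).contDiffAt hOn).differentiableAt (by simp)
  have hψd : ∀ j, DifferentiableAt ℝ (spinorCoord ψ a y z j) q := fun j ↦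
    (contDiffAt_spinorCoord ψ hφ hy hz hq hx hxy j).differentiableAt (by simp)
  have hJc : ∀ i j, DifferentiableAt ℝ (fun p ↦ jac y y' i j (mapCoord φ y z p)) q :=
    fun i j ↦ (hJd i j).comp q hΦ
  have hdm : ∀ i, fderiv ℝ (fun p ↦ mapCoord φ y' z p i) q V
      = ∑ j, jac y y' i j u * fderiv ℝ (fun p ↦ mapCoord φ y z p j) q V := by
    intro i
    have h1 : (fun p ↦ mapCoord φ y' z p i) =ᶠ[nhds q]
        fun p ↦ (fun v ↦ y' (y.symm v) i) (mapCoord φ y z p) := by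
      filter_upwards [hev] with p hp
      simp only [mapCoord, y.left_inv hp.1]
    rw [h1.fderiv_eq]
    exact fderiv_comp_eq_sum hΦ (((contDiffOn_chartChange hy hy' i).contDiffAt
      hOn).differentiableAt (by simp)) V
  have hds : ∀ i, fderiv ℝ (spinorCoord ψ a y' z i) q V
      = (∑ j, jac y y' i j u • fderiv ℝ (spinorCoord ψ a y z j) q V)
        + ∑ j, (∑ k, partialD k (jac y y' i j) u * fderiv ℝ (fun p ↦ mapCoord φ y z p k) q V)
          • spinorCoord ψ a y z j q := by
    intro i
    have h1 : spinorCoord ψ a y' z i =ᶠ[nhds q]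
        fun p ↦ ∑ j, jac y y' i j (mapCoord φ y z p) • spinorCoord ψ a y z j p := by
      filter_upwards [hev] with p hp
      exact hs i p hp.1 hp.2
    rw [h1.fderiv_eq, fderiv_fun_sum fun j _ ↦ (hJc i j).fun_smul (hψd j), sum_apply,
      ← Finset.sum_add_distrib]
    refine Finset.sum_congr rfl fun j _ ↦ ?_
    rw [fderiv_fun_smul (hJc i j) (hψd j), ← fderiv_comp_eq_sum hΦ (hJd i j) V]
    simp [hu_def]
  have key := kinExpr_chart (H := metricCoeff h y u) (H' := metricCoeff h y' (mapCoord φ y' z q))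
    (dH := fun l i k ↦ partialD l (metricFn h y i k) u)
    (dH' := fun l i k ↦ partialD l (metricFn h y' i k) (mapCoord φ y' z q))
    (ψ := fun i ↦ spinorCoord ψ a y z i q) (dψ := fun i ↦ fderiv ℝ (spinorCoord ψ a y z i) q V)
    (p := fun i ↦ fderiv ℝ (fun q ↦ mapCoord φ y z q i) q V) hX
    (J := fun i j ↦ jac y y' i j u) (J2 := fun i j k ↦ partialD k (jac y y' i j) u)
    (fun i j k ↦ partialD_comm hO (contDiffOn_chartChange hy hy' i) ⟨hu, hu'⟩ k j)
    (fun i j ↦ by rw [hm]; exact metricFn_chart h hy hy' hu hu' i j)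
    (fun k i j ↦ by rw [hm]; exact partialD_metricFn_chart h hy hy' hu hu' k i j)
  rw [kinForm, kinForm, ← key]
  congr 1
  · ext1 i
    exact hs i q hxy hxy'
  · ext1 i
    exact hds i
  · ext1 i
    exact hdm i

/-- Clifford multiplication by a tangent vector, in a frame. -/
def cliffVec (σ : SpinStructure g ι) (a : ι) (x : M) (v : TangentSpace 𝓘(ℝ, ℂ) x) : Quaternion ℝ :=
  ∑ α, g.inner x (σ.frame a α x) v • cliff α

lemma re_cliffVec (x : M) (v : TangentSpace 𝓘(ℝ, ℂ) x) : (cliffVec σ a x v).re = 0 := by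
  simp [cliffVec, Fin.sum_univ_two]

lemma imK_cliffVec (x : M) (v : TangentSpace 𝓘(ℝ, ℂ) x) : (cliffVec σ a x v).imK = 0 := by
  simp [cliffVec, Fin.sum_univ_two]

lemma star_lift_mul_lift {x : M} (hx : x ∈ σ.U a ∩ σ.U b) :
    star (σ.lift a b x) * σ.lift a b x = 1 := by
  obtain ⟨t, ht⟩ := σ.lift_mem a b x hx
  rw [Quaternion.star_mul_self, Quaternion.normSq_def', ht]
  simp

lemma fderiv_inner_eq_zero {f : ℂ → Quaternion ℝ} (hf : DifferentiableAt ℝ f q) {c : Quaternion ℝ}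
    (hc : ∀ᶠ p in nhds q, inner ℝ c (f p) = 0) (V : ℂ) : inner ℝ c (fderiv ℝ f q V) = 0 := by
  have h1 := (innerSL ℝ c).hasFDerivAt.comp q hf.hasFDerivAt
  have h2 : HasFDerivAt ((innerSL ℝ c) ∘ f) (0 : ℂ →L[ℝ] ℝ) q :=
    (hasFDerivAt_const (0 : ℝ) q).congr_of_eventuallyEq hc
  exact congrArg (fun L : ℂ →L[ℝ] ℝ ↦ L V) (h1.unique h2)

include hφ hy hz hq hx hx' hxy in
-- The lift takes values in the span of 1 and ω, and so does its derivative, while a tangent vector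
-- acts by an element of the span of e₀ and e₁. Hence q̄ X dq has no real part, as `kinExpr_frame`
-- demands.
lemma kinForm_frame (V : ℂ) (v : TangentSpace 𝓘(ℝ, ℂ) (z.symm q)) :
    kinForm h ψ a y z q V (cliffVec σ a _ v) = kinForm h ψ b y z q V (cliffVec σ b _ v) := by
  set l : ℂ → Quaternion ℝ := fun p ↦ σ.lift a b (z.symm p) with hl
  have hOn : z.target ∩ z.symm ⁻¹' (σ.U a ∩ σ.U b) ∈ nhds q :=
    (z.isOpen_inter_preimage_symm ((σ.isOpen a).inter (σ.isOpen b))).mem_nhds ⟨hq, hx, hx'⟩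
  have hld : DifferentiableAt ℝ l q :=
    ((contDiffOn_comp_symm hz (σ.lift_smooth a b)).contDiffAt hOn).differentiableAt (by simp)
  have hs : ∀ i, spinorCoord ψ a y z i =ᶠ[nhds q] fun p ↦ l p * spinorCoord ψ b y z i p := by
    intro i
    filter_upwards [hOn] with p hp
    simp only [spinorCoord, VectorSpinor.comp, ψ.compat a b _ hp.2, coeff_spinAct, hl]
  have hψd : ∀ j, DifferentiableAt ℝ (spinorCoord ψ b y z j) q := fun j ↦
    (contDiffAt_spinorCoord ψ hφ hy hz hq hx' hxy j).differentiableAt (by simp)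
  have him : ∀ p ∈ z.target ∩ z.symm ⁻¹' (σ.U a ∩ σ.U b), (l p).imI = 0 ∧ (l p).imJ = 0 := by
    intro p hp
    obtain ⟨t, ht⟩ := σ.lift_mem a b _ hp.2
    simp [hl, ht]
  have hI : (fderiv ℝ l q V).imI = 0 := by
    have := fderiv_inner_eq_zero (c := cliff 0) hld (by
      filter_upwards [hOn] with p hp
      simp [quat_inner, (him p hp).1]) V
    simpa [quat_inner] using this
  have hJ : (fderiv ℝ l q V).imJ = 0 := by
    have := fderiv_inner_eq_zero (c := cliff 1) hld (by
      filter_upwards [hOn] with p hp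
      simp [quat_inner, (him p hp).2]) V
    simpa [quat_inner] using this
  have hlq := him q (mem_of_mem_nhds hOn)
  have hd : (star (l q) * (cliffVec σ a _ v * fderiv ℝ l q V)).re = 0 := by
    simp [Quaternion.re_mul, hI, hJ, hlq, re_cliffVec, imK_cliffVec]
  have key := kinExpr_frame (H := metricCoeff h y (mapCoord φ y z q))
    (dH := fun l i k ↦ partialD l (metricFn h y i k) (mapCoord φ y z q))
    (ψ := fun i ↦ spinorCoord ψ b y z i q) (dψ := fun i ↦ fderiv ℝ (spinorCoord ψ b y z i) q V)
    (p := fun i ↦ fderiv ℝ (fun q ↦ mapCoord φ y z q i) q V)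
    (metricCoeff_symm h _) (star_lift_mul_lift ⟨hx, hx'⟩) (σ.lift_covers a b _ ⟨hx, hx'⟩ v) hd
  rw [kinForm, kinForm]
  refine Eq.trans ?_ key
  change kinExpr _ _ _ _ _ (cliffVec σ a _ v) = kinExpr _ _ _ _ _ (cliffVec σ a _ v)
  congr 1
  · ext1 i
    exact (hs i).eq_of_nhds
  · ext1 i
    rw [(hs i).fderiv_eq, fderiv_fun_mul' hld (hψd i)]
    simp [hl]

end KineticForm

/-! ### Bilinear forms given in a frame; covariance of Q -/

section FrameForm

variable {M : Type*} [TopologicalSpace M] [ChartedSpace ℂ M] [IsManifold 𝓘(ℝ, ℂ) ∞ M]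
  {g : SurfaceMetric M} {ι : Type*} (σ : SpinStructure g ι) {a b : ι} {x : M}

/-- The bilinear form `B_αβ e^α ⊗ e^β`. -/
def frameForm (a : ι) (x : M) (B : Fin 2 → Fin 2 → ℝ) (v w : TangentSpace 𝓘(ℝ, ℂ) x) : ℝ :=
  ∑ α, ∑ β, B α β * g.inner x (σ.frame a α x) v * g.inner x (σ.frame a β x) w

variable {σ}

/-- Serves to recognise a frame expression as an intrinsic bilinear form, after which frames are
compared through that form. -/
lemma frameForm_eq (hx : x ∈ σ.U a) {F : TangentSpace 𝓘(ℝ, ℂ) x → TangentSpace 𝓘(ℝ, ℂ) x → ℝ}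
    (h1 : ∀ (s t : ℝ) v v' w, F (s • v + t • v') w = s * F v w + t * F v' w)
    (h2 : ∀ (s t : ℝ) v w w', F v (s • w + t • w') = s * F v w + t * F v w')
    (v w : TangentSpace 𝓘(ℝ, ℂ) x) :
    frameForm σ a x (fun α β ↦ F (σ.frame a α x) (σ.frame a β x)) v w = F v w := by
  conv_rhs => rw [eq_sum_frame σ hx v, eq_sum_frame σ hx w]
  simp only [h1, h2, frameForm, Fin.sum_univ_two]
  ring

lemma frameForm_frame (hx : x ∈ σ.U a) (B : Fin 2 → Fin 2 → ℝ) (α β : Fin 2) :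
    frameForm σ a x B (σ.frame a α x) (σ.frame a β x) = B α β := by
  have ho := σ.orthonormal a x hx
  simp [frameForm, ho]

lemma inner_eq_sum_frame (hx : x ∈ σ.U a) (v w : TangentSpace 𝓘(ℝ, ℂ) x) :
    g.inner x v w = g.inner x (σ.frame a 0 x) v * g.inner x (σ.frame a 0 x) w
      + g.inner x (σ.frame a 1 x) v * g.inner x (σ.frame a 1 x) w := by
  conv_lhs => rw [eq_sum_frame σ hx w]
  rw [map_add, map_smul, map_smul, g.symm x v, g.symm x v]
  simp only [smul_eq_mul]
  ring

/-- The trace is the same in all orthonormal frames: each vector of the frame b has unit length and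
is orthogonal to the other when expanded in the frame a. -/
lemma frameForm_trace (hx : x ∈ σ.U a) (hx' : x ∈ σ.U b) {B B' : Fin 2 → Fin 2 → ℝ}
    (hB : ∀ v w, frameForm σ a x B v w = frameForm σ b x B' v w) :
    B 0 0 + B 1 1 = B' 0 0 + B' 1 1 := by
  have h1 : ∀ α, B α α = frameForm σ b x B' (σ.frame a α x) (σ.frame a α x) := fun α ↦ by
    rw [← hB, frameForm_frame hx]
  have h2 : ∀ α β, ∑ γ, g.inner x (σ.frame b α x) (σ.frame a γ x)
      * g.inner x (σ.frame b β x) (σ.frame a γ x) = if α = β then 1 else 0 := by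
    intro α β
    rw [← σ.orthonormal b x hx' α β, inner_eq_sum_frame hx, Fin.sum_univ_two,
      g.symm x (σ.frame a 0 x), g.symm x (σ.frame a 0 x), g.symm x (σ.frame a 1 x),
      g.symm x (σ.frame a 1 x)]
  have h00 := h2 0 0
  have h01 := h2 0 1
  have h11 := h2 1 1
  rw [h1, h1]
  simp only [frameForm, Fin.sum_univ_two, zero_ne_one, if_true, if_false] at h00 h01 h11 ⊢
  linear_combination B' 0 0 * h00 + (B' 0 1 + B' 1 0) * h01 + B' 1 1 * h11

lemma cliffVec_frame (hx : x ∈ σ.U a) (α : Fin 2) : cliffVec σ a x (σ.frame a α x) = cliff α := by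
  have ho := σ.orthonormal a x hx
  simp [cliffVec, ho]

lemma cliffVec_add (s t : ℝ) (v w : TangentSpace 𝓘(ℝ, ℂ) x) :
    cliffVec σ a x (s • v + t • w) = s • cliffVec σ a x v + t • cliffVec σ a x w := by
  simp only [cliffVec, map_add, map_smul, Fin.sum_univ_two, smul_eq_mul]
  module

/-- The value of `Qχ` at a tangent vector. -/
def projVec (χ : Gravitino σ) (a : ι) (x : M) (v : TangentSpace 𝓘(ℝ, ℂ) x) : Quaternion ℝ :=
  ∑ α, g.inner x (σ.frame a α x) v • χ.proj a α x

variable (χ : Gravitino σ)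

lemma projVec_frame (hx : x ∈ σ.U a) (α : Fin 2) :
    projVec χ a x (σ.frame a α x) = χ.proj a α x := by
  have ho := σ.orthonormal a x hx
  simp [projVec, ho]

lemma projVec_add (s t : ℝ) (v w : TangentSpace 𝓘(ℝ, ℂ) x) :
    projVec χ a x (s • v + t • w) = s • projVec χ a x v + t • projVec χ a x w := by
  simp only [projVec, map_add, map_smul, Fin.sum_univ_two, smul_eq_mul]
  module

lemma projVec_eq (v : TangentSpace 𝓘(ℝ, ℂ) x) : projVec χ a x v
    = -(1 / 2 : ℝ) • ∑ β, cliff β * cliffVec σ a x v * χ.comp a β x := by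
  simp only [projVec, Gravitino.proj, cliffVec, Fin.sum_univ_two, mul_add, add_mul,
    mul_smul_comm, smul_mul_assoc]
  module

/-- For χ = s ⊗ u the value of Qχ at v is -½ u·v·s, so the claim is the covariance of Clifford
multiplication used twice; linearity covers the general case. -/
lemma projVec_change (hx : x ∈ σ.U a ∩ σ.U b) (v : TangentSpace 𝓘(ℝ, ℂ) x) :
    projVec χ a x v = σ.lift a b x * projVec χ b x v := by
  rw [projVec_eq, projVec_eq, mul_smul_comm]
  congr 1
  have hc := σ.lift_covers a b x hx
  simp only [Gravitino.comp, χ.compat a b x hx]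
  generalize χ.val b x = t
  induction t with
  | zero => simp
  | add s t hs ht =>
    simp only [map_add, mul_add, Finset.sum_add_distrib] at hs ht ⊢
    rw [hs, ht]
  | tmul s u =>
    have e : ∀ c w, ∑ β, cliff β * cliffVec σ c x v *
        (g.inner x (σ.frame c β x) u • w) = cliffVec σ c x u * (cliffVec σ c x v * w) := by
      intro c w
      simp only [cliffVec, Fin.sum_univ_two, mul_smul_comm, smul_mul_assoc, add_mul, mul_add,
        mul_assoc]
      module
    simp only [coeff_spinAct, coeff_tmul]
    have e1 := e a (σ.lift a b x * s)
    have e2 := e b s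
    simp only [mul_smul_comm] at e1 e2 ⊢
    refine e1.trans ?_
    refine Eq.trans ?_ (congrArg (σ.lift a b x * ·) e2.symm)
    rw [← mul_assoc (cliffVec σ a x v), show cliffVec σ a x v * σ.lift a b x = _ from hc v,
      mul_assoc, ← mul_assoc (cliffVec σ a x u),
      show cliffVec σ a x u * σ.lift a b x = _ from hc u, mul_assoc]
    rfl

lemma inner_lift_mul (hx : x ∈ σ.U a ∩ σ.U b) (s t : Quaternion ℝ) :
    inner ℝ (σ.lift a b x * s) (σ.lift a b x * t) = inner ℝ s t := by
  rw [inner_mul_left_star, ← mul_assoc, star_lift_mul_lift hx, one_mul]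

lemma frameForm_proj (ζ : Gravitino σ) (hx : x ∈ σ.U a) (hx' : x ∈ σ.U b)
    (v w : TangentSpace 𝓘(ℝ, ℂ) x) :
    frameForm σ a x (fun α β ↦ inner ℝ (χ.proj a α x) (ζ.proj a β x)) v w
      = frameForm σ b x (fun α β ↦ inner ℝ (χ.proj b α x) (ζ.proj b β x)) v w := by
  have e : ∀ c, x ∈ σ.U c → frameForm σ c x (fun α β ↦ inner ℝ (χ.proj c α x) (ζ.proj c β x)) v w
      = inner ℝ (projVec χ c x v) (projVec ζ c x w) := by
    intro c hc
    simp only [← projVec_frame _ hc]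
    exact frameForm_eq hc (F := fun v w ↦ inner ℝ (projVec χ c x v) (projVec ζ c x w))
      (fun s t v v' w ↦ by
        simp only [projVec_add, inner_add_left, inner_smul_left, conj_trivial])
      (fun s t v w w' ↦ by
        simp only [projVec_add, inner_add_right, inner_smul_right]) v w
  rw [e a hx, e b hx', projVec_change χ ⟨hx, hx'⟩, projVec_change ζ ⟨hx, hx'⟩,
    inner_lift_mul ⟨hx, hx'⟩]

end FrameForm

/-! ### Independence of T from frames and charts -/

section Invariance

variable {M : Type*} [TopologicalSpace M] [ChartedSpace ℂ M] [IsManifold 𝓘(ℝ, ℂ) ∞ M]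
  {g : SurfaceMetric M} {ι : Type*}
  {n : ℕ} {N : Type*} [TopologicalSpace N] [ChartedSpace (EuclideanSpace ℝ (Fin n)) N]
  [IsManifold (𝓡 n) ∞ N]
  {σ : SpinStructure g ι} (h : TargetMetric n N) {φ : M → N} (ψ : VectorSpinor n σ φ)
  (χ : Gravitino σ)
  {a b : ι} {y y' : OpenPartialHomeomorph N (EuclideanSpace ℝ (Fin n))}

/-- The components of `dφ(v)`. -/
def pushVec (φ : M → N) (y : OpenPartialHomeomorph N (EuclideanSpace ℝ (Fin n))) (x : M)
    (v : TangentSpace 𝓘(ℝ, ℂ) x) (i : Fin n) : ℝ :=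
  coordForm y i (φ x) (mfderiv 𝓘(ℝ, ℂ) (𝓡 n) φ x v)

lemma pushVec_add {x : M} (s t : ℝ) (v w : TangentSpace 𝓘(ℝ, ℂ) x) :
    pushVec φ y x (s • v + t • w) = s • pushVec φ y x v + t • pushVec φ y x w := by
  ext1 i
  simp only [pushVec, Pi.add_apply, Pi.smul_apply]
  rw [map_add, map_smul, map_smul, map_add, map_smul, map_smul]

lemma hin_chart {H H' J : Fin n → Fin n → ℝ}
    (hH : ∀ a b, H a b = ∑ i, ∑ j, H' i j * (J i a * J j b)) (s t : Fin n → Quaternion ℝ) :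
    hin H' (fun i ↦ ∑ a, J i a • s a) (fun i ↦ ∑ a, J i a • t a) = hin H s t := by
  have e : ∀ i j, inner ℝ (∑ a, J i a • s a) (∑ a, J j a • t a)
      = ∑ a, ∑ c, J i a * J j c * inner ℝ (s a) (t c) := fun i j ↦ by
    simpa using inner_sum_mul_sum (J i) (J j) s t 1
  simp only [hin, hH, e]
  simp only [Finset.mul_sum, Finset.sum_mul]
  rw [sum_comm_pairs]
  refine Finset.sum_congr rfl fun a _ ↦ Finset.sum_congr rfl fun b _ ↦
    Finset.sum_congr rfl fun i _ ↦ Finset.sum_congr rfl fun j _ ↦ ?_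
  ring

variable (hφ : ContMDiff 𝓘(ℝ, ℂ) (𝓡 n) ∞ φ) (hy : y ∈ IsManifold.maximalAtlas (𝓡 n) ∞ N)
  (hy' : y' ∈ IsManifold.maximalAtlas (𝓡 n) ∞ N) {x : M} (hx : x ∈ σ.U a) (hx' : x ∈ σ.U b)
  (hxy : φ x ∈ y.source) (hxy' : φ x ∈ y'.source)

include hφ hy hxy in
lemma push_eq_pushVec (α : Fin 2) (i : Fin n) :
    push σ φ a y α i x = pushVec φ y x (σ.frame a α x) i := by
  have h1 := mfderiv_comp x (mdifferentiableAt_chart hy hxy) (hφ.mdifferentiableAt (by simp))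
  have h2 := mfderiv_comp x
      (EuclideanSpace.proj i : EuclideanSpace ℝ (Fin n) →L[ℝ] ℝ).mdifferentiableAt
      ((mdifferentiableAt_chart hy hxy).comp x (hφ.mdifferentiableAt (by simp)))
  rw [ContinuousLinearMap.mfderiv_eq, h1] at h2
  exact congrArg (fun L : TangentSpace 𝓘(ℝ, ℂ) x →L[ℝ] ℝ ↦ L (σ.frame a α x)) h2

include hy hy' hxy hxy' in
lemma pushVec_chart (v : TangentSpace 𝓘(ℝ, ℂ) x) (i : Fin n) :
    pushVec φ y' x v i = ∑ j, jac y y' i j (y (φ x)) * pushVec φ y x v j :=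
  coordForm_chart hy hy' hxy hxy' i _

include hy hy' hxy hxy' in
lemma comp_chart (i : Fin n) :
    ψ.comp a y' i x = ∑ j, jac y y' i j (y (φ x)) • ψ.comp a y j x :=
  coeff_sum _ _ (fun w ↦ coordForm_chart hy hy' hxy hxy' i w) _

include hx hx' in
lemma comp_change (i : Fin n) : ψ.comp a y i x = σ.lift a b x * ψ.comp b y i x := by
  simp only [VectorSpinor.comp, ψ.compat a b x ⟨hx, hx'⟩, coeff_spinAct]

include hy hy' hxy hxy' in
lemma metricCoeff_chart (i j : Fin n) : metricCoeff h y (y (φ x)) i j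
    = ∑ k, ∑ l, metricCoeff h y' (y' (φ x)) k l
      * (jac y y' k i (y (φ x)) * jac y y' l j (y (φ x))) := by
  have h1 := metricFn_chart h hy hy' (y.map_source hxy) (by rwa [y.left_inv hxy]) i j
  rw [y.left_inv hxy] at h1
  exact h1

include hφ hy hy' hx hx' hxy hxy' in
lemma frameForm_pushInner (v w : TangentSpace 𝓘(ℝ, ℂ) x) :
    frameForm σ a x (fun α β ↦ pushInner σ h φ a y α β x) v w
      = frameForm σ b x (fun α β ↦ pushInner σ h φ b y' α β x) v w := by
  have e : ∀ c y, y ∈ IsManifold.maximalAtlas (𝓡 n) ∞ N → φ x ∈ y.source → x ∈ σ.U c →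
      frameForm σ c x (fun α β ↦ pushInner σ h φ c y α β x) v w
      = h.inner (φ x) (mfderiv 𝓘(ℝ, ℂ) (𝓡 n) φ x v) (mfderiv 𝓘(ℝ, ℂ) (𝓡 n) φ x w) := by
    intro c y hy hxy hc
    have e1 : ∀ α β, pushInner σ h φ c y α β x
        = h.inner (φ x) (mfderiv 𝓘(ℝ, ℂ) (𝓡 n) φ x (σ.frame c α x))
          (mfderiv 𝓘(ℝ, ℂ) (𝓡 n) φ x (σ.frame c β x)) := by
      intro α β
      rw [inner_eq_sum_coordForm h hy hxy]
      simp only [pushInner, push_eq_pushVec (σ := σ) hφ hy hxy]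
      rfl
    simp only [e1]
    refine frameForm_eq hc (F := fun v w ↦ h.inner (φ x) (mfderiv 𝓘(ℝ, ℂ) (𝓡 n) φ x v)
      (mfderiv 𝓘(ℝ, ℂ) (𝓡 n) φ x w)) ?_ ?_ v w
    · intro s t v v' w
      simp only [map_add, map_smul, add_apply, smul_apply, smul_eq_mul]
    · intro s t v w w'
      simp only [map_add, map_smul, smul_eq_mul]
  rw [e a y hy hxy hx, e b y' hy' hxy' hx']

include hφ hy hy' hx hx' hxy hxy' in
lemma frameForm_coupling (v w : TangentSpace 𝓘(ℝ, ℂ) x) :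
    frameForm σ a x (fun α β ↦ coupling h ψ χ a y α β x) v w
      = frameForm σ b x (fun α β ↦ coupling h ψ χ b y' α β x) v w := by
  have e : ∀ c y, y ∈ IsManifold.maximalAtlas (𝓡 n) ∞ N → φ x ∈ y.source → x ∈ σ.U c →
      frameForm σ c x (fun α β ↦ coupling h ψ χ c y α β x) v w
      = hin (metricCoeff h y (y (φ x))) (tens (pushVec φ y x v) (projVec χ c x w))
        (fun i ↦ ψ.comp c y i x) := by
    intro c y hy hxy hc
    simp only [coupling, push_eq_pushVec (σ := σ) hφ hy hxy, ← projVec_frame χ hc]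
    set H : Fin n → Fin n → ℝ := metricCoeff h y (y (φ x))
    refine frameForm_eq hc (F := fun v w ↦ hin H (tens (pushVec φ y x v) (projVec χ c x w))
        (fun i ↦ ψ.comp c y i x)) ?_ ?_ v w
    · intro s t v v' w
      have : tens (pushVec φ y x (s • v + t • v')) (projVec χ c x w)
          = s • tens (pushVec φ y x v) (projVec χ c x w)
            + t • tens (pushVec φ y x v') (projVec χ c x w) := by
        ext1 i
        simp only [pushVec_add, tens, Pi.add_apply, Pi.smul_apply, smul_eq_mul]
        module
      simp only [this, hin_add_left, hin_smul_left]
    · intro s t v w w'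
      have : tens (pushVec φ y x v) (projVec χ c x (s • w + t • w'))
          = s • tens (pushVec φ y x v) (projVec χ c x w)
            + t • tens (pushVec φ y x v) (projVec χ c x w') := by
        ext1 i
        simp only [projVec_add, tens, Pi.add_apply, Pi.smul_apply]
        module
      simp only [this, hin_add_left, hin_smul_left]
  rw [e a y hy hxy hx, e b y' hy' hxy' hx']
  have h1 : tens (pushVec φ y' x v) (projVec χ b x w)
      = fun i ↦ ∑ j, jac y y' i j (y (φ x)) • tens (pushVec φ y x v) (projVec χ b x w) j := by
    ext1 i
    simp only [tens, pushVec_chart hy hy' hxy hxy', Finset.sum_smul, mul_smul]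
  have h2 : (fun i ↦ ψ.comp b y' i x) = fun i ↦ ∑ j, jac y y' i j (y (φ x)) • ψ.comp b y j x :=
    funext fun i ↦ comp_chart ψ hy hy' hxy hxy' i
  rw [h1, h2, hin_chart (metricCoeff_chart h hy hy' hxy hxy')]
  simp only [hin, tens, comp_change ψ hx hx', projVec_change χ ⟨hx, hx'⟩, ← mul_smul_comm,
    inner_lift_mul ⟨hx, hx'⟩]

include hy hy' hx hx' hxy hxy' in
lemma normSqSpinor_invariant :
    normSqSpinor σ h φ ψ a y x = normSqSpinor σ h φ ψ b y' x := by
  have h2 : (fun i ↦ ψ.comp b y' i x) = fun i ↦ ∑ j, jac y y' i j (y (φ x)) • ψ.comp b y j x :=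
    funext fun i ↦ comp_chart ψ hy hy' hxy hxy' i
  rw [normSqSpinor, normSqSpinor, pairing_eq, pairing_eq, h2,
    hin_chart (metricCoeff_chart h hy hy' hxy hxy')]
  simp only [hin, comp_change ψ hx hx', inner_lift_mul ⟨hx, hx'⟩]

include hφ hy hy' hx hx' hxy hxy' in
lemma frameForm_kinetic (v w : TangentSpace 𝓘(ℝ, ℂ) x) :
    frameForm σ a x (fun α β ↦ kinetic h ψ a y α β x) v w
      = frameForm σ b x (fun α β ↦ kinetic h ψ b y' α β x) v w := by
  obtain ⟨z, hz, q, hq, rfl⟩ : ∃ z ∈ IsManifold.maximalAtlas 𝓘(ℝ, ℂ) ∞ M, ∃ q ∈ z.target,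
      z.symm q = x :=
    ⟨chartAt ℂ x, IsManifold.chart_mem_maximalAtlas x, chartAt ℂ x x, mem_chart_target ℂ x,
      (chartAt ℂ x).left_inv (mem_chart_source ℂ x)⟩
  have e : ∀ c y, y ∈ IsManifold.maximalAtlas (𝓡 n) ∞ N → φ (z.symm q) ∈ y.source →
      z.symm q ∈ σ.U c →
      frameForm σ c _ (fun α β ↦ kinetic h ψ c y α β (z.symm q)) v w
      = kinForm h ψ c y z q (dchart z (z.symm q) w) (cliffVec σ c _ v) := by
    intro c y hy hxy hc
    simp only [kinetic_eq_kinForm h ψ hφ hy hz hq hc hxy, ← cliffVec_frame hc]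
    refine frameForm_eq hc (F := fun v w ↦ kinForm h ψ c y z q (dchart z (z.symm q) w)
      (cliffVec σ c _ v)) ?_ ?_ v w
    · intro s t v v' w
      simp only [cliffVec_add, kinForm]
      exact kinExpr_add_mul _ _ _ _
    · intro s t v w w'
      simp only [kinForm, map_add, map_smul]
      exact kinExpr_add_deriv _ _ _ _ _ _
  rw [e a y hy hxy hx, e b y' hy' hxy' hx', kinForm_frame h ψ hφ hy hz hq hx hx' hxy,
    kinForm_chart h ψ hφ hy hy' hz hq hx' hxy hxy' (re_cliffVec _ _)]

include hφ hy hy' hx hx' hxy hxy' in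
/-- On shell, the energy-momentum tensor does not depend on frames and charts. -/
lemma emTensorLocal_invariant (hEL : EulerLagrange σ h φ ψ χ)
    (hcrit : ∀ s, gravitinoEq h ψ χ a y x s = 0) (hcrit' : ∀ s, gravitinoEq h ψ χ b y' x s = 0)
    (v w : TangentSpace 𝓘(ℝ, ℂ) x) :
    emTensorLocal σ h φ ψ χ a y x v w = emTensorLocal σ h φ ψ χ b y' x v w := by
  have e : ∀ c y, y ∈ IsManifold.maximalAtlas (𝓡 n) ∞ N → φ x ∈ y.source → x ∈ σ.U c →
      (∀ s, gravitinoEq h ψ χ c y x s = 0) → emTensorLocal σ h φ ψ χ c y x v w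
      = 2 * frameForm σ c x (fun α β ↦ pushInner σ h φ c y α β x) v w
        + 1 / 2 * (frameForm σ c x (fun α β ↦ kinetic h ψ c y α β x) v w
          + frameForm σ c x (fun α β ↦ kinetic h ψ c y α β x) w v)
        - 2 * (frameForm σ c x (fun α β ↦ coupling h ψ χ c y α β x) v w
          + frameForm σ c x (fun α β ↦ coupling h ψ χ c y α β x) w v)
        - (pushInner σ h φ c y 0 0 x + pushInner σ h φ c y 1 1 x
          + 1 / 2 * (kinetic h ψ c y 0 0 x + kinetic h ψ c y 1 1 x)
          - 2 * (coupling h ψ χ c y 0 0 x + coupling h ψ χ c y 1 1 x)) * g.inner x v w := by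
    intro c y hy hxy hc hcr
    -- The multiple of g in T contains Rm(ψ). Tracelessness expresses it by the traces of the other
    -- terms, whose invariance is known, so the curvature need not be transformed.
    have ht := emCoeff_trace h ψ χ hy hEL hc hxy hcr
    simp only [emCoeff_eq, if_true] at ht
    simp only [emTensorLocal, emCoeff_eq, frameForm, Fin.sum_univ_two, if_true, zero_ne_one,
      one_ne_zero, if_false, inner_eq_sum_frame hc v w]
    linear_combination (1 / 2) * (g.inner x (σ.frame c 0 x) v * g.inner x (σ.frame c 0 x) w
      + g.inner x (σ.frame c 1 x) v * g.inner x (σ.frame c 1 x) w) * ht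
  rw [e a y hy hxy hx hcrit, e b y' hy' hxy' hx' hcrit']
  have h1 := frameForm_pushInner (σ := σ) h hφ hy hy' hx hx' hxy hxy'
  have h2 := frameForm_kinetic h ψ hφ hy hy' hx hx' hxy hxy'
  have h3 := frameForm_coupling h ψ χ hφ hy hy' hx hx' hxy hxy'
  have t1 := frameForm_trace hx hx' h1
  have t2 := frameForm_trace hx hx' h2
  have t3 := frameForm_trace hx hx' h3
  simp only [h1, h2, h3, t1, t2, t3]

end Invariance

/-! ### The volume measure is finite and positive on open sets -/

section Volume

variable {M : Type*} [TopologicalSpace M] [ChartedSpace ℂ M] [IsManifold 𝓘(ℝ, ℂ) ∞ M]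
  (g : SurfaceMetric M) {z z' : OpenPartialHomeomorph M ℂ}

/-- The Gram determinant `det g` in a chart. -/
def gramDet (z : OpenPartialHomeomorph M ℂ) (p : ℂ) : ℝ :=
  surfaceCoeff g z 1 1 p * surfaceCoeff g z Complex.I Complex.I p - surfaceCoeff g z 1 Complex.I p ^ 2

/-- The measure `√(det g) dx dy` of a chart. -/
def chartMeasure [MeasurableSpace M] (z : OpenPartialHomeomorph M ℂ) : Measure M :=
  Measure.map z.symm (((volume : Measure ℂ).restrict z.target).withDensity fun p ↦
    ENNReal.ofReal √(gramDet g z p))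

lemma volumeMeasure_eq [MeasurableSpace M] : volumeMeasure g
    = ⨆ z ∈ IsManifold.maximalAtlas 𝓘(ℝ, ℂ) ∞ M, chartMeasure g z := rfl

lemma surfaceCoeff_eq (v w p : ℂ) : surfaceCoeff g z v w p
    = v.re * w.re * surfaceCoeff g z 1 1 p
      + (v.re * w.im + v.im * w.re) * surfaceCoeff g z 1 Complex.I p
      + v.im * w.im * surfaceCoeff g z Complex.I Complex.I p := by
  have hs : surfaceCoeff g z Complex.I 1 p = surfaceCoeff g z 1 Complex.I p := g.symm _ _ _
  have he : ∀ w : ℂ, w = w.re • (1 : ℂ) + w.im • Complex.I := fun w ↦ by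
    simp [Complex.re_add_im]
  have hv : ∀ w : ℂ, coordVec z w p = w.re • coordVec z 1 p + w.im • coordVec z Complex.I p := by
    intro w
    have h1 := congrArg (dchartSymm z p) (he w)
    rw [map_add, map_smul, map_smul] at h1
    exact h1
  rw [show surfaceCoeff g z v w p = g.inner (z.symm p) (coordVec z v p) (coordVec z w p) from rfl,
    hv v, hv w]
  simp only [map_add, map_smul, add_apply, smul_apply, smul_eq_mul]
  change w.re * (v.re * surfaceCoeff g z 1 1 p + v.im * surfaceCoeff g z Complex.I 1 p)
    + w.im * (v.re * surfaceCoeff g z 1 Complex.I p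
      + v.im * surfaceCoeff g z Complex.I Complex.I p) = _
  rw [hs]
  ring

variable (hz : z ∈ IsManifold.maximalAtlas 𝓘(ℝ, ℂ) ∞ M)
  (hz' : z' ∈ IsManifold.maximalAtlas 𝓘(ℝ, ℂ) ∞ M)

include hz in
lemma continuousOn_gramDet : ContinuousOn (gramDet g z) z.target := by
  have hc := fun v w : ℂ ↦ (contDiffOn_metric g hz v w).continuousOn
  exact ((hc _ _).mul (hc _ _)).sub ((hc _ _).pow 2)

include hz in
lemma gramDet_pos {p : ℂ} (hp : p ∈ z.target) : 0 < gramDet g z p := by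
  have hpos : ∀ w : ℂ, w ≠ 0 → 0 < surfaceCoeff g z w w p := by
    intro w hw
    refine g.pos _ _ fun h0 ↦ hw ?_
    have := dchart_dchartSymm hz hp w
    rw [← this, show dchartSymm z p w = 0 from h0, map_zero]
  have h1 := hpos 1 one_ne_zero
  set A := surfaceCoeff g z 1 1 p
  set B := surfaceCoeff g z 1 Complex.I p with hB
  -- With A, B, C the coefficients of g, this vector is orthogonal to ∂_x and has squared length
  -- A(AC - B²).
  have h2 := hpos ⟨-B, A⟩ (by
    intro h0
    have := congrArg Complex.im h0
    exact h1.ne' this)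
  rw [surfaceCoeff_eq] at h2
  change 0 < A * _ - B ^ 2
  have h3 : 0 < A * (A * surfaceCoeff g z Complex.I Complex.I p - B ^ 2) := by
    refine h2.trans_eq ?_
    simp only
    ring
  exact (pos_iff_pos_of_mul_pos h3).mp h1

include hz hz' in
lemma contDiffAt_transition {p : ℂ} (hp : p ∈ z'.target) (hp' : z'.symm p ∈ z.source) :
    ContDiffAt ℝ ∞ (z ∘ z'.symm) p :=
  (contDiffOn_comp_symm hz' (contMDiffOn_of_mem_maximalAtlas hz)).contDiffAt
    ((z'.isOpen_inter_preimage_symm z.open_source).mem_nhds ⟨hp, hp'⟩)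

include hz hz' in
lemma dchart_coordVec {p : ℂ} (hp : p ∈ z'.target) (hp' : z'.symm p ∈ z.source) (v : ℂ) :
    dchart z (z'.symm p) (coordVec z' v p) = fderiv ℝ (z ∘ z'.symm) p v := by
  have h1 := mfderiv_eq_fderiv_chart hz' hp (mdifferentiableAt_chart hz hp') (coordVec z' v p)
  refine h1.trans ?_
  rw [show dchart z' (z'.symm p) (coordVec z' v p) = v from dchart_dchartSymm hz' hp v]

include hz in
lemma inner_eq_surfaceCoeff {x : M} (hx : x ∈ z.source) (v w : TangentSpace 𝓘(ℝ, ℂ) x) :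
    g.inner x v w = surfaceCoeff g z (dchart z x v) (dchart z x w) (z x) := by
  obtain ⟨u, hu, rfl⟩ : ∃ u ∈ z.target, z.symm u = x := ⟨z x, z.map_source hx, z.left_inv hx⟩
  have h1 := dchartSymm_dchart hz hu
  rw [z.right_inv hu, surfaceCoeff, show coordVec z (dchart z (z.symm u) v) u = v from h1 v,
    show coordVec z (dchart z (z.symm u) w) u = w from h1 w]

include hz hz' in
lemma surfaceCoeff_transition {p : ℂ} (hp : p ∈ z'.target) (hp' : z'.symm p ∈ z.source) (v w : ℂ) :
    surfaceCoeff g z' v w p = surfaceCoeff g z (fderiv ℝ (z ∘ z'.symm) p v)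
      (fderiv ℝ (z ∘ z'.symm) p w) ((z ∘ z'.symm) p) := by
  rw [← dchart_coordVec hz hz' hp hp', ← dchart_coordVec hz hz' hp hp']
  exact inner_eq_surfaceCoeff g hz hp' _ _

lemma det_complex (L : ℂ →L[ℝ] ℂ) :
    L.det = (L 1).re * (L Complex.I).im - (L Complex.I).re * (L 1).im := by
  rw [ContinuousLinearMap.det, ← LinearMap.det_toMatrix Complex.basisOneI, Matrix.det_fin_two]
  simp [LinearMap.toMatrix_apply]

include hz hz' in
lemma gramDet_transition {p : ℂ} (hp : p ∈ z'.target) (hp' : z'.symm p ∈ z.source) :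
    gramDet g z' p = (fderiv ℝ (z ∘ z'.symm) p).det ^ 2 * gramDet g z ((z ∘ z'.symm) p) := by
  simp only [gramDet, det_complex]
  rw [surfaceCoeff_transition g hz hz' hp hp', surfaceCoeff_transition g hz hz' hp hp',
    surfaceCoeff_transition g hz hz' hp hp', surfaceCoeff_eq g (fderiv ℝ (z ∘ z'.symm) p 1),
    surfaceCoeff_eq g (fderiv ℝ (z ∘ z'.symm) p 1),
    surfaceCoeff_eq g (fderiv ℝ (z ∘ z'.symm) p Complex.I)]
  ring

variable [MeasurableSpace M] [BorelSpace M]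

lemma measurableSet_preimage_symm (z : OpenPartialHomeomorph M ℂ) {A : Set M}
    (hA : MeasurableSet A) : MeasurableSet (z.symm ⁻¹' A ∩ z.target) := by
  have h1 : Continuous (z.target.domRestrict z.symm) :=
    continuousOn_iff_continuous_domRestrict.mp z.continuousOn_symm
  have h2 := MeasurableSet.subtype_image z.open_target.measurableSet (h1.measurable hA)
  convert h2 using 1
  ext p
  simp [Set.domRestrict, and_comm]

lemma chartMeasure_apply {A : Set M} (hA : MeasurableSet A) : chartMeasure g z A
    = ∫⁻ p in z.symm ⁻¹' A ∩ z.target, ENNReal.ofReal √(gramDet g z p) := by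
  have hm : AEMeasurable z.symm (((volume : Measure ℂ).restrict z.target).withDensity fun p ↦
      ENNReal.ofReal √(gramDet g z p)) :=
    (z.continuousOn_symm.aemeasurable z.open_target.measurableSet).mono_ac
      (withDensity_absolutelyContinuous _ _)
  rw [chartMeasure, Measure.map_apply_of_aemeasurable hm hA, withDensity_apply',
    Measure.restrict_restrict' z.open_target.measurableSet]

include hz hz' in
-- Change of variables: the Jacobian |det| is the factor by which √(det g) transforms.
lemma chartMeasure_eq {A : Set M} (hA : MeasurableSet A) (h : A ⊆ z.source) (h' : A ⊆ z'.source) :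
    chartMeasure g z A = chartMeasure g z' A := by
  rw [chartMeasure_apply g hA, chartMeasure_apply g hA]
  have hS : z.symm ⁻¹' A ∩ z.target = (z ∘ z'.symm) '' (z'.symm ⁻¹' A ∩ z'.target) := by
    ext p
    constructor
    · rintro ⟨hp, hpt⟩
      refine ⟨z' (z.symm p), ⟨?_, z'.map_source (h' hp)⟩, ?_⟩
      · rwa [Set.mem_preimage, z'.left_inv (h' hp)]
      · simp only [Function.comp_apply, z'.left_inv (h' hp), z.right_inv hpt]
    · rintro ⟨p, ⟨hp, hpt⟩, rfl⟩
      refine ⟨?_, z.map_source (h hp)⟩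
      rw [Set.mem_preimage, Function.comp_apply, z.left_inv (h hp)]
      exact hp
  have hinj : Set.InjOn (z ∘ z'.symm) (z'.symm ⁻¹' A ∩ z'.target) :=
    z.injOn.comp (z'.symm.injOn.mono Set.inter_subset_right) fun p hp ↦ h hp.1
  have hm := measurableSet_preimage_symm z' hA
  rw [hS, lintegral_image_eq_lintegral_abs_det_fderiv_mul volume hm (fun p hp ↦
    ((contDiffAt_transition hz hz' hp.2 (h hp.1)).differentiableAt
      (by simp)).hasFDerivAt.hasFDerivWithinAt) hinj]
  refine setLIntegral_congr_fun hm fun p hp ↦ ?_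
  rw [gramDet_transition g hz hz' hp.2 (h hp.1), Real.sqrt_mul (sq_nonneg _), Real.sqrt_sq_eq_abs,
    ENNReal.ofReal_mul (abs_nonneg _)]

include hz in
lemma chartMeasure_lt_top {K : Set M} (hK : IsCompact K) (hKm : MeasurableSet K)
    (hKz : K ⊆ z.source) : chartMeasure g z K < ⊤ := by
  rw [chartMeasure_apply g hKm]
  have hS : z.symm ⁻¹' K ∩ z.target = z '' K := by
    rw [Set.inter_comm, ← z.image_eq_target_inter_inv_preimage hKz]
  have hc : IsCompact (z '' K) := hK.image_of_continuousOn (z.continuousOn.mono hKz)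
  have hsub : z '' K ⊆ z.target := by
    rintro _ ⟨x, hx, rfl⟩
    exact z.map_source (hKz hx)
  have hcont : ContinuousOn (fun p ↦ √(gramDet g z p)) (z '' K) :=
    (continuousOn_gramDet g hz).sqrt.mono hsub
  rw [hS]
  obtain ⟨C, hC⟩ := hc.bddAbove_image hcont
  refine (setLIntegral_mono' hc.measurableSet (g := fun _ ↦ ENNReal.ofReal C) fun p hp ↦
    ENNReal.ofReal_le_ofReal (hC ⟨p, hp, rfl⟩)).trans_lt ?_
  rw [setLIntegral_const]
  exact ENNReal.mul_lt_top ENNReal.ofReal_lt_top hc.measure_lt_top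

/-- Finitely many compact sets lying in charts cover M. Since chart measures agree on common
domains, the supremum is bounded by the sum of finitely many of them restricted to these compacts,
on each of which the density is bounded. -/
lemma isFiniteMeasure_volumeMeasure [T2Space M] [CompactSpace M] :
    IsFiniteMeasure (volumeMeasure g) := by
  have : LocallyCompactSpace M := ChartedSpace.locallyCompactSpace ℂ M
  have hK : ∀ x : M, ∃ K : Set M, K ∈ nhds x ∧ K ⊆ (chartAt ℂ x).source ∧ IsCompact K :=
    fun x ↦ local_compact_nhds ((chartAt ℂ x).open_source.mem_nhds (mem_chart_source ℂ x))
  choose K hKn hKs hKc using hK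
  obtain ⟨t, -, ht⟩ := isCompact_univ.elim_nhds_subcover K fun x _ ↦ hKn x
  have hle : volumeMeasure g ≤ ∑ x ∈ t, (chartMeasure g (chartAt ℂ x)).restrict (K x) := by
    rw [volumeMeasure_eq]
    refine iSup₂_le fun z hz ↦ Measure.le_iff.mpr fun A hA ↦ ?_
    have hz0 : chartMeasure g z A = chartMeasure g z (A ∩ z.source) := by
      rw [chartMeasure_apply g hA, chartMeasure_apply g (hA.inter z.open_source.measurableSet)]
      congr 2
      ext p
      exact ⟨fun hp ↦ ⟨⟨hp.1, z.map_target hp.2⟩, hp.2⟩, fun hp ↦ ⟨hp.1.1, hp.2⟩⟩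
    rw [hz0, Measure.finsetSum_apply]
    have h1 : A ∩ z.source ⊆ ⋃ x ∈ t, A ∩ z.source ∩ K x := by
      intro p hp
      obtain ⟨x, hx, hpx⟩ := Set.mem_iUnion₂.mp (ht (Set.mem_univ p))
      exact Set.mem_iUnion₂.mpr ⟨x, hx, hp, hpx⟩
    refine (measure_mono h1).trans ((measure_biUnion_finset_le t _).trans
      (Finset.sum_le_sum fun x _ ↦ ?_))
    rw [Measure.restrict_apply hA, chartMeasure_eq g hz (IsManifold.chart_mem_maximalAtlas x)
      ((hA.inter z.open_source.measurableSet).inter (hKc x).measurableSet)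
      (fun p hp ↦ hp.1.2) fun p hp ↦ hKs x hp.2]
    exact measure_mono fun p hp ↦ ⟨hp.1.1, hp.2⟩
  refine ⟨(hle Set.univ).trans_lt ?_⟩
  rw [Measure.finsetSum_apply]
  refine ENNReal.sum_lt_top.mpr fun x _ ↦ ?_
  rw [Measure.restrict_apply MeasurableSet.univ, Set.univ_inter]
  exact chartMeasure_lt_top g (IsManifold.chart_mem_maximalAtlas x) (hKc x) (hKc x).measurableSet
    (hKs x)

/-- The volume dominates the measure of a single chart, whose density is positive. -/
lemma isOpenPosMeasure_volumeMeasure : (volumeMeasure g).IsOpenPosMeasure := by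
  refine ⟨fun O hO ⟨x, hx⟩ h0 ↦ ?_⟩
  set z := chartAt ℂ x
  have hz : z ∈ IsManifold.maximalAtlas 𝓘(ℝ, ℂ) ∞ M := IsManifold.chart_mem_maximalAtlas x
  have h1 : chartMeasure g z O = 0 := by
    refine le_antisymm ?_ zero_le
    rw [← h0, volumeMeasure_eq]
    exact (le_iSup₂_of_le (f := fun z (_ : z ∈ IsManifold.maximalAtlas 𝓘(ℝ, ℂ) ∞ M) ↦
      chartMeasure g z) z hz le_rfl) O
  have hSo : IsOpen (z.symm ⁻¹' O ∩ z.target) := by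
    rw [Set.inter_comm]
    exact z.isOpen_inter_preimage_symm hO
  have hne : (z.symm ⁻¹' O ∩ z.target).Nonempty :=
    ⟨z x, by rwa [Set.mem_preimage, z.left_inv (mem_chart_source ℂ x)], mem_chart_target ℂ x⟩
  rw [chartMeasure_apply g hO.measurableSet] at h1
  have hm : AEMeasurable (fun p ↦ ENNReal.ofReal √(gramDet g z p))
      (volume.restrict (z.symm ⁻¹' O ∩ z.target)) :=
    (((continuousOn_gramDet g hz).sqrt.mono
      Set.inter_subset_right).aemeasurable hSo.measurableSet).ennreal_ofReal
  rw [lintegral_eq_zero_iff' hm] at h1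
  have h2 := (ae_restrict_iff' hSo.measurableSet).mp h1
  refine hSo.measure_ne_zero volume hne (measure_mono_null (fun p hp ↦ ?_) h2)
  simp only [Set.mem_compl_iff, Set.mem_ofPred_eq, Classical.not_imp]
  refine ⟨hp, fun h3 ↦ ?_⟩
  simp only [Pi.zero_apply, ENNReal.ofReal_eq_zero] at h3
  exact absurd h3 (not_le.mpr (Real.sqrt_pos.mpr (gramDet_pos g hz hp.2)))

end Volume

/-! ### Linear variations of the gravitino -/

section Variation

variable {M : Type*} [TopologicalSpace M] [ChartedSpace ℂ M] [IsManifold 𝓘(ℝ, ℂ) ∞ M]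
  {g : SurfaceMetric M} {ι : Type*} {σ : SpinStructure g ι} (χ ζ : Gravitino σ)

/-- The gravitino `χ + t ζ`. -/
def Gravitino.perturb (t : ℝ) : Gravitino σ where
  val a x := χ.val a x + t • ζ.val a x
  compat a b x hx := by
    rw [χ.compat a b x hx, ζ.compat a b x hx, map_add, map_smul]
  smooth a α := by
    have h1 := (χ.smooth a α).add
      ((t • ContinuousLinearMap.id ℝ (Quaternion ℝ)).contMDiff.comp_contMDiffOn (ζ.smooth a α))
    refine h1.congr fun x _ ↦ ?_
    simp only [map_add, map_smul]
    rfl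

lemma comp_perturb (t : ℝ) (a : ι) (α : Fin 2) (x : M) :
    (χ.perturb ζ t).comp a α x = χ.comp a α x + t • ζ.comp a α x := by
  simp only [Gravitino.comp, Gravitino.perturb, map_add, map_smul]

lemma proj_perturb (t : ℝ) (a : ι) (α : Fin 2) (x : M) :
    (χ.perturb ζ t).proj a α x = χ.proj a α x + t • ζ.proj a α x := by
  simp only [Gravitino.proj, comp_perturb, Fin.sum_univ_two, mul_add, mul_smul_comm]
  module

lemma perturb_zero : χ.perturb ζ 0 = χ := by
  simp only [Gravitino.perturb, zero_smul, add_zero]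

lemma smoothFamily_perturb : SmoothFamily (χ.perturb ζ) := by
  intro a α
  have hf : ∀ ξ : Gravitino σ, ContMDiffOn (𝓘(ℝ, ℝ).prod 𝓘(ℝ, ℂ)) 𝓘(ℝ, Quaternion ℝ) ∞
      (fun p : ℝ × M ↦ ξ.comp a α p.2) (Set.univ ×ˢ σ.U a) := fun ξ ↦
    (ξ.smooth a α).comp contMDiff_snd.contMDiffOn fun p hp ↦ hp.2
  exact ((hf χ).add ((contMDiff_fst (I := 𝓘(ℝ, ℝ)) (J := 𝓘(ℝ, ℂ))).contMDiffOn.smul (hf ζ))).congr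
    fun p _ ↦ comp_perturb χ ζ p.1 a α p.2

variable {n : ℕ} {N : Type*} [TopologicalSpace N] [ChartedSpace (EuclideanSpace ℝ (Fin n)) N]
  [IsManifold (𝓡 n) ∞ N]
  (h : TargetMetric n N) {φ : M → N} (ψ : VectorSpinor n σ φ)
  {a b : ι} {y y' : OpenPartialHomeomorph N (EuclideanSpace ℝ (Fin n))} {x : M}

lemma lagrangianLocal_eq : lagrangianLocal σ h φ ψ χ a y x
    = pushInner σ h φ a y 0 0 x + pushInner σ h φ a y 1 1 x
      + (kinetic h ψ a y 0 0 x + kinetic h ψ a y 1 1 x)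
      - 4 * (coupling h ψ χ a y 0 0 x + coupling h ψ χ a y 1 1 x)
      - χ.projSq a x * normSqSpinor σ h φ ψ a y x - 1 / 6 * curvRm σ h φ ψ a y x := by
  rw [lagrangianLocal, pairing_dirac, pairing_pushProj, Fin.sum_univ_two]

lemma coupling_perturb (t : ℝ) (α β : Fin 2) : coupling h ψ (χ.perturb ζ t) a y α β x
    = coupling h ψ χ a y α β x + t * coupling h ψ ζ a y α β x := by
  have h1 : tens (fun i ↦ push σ φ a y α i x) ((χ.perturb ζ t).proj a β x)
      = tens (fun i ↦ push σ φ a y α i x) (χ.proj a β x)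
        + t • tens (fun i ↦ push σ φ a y α i x) (ζ.proj a β x) := by
    ext1 i
    simp only [tens, proj_perturb, Pi.add_apply, Pi.smul_apply]
    module
  rw [coupling, h1]
  refine (hin_add_left _ _ _ _).trans ?_
  exact congrArg _ (hin_smul_left _ _ _ _)

/-- The first variation of the Lagrangian with respect to the gravitino, up to the sign. -/
def firstVar (h : TargetMetric n N) (ψ : VectorSpinor n σ φ) (χ ζ : Gravitino σ) (a : ι)
    (y : OpenPartialHomeomorph N (EuclideanSpace ℝ (Fin n))) (x : M) : ℝ :=
  4 * (coupling h ψ ζ a y 0 0 x + coupling h ψ ζ a y 1 1 x)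
    + 2 * (inner ℝ (χ.proj a 0 x) (ζ.proj a 0 x) + inner ℝ (χ.proj a 1 x) (ζ.proj a 1 x))
      * normSqSpinor σ h φ ψ a y x

/-- The Lagrangian is a quadratic polynomial in χ, so the expansion is exact and no differentiation
under the integral is needed later. -/
lemma lagrangianLocal_perturb (t : ℝ) : lagrangianLocal σ h φ ψ (χ.perturb ζ t) a y x
    = lagrangianLocal σ h φ ψ χ a y x - t * firstVar h ψ χ ζ a y x
      - t ^ 2 * (ζ.projSq a x * normSqSpinor σ h φ ψ a y x) := by
  rw [lagrangianLocal_eq, lagrangianLocal_eq]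
  simp only [coupling_perturb, firstVar, Gravitino.projSq, proj_perturb, Fin.sum_univ_two,
    inner_add_left, inner_add_right, inner_smul_left, inner_smul_right, conj_trivial]
  rw [real_inner_comm (χ.proj a 0 x) (ζ.proj a 0 x), real_inner_comm (χ.proj a 1 x) (ζ.proj a 1 x)]
  ring

variable (hφ : ContMDiff 𝓘(ℝ, ℂ) (𝓡 n) ∞ φ) (hy : y ∈ IsManifold.maximalAtlas (𝓡 n) ∞ N)
  (hy' : y' ∈ IsManifold.maximalAtlas (𝓡 n) ∞ N) (hx : x ∈ σ.U a) (hx' : x ∈ σ.U b)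
  (hxy : φ x ∈ y.source) (hxy' : φ x ∈ y'.source)

include hx hx' in
lemma projSq_invariant : χ.projSq a x = χ.projSq b x := by
  simp only [Gravitino.projSq, Fin.sum_univ_two]
  exact frameForm_trace hx hx' (frameForm_proj χ χ hx hx')

include hφ hy hy' hx hx' hxy hxy' in
lemma firstVar_invariant : firstVar h ψ χ ζ a y x = firstVar h ψ χ ζ b y' x := by
  rw [firstVar, firstVar, frameForm_trace hx hx' (frameForm_proj χ ζ hx hx'),
    frameForm_trace hx hx' (frameForm_coupling h ψ ζ hφ hy hy' hx hx' hxy hxy'),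
    normSqSpinor_invariant h ψ hy hy' hx hx' hxy hxy']

/-- The Dirac equation paired with ψ eliminates Rm(ψ). The remaining terms are known to be invariant
and continuous. -/
lemma lagrangianLocal_onShell (hy : y ∈ IsManifold.maximalAtlas (𝓡 n) ∞ N) (hx : x ∈ σ.U a)
    (hxy : φ x ∈ y.source) (hEL : EulerLagrange σ h φ ψ χ) : lagrangianLocal σ h φ ψ χ a y x
    = pushInner σ h φ a y 0 0 x + pushInner σ h φ a y 1 1 x
      + 1 / 2 * (kinetic h ψ a y 0 0 x + kinetic h ψ a y 1 1 x)
      - 3 * (coupling h ψ χ a y 0 0 x + coupling h ψ χ a y 1 1 x)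
      - 1 / 2 * (χ.projSq a x * normSqSpinor σ h φ ψ a y x) := by
  rw [lagrangianLocal_eq]
  linear_combination (1 / 2) * kinetic_trace h ψ χ hy hEL hx hxy

include hφ hy hy' hx hx' hxy hxy' in
lemma lagrangianLocal_invariant (hEL : EulerLagrange σ h φ ψ χ) :
    lagrangianLocal σ h φ ψ χ a y x = lagrangianLocal σ h φ ψ χ b y' x := by
  rw [lagrangianLocal_onShell χ h ψ hy hx hxy hEL, lagrangianLocal_onShell χ h ψ hy' hx' hxy' hEL,
    frameForm_trace hx hx' (frameForm_pushInner (σ := σ) h hφ hy hy' hx hx' hxy hxy'),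
    frameForm_trace hx hx' (frameForm_kinetic h ψ hφ hy hy' hx hx' hxy hxy'),
    frameForm_trace hx hx' (frameForm_coupling h ψ χ hφ hy hy' hx hx' hxy hxy'),
    normSqSpinor_invariant h ψ hy hy' hx hx' hxy hxy', projSq_invariant χ hx hx']

end Variation

/-! ### Continuity of the Lagrangian and of the gravitino equation -/

section Continuity

variable {M : Type*} [TopologicalSpace M] [ChartedSpace ℂ M] [IsManifold 𝓘(ℝ, ℂ) ∞ M]
  {g : SurfaceMetric M} {ι : Type*} {σ : SpinStructure g ι} (χ : Gravitino σ)
  {n : ℕ} {N : Type*} [TopologicalSpace N] [ChartedSpace (EuclideanSpace ℝ (Fin n)) N]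
  [IsManifold (𝓡 n) ∞ N]
  (h : TargetMetric n N) {φ : M → N} (ψ : VectorSpinor n σ φ)
  {a b : ι} {y : OpenPartialHomeomorph N (EuclideanSpace ℝ (Fin n))} {x : M}

lemma contMDiffAt_of_comp_symm {F : Type*} [NormedAddCommGroup F] [NormedSpace ℝ F] {f : M → F}
    {z : OpenPartialHomeomorph M ℂ} (hz : z ∈ IsManifold.maximalAtlas 𝓘(ℝ, ℂ) ∞ M)
    (hx : x ∈ z.source) (hf : ContDiffAt ℝ ∞ (f ∘ z.symm) (z x)) :
    ContMDiffAt 𝓘(ℝ, ℂ) 𝓘(ℝ, F) ∞ f x := by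
  refine (hf.contMDiffAt.comp x (contMDiffAt_of_mem_maximalAtlas hz hx)).congr_of_eventuallyEq ?_
  filter_upwards [z.open_source.mem_nhds hx] with p hp
  simp only [Function.comp_apply, z.left_inv hp]

lemma contMDiffOn_inner_frame (α β : Fin 2) : ContMDiffOn 𝓘(ℝ, ℂ) 𝓘(ℝ, ℝ) ∞
    (fun x ↦ g.inner x (σ.frame a α x) (σ.frame b β x)) (σ.U a ∩ σ.U b) := by
  intro x hx
  have hz := IsManifold.chart_mem_maximalAtlas (I := 𝓘(ℝ, ℂ)) (n := ∞) x
  have hxz := mem_chart_source ℂ x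
  set z := chartAt ℂ x
  have hq := z.map_source hxz
  have hs := z.left_inv hxz
  refine (contMDiffAt_of_comp_symm hz hxz ?_).contMDiffWithinAt
  refine (contDiffAt_inner_dchartSymm (g := g) hz hq
    (contDiffAt_frameCoord σ hz hq (by rw [hs]; exact hx.1) α)
    (contDiffAt_frameCoord σ hz hq (by rw [hs]; exact hx.2) β)).congr_of_eventuallyEq ?_
  filter_upwards [z.open_target.mem_nhds hq] with p hp
  have hd : ∀ c γ, dchartSymm z p (frameCoord σ c z γ p) = σ.frame c γ (z.symm p) :=
    fun c γ ↦ dchartSymm_dchart hz hp _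
  rw [hd, hd]
  rfl

variable (hφ : ContMDiff 𝓘(ℝ, ℂ) (𝓡 n) ∞ φ) (hy : y ∈ IsManifold.maximalAtlas (𝓡 n) ∞ N)
  (hx : x ∈ σ.U a) (hxy : φ x ∈ y.source)
include hφ hy hxy

lemma continuousAt_hin {F : Type*} [NormedAddCommGroup F] [InnerProductSpace ℝ F]
    {s t : Fin n → M → F} (hs : ∀ i, ContinuousAt (s i) x) (ht : ∀ i, ContinuousAt (t i) x) :
    ContinuousAt (fun x ↦ hin (metricCoeff h y (y (φ x))) (fun i ↦ s i x) (fun i ↦ t i x)) x := by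
  have hm : ∀ i j, ContinuousAt (fun x ↦ metricCoeff h y (y (φ x)) i j) x := fun i j ↦
    ContinuousAt.comp (g := metricFn h y i j) (f := fun x ↦ y (φ x))
      ((contDiffOn_metricCoeff h hy i j).continuousOn.continuousAt
        (y.open_target.mem_nhds (y.map_source hxy)))
      ((y.continuousAt hxy).comp hφ.continuous.continuousAt)
  unfold hin
  exact tendsto_finsetSum _ fun i _ ↦ tendsto_finsetSum _ fun j _ ↦
    (hm i j).mul ((hs i).inner (𝕜 := ℝ) (ht j))

include hx

lemma continuousAt_push (α : Fin 2) (i : Fin n) : ContinuousAt (push σ φ a y α i) x :=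
  (contMDiffAt_push hφ hy (IsManifold.chart_mem_maximalAtlas x) hx (mem_chart_source ℂ x) hxy
    α i).continuousAt

lemma continuousAt_comp (i : Fin n) : ContinuousAt (ψ.comp a y i) x :=
  (contMDiffAt_comp ψ hφ hy (IsManifold.chart_mem_maximalAtlas x) hx hxy i).continuousAt

lemma continuousAt_covDeriv (α : Fin 2) (i : Fin n) :
    ContinuousAt (covDeriv σ h φ ψ a y α i) x := by
  have hz := IsManifold.chart_mem_maximalAtlas (I := 𝓘(ℝ, ℂ)) (n := ∞) x
  have hxz := mem_chart_source ℂ x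
  set z := chartAt ℂ x
  have hq := z.map_source hxz
  have hs := z.left_inv hxz
  have hx2 : z.symm (z x) ∈ σ.U a := by rwa [hs]
  have hxy2 : φ (z.symm (z x)) ∈ y.source := by rwa [hs]
  refine (contMDiffAt_of_comp_symm hz hxz ?_).continuousAt
  have h1 : ContDiffAt ℝ ∞ (spinCov h y (mapCoord φ y z) (cliff 0 * cliff 1) (connCoord σ a z α)
      (frameCoord σ a z α) (spinorCoord ψ a y z) i) (z x) :=
    (contDiffAt_cov h hy (contDiffAt_mapCoord hφ hy hz hq hxy2) (y.map_source hxy2)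
      (contDiffAt_frameCoord σ hz hq hx2 α)
      (contDiffAt_spinorCoord ψ hφ hy hz hq hx2 hxy2) i).add
      (((contDiffAt_connCoord σ hz hq hx2 α).div_const 2).smul
        (contDiffAt_const.mul (contDiffAt_spinorCoord ψ hφ hy hz hq hx2 hxy2 i)))
  refine h1.congr_of_eventuallyEq ?_
  filter_upwards [eventually_nhds_chart (σ := σ) (a := a) hφ hy hz hq hx2 hxy2] with p hp
  exact covDeriv_eq h ψ hφ hy hz hp.1 hp.2.1 hp.2.2 α i

omit hφ hy hxy in
lemma continuousAt_proj (α : Fin 2) : ContinuousAt (χ.proj a α) x :=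
  ((contMDiffOn_proj χ α).contMDiffAt ((σ.isOpen a).mem_nhds hx)).continuousAt

omit hφ hy hxy in
lemma continuousAt_projSq : ContinuousAt (χ.projSq a) x :=
  tendsto_finsetSum _ fun α _ ↦ (continuousAt_proj χ hx α).inner (𝕜 := ℝ) (continuousAt_proj χ hx α)

lemma continuousAt_normSqSpinor : ContinuousAt (normSqSpinor σ h φ ψ a y) x :=
  continuousAt_hin h hφ hy hxy (continuousAt_comp ψ hφ hy hx hxy) (continuousAt_comp ψ hφ hy hx hxy)

lemma continuousAt_gravitinoEq (s : Quaternion ℝ) :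
    ContinuousAt (fun x ↦ gravitinoEq h ψ χ a y x s) x := by
  have hc := continuousAt_comp ψ hφ hy hx hxy
  refine ((continuousAt_hin h hφ hy hxy
    (fun i ↦ (continuousAt_push hφ hy hx hxy 0 i).smul continuousAt_const) hc).add
    (continuousAt_hin h hφ hy hxy
    (fun i ↦ (continuousAt_push hφ hy hx hxy 1 i).smul continuousAt_const) hc)).add
    (((continuousAt_proj χ hx 0).inner (𝕜 := ℝ) continuousAt_const).mul
      (continuousAt_normSqSpinor h ψ hφ hy hx hxy))

lemma continuousAt_lagrangianLocal (hEL : EulerLagrange σ h φ ψ χ) :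
    ContinuousAt (lagrangianLocal σ h φ ψ χ a y) x := by
  have hc := continuousAt_comp ψ hφ hy hx hxy
  have hp := continuousAt_push (σ := σ) hφ hy hx hxy
  have hP : ∀ α, ContinuousAt (fun x ↦ pushInner σ h φ a y α α x) x := fun α ↦ by
    simp only [pushInner_eq]
    exact continuousAt_hin h hφ hy hxy (hp α) (hp α)
  have hK : ∀ α, ContinuousAt (fun x ↦ kinetic h ψ a y α α x) x := fun α ↦
    continuousAt_hin h hφ hy hxy hc
      fun i ↦ continuousAt_const.mul (continuousAt_covDeriv h ψ hφ hy hx hxy α i)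
  have hC : ∀ α, ContinuousAt (fun x ↦ coupling h ψ χ a y α α x) x := fun α ↦
    continuousAt_hin h hφ hy hxy (fun i ↦ (hp α i).smul (continuousAt_proj χ hx α)) hc
  have h1 := ((((hP 0).add (hP 1)).add
    (((hK 0).add (hK 1)).const_mul (1 / 2))).sub (((hC 0).add (hC 1)).const_mul 3)).sub
    (((continuousAt_projSq χ hx).mul (continuousAt_normSqSpinor h ψ hφ hy hx hxy)).const_mul (1 / 2))
  refine h1.congr ?_
  filter_upwards [((σ.isOpen a).inter (y.open_source.preimage hφ.continuous)).mem_nhds ⟨hx, hxy⟩]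
    with p hp
  exact (lagrangianLocal_onShell χ h ψ hy hp.1 hp.2 hEL).symm

omit hφ hy hxy hx in
/-- On shell, the Lagrangian is a continuous function on the surface. -/
lemma continuous_lagrangian (hφ : ContMDiff 𝓘(ℝ, ℂ) (𝓡 n) ∞ φ) (hEL : EulerLagrange σ h φ ψ χ) :
    Continuous fun x ↦ lagrangianLocal σ h φ ψ χ (σ.index x)
      (chartAt (EuclideanSpace ℝ (Fin n)) (φ x)) x := by
  refine continuous_iff_continuousAt.mpr fun x ↦ ?_
  have hx := (σ.cover x).choose_spec
  have hy := IsManifold.chart_mem_maximalAtlas (I := 𝓡 n) (n := ∞) (φ x)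
  have hxy := mem_chart_source (EuclideanSpace ℝ (Fin n)) (φ x)
  -- The integrand chooses a frame and a chart at every point separately. By invariance those chosen
  -- at x may be used throughout a neighbourhood.
  refine (continuousAt_lagrangianLocal χ h ψ hφ hy hx hxy hEL).congr ?_
  filter_upwards [((σ.isOpen _).inter ((chartAt (EuclideanSpace ℝ (Fin n))
    (φ x)).open_source.preimage hφ.continuous)).mem_nhds ⟨hx, hxy⟩] with p hp
  exact lagrangianLocal_invariant χ h ψ hφ hy (IsManifold.chart_mem_maximalAtlas _) hp.1
    (σ.cover p).choose_spec hp.2 (mem_chart_source _ _) hEL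

end Continuity

/-! ### Test gravitinos supported in the domain of a frame -/

section Bump

variable {M : Type*} [TopologicalSpace M] [ChartedSpace ℂ M] [IsManifold 𝓘(ℝ, ℂ) ∞ M]
  {g : SurfaceMetric M} {ι : Type*} (σ : SpinStructure g ι) {a b : ι} {x : M}

/-- The cocycle condition makes it idempotent, and it is a unit quaternion. -/
lemma lift_self (hx : x ∈ σ.U a) : σ.lift a a x = 1 := by
  have h1 := star_lift_mul_lift (σ := σ) ⟨hx, hx⟩
  have h2 := σ.cocycle a a a x ⟨⟨hx, hx⟩, hx⟩
  rw [← h1]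
  conv_lhs => rw [← one_mul (σ.lift a a x), ← h1, mul_assoc, h2]

lemma spinAct_mul {V : Type*} [AddCommGroup V] [Module ℝ V] (p q : Quaternion ℝ)
    (t : Quaternion ℝ ⊗[ℝ] V) : spinAct (p * q) t = spinAct p (spinAct q t) := by
  induction t with
  | zero => simp
  | tmul s v => simp [spinAct]
  | add s t hs ht => simp only [map_add, hs, ht]

open Classical in
/-- The local representatives of the gravitino that equals `f (v ⊗ e₁ - ε₁ ε₂ v ⊗ e₂)` in the
frame `a`. -/
def bumpVal (a : ι) (f : M → ℝ) (v : Quaternion ℝ) (b : ι) (x : M) :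
    Quaternion ℝ ⊗[ℝ] TangentSpace 𝓘(ℝ, ℂ) x :=
  if x ∈ σ.U a then spinAct (σ.lift b a x) (f x • (v ⊗ₜ[ℝ] σ.frame a 0 x
    + (-(cliff 0 * cliff 1 * v)) ⊗ₜ[ℝ] σ.frame a 1 x)) else 0

lemma bumpVal_eq_zero {f : M → ℝ} {v : Quaternion ℝ} (hf : f x = 0) : bumpVal σ a f v b x = 0 := by
  unfold bumpVal
  split_ifs <;> simp [hf]

lemma coeff_bumpVal {f : M → ℝ} {v : Quaternion ℝ} (hx : x ∈ σ.U a) (α : Fin 2) :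
    coeff (g.inner x (σ.frame b α x) : TangentSpace 𝓘(ℝ, ℂ) x →ₗ[ℝ] ℝ) (bumpVal σ a f v b x)
      = f x • (σ.lift b a x * (g.inner x (σ.frame b α x) (σ.frame a 0 x) • v
        + g.inner x (σ.frame b α x) (σ.frame a 1 x) • -(cliff 0 * cliff 1 * v))) := by
  rw [bumpVal, if_pos hx, coeff_spinAct, map_smul, map_add, coeff_tmul, coeff_tmul, mul_smul_comm]
  rfl

/-- A gravitino supported in the domain of a frame. -/
def bumpGravitino (a : ι) {f : M → ℝ} (hf : ContMDiff 𝓘(ℝ, ℂ) 𝓘(ℝ, ℝ) ∞ f)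
    (hs : tsupport f ⊆ σ.U a) (v : Quaternion ℝ) : Gravitino σ where
  val := bumpVal σ a f v
  compat b c x hx := by
    unfold bumpVal
    split_ifs with ha
    · rw [← spinAct_mul, σ.cocycle b c a x ⟨hx, ha⟩]
    · simp
  smooth b α := by
    intro x hx
    -- Inside the domain of the frame the representative is a product of smooth factors. A point
    -- outside is not in the support of f, so the representative vanishes near it.
    by_cases ha : x ∈ σ.U a
    · have hO := ((σ.isOpen b).inter (σ.isOpen a)).mem_nhds ⟨hx, ha⟩
      have hg : ∀ β, ContMDiffAt 𝓘(ℝ, ℂ) 𝓘(ℝ, ℝ) ∞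
          (fun x ↦ g.inner x (σ.frame b α x) (σ.frame a β x)) x :=
        fun β ↦ (contMDiffOn_inner_frame α β).contMDiffAt hO
      have hw : ContMDiffAt 𝓘(ℝ, ℂ) 𝓘(ℝ, Quaternion ℝ) ∞
          (fun x ↦ g.inner x (σ.frame b α x) (σ.frame a 0 x) • v
            + g.inner x (σ.frame b α x) (σ.frame a 1 x) • -(cliff 0 * cliff 1 * v)) x :=
        ((hg 0).smul contMDiffAt_const).add ((hg 1).smul contMDiffAt_const)
      have hl : ContMDiffAt 𝓘(ℝ, ℂ) 𝓘(ℝ, Quaternion ℝ) ∞ (σ.lift b a) x :=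
        (σ.lift_smooth b a).contMDiffAt hO
      have hm : ContMDiffAt 𝓘(ℝ, ℂ) 𝓘(ℝ, Quaternion ℝ) ∞
          (fun x ↦ ContinuousLinearMap.mul ℝ (Quaternion ℝ) (σ.lift b a x)
            (g.inner x (σ.frame b α x) (σ.frame a 0 x) • v
            + g.inner x (σ.frame b α x) (σ.frame a 1 x) • -(cliff 0 * cliff 1 * v))) x :=
        ((ContinuousLinearMap.mul ℝ (Quaternion ℝ)).contMDiff.contMDiffAt.comp x hl).clm_apply hw
      refine ((hf.contMDiffAt.smul hm).congr_of_eventuallyEq ?_).contMDiffWithinAt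
      filter_upwards [hO] with p hp
      exact coeff_bumpVal σ hp.2 α
    · have h0 : f =ᶠ[nhds x] 0 := notMem_tsupport_iff_eventuallyEq.mp fun h ↦ ha (hs h)
      refine ((contMDiffAt_const (c := (0 : Quaternion ℝ))).congr_of_eventuallyEq
        ?_).contMDiffWithinAt
      filter_upwards [h0] with p hp
      rw [bumpVal_eq_zero σ hp, map_zero]

variable {f : M → ℝ} (hf : ContMDiff 𝓘(ℝ, ℂ) 𝓘(ℝ, ℝ) ∞ f) (hs : tsupport f ⊆ σ.U a)
  (v : Quaternion ℝ)

lemma proj_bumpGravitino_of_eq_zero (hfx : f x = 0) (α : Fin 2) :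
    (bumpGravitino σ a hf hs v).proj b α x = 0 := by
  have h1 : ∀ β, (bumpGravitino σ a hf hs v).comp b β x = 0 := fun β ↦ by
    rw [Gravitino.comp, show (bumpGravitino σ a hf hs v).val b x = 0 from bumpVal_eq_zero σ hfx,
      map_zero]
  simp [Gravitino.proj, h1]

/-- The profile v ⊗ e₀ - ωv ⊗ e₁ satisfies the constraint of `proj_one` and is fixed by Q, so v can
be prescribed freely. -/
lemma proj_zero_bumpGravitino (hx : x ∈ σ.U a) :
    (bumpGravitino σ a hf hs v).proj a 0 x = f x • v := by
  have ho := σ.orthonormal a x hx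
  have h1 : ∀ β, (bumpGravitino σ a hf hs v).comp a β x = _ := fun β ↦ coeff_bumpVal σ hx β
  simp only [Gravitino.proj, h1, Fin.sum_univ_two, ho, lift_self σ hx]
  ext <;> simp <;> ring

lemma proj_one_bumpGravitino (hx : x ∈ σ.U a) :
    (bumpGravitino σ a hf hs v).proj a 1 x = f x • -(cliff 0 * cliff 1 * v) := by
  rw [proj_one, proj_zero_bumpGravitino σ hf hs v hx, mul_smul_comm, smul_neg]

end Bump

/-! ### The pointwise equation of the gravitino -/

section Criticality

variable {M : Type*} [TopologicalSpace M] [ChartedSpace ℂ M] [IsManifold 𝓘(ℝ, ℂ) ∞ M]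
  {g : SurfaceMetric M} {ι : Type*} {σ : SpinStructure g ι} (χ : Gravitino σ)
  {n : ℕ} {N : Type*} [TopologicalSpace N] [ChartedSpace (EuclideanSpace ℝ (Fin n)) N]
  [IsManifold (𝓡 n) ∞ N]
  (h : TargetMetric n N) {φ : M → N} (ψ : VectorSpinor n σ φ)
  {a b : ι} {y y' : OpenPartialHomeomorph N (EuclideanSpace ℝ (Fin n))} {x : M}

lemma gravitinoEq_neg (s : Quaternion ℝ) :
    gravitinoEq h ψ χ a y x (-s) = -gravitinoEq h ψ χ a y x s := by
  have h1 : ∀ t (w : Fin n → ℝ), tens w (-t) = -tens w (t : Quaternion ℝ) := fun t w ↦ by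
    ext1 i
    simp [tens]
  unfold gravitinoEq
  generalize metricCoeff h y (y (φ x)) = H
  set H' : Fin n → Fin n → ℝ := H
  simp only [mul_neg, h1, hin_neg_left, inner_neg_right]
  ring

variable {f : M → ℝ} (hf : ContMDiff 𝓘(ℝ, ℂ) 𝓘(ℝ, ℝ) ∞ f) (hs : tsupport f ⊆ σ.U a)
  (v : Quaternion ℝ)

/-- By the constraint the two components contribute equally to the |Qχ|² term, so its factor 2
becomes the same 4 that multiplies the coupling. -/
lemma firstVar_bumpGravitino (hx : x ∈ σ.U a) :
    firstVar h ψ χ (bumpGravitino σ a hf hs v) a y x = 4 * (f x * gravitinoEq h ψ χ a y x v) := by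
  have h1 : ∀ (w : Fin n → ℝ) (t : Quaternion ℝ), tens w (f x • t) = f x • tens w t := fun w t ↦ by
    ext1 i
    simp only [tens, Pi.smul_apply]
    module
  have h2 : inner ℝ (χ.proj a 1 x) (-(cliff 0 * cliff 1 * v)) = inner ℝ (χ.proj a 0 x) v := by
    rw [proj_one]
    simp only [quat_inner]
    simp
    ring
  rw [firstVar, coupling, coupling, proj_zero_bumpGravitino σ hf hs v hx,
    proj_one_bumpGravitino σ hf hs v hx, h1, h1, inner_smul_right, inner_smul_right, h2,
    gravitinoEq, normSqSpinor, pairing_eq]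
  generalize metricCoeff h y (y (φ x)) = H
  set H' : Fin n → Fin n → ℝ := H
  simp only [hin_smul_left]
  ring

lemma projSq_bumpGravitino (hx : x ∈ σ.U a) :
    (bumpGravitino σ a hf hs v).projSq a x = f x ^ 2 * (2 * inner ℝ v v) := by
  rw [projSq_eq, proj_zero_bumpGravitino σ hf hs v hx, inner_smul_left, inner_smul_right,
    conj_trivial]
  ring

/-- The Lagrangian may be computed in any frame and chart, while its variation is expressed in the
fixed pair (a, y) in which the test gravitino lives. Outside the support of f there is no variation.
-/
lemma lagrangianLocal_bump (hφ : ContMDiff 𝓘(ℝ, ℂ) (𝓡 n) ∞ φ)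
    (hy : y ∈ IsManifold.maximalAtlas (𝓡 n) ∞ N) (hy' : y' ∈ IsManifold.maximalAtlas (𝓡 n) ∞ N)
    (hb : x ∈ σ.U b) (hby : φ x ∈ y'.source) (hsy : tsupport f ⊆ φ ⁻¹' y.source) (t : ℝ) :
    lagrangianLocal σ h φ ψ (χ.perturb (bumpGravitino σ a hf hs v) t) b y' x
      = lagrangianLocal σ h φ ψ χ b y' x - t * (4 * (f x * gravitinoEq h ψ χ a y x v))
        - t ^ 2 * (f x ^ 2 * (2 * inner ℝ v v) * normSqSpinor σ h φ ψ a y x) := by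
  rw [lagrangianLocal_perturb]
  by_cases hx : x ∈ tsupport f
  · rw [firstVar_invariant χ _ h ψ hφ hy' hy hb (hs hx) hby (hsy hx),
      projSq_invariant _ hb (hs hx), normSqSpinor_invariant h ψ hy' hy hb (hs hx) hby (hsy hx),
      firstVar_bumpGravitino χ h ψ hf hs v (hs hx), projSq_bumpGravitino hf hs v (hs hx)]
  · have h0 : f x = 0 := image_eq_zero_of_notMem_tsupport hx
    have h1 := fun α ↦ proj_bumpGravitino_of_eq_zero σ (b := b) hf hs v h0 α
    have h2 : ∀ α, coupling h ψ (bumpGravitino σ a hf hs v) b y' α α x = 0 := fun α ↦ by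
      rw [coupling, h1]
      simp [tens, hin]
    simp [firstVar, Gravitino.projSq, h1, h2, h0]

lemma continuous_mul_of_tsupport {F : M → ℝ} (hf : Continuous f)
    (hF : ∀ x ∈ tsupport f, ContinuousAt F x) : Continuous fun x ↦ f x * F x := by
  refine continuous_iff_continuousAt.mpr fun x ↦ ?_
  by_cases hx : x ∈ tsupport f
  · exact hf.continuousAt.mul (hF x hx)
  · have h0 : f =ᶠ[nhds x] 0 := notMem_tsupport_iff_eventuallyEq.mp hx
    refine (continuousAt_const (y := (0 : ℝ))).congr ?_
    filter_upwards [h0] with p hp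
    rw [hp, Pi.zero_apply, zero_mul]

/-- The Euler-Lagrange equation of the gravitino. -/
theorem gravitinoEq_eq_zero [T2Space M] [CompactSpace M] [MeasurableSpace M] [BorelSpace M]
    (hφ : ContMDiff 𝓘(ℝ, ℂ) (𝓡 n) ∞ φ) (hy : y ∈ IsManifold.maximalAtlas (𝓡 n) ∞ N)
    (hx : x ∈ σ.U a) (hxy : φ x ∈ y.source) (hEL : EulerLagrange σ h φ ψ χ)
    (hcrit : IsCriticalGravitino σ h φ ψ χ) (s : Quaternion ℝ) :
    gravitinoEq h ψ χ a y x s = 0 := by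
  have := isFiniteMeasure_volumeMeasure g
  have := isOpenPosMeasure_volumeMeasure g
  -- The fundamental lemma of the calculus of variations: a positive value persists near x, and a
  -- bump function supported there would make the first variation of the action strictly negative.
  -- By linearity in v, excluding positive values for s and -s is enough.
  have key : ∀ v, ¬ 0 < gravitinoEq h ψ χ a y x v := by
    intro v hv
    have hO : {p | 0 < gravitinoEq h ψ χ a y p v} ∩ (σ.U a ∩ φ ⁻¹' y.source) ∈ nhds x :=
      Filter.inter_mem ((continuousAt_gravitinoEq χ h ψ hφ hy hx hxy v).eventually
        (lt_mem_nhds hv))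
        (((σ.isOpen a).inter (y.open_source.preimage hφ.continuous)).mem_nhds ⟨hx, hxy⟩)
    obtain ⟨F, -, hF⟩ := (SmoothBumpFunction.nhds_basis_tsupport (I := 𝓘(ℝ, ℂ)) x).mem_iff.mp hO
    have hf : ContMDiff 𝓘(ℝ, ℂ) 𝓘(ℝ, ℝ) ∞ F := F.contMDiff
    have hs : tsupport F ⊆ σ.U a := fun p hp ↦ (hF hp).2.1
    have hsy : tsupport F ⊆ φ ⁻¹' y.source := fun p hp ↦ (hF hp).2.2
    set L := fun x ↦ lagrangianLocal σ h φ ψ χ (σ.index x)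
      (chartAt (EuclideanSpace ℝ (Fin n)) (φ x)) x
    set G := fun x ↦ F x * gravitinoEq h ψ χ a y x v with hG
    set Q := fun x ↦ F x * (F x * (2 * inner ℝ v v * normSqSpinor σ h φ ψ a y x))
    have hLc : Continuous L := continuous_lagrangian χ h ψ hφ hEL
    have hGc : Continuous G := continuous_mul_of_tsupport hf.continuous fun p hp ↦
      continuousAt_gravitinoEq χ h ψ hφ hy (hs hp) (hsy hp) v
    have hQc : Continuous Q := continuous_mul_of_tsupport hf.continuous fun p hp ↦
      hf.continuous.continuousAt.mul (continuousAt_const.mul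
        (continuousAt_normSqSpinor h ψ hφ hy (hs hp) (hsy hp)))
    -- Integrability is essential for splitting the integral, because a non-integrable integrand
    -- would have integral zero by convention.
    have hLi : Integrable L (volumeMeasure g) :=
      hLc.integrable_of_hasCompactSupport (HasCompactSupport.of_compactSpace L)
    have hGi : Integrable G (volumeMeasure g) :=
      hGc.integrable_of_hasCompactSupport (HasCompactSupport.of_compactSpace G)
    have hQi : Integrable Q (volumeMeasure g) :=
      hQc.integrable_of_hasCompactSupport (HasCompactSupport.of_compactSpace Q)
    have hact : ∀ t, action σ h φ ψ (χ.perturb (bumpGravitino σ a hf hs v) t)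
        = ∫ x, L x ∂volumeMeasure g - t * (4 * ∫ x, G x ∂volumeMeasure g)
          - t ^ 2 * ∫ x, Q x ∂volumeMeasure g := by
      intro t
      have h1 : ∀ p, lagrangianLocal σ h φ ψ (χ.perturb (bumpGravitino σ a hf hs v) t)
          (σ.index p) (chartAt (EuclideanSpace ℝ (Fin n)) (φ p)) p
          = L p - t * (4 * G p) - t ^ 2 * Q p := by
        intro p
        rw [lagrangianLocal_bump χ h ψ hf hs v hφ hy (IsManifold.chart_mem_maximalAtlas _)
          (show p ∈ σ.U (σ.index p) from (σ.cover p).choose_spec) (mem_chart_source _ _) hsy]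
        simp only [L, G, Q]
        ring
      simp only [action, h1]
      rw [integral_sub, integral_sub, integral_const_mul, integral_const_mul, integral_const_mul]
      exacts [hLi, (hGi.const_mul 4).const_mul t, hLi.sub ((hGi.const_mul 4).const_mul t),
        hQi.const_mul _]
    have hd := hcrit _ (smoothFamily_perturb χ (bumpGravitino σ a hf hs v)) (perturb_zero χ _)
    simp only [hact] at hd
    have hd2 := (((hasDerivAt_id (0 : ℝ)).mul_const (4 * ∫ x, G x ∂volumeMeasure g)).const_sub
      (∫ x, L x ∂volumeMeasure g)).sub
      (((hasDerivAt_id (0 : ℝ)).pow 2).mul_const (∫ x, Q x ∂volumeMeasure g))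
    have h0 := hd.unique hd2
    -- G is continuous, nonnegative and positive at x, where the bump function equals 1; the measure
    -- charges open sets.
    have hpos : 0 < ∫ x, G x ∂volumeMeasure g := by
      refine hGc.integral_pos_of_hasCompactSupport_nonneg_nonzero
        (HasCompactSupport.of_compactSpace G) (x := x) (fun p ↦ ?_) ?_
      · by_cases hp : p ∈ tsupport F
        · exact mul_nonneg F.nonneg (hF hp).1.le
        · simp [hG, image_eq_zero_of_notMem_tsupport hp]
      · simp only [hG, F.eq_one, one_mul]
        exact hv.ne'
    simp at h0
    exact hpos.ne' h0
  have h1 := key s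
  have h2 := key (-s)
  rw [gravitinoEq_neg] at h2
  linarith

end Criticality

/-! ### Criteria for complex differentiability -/

section Complex

/-- Write L(w) = αw + βw̄. Then L(ic) - iL(c) = -2iβc̄, so commuting with i at a single nonzero
vector forces β = 0. -/
lemma map_I_of_map_I_mul {L : ℂ →L[ℝ] ℂ} {c : ℂ} (hc : c ≠ 0)
    (h : L (Complex.I * c) = Complex.I * L c) : L Complex.I = Complex.I • L 1 := by
  have he : ∀ w : ℂ, L w = (w.re : ℂ) * L 1 + (w.im : ℂ) * L Complex.I := by
    intro w
    conv_lhs => rw [← Complex.re_add_im w, show (w.re : ℂ) + w.im * Complex.I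
      = w.re • (1 : ℂ) + w.im • Complex.I by simp]
    rw [map_add, map_smul, map_smul, Complex.real_smul, Complex.real_smul]
  rw [he c, he (Complex.I * c)] at h
  have h1 : (starRingEnd ℂ c) * (L Complex.I - Complex.I * L 1) = 0 := by
    have h2 : starRingEnd ℂ c = c.re - c.im * Complex.I := by
      apply Complex.ext <;> simp
    rw [h2]
    simp only [Complex.mul_re, Complex.mul_im, Complex.I_re, Complex.I_im] at h
    push_cast at h
    linear_combination h + c.im * (L 1) * Complex.I_sq
  rcases mul_eq_zero.mp h1 with h2 | h2
  · exact absurd ((map_eq_zero _).mp h2) hc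
  · exact sub_eq_zero.mp h2

lemma differentiableAt_complex_of_map_I_mul {f : ℂ → ℂ} {q c : ℂ} (hf : DifferentiableAt ℝ f q)
    (hc : c ≠ 0) (h : fderiv ℝ f q (Complex.I * c) = Complex.I * fderiv ℝ f q c) :
    DifferentiableAt ℂ f q :=
  differentiableAt_complex_iff_differentiableAt_real.mpr ⟨hf, map_I_of_map_I_mul hc h⟩

/-- Cauchy-Riemann equations for `F / c²`. -/
lemma differentiableAt_div_sq {F c : ℂ → ℂ} {q Ω : ℂ} (hF : DifferentiableAt ℝ F q)
    (hc : DifferentiableAt ℝ c q) (h0 : c q ≠ 0)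
    (h1 : fderiv ℝ F q (Complex.I * c q) = Complex.I * fderiv ℝ F q (c q) + 2 * Ω * F q)
    (h2 : fderiv ℝ c q (Complex.I * c q) = Complex.I * fderiv ℝ c q (c q) + Ω * c q) :
    DifferentiableAt ℂ (fun p ↦ F p / c p ^ 2) q := by
  have hd := hF.hasFDerivAt.mul ((hasDerivAt_inv (pow_ne_zero 2
    h0)).hasFDerivAt.restrictScalars ℝ |>.comp q (hc.hasFDerivAt.pow 2))
  -- It suffices to compare the derivatives along c and ic. The term 2Ω from F cancels against twice
  -- the Ω from c, because c occurs squared.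
  refine differentiableAt_complex_of_map_I_mul (f := fun p ↦ F p / c p ^ 2) hd.differentiableAt h0 ?_
  have he : fderiv ℝ (fun p ↦ F p / c p ^ 2) q = _ := hd.fderiv
  rw [he]
  simp [h1, h2]
  field_simp
  ring

end Complex

/-! ### The quadratic differential in isothermal coordinates -/

section Isothermal

variable {M : Type*} [TopologicalSpace M] [ChartedSpace ℂ M] [IsManifold 𝓘(ℝ, ℂ) ∞ M]
  {g : SurfaceMetric M} {ι : Type*} {σ : SpinStructure g ι} (χ : Gravitino σ)
  {n : ℕ} {N : Type*} [TopologicalSpace N] [ChartedSpace (EuclideanSpace ℝ (Fin n)) N]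
  [IsManifold (𝓡 n) ∞ N]
  (h : TargetMetric n N) {φ : M → N} (ψ : VectorSpinor n σ φ)
  {a b : ι} {y y' : OpenPartialHomeomorph N (EuclideanSpace ℝ (Fin n))} {x : M}
  {z z' : OpenPartialHomeomorph M ℂ} {q : ℂ}

lemma surfaceCoeff_isothermal (hz : IsIsothermal σ z) (hq : q ∈ z.target) (v w : ℂ) :
    surfaceCoeff g z v w q = surfaceCoeff g z 1 1 q * (v.re * w.re + v.im * w.im) := by
  obtain ⟨h1, h2⟩ := hz.conformal q hq
  rw [surfaceCoeff_eq g v w, h2, ← h1]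
  ring

lemma inner_frame_isothermal (hz : IsIsothermal σ z) (hq : q ∈ z.target) (α β : Fin 2) :
    g.inner (z.symm q) (σ.frame a α (z.symm q)) (σ.frame a β (z.symm q))
      = surfaceCoeff g z 1 1 q * ((frameCoord σ a z α q).re * (frameCoord σ a z β q).re
        + (frameCoord σ a z α q).im * (frameCoord σ a z β q).im) := by
  rw [inner_eq_surfaceCoeff g hz.smooth (z.map_target hq), z.right_inv hq,
    surfaceCoeff_isothermal hz hq]
  rfl

lemma surfaceCoeff_mul_normSq (hz : IsIsothermal σ z) (hq : q ∈ z.target)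
    (hx : z.symm q ∈ σ.U a) : surfaceCoeff g z 1 1 q *
      ((frameCoord σ a z 0 q).re ^ 2 + (frameCoord σ a z 0 q).im ^ 2) = 1 := by
  have h00 := σ.orthonormal a _ hx 0 0
  rw [inner_frame_isothermal hz hq, if_pos rfl] at h00
  rw [← h00]
  ring

/-- In a conformal coordinate the images of e₀ and e₁ are orthogonal and of equal Euclidean length,
and the orientation excludes the factor -i. -/
lemma frameCoord_one (hz : IsIsothermal σ z) (hq : q ∈ z.target) (hx : z.symm q ∈ σ.U a) :
    frameCoord σ a z 1 q = Complex.I * frameCoord σ a z 0 q := by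
  have h00 := surfaceCoeff_mul_normSq hz hq hx
  have h01 := σ.orthonormal a _ hx 0 1
  have h11 := σ.orthonormal a _ hx 1 1
  rw [inner_frame_isothermal hz hq, if_neg zero_ne_one] at h01
  rw [inner_frame_isothermal hz hq, if_pos rfl] at h11
  have ho := hz.oriented a _ ⟨hx, z.map_target hq⟩
  change 0 < (starRingEnd ℂ (frameCoord σ a z 0 q) * frameCoord σ a z 1 q).im at ho
  set V := frameCoord σ a z 0 q
  set W := frameCoord σ a z 1 q
  set ρ := surfaceCoeff g z 1 1 q
  have hρ : ρ ≠ 0 := by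
    rintro h0
    rw [h0, zero_mul] at h00
    exact zero_ne_one h00
  have e1 : V.re * W.re + V.im * W.im = 0 := (mul_eq_zero.mp h01).resolve_left hρ
  have e2 : W.re ^ 2 + W.im ^ 2 = V.re ^ 2 + V.im ^ 2 := by
    apply mul_left_cancel₀ hρ
    linear_combination h11 - h00
  have ho' : 0 < V.re * W.im - V.im * W.re := by
    simpa [sub_eq_add_neg] using ho
  have e3 : V.re * W.im - V.im * W.re = V.re ^ 2 + V.im ^ 2 := by
    -- Lagrange's identity for the determinant of V and W, with ⟨V, W⟩ = 0 and |W| = |V|.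
    have h4 : (V.re * W.im - V.im * W.re) ^ 2 = (V.re ^ 2 + V.im ^ 2) ^ 2 := by
      linear_combination (V.re ^ 2 + V.im ^ 2) * e2 - (V.re * W.re + V.im * W.im) * e1
    exact (pow_left_inj₀ ho'.le (by positivity) two_ne_zero).mp h4
  -- The left-hand side is |W - iV|².
  have e4 : (W.re + V.im) ^ 2 + (W.im - V.re) ^ 2 = 0 := by
    linear_combination e2 - 2 * e3
  have e5 : W.re + V.im = 0 := by nlinarith [sq_nonneg (W.re + V.im), sq_nonneg (W.im - V.re)]
  have e6 : W.im - V.re = 0 := by nlinarith [sq_nonneg (W.re + V.im), sq_nonneg (W.im - V.re)]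
  apply Complex.ext
  · simp
    linarith
  · simp
    linarith

lemma frameCoord_ne_zero (hz : IsIsothermal σ z) (hq : q ∈ z.target) (hx : z.symm q ∈ σ.U a) :
    frameCoord σ a z 0 q ≠ 0 := by
  intro h0
  have h1 := surfaceCoeff_mul_normSq hz hq hx
  simp [h0] at h1

lemma inner_coordVec_isothermal (hz : IsIsothermal σ z) (hq : q ∈ z.target) (α : Fin 2) (v : ℂ) :
    g.inner (z.symm q) (σ.frame a α (z.symm q)) (coordVec z v q)
      = surfaceCoeff g z 1 1 q * ((frameCoord σ a z α q).re * v.re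
        + (frameCoord σ a z α q).im * v.im) := by
  rw [inner_eq_surfaceCoeff g hz.smooth (z.map_target hq), z.right_inv hq,
    surfaceCoeff_isothermal hz hq,
    show dchart z (z.symm q) (coordVec z v q) = v from dchart_dchartSymm hz.smooth hq v]
  rfl

variable [T2Space M] [CompactSpace M] [MeasurableSpace M] [BorelSpace M]
  (hφ : ContMDiff 𝓘(ℝ, ℂ) (𝓡 n) ∞ φ) (hEL : EulerLagrange σ h φ ψ χ)
  (hcrit : IsCriticalGravitino σ h φ ψ χ)
  (hy : y ∈ IsManifold.maximalAtlas (𝓡 n) ∞ N)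
include hφ hEL hcrit hy

lemma emTensorLocal_eq_emTensor (hx : x ∈ σ.U a) (hxy : φ x ∈ y.source)
    (v w : TangentSpace 𝓘(ℝ, ℂ) x) :
    emTensorLocal σ h φ ψ χ a y x v w = emTensor σ h φ ψ χ x v w := by
  have hx' : x ∈ σ.U (σ.index x) := (σ.cover x).choose_spec
  have hy' := IsManifold.chart_mem_maximalAtlas (I := 𝓡 n) (n := ∞) (φ x)
  have hxy' := mem_chart_source (EuclideanSpace ℝ (Fin n)) (φ x)
  exact emTensorLocal_invariant h ψ χ hφ hy hy' hx hx' hxy hxy' hEL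
    (gravitinoEq_eq_zero χ h ψ hφ hy hx hxy hEL hcrit)
    (gravitinoEq_eq_zero χ h ψ hφ hy' hx' hxy' hEL hcrit) v w

/-- For a symmetric trace-free T the form T(z) dz² takes on e₀ the value T₀₀ - iT₀₁, and dz(e₀) = c.
-/
lemma quadCoeff_eq (hz : IsIsothermal σ z) (hq : q ∈ z.target) (hx : z.symm q ∈ σ.U a)
    (hxy : φ (z.symm q) ∈ y.source) : quadCoeff σ h φ ψ χ z q
      = (emCoeff σ h φ ψ χ a y 0 0 (z.symm q) - Complex.I * emCoeff σ h φ ψ χ a y 0 1 (z.symm q))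
        / frameCoord σ a z 0 q ^ 2 := by
  have ht := emCoeff_trace h ψ χ hy hEL hx hxy (gravitinoEq_eq_zero χ h ψ hφ hy hx hxy hEL hcrit)
  have hc0 := frameCoord_ne_zero hz hq hx
  have hn := surfaceCoeff_mul_normSq hz hq hx
  rw [eq_div_iff (pow_ne_zero 2 hc0), quadCoeff,
    ← emTensorLocal_eq_emTensor χ h ψ hφ hEL hcrit hy hx hxy,
    ← emTensorLocal_eq_emTensor χ h ψ hφ hEL hcrit hy hx hxy]
  simp only [emTensorLocal, inner_coordVec_isothermal hz hq, frameCoord_one hz hq hx,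
    Fin.sum_univ_two, ht, emCoeff_comm h ψ χ 1 0]
  set c := frameCoord σ a z 0 q
  generalize emCoeff σ h φ ψ χ a y 0 0 (z.symm q) = A
  generalize emCoeff σ h φ ψ χ a y 0 1 (z.symm q) = B
  generalize surfaceCoeff g z 1 1 q = ρ at hn ⊢
  have hcc : c = c.re + c.im * Complex.I := (Complex.re_add_im c).symm
  have hn' : (ρ : ℂ) * ((c.re : ℂ) ^ 2 + (c.im : ℂ) ^ 2) = 1 := by exact_mod_cast hn
  have hI := Complex.I_sq
  rw [show c ^ 2 = (c.re + c.im * Complex.I) ^ 2 by rw [← hcc]]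
  simp only [Complex.one_re, Complex.one_im, Complex.I_re, Complex.I_im, Complex.mul_re,
    Complex.mul_im]
  push_cast
  generalize (c.re : ℂ) = s at hn' ⊢
  generalize (c.im : ℂ) = t at hn' ⊢
  generalize (ρ : ℂ) = r at hn' ⊢
  generalize Complex.I = i at hI ⊢
  have e1 : (s + t * i) * (s - t * i) = s ^ 2 + t ^ 2 := by linear_combination -t ^ 2 * hI
  have e2 : (A * (s ^ 2 - t ^ 2) - 2 * B * (s * t)) - i * (2 * A * (s * t) + B * (s ^ 2 - t ^ 2))
      = (A - i * B) * (s - t * i) ^ 2 := by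
    linear_combination (-(A : ℂ) * t ^ 2 + i * B * t ^ 2 - 2 * B * s * t) * hI
  -- Here r is the conformal factor and c = s + ti has r|c|² = 1. The coordinate components of T
  -- carry the factor r²(s - ti)², which c² turns into 1.
  trans r ^ 2 * ((A * (s ^ 2 - t ^ 2) - 2 * B * (s * t))
    - i * (2 * A * (s * t) + B * (s ^ 2 - t ^ 2))) * (s + t * i) ^ 2
  · ring
  · rw [e2]
    linear_combination (A - i * B) * r ^ 2 * ((s + t * i) * (s - t * i) + (s ^ 2 + t ^ 2)) * e1
      + (A - i * B) * (r * (s ^ 2 + t ^ 2) + 1) * hn'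

lemma differentiableAt_quadCoeff (hz : IsIsothermal σ z) (hq : q ∈ z.target)
    (hx : z.symm q ∈ σ.U a) (hxy : φ (z.symm q) ∈ y.source) :
    DifferentiableAt ℂ (quadCoeff σ h φ ψ χ z) q := by
  have hcr : ∀ x ∈ σ.U a, φ x ∈ y.source → ∀ s, gravitinoEq h ψ χ a y x s = 0 :=
    fun x hx hxy ↦ gravitinoEq_eq_zero χ h ψ hφ hy hx hxy hEL hcrit
  have hev := eventually_nhds_chart (σ := σ) (a := a) hφ hy hz.smooth hq hx hxy
  obtain ⟨hA, hB⟩ := contDiffAt_emCoord h ψ χ hφ hy hz.smooth hEL hcr hq hx hxy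
  have hAd := hA.differentiableAt (n := ∞) (by simp)
  have hBd := hB.differentiableAt (n := ∞) (by simp)
  have hcd := (contDiffAt_frameCoord σ hz.smooth hq hx 0).differentiableAt (n := ∞) (by simp)
  have hV1 : frameCoord σ a z 1 =ᶠ[nhds q] fun p ↦ Complex.I * frameCoord σ a z 0 p := by
    filter_upwards [hev] with p hp
    exact frameCoord_one hz hp.1 hp.2.1
  have hd1 := div_emCoord h ψ χ hφ hy hz.smooth hEL hcr hq hx hxy
  have hd2 := div_emCoord_rotate h ψ χ hφ hy hz.smooth hEL hcr hq hx hxy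
  have hbr := lieBracket_frameCoord σ hz.smooth hq hx
  -- With e₁ = i e₀ in the coordinate, the bracket formula becomes the equation e₁c = i e₀c + (w₀ +
  -- iw₁)c, which dictates Ω.
  rw [VectorField.lieBracket, hV1.fderiv_eq, fderiv_const_mul hcd, hV1.eq_of_nhds] at hbr
  rw [hV1.eq_of_nhds] at hd1 hd2
  have hF : HasFDerivAt (fun p ↦ (emCoord h ψ χ a y z 0 0 p : ℂ)
      - Complex.I * (emCoord h ψ χ a y z 0 1 p : ℂ)) _ q :=
    (Complex.ofRealCLM.hasFDerivAt.comp q hAd.hasFDerivAt).sub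
      ((Complex.ofRealCLM.hasFDerivAt.comp q hBd.hasFDerivAt).const_mul Complex.I)
  have key := differentiableAt_div_sq (Ω := connCoord σ a z 0 q + Complex.I * connCoord σ a z 1 q)
    hF.differentiableAt hcd (frameCoord_ne_zero hz hq hx) (by
      have h1 : (fderiv ℝ (emCoord h ψ χ a y z 0 0) q (frameCoord σ a z 0 q) : ℂ)
        + (fderiv ℝ (emCoord h ψ χ a y z 0 1) q (Complex.I * frameCoord σ a z 0 q) : ℂ)
        + 2 * connCoord σ a z 1 q * emCoord h ψ χ a y z 0 0 q
        - 2 * connCoord σ a z 0 q * emCoord h ψ χ a y z 0 1 q = 0 := by exact_mod_cast hd1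
      have h2 : (fderiv ℝ (emCoord h ψ χ a y z 0 0) q (Complex.I * frameCoord σ a z 0 q) : ℂ)
        - (fderiv ℝ (emCoord h ψ χ a y z 0 1) q (frameCoord σ a z 0 q) : ℂ)
        - 2 * connCoord σ a z 0 q * emCoord h ψ χ a y z 0 0 q
        - 2 * connCoord σ a z 1 q * emCoord h ψ χ a y z 0 1 q = 0 := by exact_mod_cast hd2
      rw [hF.fderiv]
      simp
      -- The complex equation for F combines the e₁ conservation law with -i times the e₀ law.
      linear_combination h2 - Complex.I * h1
        + (2 * connCoord σ a z 1 q * emCoord h ψ χ a y z 0 1 q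
          + (fderiv ℝ (emCoord h ψ χ a y z 0 1) q (frameCoord σ a z 0 q) : ℂ)) * Complex.I_sq)
    (by
      simp only [smul_apply, smul_eq_mul, Complex.real_smul] at hbr
      linear_combination -hbr)
  refine key.congr_of_eventuallyEq ?_
  filter_upwards [hev] with p hp
  exact quadCoeff_eq χ h ψ hφ hEL hcrit hy hz hp.1 hp.2.1 hp.2.2

omit hφ hEL hcrit hy [T2Space M] [CompactSpace M] [MeasurableSpace M] [BorelSpace M] in
lemma fderiv_transition_frameCoord (hz : IsIsothermal σ z) (hz' : IsIsothermal σ z')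
    (hx : x ∈ z.source) (hx' : x ∈ z'.source) (α : Fin 2) :
    fderiv ℝ (fun p ↦ z' (z.symm p)) (z x) (frameCoord σ a z α (z x))
      = frameCoord σ a z' α (z' x) := by
  have h1 := mfderiv_eq_fderiv_chart hz.smooth (z.map_source hx)
    (mdifferentiableAt_chart hz'.smooth (x := z.symm (z x)) (by rwa [z.left_inv hx]))
    (σ.frame a α (z.symm (z x)))
  refine h1.symm.trans ?_
  rw [frameCoord, z'.left_inv hx', z.left_inv hx]
  rfl

/-- The differential of the transition map carries the coordinates c, ic of the frame to those in
the other chart, which are again of the form c', ic'. So it commutes with i at c ≠ 0 and is complex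
linear, with c' equal to its derivative times c; the formula F/c² then gives the transformation law.
-/
lemma quadCoeff_transition (hz : IsIsothermal σ z) (hz' : IsIsothermal σ z')
    (hx : x ∈ z.source) (hx' : x ∈ z'.source) (hxa : x ∈ σ.U a) (hxy : φ x ∈ y.source) :
    DifferentiableAt ℂ (fun p ↦ z' (z.symm p)) (z x) ∧
      quadCoeff σ h φ ψ χ z (z x) = quadCoeff σ h φ ψ χ z' (z' x) *
        deriv (fun p ↦ z' (z.symm p)) (z x) ^ 2 := by
  have hs := z.left_inv hx
  have hs' := z'.left_inv hx'
  have hq := z.map_source hx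
  have hq' := z'.map_source hx'
  have hxa1 : z.symm (z x) ∈ σ.U a := by rwa [hs]
  have hxa2 : z'.symm (z' x) ∈ σ.U a := by rwa [hs']
  have hT0 := fderiv_transition_frameCoord (a := a) hz hz' hx hx' 0
  have hT1 := fderiv_transition_frameCoord (a := a) hz hz' hx hx' 1
  rw [frameCoord_one hz hq hxa1, frameCoord_one hz' hq' hxa2, ← hT0] at hT1
  have hc := frameCoord_ne_zero hz hq hxa1
  have hd : DifferentiableAt ℝ (fun p ↦ z' (z.symm p)) (z x) :=
    (contDiffAt_transition hz'.smooth hz.smooth hq (by rwa [hs])).differentiableAt (by simp)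
  have hdc := differentiableAt_complex_of_map_I_mul hd hc hT1
  refine ⟨hdc, ?_⟩
  have h1 : deriv (fun p ↦ z' (z.symm p)) (z x) * frameCoord σ a z 0 (z x)
      = frameCoord σ a z' 0 (z' x) := by
    rw [← hT0, (hdc.hasDerivAt.hasFDerivAt.restrictScalars ℝ).fderiv]
    simp [mul_comm]
  have hc' := frameCoord_ne_zero hz' hq' hxa2
  rw [quadCoeff_eq χ h ψ hφ hEL hcrit hy hz hq hxa1 (by rwa [hs]),
    quadCoeff_eq χ h ψ hφ hEL hcrit hy hz' hq' hxa2 (by rwa [hs']), hs, hs', ← h1] at *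
  have hd0 : deriv (fun p ↦ z' (z.symm p)) (z x) ≠ 0 := by
    intro h0
    rw [h0, zero_mul] at hc'
    exact hc' rfl
  field_simp

end Isothermal

end SigmaModel

end

/-! ### The main theorem -/

theorem mainTheorem7
    {M : Type*} [TopologicalSpace M] [T2Space M] [CompactSpace M] [ChartedSpace ℂ M]
    [IsManifold 𝓘(ℝ, ℂ) ∞ M] [MeasurableSpace M] [BorelSpace M]
    (g : SigmaModel.SurfaceMetric M) {ι : Type*} (σ : SigmaModel.SpinStructure g ι)
    {n : ℕ} {N : Type*} [TopologicalSpace N] [T2Space N] [CompactSpace N]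
    [ChartedSpace (EuclideanSpace ℝ (Fin n)) N] [IsManifold (𝓡 n) ∞ N]
    (h : SigmaModel.TargetMetric n N)
    (φ : M → N) (hφ : ContMDiff 𝓘(ℝ, ℂ) (𝓡 n) ∞ φ)
    (ψ : SigmaModel.VectorSpinor n σ φ) (χ : SigmaModel.Gravitino σ)
    (hEL : SigmaModel.EulerLagrange σ h φ ψ χ)
    (hcrit : SigmaModel.IsCriticalGravitino σ h φ ψ χ) :
    -- the tensor `T` does not depend on the local frames and charts used to compute it
    (∀ a, ∀ y ∈ IsManifold.maximalAtlas (𝓡 n) ∞ N, ∀ x ∈ σ.U a, φ x ∈ y.source →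
      ∀ v w : TangentSpace 𝓘(ℝ, ℂ) x,
        SigmaModel.emTensorLocal σ h φ ψ χ a y x v w = SigmaModel.emTensor σ h φ ψ χ x v w) ∧
    -- `T(z) dz²` is invariant under changes of oriented isothermal coordinates
    (∀ z z' : OpenPartialHomeomorph M ℂ, SigmaModel.IsIsothermal σ z →
      SigmaModel.IsIsothermal σ z' → ∀ x ∈ z.source ∩ z'.source,
        DifferentiableAt ℂ (fun p ↦ z' (z.symm p)) (z x) ∧
        SigmaModel.quadCoeff σ h φ ψ χ z (z x) =
          SigmaModel.quadCoeff σ h φ ψ χ z' (z' x) *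
            deriv (fun p ↦ z' (z.symm p)) (z x) ^ 2) ∧
    -- `T(z)` is holomorphic in every oriented isothermal coordinate
    (∀ z : OpenPartialHomeomorph M ℂ, SigmaModel.IsIsothermal σ z →
      DifferentiableOn ℂ (SigmaModel.quadCoeff σ h φ ψ χ z) z.target) := by
  have hc := fun p : N ↦ IsManifold.chart_mem_maximalAtlas (I := 𝓡 n) (n := ∞) p
  refine ⟨fun a y hy x hx hxy v w ↦
    SigmaModel.emTensorLocal_eq_emTensor χ h ψ hφ hEL hcrit hy hx hxy v w,
    fun z z' hz hz' x hx ↦ ?_, fun z hz q hq ↦ ?_⟩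
  · exact SigmaModel.quadCoeff_transition χ h ψ hφ hEL hcrit (hc (φ x)) hz hz' hx.1 hx.2
      (σ.cover x).choose_spec (mem_chart_source _ _)
  · exact (SigmaModel.differentiableAt_quadCoeff χ h ψ hφ hEL hcrit (hc (φ (z.symm q))) hz hq
      (σ.cover (z.symm q)).choose_spec (mem_chart_source _ _)).differentiableWithinAt
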